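/- Let $\overline\Omega$ be a compact connected smooth manifold with nonempty smooth boundary and interior $\Omega$, let $m\ge 2$, $0\le k\le m$, and let $g$ be a $C^m(\overline\Omega)$ Riemannian metric with volume measure $\mu_g$ and Levi-Civita connection $\nabla$. Put $d(x)=d_g(x,\partial\Omega)$, let $0<r_1<r_0<\tfrac12$, and assume that $d$ is of class $C^m$, up to the boundary, in a neighbourhood of $\{d\le r_0\}$. Let $V=\{x\in\Omega: d(x)<r_0\}$. Let $\tilde\rho:(0,\infty)\to(0,\infty)$ be smooth and nondecreasing with $\tilde\rho(t)=e^{-1/t}$ for $0<t<r_1$ and $\tilde\rho(t)=1$ for $t>r_0$. For $N\in\mathbb R$ put $\rho=(\tilde\rho\circ d)^N$. For a weight $\sigma\ge 0$ let $H^k_\sigma(\Omega)$ be the space of functions or tensor fields $u$ (of any type) on $\Omega$ whose weak covariant derivatives up to order $k$ exist and have finite norm $$\|u\|_{H^k_\sigma}=\Big(\sum_{j=0}^k\int_\Omega|\nabla^ju|_g^2\,\sigma\,d\mu_g\Big)^{1/2},$$ and write $H^k=H^k_1$. Assume $$N\ge 4(4k-3).$$ (1) Let $r_2\in(0,r_1)$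 satisfy $r_2^2\,\|\Delta_g d\|_{C^0(V)}+2r_2\le\tfrac12$. Then every $u\in H^k_\rho(\Omega)$ satisfies $u\rho^{1/2}\in H^k(\Omega)$ and $$\|u\rho^{1/2}\|_{H^k(\Omega)}\le C\,\|u\|_{H^k_\rho(\Omega)},$$ where $C$ depends only on $N$, $k$, $r_2$ and upper bounds for $\|\log\tilde\rho\|_{C^k([r_1,r_0])}$ and $\|d\|_{C^k(\overline V)}$, the latter being measured by $\sup_V|\nabla^jd|_g$, $0\le j\le k$. (2) In particular $C$ is uniform over families of metrics: let $\overline\Omega$, $k$, $m$, $N$, $r_0$, $r_1$, $\tilde\rho$ be fixed and let $\mathcal U_0$ be a set of $C^m(\overline\Omega)$ metrics such that, for every $g\in\mathcal U_0$, $d_g$ is of class $C^m$ in a neighbourhood of $\{d_g\le r_0\}$, and such that $\sup_{g\in\mathcal U_0}\|d_g\|_{C^m(\overline{V_g})}<\infty$, where $V_g=\{x\in\Omega: d_g(x)<r_0\}$. Then there is one constant $C$ such that for all $g\in\mathcal U_0$ and all $u\in H^k_{\rho_g}(\Omega,g)$, where $\rho_g=(\tilde\rho\circ d_g)^N$, one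 has $u\rho_g^{1/2}\in H^k(\Omega,g)$ and $\|u\rho_g^{1/2}\|_{H^k(\Omega,g)}\le C\|u\|_{H^k_{\rho_g}(\Omega,g)}$. -/

import Mathlib

open Set MeasureTheory Manifold Bundle
open scoped Manifold ContDiff Bundle ENNReal Topology

universe u

noncomputable section

namespace WeightedSobolev

/-- A Riemannian metric of class `C^m`, up to and including the boundary, on an `n`-dimensional
manifold with boundary `M`. -/
abbrev Metric (n : ℕ) [NeZero n] (m : ℕ) (M : Type*) [TopologicalSpace M]
    [ChartedSpace (EuclideanHalfSpace n) M] [IsManifold (𝓡∂ n) ∞ M] :=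
  ContMDiffRiemannianMetric (𝓡∂ n) (m : WithTop ℕ∞) (EuclideanSpace ℝ (Fin n))
    (fun x : M => TangentSpace (𝓡∂ n) x)

/-- (Rough) tensor fields of type `(r, s)`: at each point a form that is multilinear in `r`
covectors and `s` vectors. Functions are the case `r = s = 0`. -/
abbrev TensorField (n : ℕ) [NeZero n] (M : Type*) [TopologicalSpace M]
    [ChartedSpace (EuclideanHalfSpace n) M] (r s : ℕ) :=
  ∀ x : M, MultilinearMap ℝ (fun _ : Fin r => TangentSpace (𝓡∂ n) x →L[ℝ] ℝ)
    (MultilinearMap ℝ (fun _ : Fin s => TangentSpace (𝓡∂ n) x) ℝ)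

variable {n : ℕ} [NeZero n] {m : ℕ} {M : Type*} [TopologicalSpace M]
  [ChartedSpace (EuclideanHalfSpace n) M] [IsManifold (𝓡∂ n) ∞ M] {r s : ℕ}

/-- The coordinate vector field `∂_i` of the chart at `c`, at the point `z`. -/
def coordVec (c z : M) (i : Fin n) : TangentSpace (𝓡∂ n) z :=
  tangentCoordChange (𝓡∂ n) c z z (EuclideanSpace.single i (1 : ℝ))

/-- The coordinate covector `dx^i` of the chart at `c`, at the point `z`. -/
def coordCovec (c z : M) (i : Fin n) : TangentSpace (𝓡∂ n) z →L[ℝ] ℝ :=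
  ((EuclideanSpace.proj i : EuclideanSpace ℝ (Fin n) →L[ℝ] ℝ).comp
    (tangentCoordChange (𝓡∂ n) z c z) : EuclideanSpace ℝ (Fin n) →L[ℝ] ℝ)

/-- The components `u^I_J` of a tensor field in the chart at `c`, as functions of the coordinates
`y` in the target of the chart. -/
def comp (u : TensorField n M r s) (c : M) (I : Fin r → Fin n) (J : Fin s → Fin n)
    (y : EuclideanSpace ℝ (Fin n)) : ℝ :=
  u ((extChartAt (𝓡∂ n) c).symm y)
    (fun a => coordCovec c ((extChartAt (𝓡∂ n) c).symm y) (I a))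
    (fun b => coordVec c ((extChartAt (𝓡∂ n) c).symm y) (J b))

/-- The tensor at `x` with prescribed components in the chart at `x`. -/
def ofComp (x : M) (A : (Fin r → Fin n) → (Fin s → Fin n) → ℝ) :
    MultilinearMap ℝ (fun _ : Fin r => TangentSpace (𝓡∂ n) x →L[ℝ] ℝ)
      (MultilinearMap ℝ (fun _ : Fin s => TangentSpace (𝓡∂ n) x) ℝ) :=
  ∑ I : Fin r → Fin n, ∑ J : Fin s → Fin n,
    MultilinearMap.smulRight
      ((MultilinearMap.mkPiAlgebra ℝ (Fin r) ℝ).compLinearMap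
        (fun a => LinearMap.applyₗ (coordVec x x (I a)) ∘ₗ
          ContinuousLinearMap.coeLM (M := TangentSpace (𝓡∂ n) x) (N₃ := ℝ) ℝ))
      (A I J • (MultilinearMap.mkPiAlgebra ℝ (Fin s) ℝ).compLinearMap
        (fun b => (coordCovec x x (J b)).toLinearMap))

/-- A function as a tensor field of type `(0, 0)`. -/
def ofFun (f : M → ℝ) : TensorField n M 0 0 := fun x => ofComp x (fun _ _ => f x)

/-- The matrix `g_{ij}` of the metric in the chart at `c`. -/
def gram (g : Metric n m M) (c : M) (y : EuclideanSpace ℝ (Fin n)) : Matrix (Fin n) (Fin n) ℝ :=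
  Matrix.of fun i j => g.inner ((extChartAt (𝓡∂ n) c).symm y)
    (coordVec c ((extChartAt (𝓡∂ n) c).symm y) i) (coordVec c ((extChartAt (𝓡∂ n) c).symm y) j)

/-- The partial derivative `∂_l f`. -/
def partialDeriv (l : Fin n) (f : EuclideanSpace ℝ (Fin n) → ℝ) (y : EuclideanSpace ℝ (Fin n)) :
    ℝ :=
  fderiv ℝ f y (EuclideanSpace.single l (1 : ℝ))

/-- The Christoffel symbols `Γ^p_{ij}` of the Levi-Civita connection in the chart at `c`. -/
def christoffel (g : Metric n m M) (c : M) (p i j : Fin n) (y : EuclideanSpace ℝ (Fin n)) : ℝ :=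
  (1 / 2) * ∑ q, (gram g c y)⁻¹ p q *
    (partialDeriv i (fun y' => gram g c y' j q) y + partialDeriv j (fun y' => gram g c y' i q) y
      - partialDeriv q (fun y' => gram g c y' i j) y)

/-- The zeroth order part of the covariant derivative `∇_l u` in the chart at `c`:
`∑_a Γ^{I_a}_{lp} u^{I[a ↦ p]}_J - ∑_b Γ^p_{l J_b} u^I_{J[b ↦ p]}`. -/
def connTerm (g : Metric n m M) (u : TensorField n M r s) (c : M) (l : Fin n)
    (I : Fin r → Fin n) (J : Fin s → Fin n) (y : EuclideanSpace ℝ (Fin n)) : ℝ :=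
  (∑ a : Fin r, ∑ p : Fin n,
      christoffel g c (I a) l p y * comp u c (Function.update I a p) J y)
    - ∑ b : Fin s, ∑ p : Fin n,
      christoffel g c p l (J b) y * comp u c I (Function.update J b p) y

/-- The classical covariant derivative at interior points; the new covariant index comes first. -/
def covDeriv (g : Metric n m M) (u : TensorField n M r s) : TensorField n M r (s + 1) := fun x =>
  ofComp x (fun I K =>
    partialDeriv (K 0) (comp u x I (Fin.tail K)) (extChartAt (𝓡∂ n) x x)
      + connTerm g u x (K 0) I (Fin.tail K) (extChartAt (𝓡∂ n) x x))

/-- The iterated classical covariant derivative `∇^j u`. -/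
def iterCovDeriv (g : Metric n m M) (u : TensorField n M r s) : ∀ j : ℕ, TensorField n M r (s + j)
  | 0 => u
  | j + 1 => covDeriv g (iterCovDeriv g u j)

/-- `v` is the weak covariant derivative of `u` in the interior of `M`: both are locally integrable
and in every chart `∂_l u^I_J = v^I_{lJ} - connTerm` when tested against smooth functions with
compact support in the interior of the chart. -/
def HasWeakCovDeriv (g : Metric n m M) (u : TensorField n M r s) (v : TensorField n M r (s + 1)) :
    Prop :=
  ∀ c : M,
    (∀ I J, LocallyIntegrableOn (comp u c I J) (interior (extChartAt (𝓡∂ n) c).target)) ∧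
    (∀ I K, LocallyIntegrableOn (comp v c I K) (interior (extChartAt (𝓡∂ n) c).target)) ∧
    ∀ (I : Fin r → Fin n) (J : Fin s → Fin n) (l : Fin n) (φ : EuclideanSpace ℝ (Fin n) → ℝ),
      ContDiff ℝ ∞ φ → HasCompactSupport φ →
      tsupport φ ⊆ interior (extChartAt (𝓡∂ n) c).target →
      ∫ y, comp u c I J y * partialDeriv l φ y
        = - ∫ y, (comp v c I (Fin.cons l J) y - connTerm g u c l I J y) * φ y

/-- The components of `u` in every chart are measurable on the interior of the chart. -/
def IsMeasurableField (u : TensorField n M r s) : Prop :=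
  ∀ (c : M) (I : Fin r → Fin n) (J : Fin s → Fin n),
    AEStronglyMeasurable (comp u c I J)
      (volume.restrict (interior (extChartAt (𝓡∂ n) c).target))

/-- `w 0 = u, w 1, …, w k` are the successive weak covariant derivatives of `u`. -/
def IsWeakJet (g : Metric n m M) (k : ℕ) (u : TensorField n M r s)
    (w : ∀ j : ℕ, TensorField n M r (s + j)) : Prop :=
  w 0 = u ∧ (∀ j ≤ k, IsMeasurableField (w j)) ∧ ∀ j < k, HasWeakCovDeriv g (w j) (w (j + 1))

/-- The squared pointwise norm `|u|²_g`, that is `g_{I I'} g^{J J'} u^I_J u^{I'}_{J'}`. -/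
def normSq (g : Metric n m M) (u : TensorField n M r s) (x : M) : ℝ :=
  ∑ I : Fin r → Fin n, ∑ I' : Fin r → Fin n, ∑ J : Fin s → Fin n, ∑ J' : Fin s → Fin n,
    (∏ a, gram g x (extChartAt (𝓡∂ n) x x) (I a) (I' a)) *
    (∏ b, (gram g x (extChartAt (𝓡∂ n) x x))⁻¹ (J b) (J' b)) *
    comp u x I J (extChartAt (𝓡∂ n) x x) * comp u x I' J' (extChartAt (𝓡∂ n) x x)

/-- The Riemannian volume measure `dμ_g`. In the chart at `c` it is `√(det g_{ij}) dy`; these local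
measures agree on overlaps, so that their supremum is the measure they glue to. -/
def volumeMeasure (g : Metric n m M) [MeasurableSpace M] : Measure M :=
  ⨆ c : M, Measure.map (extChartAt (𝓡∂ n) c).symm
    ((volume.restrict (extChartAt (𝓡∂ n) c).target).withDensity
      (fun y => ENNReal.ofReal (Real.sqrt (gram g c y).det)))

/-- The distance `d_g(x) = d_g(x, ∂M)`. -/
def boundaryDist (g : Metric n m M) (x : M) : ℝ :=
  letI : RiemannianBundle (fun x : M => TangentSpace (𝓡∂ n) x) := ⟨g.toRiemannianMetric⟩
  (⨅ y ∈ (𝓡∂ n).boundary M, riemannianEDist (𝓡∂ n) x y).toReal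

/-- The Laplacian `Δ_g f = g^{ij} (∇² f)_{ij}` of a function, at interior points. -/
def laplacian (g : Metric n m M) (f : M → ℝ) (x : M) : ℝ :=
  ∑ i, ∑ j, (gram g x (extChartAt (𝓡∂ n) x x))⁻¹ i j *
    comp (covDeriv g (covDeriv g (ofFun f))) x ![] ![i, j] (extChartAt (𝓡∂ n) x x)

/-- `∫_Ω |w|²_g σ dμ_g`, where `Ω` is the interior of `M`. -/
def weightedEnergy [MeasurableSpace M] (g : Metric n m M) (σ : M → ℝ) (w : TensorField n M r s) :
    ℝ≥0∞ :=
  ∫⁻ x in (𝓡∂ n).interior M, ENNReal.ofReal (normSq g w x * σ x) ∂(volumeMeasure g)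

/-- `u` belongs to the weighted Sobolev space `H^k_σ(Ω, g)`: its weak covariant derivatives up to
order `k` exist and are square integrable with respect to `σ dμ_g`. -/
def MemSobolev [MeasurableSpace M] (g : Metric n m M) (σ : M → ℝ) (k : ℕ)
    (u : TensorField n M r s) : Prop :=
  ∃ w : ∀ j : ℕ, TensorField n M r (s + j), IsWeakJet g k u w ∧
    ∀ j ≤ k, weightedEnergy g σ (w j) < ⊤

/-- The norm `(∑_{j ≤ k} ∫_Ω |∇^j u|²_g σ dμ_g)^{1/2}` of `H^k_σ(Ω, g)`. Weak derivatives are unique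
up to null sets, so the infimum is over equal numbers. -/
def sobolevNorm [MeasurableSpace M] (g : Metric n m M) (σ : M → ℝ) (k : ℕ)
    (u : TensorField n M r s) : ℝ≥0∞ :=
  ⨅ (w : ∀ j : ℕ, TensorField n M r (s + j)) (_ : IsWeakJet g k u w),
    (∑ j ∈ Finset.range (k + 1), weightedEnergy g σ (w j)) ^ (1 / 2 : ℝ)

/-- The profile `ρ̃ : (0, ∞) → ℝ`: smooth, positive, monotone, equal to `e^{-1/t}` on `(0, r₁)` and
to `1` on `(r₀, ∞)`. Values at `t ≤ 0` play no role. -/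
structure IsProfile (ρ : ℝ → ℝ) (r₁ r₀ : ℝ) : Prop where
  smooth : ContDiffOn ℝ ∞ ρ (Ioi 0)
  pos : ∀ t, 0 < t → 0 < ρ t
  mono : MonotoneOn ρ (Ioi 0)
  eq_exp : ∀ t, 0 < t → t < r₁ → ρ t = Real.exp (-1 / t)
  eq_one : ∀ t, r₀ < t → ρ t = 1

/-- The exponential weight `ρ_g = (ρ̃ ∘ d_g)^N`. -/
def weight (g : Metric n m M) (ρ : ℝ → ℝ) (N : ℝ) (x : M) : ℝ := (ρ (boundaryDist g x)) ^ N

/-- The multiplication of a tensor field by `ρ_g^{1/2}`. -/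
def mulSqrtWeight (g : Metric n m M) (ρ : ℝ → ℝ) (N : ℝ) (u : TensorField n M r s) :
    TensorField n M r s :=
  fun x => Real.sqrt (weight g ρ N x) • u x

/-- The function `d_g` is as regular as `g` (of class `C^m`, up to the boundary) in a neighbourhood
of the closed collar `{d_g ≤ r₀}`. -/
def HasRegularCollar (g : Metric n m M) (r₀ : ℝ) : Prop :=
  ∃ r' > r₀, ContMDiffOn (𝓡∂ n) 𝓘(ℝ, ℝ) (m : WithTop ℕ∞) (boundaryDist g)
    {x : M | boundaryDist g x < r'}

/-- The `C^k` norm of `d_g` on the closure of the collar `{x ∈ Ω : d_g(x) < r₀}` is at most `D`. -/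
def DistCkBound (g : Metric n m M) (r₀ : ℝ) (k : ℕ) (D : ℝ) : Prop :=
  ∀ x ∈ (𝓡∂ n).interior M, boundaryDist g x < r₀ → ∀ j ≤ k,
    Real.sqrt (normSq g (iterCovDeriv g (ofFun (boundaryDist g)) j) x) ≤ D

/-- The `C^k([r₁, r₀])` norm of `log ρ̃` is at most `L`. -/
def LogProfileCkBound (ρ : ℝ → ℝ) (r₁ r₀ : ℝ) (k : ℕ) (L : ℝ) : Prop :=
  ∀ t ∈ Icc r₁ r₀, ∀ j ≤ k, |iteratedDeriv j (fun t => Real.log (ρ t)) t| ≤ L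

/-- `r₂ ∈ (0, r₁)` is small against the `C⁰` norm of `Δ_g d_g` on the collar `{d_g < r₀}`. -/
def IsInnerRadius (g : Metric n m M) (r₂ r₁ r₀ : ℝ) : Prop :=
  0 < r₂ ∧ r₂ < r₁ ∧ ∀ x ∈ (𝓡∂ n).interior M, boundaryDist g x < r₀ →
    r₂ ^ 2 * |laplacian g (boundaryDist g) x| + 2 * r₂ ≤ 1 / 2

end WeightedSobolev

end

/-!
Write `d` for the distance to the boundary, and `ρ` for the weight, which is `e^{-N/d}` where `d <
r₁`. The theorem is the combination of the product rule with a Hardy inequality.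

*Product rule.* The logarithmic derivative of `ρ^{1/2}` is `N/2` times `∇d / d²` near the
boundary, so each derivative that falls on `ρ^{1/2}` costs at most a factor `d^{-2}`. Hence
`∇^j(ρ^{1/2} u)` exists weakly, and its square is at most a constant times the sum over `i ≤ j` of
`ρ d^{-4(j-i)} |∇^i u|²` (`exists_isWeakJet_mulSqrtWeight`). Derivatives of products and of
compositions are counted by means of `JetBound`: bounds for the successive derivatives of a field,
by a given sequence of functions, for classical and for weak derivatives alike. The constant
involves only bounds for the derivatives of `d` and of `log ρ̃`. Only the derivatives of `d` on
the collar `d < r₀` enter, since the weight is constant beyond it.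

*Hardy inequality.* The losses are made up for, one derivative at a time, by `∫ ρ d^{-4(p+1)} |u|²
≤ ∫ ρ d^{-4p} |∇u|² + C ∫ ρ |u|²` (`weightedEnergy_blowupWeight_succ_le`). For its proof let `ψ`
be `e^{-N/d} d^{-(4p+2)}`, cut off near the boundary and beyond `d = r₂`, and integrate the
divergence of `ψ |u|² ∇d`, which gives zero (`setIntegral_divField`). The derivative of the
exponential contributes `N d^{-2} ψ |u|² |∇d|²`, where `|∇d| ≥ 1` because an almost shortest path
to the boundary decreases `d` at full rate (`one_le_tnorm_grad`). This dominates the derivative of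
the power of `d`, because `N` is large, the term with `Δd`, because `r₂` is small, and, by
Cauchy–Schwarz, the part of `2 ψ ⟨∇_{∇d} u, u⟩` that is not absorbed in `∫ ρ d^{-4p} |∇u|²`; see
`hardy_pointwise`. The outer cut-off and the region `d ≥ r₂/2` only produce multiples of `∫ ρ
|u|²`, and the inner cut-off has the favourable sign, so that it can be removed in the limit. The
condition on `N` is strongest at the last of the `k` steps, `p = k - 1`.

Iterating the Hardy inequality along the derivatives of `u` (`weightedEnergy_blowupWeight_le`)
bounds each `∫ ρ d^{-4(j-i)} |∇^i u|²` by the square of the norm of `u`, which is the first part.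
The second part follows from it: since `|Δd| ≤ √n |∇²d|`, a common bound for the derivatives of
the distances provides a common `r₂` (`exists_isInnerRadius`), and the derivatives of `log ρ̃` are
bounded on `[r₁, r₀]` because they are continuous.

What makes these computations possible is that the objects defined in the preferred chart at each
point are given by the same formulas in every chart: the covariant derivative (`comp_covDeriv`),
the inner product of tensors (`tinner_eq`) and the volume measure
(`volumeMeasure_restrict_eq_map`).
-/

noncomputable section

set_option linter.unusedSectionVars false

namespace WeightedSobolev

/-! ### Linear algebra of multi-index arrays -/

section Slots

variable {ι σ : Type*} [Fintype ι] [DecidableEq ι] [Fintype σ] [DecidableEq σ]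

/-- The tensor product of the matrices `P a` over the slots `a : σ`, acting on arrays. -/
def slotMap (P : σ → Matrix ι ι ℝ) : ((σ → ι) → ℝ) →ₗ[ℝ] ((σ → ι) → ℝ) where
  toFun u K := ∑ L, (∏ a, P a (K a) (L a)) * u L
  map_add' u v := by ext K; simp [mul_add, Finset.sum_add_distrib]
  map_smul' c u := by ext K; simp [Finset.mul_sum, mul_left_comm]

lemma slotMap_apply (P : σ → Matrix ι ι ℝ) (u : (σ → ι) → ℝ) (K : σ → ι) :
    slotMap P u K = ∑ L, (∏ a, P a (K a) (L a)) * u L := rfl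

lemma slotMap_slotMap (P Q : σ → Matrix ι ι ℝ) (u : (σ → ι) → ℝ) :
    slotMap P (slotMap Q u) = slotMap (fun a => P a * Q a) u := by
  ext K
  simp only [slotMap_apply, Matrix.mul_apply, Finset.mul_sum]
  rw [Finset.sum_comm]
  refine Finset.sum_congr rfl fun L _ => ?_
  rw [Finset.prod_univ_sum, Finset.sum_mul]
  simp only [Fintype.piFinset_univ]
  refine Finset.sum_congr rfl fun M _ => ?_
  rw [Finset.prod_mul_distrib, mul_assoc]

lemma slotMap_one (u : (σ → ι) → ℝ) : slotMap (fun _ => (1 : Matrix ι ι ℝ)) u = u := by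
  ext K
  rw [slotMap_apply, Finset.sum_eq_single K]
  · simp
  · intro L _ hL
    obtain ⟨a, ha⟩ : ∃ a, L a ≠ K a := Function.ne_iff.1 hL
    have h1 : (1 : Matrix ι ι ℝ) (K a) (L a) = 0 := Matrix.one_apply_ne (fun h => ha h.symm)
    rw [Finset.prod_eq_zero (Finset.mem_univ a) h1, zero_mul]
  · simp

/-- The sum over the slots of the matrices `B a` acting on one slot each: the derivation induced
by `B` on arrays. -/
def slotDer (B : σ → Matrix ι ι ℝ) (u : (σ → ι) → ℝ) (K : σ → ι) : ℝ :=
  ∑ a, ∑ p, B a (K a) p * u (Function.update K a p)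

/-- The derivative of `slotMap P` in the direction `X`. -/
def slotVar (P X : σ → Matrix ι ι ℝ) (u : (σ → ι) → ℝ) : (σ → ι) → ℝ :=
  ∑ a, slotMap (Function.update P a (X a)) u

lemma slotMap_update_one (a : σ) (B : Matrix ι ι ℝ) (u : (σ → ι) → ℝ) (K : σ → ι) :
    slotMap (Function.update (fun _ => (1 : Matrix ι ι ℝ)) a B) u K
      = ∑ p, B (K a) p * u (Function.update K a p) := by
  rw [slotMap_apply]
  symm
  refine Finset.sum_of_injOn (Function.update K a) ?_ (by simp) ?_ ?_
  · intro p _ q _ h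
    simpa using congrFun h a
  · intro L _ hL
    have : ∃ b, b ≠ a ∧ K b ≠ L b := by
      by_contra! h
      refine hL ⟨L a, by simp, ?_⟩
      ext b
      by_cases hb : b = a
      · subst hb; simp
      · simp [hb, h b hb]
    obtain ⟨b, hb, hK⟩ := this
    rw [Finset.prod_eq_zero (Finset.mem_univ b), zero_mul]
    rw [Function.update_of_ne hb, Matrix.one_apply_ne hK]
  · intro p _
    congr 1
    rw [Finset.prod_eq_single a]
    · simp
    · intro b _ hb
      simp [hb]
    · simp

lemma slotDer_eq_slotVar (B : σ → Matrix ι ι ℝ) (u : (σ → ι) → ℝ) :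
    slotDer B u = slotVar (fun _ => 1) B u := by
  ext K
  simp [slotDer, slotVar, slotMap_update_one]

lemma slotDer_slotMap (B P : σ → Matrix ι ι ℝ) (u : (σ → ι) → ℝ) :
    slotDer B (slotMap P u) = slotVar P (fun a => B a * P a) u := by
  rw [slotDer_eq_slotVar, slotVar, slotVar]
  refine Finset.sum_congr rfl fun a _ => ?_
  rw [slotMap_slotMap]
  congr 2
  ext b : 1
  by_cases hb : b = a
  · subst hb; simp
  · simp [hb]

lemma slotMap_slotDer (B P : σ → Matrix ι ι ℝ) (u : (σ → ι) → ℝ) :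
    slotMap P (slotDer B u) = slotVar P (fun a => P a * B a) u := by
  rw [slotDer_eq_slotVar, slotVar, slotVar, map_sum]
  refine Finset.sum_congr rfl fun a _ => ?_
  rw [slotMap_slotMap]
  congr 2
  ext b : 1
  by_cases hb : b = a
  · subst hb; simp
  · simp [hb]

lemma slotMap_update_add (P : σ → Matrix ι ι ℝ) (a : σ) (X Y : Matrix ι ι ℝ) (u : (σ → ι) → ℝ) :
    slotMap (Function.update P a (X + Y)) u
      = slotMap (Function.update P a X) u + slotMap (Function.update P a Y) u := by
  ext K
  simp only [slotMap_apply, Pi.add_apply, ← Finset.sum_add_distrib, ← add_mul]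
  refine Finset.sum_congr rfl fun L _ => ?_
  congr 1
  have h : ∀ Z : Matrix ι ι ℝ, ∏ b, Function.update P a Z b (K b) (L b)
      = Z (K a) (L a) * ∏ b ∈ Finset.univ.erase a, P b (K b) (L b) := by
    intro Z
    rw [← Finset.mul_prod_erase _ _ (Finset.mem_univ a)]
    congr 1
    · simp
    · exact Finset.prod_congr rfl fun b hb => by simp [Finset.ne_of_mem_erase hb]
  simp only [h, Matrix.add_apply, add_mul]

lemma slotVar_add (P X Y : σ → Matrix ι ι ℝ) (u : (σ → ι) → ℝ) :
    slotVar P (X + Y) u = slotVar P X u + slotVar P Y u := by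
  simp [slotVar, slotMap_update_add, Finset.sum_add_distrib]

lemma slotMap_dotProduct (P : σ → Matrix ι ι ℝ) (u v : (σ → ι) → ℝ) :
    slotMap P u ⬝ᵥ v = u ⬝ᵥ slotMap (fun a => (P a).transpose) v := by
  simp only [dotProduct, slotMap_apply, Finset.sum_mul, Finset.mul_sum, Matrix.transpose_apply]
  rw [Finset.sum_comm]
  refine Finset.sum_congr rfl fun K _ => Finset.sum_congr rfl fun L _ => by ring

lemma slotDer_dotProduct (B : σ → Matrix ι ι ℝ) (u v : (σ → ι) → ℝ) :
    slotDer B u ⬝ᵥ v = u ⬝ᵥ slotDer (fun a => (B a).transpose) v := by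
  rw [slotDer_eq_slotVar, slotDer_eq_slotVar, slotVar, slotVar, sum_dotProduct, dotProduct_sum]
  refine Finset.sum_congr rfl fun a _ => ?_
  rw [slotMap_dotProduct]
  have : (fun b => (Function.update (fun _ => (1 : Matrix ι ι ℝ)) a (B a) b).transpose)
      = Function.update (fun _ => 1) a (B a).transpose := by
    ext b : 1
    by_cases hb : b = a
    · subst hb; simp
    · simp [hb]
  rw [this]

/-- The bilinear form on arrays whose kernel is the tensor product of the `H a`. -/
def slotForm (H : σ → Matrix ι ι ℝ) (u v : (σ → ι) → ℝ) : ℝ := u ⬝ᵥ slotMap H v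

lemma slotForm_slotMap (H P : σ → Matrix ι ι ℝ) (u v : (σ → ι) → ℝ) :
    slotForm H (slotMap P u) (slotMap P v)
      = slotForm (fun a => (P a).transpose * H a * P a) u v := by
  rw [slotForm, slotForm, slotMap_dotProduct, slotMap_slotMap, slotMap_slotMap]

lemma slotForm_transpose_mul_self (P : σ → Matrix ι ι ℝ) (u v : (σ → ι) → ℝ) :
    slotForm (fun a => (P a).transpose * P a) u v = slotMap P u ⬝ᵥ slotMap P v := by
  rw [slotForm, slotMap_dotProduct, slotMap_slotMap]

lemma slotForm_comm {H : σ → Matrix ι ι ℝ} (hH : ∀ a, (H a).transpose = H a)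
    (u v : (σ → ι) → ℝ) : slotForm H u v = slotForm H v u := by
  rw [slotForm, ← dotProduct_comm, slotMap_dotProduct, slotForm]
  simp only [hH]

lemma slotForm_add_left (H : σ → Matrix ι ι ℝ) (u u' v : (σ → ι) → ℝ) :
    slotForm H (u + u') v = slotForm H u v + slotForm H u' v := add_dotProduct _ _ _

lemma slotForm_add_right (H : σ → Matrix ι ι ℝ) (u v v' : (σ → ι) → ℝ) :
    slotForm H u (v + v') = slotForm H u v + slotForm H u v' := by
  rw [slotForm, map_add, dotProduct_add]; rfl

lemma slotForm_smul_left (H : σ → Matrix ι ι ℝ) (c : ℝ) (u v : (σ → ι) → ℝ) :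
    slotForm H (c • u) v = c * slotForm H u v := by
  rw [slotForm, smul_dotProduct]; rfl

/-- A parallel form: if the kernels vary by `H B + Bᵀ H`, the derivation `B` accounts for the
variation of the form. -/
lemma slotForm_var {H B : σ → Matrix ι ι ℝ} (hH : ∀ a, (H a).transpose = H a)
    (u : (σ → ι) → ℝ) :
    u ⬝ᵥ slotVar H (fun a => H a * B a + (B a).transpose * H a) u
      = 2 * slotForm H u (slotDer B u) := by
  have h : (fun a => H a * B a + (B a).transpose * H a)
      = (fun a => H a * B a) + (fun a => (B a).transpose * H a) := rfl
  rw [h, slotVar_add, dotProduct_add, ← slotMap_slotDer,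
    ← slotDer_slotMap (fun a => (B a).transpose), ← slotDer_dotProduct]
  change slotForm H u (slotDer B u) + slotForm H (slotDer B u) u = _
  rw [slotForm_comm hH (slotDer B u)]
  ring

end Slots

section PartialDeriv

variable {n : ℕ} {y : EuclideanSpace ℝ (Fin n)} {l : Fin n}

lemma partialDeriv_add {f h : EuclideanSpace ℝ (Fin n) → ℝ} (hf : DifferentiableAt ℝ f y)
    (hh : DifferentiableAt ℝ h y) :
    partialDeriv l (fun z => f z + h z) y = partialDeriv l f y + partialDeriv l h y := by
  simp only [partialDeriv]
  rw [fderiv_fun_add hf hh]; rfl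

lemma partialDeriv_mul {f h : EuclideanSpace ℝ (Fin n) → ℝ} (hf : DifferentiableAt ℝ f y)
    (hh : DifferentiableAt ℝ h y) :
    partialDeriv l (fun z => f z * h z) y
      = partialDeriv l f y * h y + f y * partialDeriv l h y := by
  simp only [partialDeriv]
  rw [fderiv_fun_mul hf hh]
  simp; ring

lemma partialDeriv_sum {κ : Type*} (s : Finset κ) {f : κ → EuclideanSpace ℝ (Fin n) → ℝ}
    (hf : ∀ a ∈ s, DifferentiableAt ℝ (f a) y) :
    partialDeriv l (fun z => ∑ a ∈ s, f a z) y = ∑ a ∈ s, partialDeriv l (f a) y := by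
  simp only [partialDeriv]
  rw [fderiv_fun_sum hf]; simp

lemma partialDeriv_const (c : ℝ) : partialDeriv l (fun _ => c) y = 0 := by
  simp [partialDeriv]

lemma partialDeriv_prod {κ : Type*} [DecidableEq κ] (s : Finset κ)
    {f : κ → EuclideanSpace ℝ (Fin n) → ℝ} (hf : ∀ a ∈ s, DifferentiableAt ℝ (f a) y) :
    partialDeriv l (fun z => ∏ a ∈ s, f a z) y
      = ∑ a ∈ s, (∏ b ∈ s.erase a, f b y) * partialDeriv l (f a) y := by
  simp only [partialDeriv]
  rw [(HasFDerivAt.finsetProd fun a ha => (hf a ha).hasFDerivAt).fderiv]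
  simp

lemma partialDeriv_congr {f h : EuclideanSpace ℝ (Fin n) → ℝ} (hfh : f =ᶠ[𝓝 y] h) :
    partialDeriv l f y = partialDeriv l h y := by
  rw [partialDeriv, partialDeriv, hfh.fderiv_eq]

variable {ι σ : Type*} [Fintype ι] [DecidableEq ι] [Fintype σ] [DecidableEq σ]

/-- The entrywise partial derivative of a matrix valued function. -/
def matDeriv (l : Fin n) (P : EuclideanSpace ℝ (Fin n) → Matrix ι ι ℝ)
    (y : EuclideanSpace ℝ (Fin n)) : Matrix ι ι ℝ :=
  Matrix.of fun i j => partialDeriv l (fun z => P z i j) y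

lemma partialDeriv_slotKernel {P : σ → EuclideanSpace ℝ (Fin n) → Matrix ι ι ℝ}
    (hP : ∀ a i j, DifferentiableAt ℝ (fun z => P a z i j) y) (K L : σ → ι) :
    partialDeriv l (fun z => ∏ a, P a z (K a) (L a)) y
      = ∑ a, ∏ b, Function.update (fun b => P b y) a (matDeriv l (P a) y) b (K b) (L b) := by
  rw [partialDeriv_prod _ fun a _ => hP a _ _]
  refine Finset.sum_congr rfl fun a _ => ?_
  rw [← Finset.prod_erase_mul _ _ (Finset.mem_univ a)]
  congr 1
  · exact Finset.prod_congr rfl fun b hb => by simp [Finset.ne_of_mem_erase hb]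
  · simp [matDeriv]

lemma partialDeriv_slotMap {P : σ → EuclideanSpace ℝ (Fin n) → Matrix ι ι ℝ}
    {u : (σ → ι) → EuclideanSpace ℝ (Fin n) → ℝ}
    (hP : ∀ a i j, DifferentiableAt ℝ (fun z => P a z i j) y)
    (hu : ∀ K, DifferentiableAt ℝ (u K) y) (K : σ → ι) :
    partialDeriv l (fun z => slotMap (fun a => P a z) (fun L => u L z) K) y
      = slotVar (fun a => P a y) (fun a => matDeriv l (P a) y) (fun L => u L y) K
        + slotMap (fun a => P a y) (fun L => partialDeriv l (u L) y) K := by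
  have hk : ∀ L : σ → ι, DifferentiableAt ℝ (fun z => ∏ a, P a z (K a) (L a)) y := fun L =>
    (HasFDerivAt.finsetProd fun a _ => (hP a _ _).hasFDerivAt).differentiableAt
  simp only [slotMap_apply, slotVar, Finset.sum_apply]
  rw [partialDeriv_sum _ fun L _ => (hk L).fun_mul (hu L), Finset.sum_comm, ← Finset.sum_add_distrib]
  refine Finset.sum_congr rfl fun L _ => ?_
  rw [partialDeriv_mul (hk L) (hu L), partialDeriv_slotKernel hP, Finset.sum_mul]

end PartialDeriv

/-! ### Weak partial derivatives in Euclidean space -/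

section Mollify

open Filter Convolution

variable {n : ℕ}

/-- `V` is the weak partial derivative `∂_l U` on `O`, tested against functions of class `C^p`. -/
def HasWeakPartial (p : ℕ∞) (O : Set (EuclideanSpace ℝ (Fin n))) (l : Fin n)
    (U V : EuclideanSpace ℝ (Fin n) → ℝ) : Prop :=
  ∀ φ : EuclideanSpace ℝ (Fin n) → ℝ, ContDiff ℝ p φ → HasCompactSupport φ → tsupport φ ⊆ O →
    ∫ y, U y * partialDeriv l φ y = - ∫ y, V y * φ y

/-- A sequence of bump functions whose supports shrink to the origin. -/
def bumpSeq (n : ℕ) (i : ℕ) : ContDiffBump (0 : EuclideanSpace ℝ (Fin n)) where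
  rIn := 1 / ((i : ℝ) + 1) / 2
  rOut := 1 / ((i : ℝ) + 1)
  rIn_pos := by positivity
  rIn_lt_rOut := by have : 0 < 1 / ((i : ℝ) + 1) := by positivity
                    linarith

lemma tendsto_rOut_bumpSeq (n : ℕ) : Tendsto (fun i => (bumpSeq n i).rOut) atTop (𝓝 0) :=
  tendsto_one_div_add_atTop_nhds_zero_nat

/-- Convolution with the `i`-th normalised bump function. -/
def mollify (i : ℕ) (f : EuclideanSpace ℝ (Fin n) → ℝ) : EuclideanSpace ℝ (Fin n) → ℝ :=
  (bumpSeq n i).normed volume ⋆[ContinuousLinearMap.lsmul ℝ ℝ, volume] f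

lemma mollify_apply (i : ℕ) (f : EuclideanSpace ℝ (Fin n) → ℝ) (x : EuclideanSpace ℝ (Fin n)) :
    mollify i f x = ∫ z, (bumpSeq n i).normed volume z * f (x - z) := rfl

lemma mollify_apply' (i : ℕ) (f : EuclideanSpace ℝ (Fin n) → ℝ) (x : EuclideanSpace ℝ (Fin n)) :
    mollify i f x = ∫ z, (bumpSeq n i).normed volume (x - z) * f z := by
  rw [mollify, convolution_eq_swap]; rfl

lemma contDiff_mollify (i : ℕ) {f : EuclideanSpace ℝ (Fin n) → ℝ} (hf : LocallyIntegrable f) :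
    ContDiff ℝ ∞ (mollify i f) :=
  (bumpSeq n i).hasCompactSupport_normed.contDiff_convolution_left _
    (bumpSeq n i).contDiff_normed hf

lemma partialDeriv_mollify (i : ℕ) {φ : EuclideanSpace ℝ (Fin n) → ℝ} (hφ : ContDiff ℝ 1 φ)
    (hc : HasCompactSupport φ) (l : Fin n) (x : EuclideanSpace ℝ (Fin n)) :
    partialDeriv l (mollify i φ) x = mollify i (partialDeriv l φ) x := by
  have hb : LocallyIntegrable ((bumpSeq n i).normed volume) :=
    (bumpSeq n i).continuous_normed.locallyIntegrable
  rw [partialDeriv, mollify, (hc.hasFDerivAt_convolution_right _ hb hφ x).fderiv,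
    convolution_precompR_apply _ hb (hc.fderiv ℝ) (hφ.continuous_fderiv one_ne_zero)]
  rfl

lemma partialDeriv_mollify_of_weak (i : ℕ) {V V' : EuclideanSpace ℝ (Fin n) → ℝ} {l : Fin n}
    (hV : LocallyIntegrable V) (h : HasWeakPartial ⊤ univ l V V') (x : EuclideanSpace ℝ (Fin n)) :
    partialDeriv l (mollify i V) x = mollify i V' x := by
  set b := (bumpSeq n i).normed (volume : Measure (EuclideanSpace ℝ (Fin n))) with hb
  have hbs : ContDiff ℝ ∞ b := (bumpSeq n i).contDiff_normed
  have hbc : HasCompactSupport b := (bumpSeq n i).hasCompactSupport_normed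
  have hb1 : ContDiff ℝ 1 b := hbs.of_le (by exact_mod_cast le_top)
  have h1 : partialDeriv l (mollify i V) x = ∫ z, partialDeriv l b (x - z) * V z := by
    rw [partialDeriv, mollify, ← convolution_flip,
      (hbc.hasFDerivAt_convolution_right _ hV hb1 x).fderiv,
      convolution_precompR_apply _ hV (hbc.fderiv ℝ) (hb1.continuous_fderiv one_ne_zero)]
    rfl
  rw [h1, mollify_apply']
  have h2 := h (fun z => b (x - z)) (hbs.comp (contDiff_const.sub contDiff_id))
    (hbc.comp_homeomorph (Homeomorph.subLeft x)) (subset_univ _)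
  have h3 : ∀ z, partialDeriv l (fun z => b (x - z)) z = - partialDeriv l b (x - z) := by
    intro z
    have hd : HasFDerivAt (fun z => b (x - z)) (-(fderiv ℝ b (x - z))) z := by
      have := ((hb1.differentiable one_ne_zero) (x - z)).hasFDerivAt.comp z
        ((hasFDerivAt_id z).const_sub x)
      convert! this using 1
      ext v; simp
    rw [partialDeriv, hd.fderiv]
    simp [partialDeriv]
  simp only [h3, mul_neg, integral_neg, neg_inj] at h2
  simpa only [mul_comm] using h2

lemma abs_mollify_le (i : ℕ) {f : EuclideanSpace ℝ (Fin n) → ℝ} {C : ℝ} (hf : ∀ x, |f x| ≤ C)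
    (x : EuclideanSpace ℝ (Fin n)) : |mollify i f x| ≤ C := by
  rw [mollify_apply]
  have hi : Integrable (fun z => (bumpSeq n i).normed volume z * C) :=
    (bumpSeq n i).integrable_normed.mul_const C
  have h := norm_integral_le_of_norm_le hi (f := fun z => (bumpSeq n i).normed volume z * f (x - z))
    (Eventually.of_forall fun z => by
      rw [Real.norm_eq_abs, abs_mul, abs_of_nonneg ((bumpSeq n i).nonneg_normed z)]
      exact mul_le_mul_of_nonneg_left (hf _) ((bumpSeq n i).nonneg_normed z))
  rwa [integral_mul_const, (bumpSeq n i).integral_normed, one_mul] at h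

lemma tendsto_mollify {f : EuclideanSpace ℝ (Fin n) → ℝ} (hf : Continuous f)
    (x : EuclideanSpace ℝ (Fin n)) : Tendsto (fun i => mollify i f x) atTop (𝓝 (f x)) :=
  ContDiffBump.convolution_tendsto_right_of_continuous (tendsto_rOut_bumpSeq n) hf x

lemma mollify_eq_zero (i : ℕ) {f : EuclideanSpace ℝ (Fin n) → ℝ} {δ : ℝ}
    (hδ : (bumpSeq n i).rOut ≤ δ) {x : EuclideanSpace ℝ (Fin n)}
    (hx : x ∉ Metric.cthickening δ (tsupport f)) : mollify i f x = 0 := by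
  rw [mollify_apply]
  refine integral_eq_zero_of_ae (Eventually.of_forall fun z => ?_)
  by_contra h
  have h1 : (bumpSeq n i).normed volume z ≠ 0 := left_ne_zero_of_mul h
  have h2 : f (x - z) ≠ 0 := right_ne_zero_of_mul h
  have h3 : z ∈ Metric.ball 0 (bumpSeq n i).rOut := by
    rw [← (bumpSeq n i).support_normed_eq (μ := volume)]; exact h1
  refine hx (Metric.mem_cthickening_of_dist_le x (x - z) δ _ (subset_tsupport _ h2) ?_)
  rw [mem_ball_zero_iff] at h3
  simpa [dist_eq_norm] using h3.le.trans hδ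

lemma continuous_partialDeriv {φ : EuclideanSpace ℝ (Fin n) → ℝ} (hφ : ContDiff ℝ 1 φ) (l : Fin n) :
    Continuous (partialDeriv l φ) :=
  (hφ.continuous_fderiv one_ne_zero).clm_apply continuous_const

lemma tsupport_partialDeriv_subset (φ : EuclideanSpace ℝ (Fin n) → ℝ) (l : Fin n) :
    tsupport (partialDeriv l φ) ⊆ tsupport φ := by
  refine (closure_mono ?_).trans (tsupport_fderiv_subset ℝ (f := φ))
  intro x hx h
  exact hx (by rw [partialDeriv, h]; rfl)

lemma partialDeriv_eq_zero_of_notMem {φ : EuclideanSpace ℝ (Fin n) → ℝ} {l : Fin n}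
    {x : EuclideanSpace ℝ (Fin n)} (hx : x ∉ tsupport φ) : partialDeriv l φ x = 0 :=
  image_eq_zero_of_notMem_tsupport fun h => hx (tsupport_partialDeriv_subset φ l h)

lemma integrable_mul_of_tsupport_subset {O : Set (EuclideanSpace ℝ (Fin n))}
    {Z ψ : EuclideanSpace ℝ (Fin n) → ℝ} (hZ : LocallyIntegrableOn Z O) (hψ : Continuous ψ)
    (hψc : HasCompactSupport ψ) (hψO : tsupport ψ ⊆ O) : Integrable (fun x => Z x * ψ x) := by
  have h := (hZ.integrableOn_compact_subset hψO hψc.isCompact).mul_continuousOn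
    hψ.continuousOn hψc.isCompact
  refine (integrableOn_iff_integrable_of_support_subset ?_).1 h
  intro x hx
  exact subset_tsupport _ (right_ne_zero_of_mul hx)

/-- Weak derivatives may be tested against `C¹` functions: mollify the test function. -/
lemma HasWeakPartial.of_top {O : Set (EuclideanSpace ℝ (Fin n))} (hO : IsOpen O) {l : Fin n}
    {U V : EuclideanSpace ℝ (Fin n) → ℝ} (hU : LocallyIntegrableOn U O)
    (hV : LocallyIntegrableOn V O) (h : HasWeakPartial ⊤ O l U V) : HasWeakPartial 1 O l U V := by
  intro φ hφ hc hs
  obtain ⟨δ, hδ, hδO⟩ := hc.isCompact.exists_cthickening_subset_open hO hs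
  set K := Metric.cthickening δ (tsupport φ) with hK
  have hKc : IsCompact K := hc.isCompact.cthickening
  have hev : ∀ᶠ i in atTop, (bumpSeq n i).rOut ≤ δ :=
    (tendsto_rOut_bumpSeq n).eventually_le_const hδ
  have key : ∀ {W ψ : EuclideanSpace ℝ (Fin n) → ℝ}, LocallyIntegrableOn W O → Continuous ψ →
      tsupport ψ ⊆ tsupport φ →
      Tendsto (fun i => ∫ y, W y * mollify i ψ y) atTop (𝓝 (∫ y, W y * ψ y)) := by
    intro W ψ hW hψ hψs
    have hψc : HasCompactSupport ψ := hc.of_isClosed_subset (isClosed_tsupport _) hψs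
    obtain ⟨C, hC⟩ := hψ.bounded_above_of_compact_support hψc
    have hWK : IntegrableOn W K := hW.integrableOn_compact_subset hδO hKc
    have hz : ∀ i, (bumpSeq n i).rOut ≤ δ → ∀ x ∉ K, mollify i ψ x = 0 := fun i hi x hx =>
      mollify_eq_zero i hi fun h => hx (Metric.cthickening_subset_of_subset δ hψs h)
    have hz' : ∀ x ∉ K, ψ x = 0 := fun x hx =>
      image_eq_zero_of_notMem_tsupport fun h => hx (Metric.self_subset_cthickening _ (hψs h))
    have e1 : ∫ y, W y * ψ y = ∫ y in K, W y * ψ y :=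
      (setIntegral_eq_integral_of_forall_compl_eq_zero fun x hx => by simp [hz' x hx]).symm
    have e2 : (fun i => ∫ y, W y * mollify i ψ y) =ᶠ[atTop] fun i => ∫ y in K, W y * mollify i ψ y := by
      filter_upwards [hev] with i hi
      exact (setIntegral_eq_integral_of_forall_compl_eq_zero fun x hx => by simp [hz i hi x hx]).symm
    rw [e1]
    refine Tendsto.congr' e2.symm ?_
    refine tendsto_integral_of_dominated_convergence (fun y => |W y| * C) ?_ ?_ ?_ ?_
    · intro i
      exact hWK.aestronglyMeasurable.mul
        (contDiff_mollify i hψ.locallyIntegrable).continuous.aestronglyMeasurable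
    · exact hWK.norm.mul_const C
    · intro i
      refine Eventually.of_forall fun y => ?_
      rw [norm_mul, Real.norm_eq_abs]
      exact mul_le_mul_of_nonneg_left (abs_mollify_le i hC y) (abs_nonneg _)
    · exact Eventually.of_forall fun y => (tendsto_mollify hψ y).const_mul _
  have t1 := key hU (continuous_partialDeriv hφ l) (tsupport_partialDeriv_subset φ l)
  have t2 := (key hV hφ.continuous subset_rfl).neg
  refine tendsto_nhds_unique_of_eventuallyEq t1 t2 ?_
  filter_upwards [hev] with i hi
  have hsub : tsupport (mollify i φ) ⊆ K :=
    closure_minimal (fun x hx => by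
      by_contra hxK
      exact hx (mollify_eq_zero i hi hxK)) hKc.isClosed
  rw [← h (mollify i φ) (contDiff_mollify i hφ.continuous.locallyIntegrable)
    (hKc.of_isClosed_subset (isClosed_tsupport _) hsub) (hsub.trans hδO)]
  simp only [partialDeriv_mollify i hφ hc]

/-- The correlation of two square integrable functions is continuous. -/
lemma continuous_integral_mul_translate {A V : EuclideanSpace ℝ (Fin n) → ℝ}
    (hA : MemLp A 2) (hV : MemLp V 2) : Continuous fun z => ∫ x, A x * V (x - z) := by
  have hmp : ∀ z : EuclideanSpace ℝ (Fin n),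
      MeasurePreserving (fun x : EuclideanSpace ℝ (Fin n) => x - z) volume volume :=
    fun z => measurePreserving_sub_right volume z
  let F : C(EuclideanSpace ℝ (Fin n) × EuclideanSpace ℝ (Fin n), EuclideanSpace ℝ (Fin n)) :=
    ⟨fun p => p.2 - p.1, by fun_prop⟩
  have h1 : Continuous fun z => Lp.compMeasurePreserving (F.curry z) (hmp z) (hV.toLp V) :=
    Continuous.compMeasurePreservingLp continuous_const F.curry.continuous hmp (by norm_num)
  have h2 : Continuous fun z => inner ℝ (hA.toLp A)
      (Lp.compMeasurePreserving (F.curry z) (hmp z) (hV.toLp V)) :=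
    continuous_const.inner h1
  refine h2.congr fun z => ?_
  rw [L2.inner_def]
  refine integral_congr_ae ?_
  have h3 := Lp.coeFn_compMeasurePreserving (hV.toLp V) (hmp z)
  have h4 := (hmp z).quasiMeasurePreserving.ae_eq_comp hV.coeFn_toLp
  filter_upwards [hA.coeFn_toLp, h3, h4] with x hx hx3 hx4
  rw [hx]
  have : (Lp.compMeasurePreserving (F.curry z) (hmp z) (hV.toLp V)) x = V (x - z) :=
    hx3.trans hx4
  rw [this]
  simp [mul_comm]

/-- Mollifications converge weakly in `L²`. -/
lemma tendsto_integral_mul_mollify {A V : EuclideanSpace ℝ (Fin n) → ℝ}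
    (hA : MemLp A 2) (hV : MemLp V 2) :
    Tendsto (fun i => ∫ x, A x * mollify i V x) atTop (𝓝 (∫ x, A x * V x)) := by
  have hcont : Continuous fun z => ∫ x, A x * V (x + z) := by
    have := (continuous_integral_mul_translate hA hV).comp continuous_neg
    simpa [Function.comp_def] using this
  have h := tendsto_mollify hcont 0
  simp only [add_zero] at h
  refine h.congr fun i => ?_
  rw [mollify_apply]
  simp only [mollify_apply, zero_sub, ← sub_eq_add_neg, ← integral_const_mul]
  have hb : Integrable ((bumpSeq n i).normed volume) := (bumpSeq n i).integrable_normed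
  rw [integral_integral_swap]
  · refine integral_congr_ae (Eventually.of_forall fun x => ?_)
    exact integral_congr_ae (Eventually.of_forall fun z => by ring)
  · have hA2 : Integrable fun x => A x ^ 2 := hA.integrable_sq
    have hV2 : Integrable fun x => V x ^ 2 := hV.integrable_sq
    have i1 := (hb.convolution_integrand (ContinuousLinearMap.lsmul ℝ ℝ) hV2).swap
    have i2 := hb.mul_prod hA2
    refine (i1.add i2).mono' ?_ ?_
    · have m1 := hA.aestronglyMeasurable.comp_snd (μ := volume (α := EuclideanSpace ℝ (Fin n)))
      have m2 := (hb.aestronglyMeasurable.convolution_integrand (ContinuousLinearMap.lsmul ℝ ℝ)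
        (μ := volume) hV.aestronglyMeasurable).prod_swap
      refine (m1.mul m2).congr (Eventually.of_forall fun p => ?_)
      simp [Function.uncurry]; ring
    · refine Eventually.of_forall fun p => ?_
      simp only [Function.uncurry, Pi.add_apply, Function.comp_apply, Prod.fst_swap, Prod.snd_swap,
        ContinuousLinearMap.lsmul_apply, smul_eq_mul]
      have hnn := (bumpSeq n i).nonneg_normed (μ := volume) p.1
      rw [Real.norm_eq_abs, abs_mul, abs_of_nonneg hnn, ← mul_add]
      refine mul_le_mul_of_nonneg_left ?_ hnn
      rw [abs_mul]
      nlinarith [sq_nonneg (|A p.2| - |V (p.2 - p.1)|), sq_abs (A p.2), sq_abs (V (p.2 - p.1)),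
        abs_nonneg (A p.2), abs_nonneg (V (p.2 - p.1))]

/-- A function that is square integrable on compact subsets of `O`. -/
def MemL2loc (O : Set (EuclideanSpace ℝ (Fin n))) (U : EuclideanSpace ℝ (Fin n) → ℝ) : Prop :=
  ∀ K ⊆ O, IsCompact K → MemLp U 2 (volume.restrict K)

lemma MemL2loc.locallyIntegrableOn {O : Set (EuclideanSpace ℝ (Fin n))} (hO : IsOpen O)
    {U : EuclideanSpace ℝ (Fin n) → ℝ} (h : MemL2loc O U) : LocallyIntegrableOn U O := by
  rw [locallyIntegrableOn_iff hO.isLocallyClosed]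
  intro K hK hKc
  have : IsFiniteMeasure (volume.restrict K) := ⟨by simpa using hKc.measure_lt_top⟩
  exact (h K hK hKc).integrable (by norm_num)

lemma MemL2loc.mul_continuous {O : Set (EuclideanSpace ℝ (Fin n))}
    {U : EuclideanSpace ℝ (Fin n) → ℝ} (h : MemL2loc O U) {ψ : EuclideanSpace ℝ (Fin n) → ℝ}
    (hψ : Continuous ψ) (hc : HasCompactSupport ψ) (hs : tsupport ψ ⊆ O) :
    MemLp (fun x => U x * ψ x) 2 := by
  obtain ⟨C, hC⟩ := hψ.bounded_above_of_compact_support hc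
  have h1 : MemLp (fun x => U x * ψ x) 2 (volume.restrict (tsupport ψ)) := by
    refine (h _ hs hc.isCompact).of_le_mul (c := C) 
      ((h _ hs hc.isCompact).aestronglyMeasurable.mul hψ.aestronglyMeasurable)
      (Eventually.of_forall fun x => ?_)
    rw [norm_mul, mul_comm]
    exact mul_le_mul_of_nonneg_right (hC x) (norm_nonneg _)
  have h2 : (tsupport ψ).indicator (fun x => U x * ψ x) = fun x => U x * ψ x := by
    rw [indicator_eq_self]
    intro x hx
    exact subset_tsupport _ (right_ne_zero_of_mul hx)
  rw [← h2]
  exact (memLp_indicator_iff_restrict (isClosed_tsupport _).measurableSet).2 h1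

/-- The product rule for two functions with locally square integrable weak derivatives. One factor
is cut off and mollified; the product rule holds for the mollified factor, and it passes to the
limit since mollifications converge weakly in `L²`. -/
lemma HasWeakPartial.mul {O : Set (EuclideanSpace ℝ (Fin n))} (hO : IsOpen O) {l : Fin n}
    {U U' V V' : EuclideanSpace ℝ (Fin n) → ℝ} (hU : MemL2loc O U) (hU' : MemL2loc O U')
    (hV : MemL2loc O V) (hV' : MemL2loc O V') (h : HasWeakPartial 1 O l U U')
    (k : HasWeakPartial 1 O l V V') :
    HasWeakPartial 1 O l (fun x => U x * V x) (fun x => U' x * V x + U x * V' x) := by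
  intro φ hφ hc hs
  -- a cutoff equal to one near the support of the test function
  obtain ⟨ζ, hζs, hζc, hζO, hζ1⟩ : ∃ ζ : EuclideanSpace ℝ (Fin n) → ℝ, ContDiff ℝ 1 ζ ∧
      HasCompactSupport ζ ∧ tsupport ζ ⊆ O ∧ ∀ x ∈ tsupport φ, ζ =ᶠ[𝓝 x] fun _ => 1 := by
    obtain ⟨K', hK'c, hK1, hK2⟩ := exists_compact_between hc.isCompact hO hs
    obtain ⟨f, hf1, hf0, -⟩ := exists_contMDiffMap_one_nhds_of_subset_interior (n := 1)
      𝓘(ℝ, EuclideanSpace ℝ (Fin n)) (isClosed_tsupport φ) hK1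
    have hsub : tsupport f ⊆ K' := closure_minimal (fun x hx => by
      by_contra hxK
      exact hx (hf0 x hxK)) hK'c.isClosed
    exact ⟨f, f.contMDiff.contDiff, hK'c.of_isClosed_subset (isClosed_tsupport _) hsub,
      hsub.trans hK2, fun x hx => hf1.filter_mono (nhds_le_nhdsSet hx)⟩
  have hζd := hζs.differentiable one_ne_zero
  have hφd := hφ.differentiable one_ne_zero
  have hζ'c : HasCompactSupport (partialDeriv l ζ) :=
    hζc.of_isClosed_subset (isClosed_tsupport _) (tsupport_partialDeriv_subset _ _)
  have hφ'c : HasCompactSupport (partialDeriv l φ) :=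
    hc.of_isClosed_subset (isClosed_tsupport _) (tsupport_partialDeriv_subset _ _)
  set W := fun x => V x * ζ x with hW
  set W' := fun x => V' x * ζ x + V x * partialDeriv l ζ x with hW'
  have hW2 : MemLp W 2 := hV.mul_continuous hζs.continuous hζc hζO
  have hW'2 : MemLp W' 2 := (hV'.mul_continuous hζs.continuous hζc hζO).add
    (hV.mul_continuous (continuous_partialDeriv hζs l) hζ'c
      ((tsupport_partialDeriv_subset _ _).trans hζO))
  have hWl : LocallyIntegrable W := hW2.locallyIntegrable (by norm_num)
  have loc : ∀ {Z ψ : EuclideanSpace ℝ (Fin n) → ℝ}, MemL2loc O Z → Continuous ψ →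
      HasCompactSupport ψ → tsupport ψ ⊆ O → Integrable (fun x => Z x * ψ x) := by
    intro Z ψ hZ hψ hψc hψO
    exact integrable_mul_of_tsupport_subset (hZ.locallyIntegrableOn hO) hψ hψc hψO
  -- the localised factor `V ζ` has a weak derivative on the whole space
  have hWw : HasWeakPartial ⊤ univ l W W' := by
    intro ψ hψ hψc _
    have hψ1 : ContDiff ℝ 1 ψ := hψ.of_le (by exact_mod_cast le_top)
    have hψd := hψ1.differentiable one_ne_zero
    have hts : tsupport (fun x => ζ x * ψ x) ⊆ tsupport ζ := tsupport_mul_subset_left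
    have e := k (fun x => ζ x * ψ x) (hζs.mul hψ1) (hζc.mul_right) (hts.trans hζO)
    simp only [partialDeriv_mul (hζd _) (hψd _)] at e
    have i1 : Integrable fun x => V x * (partialDeriv l ζ x * ψ x) :=
      loc hV ((continuous_partialDeriv hζs l).mul hψ.continuous) hζ'c.mul_right
        (tsupport_mul_subset_left.trans ((tsupport_partialDeriv_subset _ _).trans hζO))
    have i2 : Integrable fun x => V x * (ζ x * partialDeriv l ψ x) :=
      loc hV (hζs.continuous.mul (continuous_partialDeriv hψ1 l)) hζc.mul_right
        (tsupport_mul_subset_left.trans hζO)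
    have i3 : Integrable fun x => V' x * (ζ x * ψ x) :=
      loc hV' (hζs.continuous.mul hψ.continuous) hζc.mul_right (hts.trans hζO)
    simp only [mul_add] at e
    rw [integral_add i1 i2] at e
    have e1 : ∫ y, W y * partialDeriv l ψ y = ∫ x, V x * (ζ x * partialDeriv l ψ x) :=
      integral_congr_ae (Eventually.of_forall fun x => by simp only [hW]; ring)
    have e2 : ∫ y, W' y * ψ y = (∫ x, V' x * (ζ x * ψ x)) + ∫ x, V x * (partialDeriv l ζ x * ψ x) := by
      rw [← integral_add i3 i1]
      exact integral_congr_ae (Eventually.of_forall fun x => by simp only [hW']; ring)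
    rw [e1, e2]; linarith
  have hA1 : MemLp (fun x => U x * partialDeriv l φ x) 2 :=
    hU.mul_continuous (continuous_partialDeriv hφ l) hφ'c
      ((tsupport_partialDeriv_subset _ _).trans hs)
  have hA2 : MemLp (fun x => U x * φ x) 2 := hU.mul_continuous hφ.continuous hc hs
  have hA3 : MemLp (fun x => U' x * φ x) 2 := hU'.mul_continuous hφ.continuous hc hs
  -- the identity for the mollified factor, and its limit
  have t := ((tendsto_integral_mul_mollify hA1 hW2).add
    (tendsto_integral_mul_mollify hA2 hW'2)).add (tendsto_integral_mul_mollify hA3 hW2)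
  have t0 : ∀ i, (∫ x, U x * partialDeriv l φ x * mollify i W x)
      + (∫ x, U x * φ x * mollify i W' x) + (∫ x, U' x * φ x * mollify i W x) = 0 := by
    intro i
    have hm : ContDiff ℝ 1 (mollify i W) := (contDiff_mollify i hWl).of_le (by exact_mod_cast le_top)
    have hmd := hm.differentiable one_ne_zero
    have e := h (fun x => φ x * mollify i W x) (hφ.mul hm) hc.mul_right
      (tsupport_mul_subset_left.trans hs)
    simp only [partialDeriv_mul (hφd _) (hmd _), partialDeriv_mollify_of_weak i hWl hWw,
      mul_add] at e
    have hm' : Continuous (mollify i W') := by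
      have := continuous_partialDeriv hm l
      simpa only [funext fun x => partialDeriv_mollify_of_weak i hWl hWw x] using this
    have i1 : Integrable fun x => U x * (partialDeriv l φ x * mollify i W x) :=
      loc hU ((continuous_partialDeriv hφ l).mul hm.continuous) hφ'c.mul_right
        (tsupport_mul_subset_left.trans ((tsupport_partialDeriv_subset _ _).trans hs))
    have i2 : Integrable fun x => U x * (φ x * mollify i W' x) :=
      loc hU (hφ.continuous.mul hm') hc.mul_right (tsupport_mul_subset_left.trans hs)
    rw [integral_add i1 i2] at e
    simp only [← mul_assoc] at e
    linarith
  simp only [t0] at t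
  have t1 := tendsto_nhds_unique t tendsto_const_nhds
  -- on the support of the test function the cutoff disappears
  have hWφ : ∀ x, φ x * W x = φ x * V x := by
    intro x
    by_cases hx : x ∈ tsupport φ
    · simp only [hW, (hζ1 x hx).self_of_nhds, mul_one]
    · rw [image_eq_zero_of_notMem_tsupport hx, zero_mul, zero_mul]
  have hWφ' : ∀ x, φ x * W' x = φ x * V' x := by
    intro x
    by_cases hx : x ∈ tsupport φ
    · have : partialDeriv l ζ x = 0 := by
        rw [partialDeriv_congr (hζ1 x hx), partialDeriv_const]
      simp only [hW', (hζ1 x hx).self_of_nhds, mul_one, this, mul_zero, add_zero]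
    · rw [image_eq_zero_of_notMem_tsupport hx, zero_mul, zero_mul]
  have hWd : ∀ x, partialDeriv l φ x * W x = partialDeriv l φ x * V x := by
    intro x
    by_cases hx : x ∈ tsupport φ
    · simp only [hW, (hζ1 x hx).self_of_nhds, mul_one]
    · rw [partialDeriv_eq_zero_of_notMem hx, zero_mul, zero_mul]
  have j2 : Integrable (fun x => U x * φ x * W' x) := hA2.integrable_mul hW'2
  have j3 : Integrable (fun x => U' x * φ x * W x) := hA3.integrable_mul hW2
  have f1 : ∫ y, U y * V y * partialDeriv l φ y = ∫ x, U x * partialDeriv l φ x * W x :=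
    integral_congr_ae (Eventually.of_forall fun x => by
      simp only []; rw [mul_assoc, mul_assoc, hWd, mul_comm (V x)])
  have f2 : ∫ y, (U' y * V y + U y * V' y) * φ y
      = (∫ x, U x * φ x * W' x) + ∫ x, U' x * φ x * W x := by
    rw [← integral_add j2 j3]
    refine integral_congr_ae (Eventually.of_forall fun x => ?_)
    simp only []
    rw [mul_assoc (U x), mul_assoc (U' x), hWφ, hWφ']; ring
  rw [f1, f2]; linarith

end Mollify

/-! ### Charts, coordinate frames and change of coordinates -/

section Charts

variable {n : ℕ} [NeZero n] {m : ℕ} {M : Type*} [TopologicalSpace M]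
  [ChartedSpace (EuclideanHalfSpace n) M] [IsManifold (𝓡∂ n) ∞ M] {r s : ℕ}

/-- The open set of coordinates of the interior points in the chart at `c`. -/
abbrev chartDom (c : M) : Set (EuclideanSpace ℝ (Fin n)) := interior (extChartAt (𝓡∂ n) c).target

lemma isOpen_chartDom (c : M) : IsOpen (chartDom (n := n) c) := isOpen_interior

lemma chartDom_subset (c : M) : chartDom (n := n) c ⊆ (extChartAt (𝓡∂ n) c).target :=
  interior_subset

lemma symm_mem_source {c : M} {y : EuclideanSpace ℝ (Fin n)} (hy : y ∈ chartDom c) :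
    (extChartAt (𝓡∂ n) c).symm y ∈ (extChartAt (𝓡∂ n) c).source :=
  (extChartAt (𝓡∂ n) c).map_target (chartDom_subset c hy)

lemma extChartAt_right_inv {c : M} {y : EuclideanSpace ℝ (Fin n)} (hy : y ∈ chartDom c) :
    extChartAt (𝓡∂ n) c ((extChartAt (𝓡∂ n) c).symm y) = y :=
  (extChartAt (𝓡∂ n) c).right_inv (chartDom_subset c hy)

lemma mem_chartDom_iff {c z : M} (hz : z ∈ (extChartAt (𝓡∂ n) c).source) :
    extChartAt (𝓡∂ n) c z ∈ chartDom c ↔ z ∈ (𝓡∂ n).interior M := by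
  rw [extChartAt_source] at hz
  exact ((𝓡∂ n).isInteriorPoint_iff_of_mem_atlas (n := (∞ : WithTop ℕ∞)) (by simp) (chart_mem_atlas _ c) hz).symm

lemma symm_mem_interior {c : M} {y : EuclideanSpace ℝ (Fin n)} (hy : y ∈ chartDom c) :
    (extChartAt (𝓡∂ n) c).symm y ∈ (𝓡∂ n).interior M := by
  rw [← mem_chartDom_iff (symm_mem_source hy), extChartAt_right_inv hy]
  exact hy

lemma extChartAt_self_mem_chartDom {x : M} (hx : x ∈ (𝓡∂ n).interior M) :
    extChartAt (𝓡∂ n) x x ∈ chartDom x :=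
  (mem_chartDom_iff (mem_extChartAt_source x)).2 hx

lemma isOpen_interior_manifold : IsOpen ((𝓡∂ n).interior M) :=
  (𝓡∂ n).isOpen_interior (n := (∞ : WithTop ℕ∞)) (by simp)

/-- The part of `chartDom c` that corresponds to the subset `U` of the manifold. -/
def chartDomIn (c : M) (U : Set M) : Set (EuclideanSpace ℝ (Fin n)) :=
  chartDom c ∩ (extChartAt (𝓡∂ n) c).symm ⁻¹' U

lemma isOpen_chartDomIn (c : M) {U : Set M} (hU : IsOpen U) : IsOpen (chartDomIn (n := n) c U) :=
  ((continuousOn_extChartAt_symm c).mono (chartDom_subset c)).isOpen_inter_preimage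
    (isOpen_chartDom c) hU

/-- The Jacobian matrix at `z` of the change of coordinates from the chart at `c` to that
at `c'`. -/
def jac (c c' z : M) : Matrix (Fin n) (Fin n) ℝ :=
  Matrix.of fun i j => tangentCoordChange (𝓡∂ n) c c' z (EuclideanSpace.single j (1 : ℝ)) i

lemma tangentCoordChange_apply (c c' z : M) (v : EuclideanSpace ℝ (Fin n)) (i : Fin n) :
    tangentCoordChange (𝓡∂ n) c c' z v i = ∑ j, jac c c' z i j * v j := by
  conv_lhs => rw [← (EuclideanSpace.basisFun (Fin n) ℝ).sum_repr v]
  simp [jac, mul_comm]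

lemma jac_self {c z : M} (hz : z ∈ (extChartAt (𝓡∂ n) c).source) :
    jac (n := n) c c z = 1 := by
  ext i j
  rw [jac, Matrix.of_apply, tangentCoordChange_self hz]
  simp [Matrix.one_apply]

lemma jac_mul_jac {c c' c'' z : M} (hz : z ∈ (extChartAt (𝓡∂ n) c).source)
    (hz' : z ∈ (extChartAt (𝓡∂ n) c').source) (hz'' : z ∈ (extChartAt (𝓡∂ n) c'').source) :
    jac (n := n) c' c'' z * jac c c' z = jac c c'' z := by
  ext i j
  have h := tangentCoordChange_comp (I := 𝓡∂ n) (w := c) (x := c') (y := c'')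
    (v := EuclideanSpace.single j (1 : ℝ)) ⟨⟨hz, hz'⟩, hz''⟩
  rw [Matrix.mul_apply]
  have := congrArg (fun v => v i) h
  simp only [tangentCoordChange_apply c' c''] at this
  exact this

lemma jac_mul_jac_self {c c' z : M} (hz : z ∈ (extChartAt (𝓡∂ n) c).source)
    (hz' : z ∈ (extChartAt (𝓡∂ n) c').source) :
    jac (n := n) c' c z * jac c c' z = 1 := by
  rw [jac_mul_jac hz hz' hz, jac_self hz]

lemma coordVec_eq {c c' z : M} (hz : z ∈ (extChartAt (𝓡∂ n) c).source)
    (hz' : z ∈ (extChartAt (𝓡∂ n) c').source) (i : Fin n) :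
    coordVec c z i = ∑ j, jac c c' z j i • coordVec c' z j := by
  have h := tangentCoordChange_comp (I := 𝓡∂ n) (w := c) (x := c') (y := z)
    (v := EuclideanSpace.single i (1 : ℝ)) ⟨⟨hz, hz'⟩, mem_extChartAt_source z⟩
  have h2 : tangentCoordChange (𝓡∂ n) c c' z (EuclideanSpace.single i (1 : ℝ))
      = ∑ j, jac c c' z j i • EuclideanSpace.single j (1 : ℝ) := by
    ext k
    simp [jac, Pi.single_apply]
  rw [h2, map_sum] at h
  simp only [map_smul] at h
  exact h.symm

lemma coordCovec_eq {c c' z : M} (hz : z ∈ (extChartAt (𝓡∂ n) c).source)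
    (hz' : z ∈ (extChartAt (𝓡∂ n) c').source) (i : Fin n) :
    coordCovec c z i = ∑ j, jac c' c z i j • coordCovec c' z j := by
  ext v
  have h := tangentCoordChange_comp (I := 𝓡∂ n) (w := z) (x := c') (y := c)
    (v := v) ⟨⟨mem_extChartAt_source z, hz'⟩, hz⟩
  have h1 : coordCovec c z i v = tangentCoordChange (𝓡∂ n) z c z v i := rfl
  have h2 : ∀ j, coordCovec c' z j v = tangentCoordChange (𝓡∂ n) z c' z v j := fun j => rfl
  rw [h1, ← h, tangentCoordChange_apply]
  simp [h2]

lemma coordCovec_coordVec {c z : M} (hz : z ∈ (extChartAt (𝓡∂ n) c).source) (i j : Fin n) :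
    coordCovec c z i (coordVec c z j) = (1 : Matrix (Fin n) (Fin n) ℝ) i j := by
  have h := tangentCoordChange_comp (I := 𝓡∂ n) (w := c) (x := z) (y := c)
    (v := EuclideanSpace.single j (1 : ℝ)) ⟨⟨hz, mem_extChartAt_source z⟩, hz⟩
  change tangentCoordChange (𝓡∂ n) z c z (tangentCoordChange (𝓡∂ n) c z z _) i = _
  rw [h, tangentCoordChange_self hz]
  simp [Matrix.one_apply]

omit [NeZero n] in
lemma sum_sumElim {σ τ : Type*} [Fintype σ] [Fintype τ] [DecidableEq σ] [DecidableEq τ]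
    (f : (σ ⊕ τ → Fin n) → ℝ) : ∑ K, f K = ∑ I : σ → Fin n, ∑ J : τ → Fin n, f (Sum.elim I J) := by
  rw [← (Equiv.sumArrowEquivProdArrow _ _ _).symm.sum_comp, Fintype.sum_prod_type]
  rfl

/-- Tensors of type `(r, s)` at the point `z`. -/
abbrev TensorAt (n : ℕ) [NeZero n] {M : Type*} [TopologicalSpace M]
    [ChartedSpace (EuclideanHalfSpace n) M] (r s : ℕ) (z : M) :=
  MultilinearMap ℝ (fun _ : Fin r => TangentSpace (𝓡∂ n) z →L[ℝ] ℝ)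
    (MultilinearMap ℝ (fun _ : Fin s => TangentSpace (𝓡∂ n) z) ℝ)

/-- The array of all components of a tensor at `z` in the chart at `c`. Contravariant and covariant
slots are put together in the index set `Fin r ⊕ Fin s`. -/
def arr (c z : M) (T : TensorAt n r s z) (K : Fin r ⊕ Fin s → Fin n) : ℝ :=
  T (fun a => coordCovec c z (K (Sum.inl a))) (fun b => coordVec c z (K (Sum.inr b)))

lemma arr_add (c z : M) (T S : TensorAt n r s z) : arr c z (T + S) = arr c z T + arr c z S := rfl

lemma comp_eq_arr (u : TensorField n M r s) (c : M) (I : Fin r → Fin n) (J : Fin s → Fin n)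
    (y : EuclideanSpace ℝ (Fin n)) :
    comp u c I J y
      = arr c ((extChartAt (𝓡∂ n) c).symm y) (u ((extChartAt (𝓡∂ n) c).symm y)) (Sum.elim I J) :=
  rfl

/-- The matrices by which components in the chart at `c'` become components in the chart at `c`. -/
def transf (r s : ℕ) (c c' z : M) : Fin r ⊕ Fin s → Matrix (Fin n) (Fin n) ℝ :=
  Sum.elim (fun _ => jac c' c z) (fun _ => (jac c c' z).transpose)

lemma arr_eq_slotMap {c c' z : M} (hz : z ∈ (extChartAt (𝓡∂ n) c).source)
    (hz' : z ∈ (extChartAt (𝓡∂ n) c').source) (T : TensorAt n r s z) :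
    arr c z T = slotMap (transf r s c c' z) (arr c' z T) := by
  ext K
  have h1 : (fun a => coordCovec c z (K (Sum.inl a)))
      = fun a => ∑ j, jac c' c z (K (Sum.inl a)) j • coordCovec (n := n) c' z j :=
    funext fun a => coordCovec_eq hz hz' _
  have h2 : (fun b => coordVec c z (K (Sum.inr b)))
      = fun b => ∑ j, jac c c' z j (K (Sum.inr b)) • coordVec (n := n) c' z j :=
    funext fun b => coordVec_eq hz hz' _
  rw [arr, h1, h2]
  simp only [MultilinearMap.map_sum, MultilinearMap.map_smul_univ, _root_.smul_apply,
    _root_.sum_apply]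
  rw [slotMap_apply, sum_sumElim]
  refine Finset.sum_congr rfl fun I _ => ?_
  rw [smul_eq_mul, Finset.mul_sum]
  refine Finset.sum_congr rfl fun J _ => ?_
  rw [Fintype.prod_sum_type, smul_eq_mul, ← mul_assoc]
  rfl

lemma arr_ofComp {x : M} (A : (Fin r → Fin n) → (Fin s → Fin n) → ℝ) :
    arr x x (ofComp x A) = fun K => A (K ∘ Sum.inl) (K ∘ Sum.inr) := by
  ext K
  have hx := mem_extChartAt_source (I := 𝓡∂ n) x
  simp only [arr, ofComp, _root_.sum_apply, MultilinearMap.smulRight_apply,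
    _root_.smul_apply, MultilinearMap.compLinearMap_apply, MultilinearMap.mkPiAlgebra_apply,
    smul_eq_mul]
  have e1 : ∀ (I : Fin r → Fin n) (a : Fin r), (LinearMap.applyₗ (coordVec x x (I a)) ∘ₗ
          ContinuousLinearMap.coeLM (M := TangentSpace (𝓡∂ n) x) (N₃ := ℝ) ℝ)
          (coordCovec x x (K (Sum.inl a))) = (1 : Matrix (Fin n) (Fin n) ℝ) (K (Sum.inl a)) (I a) :=
    fun I a => coordCovec_coordVec hx _ _
  have e2 : ∀ (J : Fin s → Fin n) (b : Fin s), (coordCovec x x (J b)).toLinearMap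
      (coordVec x x (K (Sum.inr b))) = (1 : Matrix (Fin n) (Fin n) ℝ) (J b) (K (Sum.inr b)) :=
    fun J b => coordCovec_coordVec hx _ _
  simp only [e1, e2]
  have := congrFun (slotMap_one fun L : Fin r ⊕ Fin s → Fin n => A (L ∘ Sum.inl) (L ∘ Sum.inr)) K
  rw [← this, slotMap_apply, sum_sumElim]
  refine Finset.sum_congr rfl fun I _ => Finset.sum_congr rfl fun J _ => ?_
  have e3 : ∀ b, (1 : Matrix (Fin n) (Fin n) ℝ) (J b) (K (Sum.inr b))
    = (1 : Matrix (Fin n) (Fin n) ℝ) (K (Sum.inr b)) (J b) := fun b => by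
      simp [Matrix.one_apply, eq_comm]
  simp only [e3, Fintype.prod_sum_type, Sum.elim_comp_inl, Sum.elim_comp_inr]
  change (∏ a, (1 : Matrix (Fin n) (Fin n) ℝ) (K (Sum.inl a)) (I a))
      * (A I J * ∏ b, (1 : Matrix (Fin n) (Fin n) ℝ) (K (Sum.inr b)) (J b))
    = (∏ a, (1 : Matrix (Fin n) (Fin n) ℝ) (K (Sum.inl a)) (I a))
      * (∏ b, (1 : Matrix (Fin n) (Fin n) ℝ) (K (Sum.inr b)) (J b)) * A I J
  ring

/-- The matrix of the metric at `z` in the chart at `c`. -/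
def gramAt (g : Metric n m M) (c z : M) : Matrix (Fin n) (Fin n) ℝ :=
  Matrix.of fun i j => g.inner z (coordVec c z i) (coordVec c z j)

lemma gram_eq_gramAt (g : Metric n m M) (c : M) (y : EuclideanSpace ℝ (Fin n)) :
    gram g c y = gramAt g c ((extChartAt (𝓡∂ n) c).symm y) := rfl

lemma gramAt_transpose (g : Metric n m M) (c z : M) :
    (gramAt g c z).transpose = gramAt g c z := by
  ext i j
  exact g.symm z _ _

lemma gramAt_eq (g : Metric n m M) {c c' z : M} (hz : z ∈ (extChartAt (𝓡∂ n) c).source)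
    (hz' : z ∈ (extChartAt (𝓡∂ n) c').source) :
    gramAt g c z = (jac c c' z).transpose * gramAt g c' z * jac c c' z := by
  ext i j
  simp only [gramAt, Matrix.of_apply, coordVec_eq hz hz' i, coordVec_eq hz hz' j, Matrix.mul_apply,
    map_sum, map_smul, _root_.sum_apply, _root_.smul_apply,
    Matrix.transpose_apply, smul_eq_mul, Finset.sum_mul, Finset.mul_sum]
  refine Finset.sum_congr rfl fun p _ => Finset.sum_congr rfl fun q _ => by ring

lemma posDef_gramAt (g : Metric n m M) {c z : M} (hz : z ∈ (extChartAt (𝓡∂ n) c).source) :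
    (gramAt g c z).PosDef := by
  refine Matrix.PosDef.of_dotProduct_mulVec_pos (by
    rw [Matrix.IsHermitian, Matrix.conjTranspose_eq_transpose_of_trivial, gramAt_transpose]) ?_
  intro v hv
  set w : TangentSpace (𝓡∂ n) z := ∑ i, v i • coordVec c z i with hw
  have hne : w ≠ 0 := by
    intro h
    apply hv
    ext i
    have : coordCovec c z i w = v i := by
      simp only [hw, map_sum, map_smul, coordCovec_coordVec hz]
      simp [Matrix.one_apply]
    rw [← this, h]; simp
  refine (g.pos z w hne).trans_eq ?_
  simp only [hw, map_sum, map_smul, _root_.sum_apply, _root_.smul_apply,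
    dotProduct, Matrix.mulVec, gramAt, Matrix.of_apply, smul_eq_mul, Finset.mul_sum, star_trivial]
  rw [Finset.sum_comm]
  refine Finset.sum_congr rfl fun p _ => Finset.sum_congr rfl fun q _ => by ring

/-! Regularity of the change of coordinates and of the metric. -/

lemma contDiffOn_transition (c c' : M) :
    ContDiffOn ℝ ∞ (extChartAt (𝓡∂ n) c' ∘ (extChartAt (𝓡∂ n) c).symm)
      (chartDomIn c (extChartAt (𝓡∂ n) c').source) := by
  intro y hy
  have h : y ∈ ((extChartAt (𝓡∂ n) c).symm ≫ extChartAt (𝓡∂ n) c').source := by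
    rw [PartialEquiv.trans_source]
    exact ⟨chartDom_subset c hy.1, hy.2⟩
  exact ((contDiffOn_ext_coord_change (I := 𝓡∂ n) c' c) y h).mono fun w hw => by
    rw [PartialEquiv.trans_source]
    exact ⟨chartDom_subset (n := n) c hw.1, hw.2⟩

lemma hasFDerivAt_transition {c c' : M} {y : EuclideanSpace ℝ (Fin n)} (hy : y ∈ chartDom c)
    (hy' : (extChartAt (𝓡∂ n) c).symm y ∈ (extChartAt (𝓡∂ n) c').source) :
    HasFDerivAt (extChartAt (𝓡∂ n) c' ∘ (extChartAt (𝓡∂ n) c).symm)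
      (tangentCoordChange (𝓡∂ n) c c' ((extChartAt (𝓡∂ n) c).symm y)) y := by
  have h := hasFDerivWithinAt_tangentCoordChange (I := 𝓡∂ n) ⟨symm_mem_source hy, hy'⟩
  rw [extChartAt_right_inv hy] at h
  refine h.hasFDerivAt (Filter.mem_of_superset ((isOpen_chartDom c).mem_nhds hy) ?_)
  exact (chartDom_subset c).trans (extChartAt_target_subset_range c)

lemma contDiffOn_jac (c c' : M) (i j : Fin n) :
    ContDiffOn ℝ ∞ (fun y => jac c c' ((extChartAt (𝓡∂ n) c).symm y) i j)
      (chartDomIn c (extChartAt (𝓡∂ n) c').source) := by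
  have hO : IsOpen (chartDomIn (n := n) c (extChartAt (𝓡∂ n) c').source) :=
    isOpen_chartDomIn c (isOpen_extChartAt_source c')
  have h := (contDiffOn_transition c c').fderiv_of_isOpen hO (m := ∞) (by simp)
  have h2 : ContDiffOn ℝ ∞ (fun y => (fderiv ℝ (extChartAt (𝓡∂ n) c' ∘
      (extChartAt (𝓡∂ n) c).symm) y (EuclideanSpace.single j (1 : ℝ))) i)
      (chartDomIn c (extChartAt (𝓡∂ n) c').source) := by
    have := h.clm_apply (contDiffOn_const (c := EuclideanSpace.single j (1 : ℝ)))
    exact (EuclideanSpace.proj (𝕜 := ℝ) i).contDiff.comp_contDiffOn this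
  refine h2.congr fun y hy => ?_
  rw [(hasFDerivAt_transition hy.1 hy.2).fderiv]
  rfl

lemma contMDiffOn_coordVec (c : M) (i : Fin n) :
    ContMDiffOn (𝓡∂ n) ((𝓡∂ n).prod 𝓘(ℝ, EuclideanSpace ℝ (Fin n))) ∞
      (fun z => TotalSpace.mk' (EuclideanSpace ℝ (Fin n)) (E := fun z : M => TangentSpace (𝓡∂ n) z)
        z (coordVec c z i)) (extChartAt (𝓡∂ n) c).source := by
  have : IsManifold (𝓡∂ n) ((∞ : WithTop ℕ∞) + 1) M := by simpa using ‹IsManifold (𝓡∂ n) ∞ M›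
  have h := (trivializationAt (EuclideanSpace ℝ (Fin n))
    (fun z : M => TangentSpace (𝓡∂ n) z) c).contMDiffOn_localFrame_baseSet (I := 𝓡∂ n) ∞
      (EuclideanSpace.basisFun (Fin n) ℝ).toBasis i
  rw [TangentBundle.trivializationAt_baseSet, ← extChartAt_source (𝓡∂ n)] at h
  refine h.congr fun z hz => ?_
  rw [extChartAt_source] at hz
  have hz' : z ∈ (trivializationAt (EuclideanSpace ℝ (Fin n))
    (fun z : M => TangentSpace (𝓡∂ n) z) c).baseSet := by
    rwa [TangentBundle.trivializationAt_baseSet]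
  have e1 := TangentBundle.symmL_trivializationAt_eq_core (I := 𝓡∂ n) hz
  have : coordVec c z i = (trivializationAt (EuclideanSpace ℝ (Fin n))
    (fun z : M => TangentSpace (𝓡∂ n) z) c).symmL ℝ z (EuclideanSpace.single i (1 : ℝ)) := by
    rw [e1]; rfl
  rw [this, Trivialization.localFrame_apply_of_mem_baseSet _ _ hz']
  simp [Trivialization.basisAt, Trivialization.symmL_apply _ hz']

lemma contDiffOn_gram (g : Metric n m M) (c : M) (i j : Fin n) :
    ContDiffOn ℝ m (fun y => gram g c y i j) (chartDom c) := by
  have hm : (m : WithTop ℕ∞) ≤ (∞ : WithTop ℕ∞) := by exact_mod_cast le_top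
  have h : ContMDiffOn (𝓡∂ n) 𝓘(ℝ, ℝ) (m : WithTop ℕ∞)
      (fun z => g.inner z (coordVec c z i) (coordVec c z j)) (extChartAt (𝓡∂ n) c).source := by
    intro z hz
    have : ContMDiffWithinAt (𝓡∂ n) ((𝓡∂ n).prod 𝓘(ℝ, ℝ)) (m : WithTop ℕ∞)
        (fun z => TotalSpace.mk' ℝ (E := Bundle.Trivial M ℝ) z
          (g.inner z (coordVec c z i) (coordVec c z j))) (extChartAt (𝓡∂ n) c).source z := by
      apply ContMDiffWithinAt.clm_bundle_apply₂ (F₁ := EuclideanSpace ℝ (Fin n))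
        (F₂ := EuclideanSpace ℝ (Fin n))
      · exact (g.contMDiff z).contMDiffWithinAt
      · exact (contMDiffOn_coordVec c i z hz).of_le hm
      · exact (contMDiffOn_coordVec c j z hz).of_le hm
    simp only [contMDiffWithinAt_totalSpace] at this
    exact this.2
  rw [← contMDiffOn_iff_contDiffOn]
  exact h.comp (((contMDiffOn_extChartAt_symm (n := (∞ : WithTop ℕ∞)) c).of_le hm).mono (chartDom_subset c))
    fun y hy => symm_mem_source hy

end Charts

/-! ### The Levi-Civita connection in coordinates -/

section Koszul

variable {n : ℕ}

/-- The Koszul formula: the connection coefficients of a matrix `G` with partial derivatives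
`dG`. -/
def koszul (G : Matrix (Fin n) (Fin n) ℝ) (dG : Fin n → Matrix (Fin n) (Fin n) ℝ) (i : Fin n) :
    Matrix (Fin n) (Fin n) ℝ :=
  Matrix.of fun p j => (1 / 2) * ∑ q, G⁻¹ p q * (dG i j q + dG j i q - dG q i j)

lemma mul_koszul {G : Matrix (Fin n) (Fin n) ℝ} (hG : IsUnit G.det)
    (dG : Fin n → Matrix (Fin n) (Fin n) ℝ) (i q j : Fin n) :
    (G * koszul G dG i) q j = (1 / 2) * (dG i j q + dG j i q - dG q i j) := by
  set V : Matrix (Fin n) (Fin n) ℝ :=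
    Matrix.of fun q j => (1 / 2) * (dG i j q + dG j i q - dG q i j) with hV
  have h : koszul G dG i = G⁻¹ * V := by
    ext p j
    simp only [koszul, hV, Matrix.mul_apply, Matrix.of_apply, Finset.mul_sum]
    exact Finset.sum_congr rfl fun q _ => by ring
  rw [h, ← mul_assoc, Matrix.mul_nonsing_inv _ hG, one_mul]
  rfl

lemma koszul_symm (G : Matrix (Fin n) (Fin n) ℝ) {dG : Fin n → Matrix (Fin n) (Fin n) ℝ}
    (hd : ∀ l i j, dG l i j = dG l j i) (p i j : Fin n) :
    koszul G dG i p j = koszul G dG j p i := by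
  simp only [koszul, Matrix.of_apply]
  congr 1
  exact Finset.sum_congr rfl fun q _ => by rw [hd q i j]; ring

lemma koszul_compat {G : Matrix (Fin n) (Fin n) ℝ} (hG : IsUnit G.det) (hs : G.transpose = G)
    {dG : Fin n → Matrix (Fin n) (Fin n) ℝ} (hd : ∀ l i j, dG l i j = dG l j i) (l : Fin n) :
    dG l = G * koszul G dG l + (koszul G dG l).transpose * G := by
  have h : (koszul G dG l).transpose * G = (G * koszul G dG l).transpose := by
    rw [Matrix.transpose_mul, hs]
  ext i j
  rw [h, Matrix.add_apply, Matrix.transpose_apply, mul_koszul hG, mul_koszul hG, hd l j i,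
    hd j l i, hd i l j]
  ring

/-- A symmetric connection compatible with `G` is given by the Koszul formula. -/
lemma eq_koszul {G : Matrix (Fin n) (Fin n) ℝ} (hG : IsUnit G.det) (hs : G.transpose = G)
    {dG : Fin n → Matrix (Fin n) (Fin n) ℝ} {A : Fin n → Matrix (Fin n) (Fin n) ℝ}
    (hA : ∀ p i j, A i p j = A j p i)
    (hc : ∀ l, dG l = G * A l + (A l).transpose * G) (l : Fin n) :
    A l = koszul G dG l := by
  have hT : ∀ l, (A l).transpose * G = (G * A l).transpose := fun l => by
    rw [Matrix.transpose_mul, hs]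
  have hsym : ∀ q i j, (G * A i) q j = (G * A j) q i := fun q i j => by
    simp only [Matrix.mul_apply, hA]
  have hdG : ∀ l i j, dG l i j = (G * A l) i j + (G * A l) j i := fun l i j => by
    rw [hc l, hT, Matrix.add_apply, Matrix.transpose_apply]
  have h : G * A l = G * koszul G dG l := by
    ext q j
    rw [mul_koszul hG, hdG, hdG, hdG, hsym q j l, hsym j q l, hsym l j q]
    ring
  have := congrArg (fun X => G⁻¹ * X) h
  simpa only [← mul_assoc, Matrix.nonsing_inv_mul _ hG, one_mul] using this

end Koszul

section MatDeriv

variable {n : ℕ} {y : EuclideanSpace ℝ (Fin n)} {l : Fin n}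

lemma partialDeriv_comm {f : EuclideanSpace ℝ (Fin n) → ℝ} (hf : ContDiffAt ℝ 2 f y)
    (i j : Fin n) :
    partialDeriv i (partialDeriv j f) y = partialDeriv j (partialDeriv i f) y := by
  have hd : DifferentiableAt ℝ (fderiv ℝ f) y :=
    (hf.fderiv_right (m := 1) (by norm_num)).differentiableAt one_ne_zero
  have h : ∀ i j : Fin n, partialDeriv i (partialDeriv j f) y
      = fderiv ℝ (fderiv ℝ f) y (EuclideanSpace.single i 1) (EuclideanSpace.single j 1) := by
    intro i j
    have := (hd.hasFDerivAt.clm_apply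
      (hasFDerivAt_const (EuclideanSpace.single j (1 : ℝ)) y)).fderiv
    change fderiv ℝ (fun z => fderiv ℝ f z (EuclideanSpace.single j 1)) y _ = _
    rw [this]; simp
  rw [h, h]
  exact (hf.isSymmSndFDerivAt (by simp)) _ _

lemma matDeriv_mul {A B : EuclideanSpace ℝ (Fin n) → Matrix (Fin n) (Fin n) ℝ}
    (hA : ∀ i j, DifferentiableAt ℝ (fun z => A z i j) y)
    (hB : ∀ i j, DifferentiableAt ℝ (fun z => B z i j) y) :
    matDeriv l (fun z => A z * B z) y = matDeriv l A y * B y + A y * matDeriv l B y := by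
  ext i j
  simp only [matDeriv, Matrix.of_apply, Matrix.mul_apply, Matrix.add_apply]
  rw [partialDeriv_sum _ fun k _ => (hA i k).fun_mul (hB k j), ← Finset.sum_add_distrib]
  exact Finset.sum_congr rfl fun k _ => partialDeriv_mul (hA i k) (hB k j)

lemma matDeriv_transpose (A : EuclideanSpace ℝ (Fin n) → Matrix (Fin n) (Fin n) ℝ) :
    matDeriv l (fun z => (A z).transpose) y = (matDeriv l A y).transpose := rfl

lemma matDeriv_congr {A B : EuclideanSpace ℝ (Fin n) → Matrix (Fin n) (Fin n) ℝ}
    (h : A =ᶠ[𝓝 y] B) : matDeriv l A y = matDeriv l B y := by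
  ext i j
  exact partialDeriv_congr (h.mono fun z hz => by simp only [hz])

lemma partialDeriv_comp {τ : EuclideanSpace ℝ (Fin n) → EuclideanSpace ℝ (Fin n)}
    {f : EuclideanSpace ℝ (Fin n) → ℝ} (hf : DifferentiableAt ℝ f (τ y))
    (hτ : DifferentiableAt ℝ τ y) :
    partialDeriv l (fun z => f (τ z)) y
      = ∑ p, fderiv ℝ τ y (EuclideanSpace.single l 1) p * partialDeriv p f (τ y) := by
  have h : partialDeriv l (fun z => f (τ z)) y
      = fderiv ℝ f (τ y) (fderiv ℝ τ y (EuclideanSpace.single l 1)) := by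
    change fderiv ℝ (f ∘ τ) y _ = _
    rw [fderiv_comp _ hf hτ]; rfl
  rw [h]
  conv_lhs => rw [← (EuclideanSpace.basisFun (Fin n) ℝ).sum_repr
    (fderiv ℝ τ y (EuclideanSpace.single l 1))]
  simp [partialDeriv]

end MatDeriv

section Connection

variable {n : ℕ} [NeZero n] {m : ℕ} {M : Type*} [TopologicalSpace M]
  [ChartedSpace (EuclideanHalfSpace n) M] [IsManifold (𝓡∂ n) ∞ M] {r s : ℕ}

/-- The matrix `Γ^p_{lj}` of the connection in the direction `∂_l` in the chart at `c`. -/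
def connMat (g : Metric n m M) (c : M) (l : Fin n) (y : EuclideanSpace ℝ (Fin n)) :
    Matrix (Fin n) (Fin n) ℝ :=
  koszul (gram g c y) (fun q => matDeriv q (gram g c) y) l

lemma connMat_apply (g : Metric n m M) (c : M) (l p j : Fin n) (y : EuclideanSpace ℝ (Fin n)) :
    connMat g c l y p j = christoffel g c p l j y := rfl

/-- The action of the connection on the contravariant and covariant slots of a tensor. -/
def connSlot (g : Metric n m M) (r s : ℕ) (c : M) (l : Fin n) (y : EuclideanSpace ℝ (Fin n)) :
    Fin r ⊕ Fin s → Matrix (Fin n) (Fin n) ℝ :=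
  Sum.elim (fun _ => connMat g c l y) (fun _ => -(connMat g c l y).transpose)

lemma connTerm_eq_slotDer (g : Metric n m M) (u : TensorField n M r s) (c : M) (l : Fin n)
    (I : Fin r → Fin n) (J : Fin s → Fin n) (y : EuclideanSpace ℝ (Fin n)) :
    connTerm g u c l I J y
      = slotDer (connSlot g r s c l y) (arr c ((extChartAt (𝓡∂ n) c).symm y)
        (u ((extChartAt (𝓡∂ n) c).symm y))) (Sum.elim I J) := by
  rw [slotDer, Fintype.sum_sum_type, connTerm, sub_eq_add_neg]
  congr 1
  · refine Finset.sum_congr rfl fun a _ => Finset.sum_congr rfl fun p _ => ?_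
    rw [comp_eq_arr, Sum.update_elim_inl]
    rfl
  · rw [← Finset.sum_neg_distrib]
    refine Finset.sum_congr rfl fun b _ => ?_
    rw [← Finset.sum_neg_distrib]
    refine Finset.sum_congr rfl fun p _ => ?_
    rw [comp_eq_arr, Sum.update_elim_inr, ← neg_mul]
    rfl

lemma isUnit_det_gram (g : Metric n m M) {c : M} {y : EuclideanSpace ℝ (Fin n)}
    (hy : y ∈ (extChartAt (𝓡∂ n) c).target) : IsUnit (gram g c y).det :=
  (posDef_gramAt g ((extChartAt (𝓡∂ n) c).map_target hy)).det_pos.ne'.isUnit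

lemma gram_transpose (g : Metric n m M) (c : M) (y : EuclideanSpace ℝ (Fin n)) :
    (gram g c y).transpose = gram g c y := gramAt_transpose g c _

lemma gram_symm (g : Metric n m M) (c : M) (y : EuclideanSpace ℝ (Fin n)) (i j : Fin n) :
    gram g c y i j = gram g c y j i := g.symm _ _ _

lemma matDeriv_gram_symm (g : Metric n m M) (c : M) (y : EuclideanSpace ℝ (Fin n))
    (l i j : Fin n) : matDeriv l (gram g c) y i j = matDeriv l (gram g c) y j i := by
  simp only [matDeriv, Matrix.of_apply, gram_symm g c _ i j]

lemma matDeriv_gram (g : Metric n m M) {c : M} {y : EuclideanSpace ℝ (Fin n)}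
    (hy : y ∈ (extChartAt (𝓡∂ n) c).target) (l : Fin n) :
    matDeriv l (gram g c) y
      = gram g c y * connMat g c l y + (connMat g c l y).transpose * gram g c y :=
  koszul_compat (isUnit_det_gram g hy) (gram_transpose g c y)
    (dG := fun q => matDeriv q (gram g c) y) (fun l i j => matDeriv_gram_symm g c y l i j) l

lemma connMat_symm (g : Metric n m M) (c : M) (y : EuclideanSpace ℝ (Fin n)) (p i j : Fin n) :
    connMat g c i y p j = connMat g c j y p i :=
  koszul_symm _ (fun l i j => matDeriv_gram_symm g c y l i j) _ _ _

lemma differentiableAt_jac {c c' : M} {y : EuclideanSpace ℝ (Fin n)} (hy : y ∈ chartDom c)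
    (hy' : (extChartAt (𝓡∂ n) c).symm y ∈ (extChartAt (𝓡∂ n) c').source) (i j : Fin n) :
    DifferentiableAt ℝ (fun w => jac c c' ((extChartAt (𝓡∂ n) c).symm w) i j) y :=
  ((contDiffOn_jac c c' i j).differentiableOn (by simp)).differentiableAt
    ((isOpen_chartDomIn c (isOpen_extChartAt_source c')).mem_nhds ⟨hy, hy'⟩)

lemma differentiableAt_gram (g : Metric n m M) (hm : m ≠ 0) {c : M}
    {y : EuclideanSpace ℝ (Fin n)} (hy : y ∈ chartDom c) (i j : Fin n) :
    DifferentiableAt ℝ (fun w => gram g c w i j) y :=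
  ((contDiffOn_gram g c i j).differentiableOn (by exact_mod_cast hm)).differentiableAt
    ((isOpen_chartDom c).mem_nhds hy)

lemma partialDeriv_comp_transition {c c' : M} {y : EuclideanSpace ℝ (Fin n)} (hy : y ∈ chartDom c)
    (hy' : (extChartAt (𝓡∂ n) c).symm y ∈ (extChartAt (𝓡∂ n) c').source)
    {f : EuclideanSpace ℝ (Fin n) → ℝ}
    (hf : DifferentiableAt ℝ f (extChartAt (𝓡∂ n) c' ((extChartAt (𝓡∂ n) c).symm y)))
    (l : Fin n) :
    partialDeriv l (fun w => f (extChartAt (𝓡∂ n) c' ((extChartAt (𝓡∂ n) c).symm w))) y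
      = ∑ p, jac c c' ((extChartAt (𝓡∂ n) c).symm y) p l
          * partialDeriv p f (extChartAt (𝓡∂ n) c' ((extChartAt (𝓡∂ n) c).symm y)) := by
  have h := hasFDerivAt_transition hy hy'
  rw [partialDeriv_comp (τ := fun w => extChartAt (𝓡∂ n) c' ((extChartAt (𝓡∂ n) c).symm w)) hf
    h.differentiableAt]
  refine Finset.sum_congr rfl fun p _ => ?_
  congr 1
  change (fderiv ℝ (extChartAt (𝓡∂ n) c' ∘ (extChartAt (𝓡∂ n) c).symm) y _) p = _
  rw [h.fderiv]; rfl

lemma matDeriv_jac_symm {c c' : M} {y : EuclideanSpace ℝ (Fin n)} (hy : y ∈ chartDom c)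
    (hy' : (extChartAt (𝓡∂ n) c).symm y ∈ (extChartAt (𝓡∂ n) c').source) (p i j : Fin n) :
    matDeriv i (fun w => jac c c' ((extChartAt (𝓡∂ n) c).symm w)) y p j
      = matDeriv j (fun w => jac c c' ((extChartAt (𝓡∂ n) c).symm w)) y p i := by
  set f : EuclideanSpace ℝ (Fin n) → ℝ :=
    fun w => extChartAt (𝓡∂ n) c' ((extChartAt (𝓡∂ n) c).symm w) p with hf
  have hO : IsOpen (chartDomIn (n := n) c (extChartAt (𝓡∂ n) c').source) :=
    isOpen_chartDomIn c (isOpen_extChartAt_source c')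
  have hfs : ContDiffAt ℝ 2 f y := by
    have := ((contDiffOn_transition c c').contDiffAt (hO.mem_nhds ⟨hy, hy'⟩))
    exact ((EuclideanSpace.proj (𝕜 := ℝ) p).contDiff.contDiffAt.comp y this).of_le
      ENat.LEInfty.out
  have key : ∀ i j, matDeriv i (fun w => jac c c' ((extChartAt (𝓡∂ n) c).symm w)) y p j
      = partialDeriv i (partialDeriv j f) y := by
    intro i j
    refine partialDeriv_congr ?_
    filter_upwards [hO.mem_nhds ⟨hy, hy'⟩] with w hw
    have h := hasFDerivAt_transition hw.1 hw.2
    have h2 := ((EuclideanSpace.proj (𝕜 := ℝ) p).hasFDerivAt.comp w h).fderiv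
    exact (congrArg (fun A => A (EuclideanSpace.single j (1 : ℝ))) h2).symm
  rw [key, key, partialDeriv_comm hfs]

/-- The transformation law of the connection coefficients under a change of coordinates. It
follows from the uniqueness of the symmetric compatible connection. -/
lemma jac_mul_connMat (g : Metric n m M) (hm : m ≠ 0) {c c' : M} {y : EuclideanSpace ℝ (Fin n)}
    (hy : y ∈ chartDom c)
    (hy' : (extChartAt (𝓡∂ n) c).symm y ∈ (extChartAt (𝓡∂ n) c').source) (l : Fin n) :
    jac c c' ((extChartAt (𝓡∂ n) c).symm y) * connMat g c l y
      = matDeriv l (fun w => jac c c' ((extChartAt (𝓡∂ n) c).symm w)) y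
        + (∑ p, jac c c' ((extChartAt (𝓡∂ n) c).symm y) p l
            • connMat g c' p (extChartAt (𝓡∂ n) c' ((extChartAt (𝓡∂ n) c).symm y)))
          * jac c c' ((extChartAt (𝓡∂ n) c).symm y) := by
  set z := (extChartAt (𝓡∂ n) c).symm y with hz
  set y' := extChartAt (𝓡∂ n) c' z with hy'def
  set J : EuclideanSpace ℝ (Fin n) → Matrix (Fin n) (Fin n) ℝ :=
    fun w => jac c c' ((extChartAt (𝓡∂ n) c).symm w) with hJ
  set τ : EuclideanSpace ℝ (Fin n) → EuclideanSpace ℝ (Fin n) :=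
    fun w => extChartAt (𝓡∂ n) c' ((extChartAt (𝓡∂ n) c).symm w) with hτ
  have hzc : z ∈ (extChartAt (𝓡∂ n) c).source := symm_mem_source hy
  have hy'd : y' ∈ chartDom c' := (mem_chartDom_iff hy').2 (symm_mem_interior hy)
  have hO : IsOpen (chartDomIn (n := n) c (extChartAt (𝓡∂ n) c').source) :=
    isOpen_chartDomIn c (isOpen_extChartAt_source c')
  have hnhds := hO.mem_nhds ⟨hy, hy'⟩
  have hJJ : jac c' c z * J y = 1 := jac_mul_jac_self hzc hy'
  have hJJ' : J y * jac c' c z = 1 := jac_mul_jac_self hy' hzc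
  have hJd : ∀ i j, DifferentiableAt ℝ (fun w => J w i j) y := differentiableAt_jac hy hy'
  have hGd : ∀ i j, DifferentiableAt ℝ (fun w => gram g c' (τ w) i j) y := fun i j =>
    (differentiableAt_gram g hm hy'd i j).comp (f := τ) y
      (hasFDerivAt_transition hy hy').differentiableAt
  have hgram : gram g c =ᶠ[𝓝 y] fun w => (J w).transpose * gram g c' (τ w) * J w := by
    filter_upwards [hnhds] with w hw
    rw [gram_eq_gramAt, gramAt_eq g (symm_mem_source hw.1) hw.2, gram_eq_gramAt,
      (extChartAt (𝓡∂ n) c').left_inv hw.2]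
  have hgram_y : gram g c y = (J y).transpose * gram g c' y' * J y := hgram.self_of_nhds
  set B : Matrix (Fin n) (Fin n) ℝ := gram g c' y' with hB
  set S : Fin n → Matrix (Fin n) (Fin n) ℝ := fun l => ∑ p, J y p l • connMat g c' p y' with hS
  have hGt : ∀ l, matDeriv l (fun w => gram g c' (τ w)) y = B * S l + (S l).transpose * B := by
    intro l
    have h1 : matDeriv l (fun w => gram g c' (τ w)) y = ∑ p, J y p l • matDeriv p (gram g c') y' := by
      ext i j
      rw [Matrix.sum_apply]
      exact partialDeriv_comp_transition hy hy' (differentiableAt_gram g hm hy'd i j) l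
    rw [h1]
    simp only [matDeriv_gram g (chartDom_subset c' hy'd), hS, Matrix.mul_sum, Matrix.transpose_sum,
      Matrix.sum_mul, Matrix.transpose_smul, Matrix.mul_smul, Matrix.smul_mul, smul_add,
      Finset.sum_add_distrib]
    rfl
  -- the connection of the other chart, pulled back, is symmetric and compatible with the metric
  have hmain := eq_koszul (isUnit_det_gram g (chartDom_subset c hy)) (gram_transpose g c y)
    (dG := fun q => matDeriv q (gram g c) y)
    (A := fun l => jac c' c z * (matDeriv l J y + S l * J y)) ?_ ?_ l
  · change _ = connMat g c l y at hmain
    rw [← hmain, ← mul_assoc]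
    change J y * jac c' c z * _ = _
    rw [hJJ', one_mul]
  · intro p i j
    have : ∀ q, (matDeriv i J y + S i * J y) q j = (matDeriv j J y + S j * J y) q i := by
      intro q
      rw [Matrix.add_apply, Matrix.add_apply, matDeriv_jac_symm hy hy']
      congr 1
      simp only [hS, Matrix.mul_apply, Matrix.sum_apply, Matrix.smul_apply, smul_eq_mul,
        Finset.sum_mul]
      rw [Finset.sum_comm]
      refine Finset.sum_congr rfl fun a _ => Finset.sum_congr rfl fun b _ => ?_
      rw [connMat_symm g c' y' q b a]; ring
    simp only [Matrix.mul_apply, this]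
  · intro l
    have h1 : matDeriv l (gram g c) y = (matDeriv l J y).transpose * B * J y
        + (J y).transpose * (B * S l + (S l).transpose * B) * J y
        + (J y).transpose * B * matDeriv l J y := by
      rw [matDeriv_congr hgram, matDeriv_mul (fun i j => ?_) hJd,
        matDeriv_mul (A := fun w => (J w).transpose) (fun i j => hJd j i) hGd, hGt, matDeriv_transpose, add_mul]
      simp only [Matrix.mul_apply]
      exact DifferentiableAt.fun_sum fun k _ => (hJd k i).fun_mul (hGd k j)
    have h2 : gram g c y * (jac c' c z * (matDeriv l J y + S l * J y))
        = (J y).transpose * B * (matDeriv l J y + S l * J y) := by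
      rw [hgram_y, ← mul_assoc, mul_assoc _ (J y), hJJ', mul_one]
    have hsB : B.transpose = B := gram_transpose g c' y'
    have h3 : (jac c' c z * (matDeriv l J y + S l * J y)).transpose * gram g c y
        = (matDeriv l J y + S l * J y).transpose * B * J y := by
      have := congrArg Matrix.transpose h2
      rw [Matrix.transpose_mul, gram_transpose] at this
      rw [this]
      simp only [Matrix.transpose_mul, Matrix.transpose_transpose, hsB, mul_assoc]
    change matDeriv l (gram g c) y = _
    rw [h1, h2, h3, Matrix.transpose_add, Matrix.transpose_mul]
    noncomm_ring

lemma differentiableAt_jac_swap {c c' : M} {y : EuclideanSpace ℝ (Fin n)} (hy : y ∈ chartDom c)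
    (hy' : (extChartAt (𝓡∂ n) c).symm y ∈ (extChartAt (𝓡∂ n) c').source) (i j : Fin n) :
    DifferentiableAt ℝ (fun w => jac c' c ((extChartAt (𝓡∂ n) c).symm w) i j) y := by
  set z := (extChartAt (𝓡∂ n) c).symm y with hz
  set y' := extChartAt (𝓡∂ n) c' z with hy'def
  have hzc : z ∈ (extChartAt (𝓡∂ n) c).source := symm_mem_source hy
  have hy'd : y' ∈ chartDom c' := (mem_chartDom_iff hy').2 (symm_mem_interior hy)
  have hinv : (extChartAt (𝓡∂ n) c').symm y' = z := (extChartAt (𝓡∂ n) c').left_inv hy'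
  have hsrc : (extChartAt (𝓡∂ n) c').symm y' ∈ (extChartAt (𝓡∂ n) c).source := by
    rw [hinv]; exact hzc
  have h1 := (differentiableAt_jac hy'd hsrc i j).comp
    (f := fun w => extChartAt (𝓡∂ n) c' ((extChartAt (𝓡∂ n) c).symm w)) y
    (hasFDerivAt_transition hy hy').differentiableAt
  refine h1.congr_of_eventuallyEq ?_
  filter_upwards [(isOpen_chartDomIn c (isOpen_extChartAt_source (I := 𝓡∂ n) c')).mem_nhds
    ⟨hy, hy'⟩] with w hw
  simp only [Function.comp_apply]
  rw [(extChartAt (𝓡∂ n) c').left_inv hw.2]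

lemma differentiableAt_transf {c c' : M} {y : EuclideanSpace ℝ (Fin n)} (hy : y ∈ chartDom c)
    (hy' : (extChartAt (𝓡∂ n) c).symm y ∈ (extChartAt (𝓡∂ n) c').source)
    (a : Fin r ⊕ Fin s) (i j : Fin n) :
    DifferentiableAt ℝ (fun w => transf r s c c' ((extChartAt (𝓡∂ n) c).symm w) a i j) y := by
  cases a with
  | inl a => exact differentiableAt_jac_swap hy hy' i j
  | inr b => exact differentiableAt_jac hy hy' j i

/-- The matrices of the change of coordinates intertwine the two connections. -/
lemma matDeriv_transf (g : Metric n m M) (hm : m ≠ 0) {c c' : M} {y : EuclideanSpace ℝ (Fin n)}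
    (hy : y ∈ chartDom c)
    (hy' : (extChartAt (𝓡∂ n) c).symm y ∈ (extChartAt (𝓡∂ n) c').source) (l : Fin n)
    (a : Fin r ⊕ Fin s) :
    matDeriv l (fun w => transf r s c c' ((extChartAt (𝓡∂ n) c).symm w) a) y
        + connSlot g r s c l y a * transf r s c c' ((extChartAt (𝓡∂ n) c).symm y) a
      = transf r s c c' ((extChartAt (𝓡∂ n) c).symm y) a
        * ∑ p, jac c c' ((extChartAt (𝓡∂ n) c).symm y) p l
            • connSlot g r s c' p (extChartAt (𝓡∂ n) c' ((extChartAt (𝓡∂ n) c).symm y)) a := by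
  have hlaw := jac_mul_connMat g hm hy hy' l
  set z := (extChartAt (𝓡∂ n) c).symm y with hz
  set y' := extChartAt (𝓡∂ n) c' z with hy'def
  have hzc : z ∈ (extChartAt (𝓡∂ n) c).source := symm_mem_source hy
  have hJJ : jac c' c z * jac c c' z = 1 := jac_mul_jac_self hzc hy'
  have hJJ' : jac c c' z * jac c' c z = 1 := jac_mul_jac_self hy' hzc
  cases a with
  | inl a =>
    simp only [transf, connSlot, Sum.elim_inl]
    have hd := differentiableAt_jac_swap hy hy'
    have hone : (fun w => jac (n := n) c' c ((extChartAt (𝓡∂ n) c).symm w)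
        * jac (n := n) c c' ((extChartAt (𝓡∂ n) c).symm w)) =ᶠ[𝓝 y] fun _ => 1 := by
      filter_upwards [(isOpen_chartDomIn c (isOpen_extChartAt_source (I := 𝓡∂ n) c')).mem_nhds
        ⟨hy, hy'⟩] with w hw
      exact jac_mul_jac_self (n := n) (symm_mem_source hw.1) hw.2
    have hder := matDeriv_congr (l := l) hone
    rw [matDeriv_mul hd (differentiableAt_jac hy hy')] at hder
    have h0 : matDeriv l (fun _ : EuclideanSpace ℝ (Fin n) => (1 : Matrix (Fin n) (Fin n) ℝ)) y
        = 0 := by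
      ext i j; exact partialDeriv_const _
    rw [h0, ← hz] at hder
    set dJ := matDeriv l (fun w => jac (n := n) c c' ((extChartAt (𝓡∂ n) c).symm w)) y
    set dI := matDeriv l (fun w => jac (n := n) c' c ((extChartAt (𝓡∂ n) c).symm w)) y
    -- the derivative of an inverse matrix
    have e1 : dI = -(jac c' c z * dJ * jac c' c z) := by
      have h := congrArg (fun X => X * jac c' c z) hder
      simp only [add_mul, zero_mul, mul_assoc, hJJ', mul_one] at h
      rw [eq_neg_iff_add_eq_zero, mul_assoc]
      exact h
    have e2 : connMat g c l y = jac c' c z * (jac c c' z * connMat g c l y) := by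
      rw [← mul_assoc, hJJ, one_mul]
    rw [e1, e2, hlaw, mul_add, add_mul]
    simp only [mul_assoc, hJJ', mul_one]
    abel
  | inr b =>
    simp only [transf, connSlot, Sum.elim_inr, matDeriv_transpose]
    have := congrArg Matrix.transpose hlaw
    simp only [Matrix.transpose_mul, Matrix.transpose_add, Matrix.transpose_sum,
      Matrix.transpose_smul] at this
    simp only [smul_neg, Finset.sum_neg_distrib, mul_neg, neg_mul]
    rw [this]
    abel

lemma slotDer_sum_smul {ι σ κ : Type*} [Fintype ι] [DecidableEq ι] [Fintype σ] [DecidableEq σ]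
    (s : Finset κ) (t : κ → ℝ) (B : κ → σ → Matrix ι ι ℝ) (u : (σ → ι) → ℝ) :
    slotDer (fun a => ∑ k ∈ s, t k • B k a) u = ∑ k ∈ s, t k • slotDer (B k) u := by
  ext K
  simp only [slotDer, Finset.sum_apply, Pi.smul_apply, smul_eq_mul, Matrix.sum_apply,
    Matrix.smul_apply, Finset.mul_sum, Finset.sum_mul]
  conv_rhs => rw [Finset.sum_comm]
  refine Finset.sum_congr rfl fun a _ => ?_
  rw [Finset.sum_comm]
  refine Finset.sum_congr rfl fun k _ => Finset.sum_congr rfl fun p _ => by ring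

/-- Splitting off the first covariant slot in a change of coordinates. -/
lemma slotMap_transf_succ (c c' z : M) (F : (Fin r ⊕ Fin (s + 1) → Fin n) → ℝ)
    (I : Fin r → Fin n) (l : Fin n) (J : Fin s → Fin n) :
    slotMap (transf r (s + 1) c c' z) F (Sum.elim I (Fin.cons l J))
      = ∑ p, jac c c' z p l * slotMap (transf r s c c' z)
          (fun K => F (Sum.elim (K ∘ Sum.inl) (Fin.cons p (K ∘ Sum.inr)))) (Sum.elim I J) := by
  simp only [slotMap_apply, sum_sumElim, Finset.mul_sum]
  conv_rhs => rw [Finset.sum_comm]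
  refine Finset.sum_congr rfl fun I' _ => ?_
  rw [← (Fin.consEquiv fun _ => Fin n).sum_comp, Fintype.sum_prod_type]
  refine Finset.sum_congr rfl fun p _ => Finset.sum_congr rfl fun J' _ => ?_
  rw [Fintype.prod_sum_type, Fintype.prod_sum_type, Fin.prod_univ_succ]
  change ((∏ a, jac c' c z (I a) (I' a)) * (jac c c' z p l * ∏ b, jac c c' z (J' b) (J b))) *
      F (Sum.elim I' (Fin.cons p J')) = jac c c' z p l * (((∏ a, jac c' c z (I a) (I' a))
        * ∏ b, jac c c' z (J' b) (J b)) * F (Sum.elim I' (Fin.cons p J')))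
  ring

/-- The components of `u` are differentiable at `z` in every chart around `z`. -/
def CompDiffAt (u : TensorField n M r s) (z : M) : Prop :=
  ∀ c : M, z ∈ (extChartAt (𝓡∂ n) c).source → ∀ I J,
    DifferentiableAt ℝ (comp u c I J) (extChartAt (𝓡∂ n) c z)

/-- The covariant derivative is given by the coordinate expression of every chart, not only by
that of the chart centred at the point. -/
lemma comp_covDeriv (g : Metric n m M) (hm : m ≠ 0) {u : TensorField n M r s} {c : M}
    {y : EuclideanSpace ℝ (Fin n)} (hy : y ∈ chartDom c)
    (hu : CompDiffAt u ((extChartAt (𝓡∂ n) c).symm y)) (I : Fin r → Fin n) (J : Fin s → Fin n)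
    (l : Fin n) :
    comp (covDeriv g u) c I (Fin.cons l J) y
      = partialDeriv l (comp u c I J) y + connTerm g u c l I J y := by
  set z := (extChartAt (𝓡∂ n) c).symm y with hz
  have hzz := mem_extChartAt_source (I := 𝓡∂ n) z
  have hzc : z ∈ (extChartAt (𝓡∂ n) c).source := symm_mem_source hy
  set y' := extChartAt (𝓡∂ n) z z with hy'
  have hinv : (extChartAt (𝓡∂ n) z).symm y' = z := (extChartAt (𝓡∂ n) z).left_inv hzz
  set τ : EuclideanSpace ℝ (Fin n) → EuclideanSpace ℝ (Fin n) :=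
    fun w => extChartAt (𝓡∂ n) z ((extChartAt (𝓡∂ n) c).symm w) with hτ
  set P : Fin r ⊕ Fin s → EuclideanSpace ℝ (Fin n) → Matrix (Fin n) (Fin n) ℝ :=
    fun a w => transf r s c z ((extChartAt (𝓡∂ n) c).symm w) a with hP
  set U : (Fin r ⊕ Fin s → Fin n) → EuclideanSpace ℝ (Fin n) → ℝ :=
    fun L => comp u z (L ∘ Sum.inl) (L ∘ Sum.inr) with hU
  have hUd : ∀ L, DifferentiableAt ℝ (U L) y' := fun L => hu z hzz _ _
  have hUarr : (fun L => U L y') = arr z z (u z) := by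
    ext L
    have : U L y' = arr z ((extChartAt (𝓡∂ n) z).symm y') (u ((extChartAt (𝓡∂ n) z).symm y')) L := by
      rw [hU]; simp only [comp_eq_arr, Sum.elim_comp_inl_inr]
    rw [this, hinv]
  have hPd : ∀ a i j, DifferentiableAt ℝ (fun w => P a w i j) y :=
    fun a => differentiableAt_transf hy hzz a
  -- the left-hand side in the chart centred at the point
  have hL : comp (covDeriv g u) c I (Fin.cons l J) y = ∑ p, jac c z z p l *
      slotMap (fun a => P a y) (fun K => partialDeriv p (U K) y'
        + slotDer (connSlot g r s z p y') (arr z z (u z)) K) (Sum.elim I J) := by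
    rw [comp_eq_arr, ← hz, covDeriv, arr_eq_slotMap hzc hzz, arr_ofComp]
    rw [slotMap_transf_succ]
    refine Finset.sum_congr rfl fun p _ => ?_
    refine congrArg (fun F => jac c z z p l * slotMap (transf r s c z z) F (Sum.elim I J))
      (funext fun K => ?_)
    simp only [connTerm_eq_slotDer, Sum.elim_comp_inl, Sum.elim_comp_inr, Fin.cons_zero,
      Fin.tail_cons, Sum.elim_comp_inl_inr, ← hy']
    have harr : arr z ((extChartAt (𝓡∂ n) z).symm y') (u ((extChartAt (𝓡∂ n) z).symm y'))
        = arr z z (u z) := by rw [hinv]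
    rw [harr]
  -- the right-hand side, by differentiating the change of components
  have hcomp : comp u c I J =ᶠ[𝓝 y]
      fun w => slotMap (fun a => P a w) (fun L => U L (τ w)) (Sum.elim I J) := by
    filter_upwards [(isOpen_chartDomIn c (isOpen_extChartAt_source (I := 𝓡∂ n) z)).mem_nhds
        ⟨hy, hzz⟩] with w hw
    have hUw : (fun L => U L (τ w))
        = arr z ((extChartAt (𝓡∂ n) c).symm w) (u ((extChartAt (𝓡∂ n) c).symm w)) := by
      ext L
      rw [hU, hτ]
      simp only [comp_eq_arr, Sum.elim_comp_inl_inr]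
      rw [(extChartAt (𝓡∂ n) z).left_inv hw.2]
    rw [comp_eq_arr, arr_eq_slotMap (symm_mem_source hw.1) hw.2, hUw]
  have hUτ : ∀ L, DifferentiableAt ℝ (fun w => U L (τ w)) y := fun L =>
    DifferentiableAt.comp (f := τ) y (hUd L) (hasFDerivAt_transition hy hzz).differentiableAt
  have hR : partialDeriv l (comp u c I J) y + connTerm g u c l I J y
      = slotMap (fun a => P a y) (fun K => ∑ p, jac c z z p l * (partialDeriv p (U K) y'
        + slotDer (connSlot g r s z p y') (arr z z (u z)) K)) (Sum.elim I J) := by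
    rw [partialDeriv_congr hcomp, partialDeriv_slotMap hPd hUτ, connTerm_eq_slotDer, ← hz,
      arr_eq_slotMap hzc hzz]
    change slotVar _ _ (fun L => U L y') _ + _ + slotDer _ (slotMap (fun a => P a y) _) _ = _
    have h1 : (fun L => partialDeriv l (fun w => U L (τ w)) y)
        = fun L => ∑ p, jac c z z p l * partialDeriv p (U L) y' :=
      funext fun L => partialDeriv_comp_transition hy hzz (hUd L) l
    rw [slotDer_slotMap, h1, hUarr]
    have h2 := slotVar_add (fun a => P a y) (fun a => matDeriv l (P a) y)
      (fun a => connSlot g r s c l y a * P a y) (arr z z (u z))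
    have h3 : (fun a => matDeriv l (P a) y) + (fun a => connSlot g r s c l y a * P a y)
        = fun a => P a y * ∑ p, jac c z z p l • connSlot g r s z p y' a :=
      funext fun a => matDeriv_transf g hm hy hzz l a
    rw [h3, ← slotMap_slotDer, slotDer_sum_smul] at h2
    rw [add_right_comm, ← Pi.add_apply, ← h2, ← Pi.add_apply, ← map_add]
    refine congrArg (fun F => slotMap (fun a => P a y) F (Sum.elim I J)) (funext fun K => ?_)
    simp only [Pi.add_apply, Finset.sum_apply, Pi.smul_apply, smul_eq_mul, mul_add,
      Finset.sum_add_distrib]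
    rw [add_comm]
  rw [hL, hR]
  simp only [slotMap_apply, Finset.mul_sum]
  rw [Finset.sum_comm]
  refine Finset.sum_congr rfl fun K _ => Finset.sum_congr rfl fun p _ => by ring

end Connection

/-! ### Pointwise norms of tensors -/

section SlotNorm

variable {ι σ : Type*} [Fintype ι] [DecidableEq ι] [Fintype σ] [DecidableEq σ]

open scoped MatrixOrder Matrix.Norms.L2Operator in
/-- In a frame that is orthonormal for every slot, the form `slotForm H` becomes the Euclidean
inner product of arrays. -/
lemma exists_frame {H : σ → Matrix ι ι ℝ} (hH : ∀ a, (H a).PosDef) :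
    ∃ Q : ((σ → ι) → ℝ) →ₗ[ℝ] EuclideanSpace ℝ (σ → ι),
      ∀ u v, slotForm H u v = inner ℝ (Q u) (Q v) := by
  have h : ∀ a, ∃ B : Matrix ι ι ℝ, B.transpose * B = H a := fun a => by
    obtain ⟨B, hB⟩ := CStarAlgebra.nonneg_iff_eq_star_mul_self.mp (hH a).posSemidef.nonneg
    exact ⟨B, by rw [hB, Matrix.star_eq_conjTranspose, Matrix.conjTranspose_eq_transpose_of_trivial]⟩
  choose B hB using h
  refine ⟨(WithLp.linearEquiv 2 ℝ ((σ → ι) → ℝ)).symm.toLinearMap ∘ₗ slotMap B, fun u v => ?_⟩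
  have : H = fun a => (B a).transpose * B a := funext fun a => (hB a).symm
  rw [this, slotForm_transpose_mul_self, PiLp.inner_apply]
  simp [dotProduct, mul_comm]

lemma slotForm_self_nonneg {H : σ → Matrix ι ι ℝ} (hH : ∀ a, (H a).PosDef) (u : (σ → ι) → ℝ) :
    0 ≤ slotForm H u u := by
  obtain ⟨Q, hQ⟩ := exists_frame hH
  rw [hQ]; exact real_inner_self_nonneg

lemma abs_slotForm_le {H : σ → Matrix ι ι ℝ} (hH : ∀ a, (H a).PosDef) (u v : (σ → ι) → ℝ) :
    |slotForm H u v| ≤ √(slotForm H u u) * √(slotForm H v v) := by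
  obtain ⟨Q, hQ⟩ := exists_frame hH
  rw [hQ, hQ, hQ, ← norm_eq_sqrt_real_inner, ← norm_eq_sqrt_real_inner]
  exact abs_real_inner_le_norm _ _

lemma sqrt_slotForm_add_le {H : σ → Matrix ι ι ℝ} (hH : ∀ a, (H a).PosDef)
    (u v : (σ → ι) → ℝ) :
    √(slotForm H (u + v) (u + v)) ≤ √(slotForm H u u) + √(slotForm H v v) := by
  obtain ⟨Q, hQ⟩ := exists_frame hH
  rw [hQ, hQ, hQ, ← norm_eq_sqrt_real_inner, ← norm_eq_sqrt_real_inner,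
    ← norm_eq_sqrt_real_inner, map_add]
  exact norm_add_le _ _

/-- A single entry of an array is controlled by the form. -/
lemma sq_apply_le_slotForm {H : σ → Matrix ι ι ℝ} (hH : ∀ a, (H a).PosDef) (u : (σ → ι) → ℝ)
    (K : σ → ι) : u K ^ 2 ≤ (∏ a, (H a)⁻¹ (K a) (K a)) * slotForm H u u := by
  have hs : ∀ a, (H a).transpose = H a := fun a => by
    have := (hH a).isHermitian
    rwa [Matrix.IsHermitian, Matrix.conjTranspose_eq_transpose_of_trivial] at this
  set e : (σ → ι) → ℝ := slotMap (fun a => (H a)⁻¹) (Pi.single K 1) with he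
  have h1 : slotMap H e = Pi.single K 1 := by
    rw [he, slotMap_slotMap]
    have : (fun a => H a * (H a)⁻¹) = fun _ => (1 : Matrix ι ι ℝ) := funext fun a =>
      Matrix.mul_nonsing_inv _ (hH a).det_pos.ne'.isUnit
    rw [this, slotMap_one]
  have h2 : slotForm H u e = u K := by rw [slotForm, h1]; simp
  have h3 : slotForm H e e = ∏ a, (H a)⁻¹ (K a) (K a) := by
    rw [slotForm, h1, he]
    simp [slotMap_apply, Pi.single_apply]
  have h := abs_slotForm_le hH u e
  rw [h2, h3] at h
  have h4 : 0 ≤ ∏ a, (H a)⁻¹ (K a) (K a) := h3 ▸ slotForm_self_nonneg hH e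
  calc u K ^ 2 = |u K| ^ 2 := (sq_abs _).symm
    _ ≤ (√(slotForm H u u) * √(∏ a, (H a)⁻¹ (K a) (K a))) ^ 2 := by gcongr
    _ = _ := by
      rw [mul_pow, Real.sq_sqrt (slotForm_self_nonneg hH u), Real.sq_sqrt h4, mul_comm]

lemma slotForm_eq_sum (H : σ → Matrix ι ι ℝ) (u v : (σ → ι) → ℝ) :
    slotForm H u v = ∑ K, ∑ L, (∏ a, H a (K a) (L a)) * u K * v L := by
  simp only [slotForm, dotProduct, slotMap_apply, Finset.mul_sum]
  exact Finset.sum_congr rfl fun K _ => Finset.sum_congr rfl fun L _ => by ring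

end SlotNorm

section Norm

variable {n : ℕ} [NeZero n] {m : ℕ} {M : Type*} [TopologicalSpace M]
  [ChartedSpace (EuclideanHalfSpace n) M] [IsManifold (𝓡∂ n) ∞ M] {r s q t : ℕ}

/-- The metric on each slot of a tensor of type `(r, s)`: `g_{ij}` on the contravariant slots and
`g^{ij}` on the covariant ones. -/
def metricSlots (g : Metric n m M) (r s : ℕ) (c z : M) :
    Fin r ⊕ Fin s → Matrix (Fin n) (Fin n) ℝ :=
  Sum.elim (fun _ => gramAt g c z) (fun _ => (gramAt g c z)⁻¹)

lemma posDef_metricSlots (g : Metric n m M) {c z : M}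
    (hz : z ∈ (extChartAt (𝓡∂ n) c).source) (a : Fin r ⊕ Fin s) :
    (metricSlots g r s c z a).PosDef := by
  cases a with
  | inl a => exact posDef_gramAt g hz
  | inr b => exact (posDef_gramAt g hz).inv

lemma metricSlots_transpose (g : Metric n m M) (c z : M) (a : Fin r ⊕ Fin s) :
    (metricSlots g r s c z a).transpose = metricSlots g r s c z a := by
  cases a with
  | inl a => exact gramAt_transpose g c z
  | inr b =>
    simp only [metricSlots, Sum.elim_inr]
    rw [Matrix.transpose_nonsing_inv, gramAt_transpose]

lemma isUnit_det_gramAt (g : Metric n m M) {c z : M}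
    (hz : z ∈ (extChartAt (𝓡∂ n) c).source) : IsUnit (gramAt g c z).det :=
  (posDef_gramAt g hz).det_pos.ne'.isUnit

lemma metricSlots_transf (g : Metric n m M) {c c' z : M}
    (hz : z ∈ (extChartAt (𝓡∂ n) c).source) (hz' : z ∈ (extChartAt (𝓡∂ n) c').source)
    (a : Fin r ⊕ Fin s) :
    (transf r s c c' z a).transpose * metricSlots g r s c z a * transf r s c c' z a
      = metricSlots g r s c' z a := by
  cases a with
  | inl a => exact (gramAt_eq g hz' hz).symm
  | inr b =>
    simp only [transf, metricSlots, Sum.elim_inr, Matrix.transpose_transpose]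
    symm
    apply Matrix.inv_eq_left_inv
    have h1 : jac (n := n) c c' z * jac c' c z = 1 := jac_mul_jac_self (n := n) hz' hz
    have h3 : (gramAt g c z)⁻¹ * gramAt g c z = 1 :=
      Matrix.nonsing_inv_mul _ (isUnit_det_gramAt g hz)
    rw [gramAt_eq g hz' hz]
    calc jac c c' z * (gramAt g c z)⁻¹ * (jac c c' z).transpose
          * ((jac c' c z).transpose * gramAt g c z * jac c' c z)
        = jac c c' z * (gramAt g c z)⁻¹ * ((jac c c' z).transpose * (jac c' c z).transpose)
          * gramAt g c z * jac c' c z := by simp only [mul_assoc]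
      _ = 1 := by
        have h2' : (jac (n := n) c c' z).transpose * (jac c' c z).transpose = 1 := by
          rw [← Matrix.transpose_mul, jac_mul_jac_self (n := n) hz hz', Matrix.transpose_one]
        rw [h2', mul_one, mul_assoc (jac c c' z), h3, mul_one, h1]

/-- The inner product of two tensors at a point. -/
def tinner (g : Metric n m M) (z : M) (T S : TensorAt n r s z) : ℝ :=
  slotForm (metricSlots g r s z z) (arr z z T) (arr z z S)

/-- The inner product is given by the coordinate expression of every chart. -/
lemma tinner_eq (g : Metric n m M) {c z : M} (hz : z ∈ (extChartAt (𝓡∂ n) c).source)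
    (T S : TensorAt n r s z) :
    tinner g z T S = slotForm (metricSlots g r s c z) (arr c z T) (arr c z S) := by
  have hzz := mem_extChartAt_source (I := 𝓡∂ n) z
  rw [tinner, arr_eq_slotMap hzz hz T, arr_eq_slotMap hzz hz S, slotForm_slotMap]
  congr 1
  exact funext fun a => metricSlots_transf g hzz hz a

lemma comp_self (u : TensorField n M r s) (x : M) (I : Fin r → Fin n) (J : Fin s → Fin n) :
    comp u x I J (extChartAt (𝓡∂ n) x x) = arr x x (u x) (Sum.elim I J) := by
  rw [comp_eq_arr, (extChartAt (𝓡∂ n) x).left_inv (mem_extChartAt_source (I := 𝓡∂ n) x)]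

lemma normSq_eq_tinner (g : Metric n m M) (u : TensorField n M r s) (x : M) :
    normSq g u x = tinner g x (u x) (u x) := by
  have hz := mem_extChartAt_source (I := 𝓡∂ n) x
  have hinv : (extChartAt (𝓡∂ n) x).symm (extChartAt (𝓡∂ n) x x) = x :=
    (extChartAt (𝓡∂ n) x).left_inv hz
  rw [tinner, slotForm_eq_sum]
  simp only [sum_sumElim, normSq, comp_self, gram_eq_gramAt, hinv]
  refine Finset.sum_congr rfl fun I _ => ?_
  rw [Finset.sum_comm]
  refine Finset.sum_congr rfl fun J _ => Finset.sum_congr rfl fun I' _ =>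
    Finset.sum_congr rfl fun J' _ => ?_
  rw [Fintype.prod_sum_type]
  rfl

lemma normSq_eq_slotForm (g : Metric n m M) {c z : M} (hz : z ∈ (extChartAt (𝓡∂ n) c).source)
    (u : TensorField n M r s) :
    normSq g u z = slotForm (metricSlots g r s c z) (arr c z (u z)) (arr c z (u z)) := by
  rw [normSq_eq_tinner, tinner_eq g hz]

lemma normSq_nonneg (g : Metric n m M) (u : TensorField n M r s) (x : M) : 0 ≤ normSq g u x := by
  rw [normSq_eq_tinner]
  exact slotForm_self_nonneg (posDef_metricSlots g (mem_extChartAt_source x)) _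

/-- The pointwise norm `|u|_g`. -/
def tnorm (g : Metric n m M) (u : TensorField n M r s) (x : M) : ℝ := √(normSq g u x)

lemma tnorm_nonneg (g : Metric n m M) (u : TensorField n M r s) (x : M) : 0 ≤ tnorm g u x :=
  Real.sqrt_nonneg _

lemma tnorm_sq (g : Metric n m M) (u : TensorField n M r s) (x : M) :
    tnorm g u x ^ 2 = normSq g u x := Real.sq_sqrt (normSq_nonneg g u x)

lemma abs_tinner_le (g : Metric n m M) (u v : TensorField n M r s) (x : M) :
    |tinner g x (u x) (v x)| ≤ tnorm g u x * tnorm g v x := by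
  rw [tnorm, tnorm, normSq_eq_tinner, normSq_eq_tinner]
  exact abs_slotForm_le (posDef_metricSlots g (mem_extChartAt_source x)) _ _

lemma tnorm_add_le (g : Metric n m M) (u v : TensorField n M r s) (x : M) :
    tnorm g (u + v) x ≤ tnorm g u x + tnorm g v x := by
  rw [tnorm, tnorm, tnorm, normSq_eq_tinner, normSq_eq_tinner, normSq_eq_tinner]
  exact sqrt_slotForm_add_le (posDef_metricSlots g (mem_extChartAt_source x)) _ _

/-- The product `a ⊗ u` of a covariant tensor field `a` of type `(0, q)` with a tensor field `u` of
type `(r, s)`. The bijection `e` says which covariant slots of the product are filled into `a`,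
and which into `u`. -/
def prod (e : Fin t ≃ Fin q ⊕ Fin s) (a : TensorField n M 0 q) (u : TensorField n M r s) :
    TensorField n M r t := fun x =>
  ({ toFun := fun b =>
      (((LinearMap.mul' ℝ ℝ).compMultilinearMap
        ((a x fun i => i.elim0).domCoprod b)).domDomCongr e.symm)
     map_add' := fun b b' => by ext v; simp [MultilinearMap.domCoprod, mul_add]
     map_smul' := fun k b => by ext v; simp [MultilinearMap.domCoprod]; ring } :
    MultilinearMap ℝ (fun _ : Fin s => TangentSpace (𝓡∂ n) x) ℝ →ₗ[ℝ]
      MultilinearMap ℝ (fun _ : Fin t => TangentSpace (𝓡∂ n) x) ℝ).compMultilinearMap (u x)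

lemma comp_prod (e : Fin t ≃ Fin q ⊕ Fin s) (a : TensorField n M 0 q) (u : TensorField n M r s)
    (c : M) (I : Fin r → Fin n) (J : Fin t → Fin n) (y : EuclideanSpace ℝ (Fin n)) :
    comp (prod e a u) c I J y
      = comp a c Fin.elim0 (fun i => J (e.symm (Sum.inl i))) y
        * comp u c I (fun i => J (e.symm (Sum.inr i))) y := by
  simp only [comp, prod]
  have : (fun a => coordCovec c ((extChartAt (𝓡∂ n) c).symm y) (Fin.elim0 a :Fin n))
    = fun i : Fin 0 => (i.elim0 : TangentSpace (𝓡∂ n) ((extChartAt (𝓡∂ n) c).symm y) →L[ℝ] ℝ) :=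
    Subsingleton.elim _ _
  rw [this]
  rfl

lemma sum_mul_sum_of_pairs {X Y : Type*} [Fintype X] [Fintype Y] (α : X → X → ℝ) (β : Y → Y → ℝ) :
    ∑ A, ∑ B, ∑ A', ∑ B', α A A' * β B B' = (∑ A, ∑ A', α A A') * ∑ B, ∑ B', β B B' := by
  simp only [← Finset.mul_sum, ← Finset.sum_mul]

lemma normSq_prod (g : Metric n m M) (e : Fin t ≃ Fin q ⊕ Fin s) (a : TensorField n M 0 q)
    (u : TensorField n M r s) (x : M) :
    normSq g (prod e a u) x = normSq g a x * normSq g u x := by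
  simp only [normSq, comp_prod]
  set y := extChartAt (𝓡∂ n) x x
  set G := gram g x y
  rw [Fintype.sum_subsingleton (fun I : Fin 0 → Fin n => _) Fin.elim0,
    Fintype.sum_subsingleton (fun I : Fin 0 → Fin n => _) Fin.elim0]
  have hre : ∀ F : (Fin t → Fin n) → ℝ, ∑ J, F J
      = ∑ A : Fin q → Fin n, ∑ B : Fin s → Fin n, F (fun i => Sum.elim A B (e i)) := fun F => by
    rw [← sum_sumElim (fun K => F (fun i => K (e i)))]
    exact (Equiv.sum_comp (e.arrowCongr (Equiv.refl (Fin n))).symm F).symm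
  simp only [hre, Equiv.apply_symm_apply, Sum.elim_inl, Sum.elim_inr]
  have hpr : ∀ (A A' : Fin q → Fin n) (B B' : Fin s → Fin n),
      ∏ b, G⁻¹ (Sum.elim A B (e b)) (Sum.elim A' B' (e b))
        = (∏ b, G⁻¹ (A b) (A' b)) * ∏ b, G⁻¹ (B b) (B' b) := fun A A' B B' => by
    rw [Equiv.prod_comp e (fun k => G⁻¹ (Sum.elim A B k) (Sum.elim A' B' k)),
      Fintype.prod_sum_type]
    rfl
  simp only [hpr, Finset.univ_eq_empty, Finset.prod_empty, one_mul]
  rw [Finset.mul_sum]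
  refine Finset.sum_congr rfl fun I _ => ?_
  rw [Finset.mul_sum]
  refine Finset.sum_congr rfl fun I' _ => ?_
  rw [← sum_mul_sum_of_pairs]
  refine Finset.sum_congr rfl fun A _ => Finset.sum_congr rfl fun B _ =>
    Finset.sum_congr rfl fun A' _ => Finset.sum_congr rfl fun B' _ => ?_
  ring

lemma tnorm_prod (g : Metric n m M) (e : Fin t ≃ Fin q ⊕ Fin s) (a : TensorField n M 0 q)
    (u : TensorField n M r s) (x : M) :
    tnorm g (prod e a u) x = tnorm g a x * tnorm g u x := by
  rw [tnorm, tnorm, tnorm, normSq_prod, Real.sqrt_mul (normSq_nonneg g a x)]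

end Norm

/-! ### Regularity of coordinate expressions -/

section Regularity

variable {n : ℕ}

lemma contDiffOn_partialDeriv {O : Set (EuclideanSpace ℝ (Fin n))} (hO : IsOpen O) {p : ℕ}
    {f : EuclideanSpace ℝ (Fin n) → ℝ} (hf : ContDiffOn ℝ (p + 1 : ℕ) f O) (l : Fin n) :
    ContDiffOn ℝ p (partialDeriv l f) O :=
  (hf.fderiv_of_isOpen hO (m := p) (by norm_cast)).clm_apply contDiffOn_const

lemma contDiffOn_det {ι : Type*} [Fintype ι] [DecidableEq ι]
    {O : Set (EuclideanSpace ℝ (Fin n))} {p : WithTop ℕ∞}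
    {A : EuclideanSpace ℝ (Fin n) → Matrix ι ι ℝ}
    (hA : ∀ i j, ContDiffOn ℝ p (fun y => A y i j) O) : ContDiffOn ℝ p (fun y => (A y).det) O := by
  simp only [Matrix.det_apply]
  exact ContDiffOn.sum fun σ _ => (contDiffOn_prod fun i _ => hA _ _).const_smul _

lemma contDiffOn_inv {ι : Type*} [Fintype ι] [DecidableEq ι]
    {O : Set (EuclideanSpace ℝ (Fin n))} {p : WithTop ℕ∞}
    {A : EuclideanSpace ℝ (Fin n) → Matrix ι ι ℝ}
    (hA : ∀ i j, ContDiffOn ℝ p (fun y => A y i j) O) (hdet : ∀ y ∈ O, (A y).det ≠ 0) (i j : ι) :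
    ContDiffOn ℝ p (fun y => (A y)⁻¹ i j) O := by
  have h : ∀ y, (A y)⁻¹ i j
      = ((A y).det)⁻¹ * ((A y).updateRow j (Pi.single i 1)).det := fun y => by
    rw [Matrix.inv_def, Matrix.smul_apply, Matrix.adjugate_apply, Ring.inverse_eq_inv, smul_eq_mul]
  simp only [h]
  refine ((contDiffOn_det hA).inv hdet).mul (contDiffOn_det fun a b => ?_)
  by_cases ha : a = j
  · subst ha; simpa using contDiffOn_const
  · simpa [Matrix.updateRow_ne ha] using hA a b

/-- A function on `O` times a test function supported in `O`. -/
lemma contDiff_mul_of_tsupport_subset {O : Set (EuclideanSpace ℝ (Fin n))} (hO : IsOpen O)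
    {p : WithTop ℕ∞} {A φ : EuclideanSpace ℝ (Fin n) → ℝ} (hA : ContDiffOn ℝ p A O)
    (hφ : ContDiffOn ℝ p φ O) (hs : tsupport φ ⊆ O) : ContDiff ℝ p (fun y => A y * φ y) := by
  rw [contDiff_iff_contDiffAt]
  intro y
  by_cases hy : y ∈ tsupport φ
  · exact (hA.contDiffAt (hO.mem_nhds (hs hy))).mul (hφ.contDiffAt (hO.mem_nhds (hs hy)))
  · have h0 : (fun y => A y * φ y) =ᶠ[𝓝 y] fun _ => 0 := by
      filter_upwards [(isClosed_tsupport φ).isOpen_compl.mem_nhds hy] with w hw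
      rw [image_eq_zero_of_notMem_tsupport hw, mul_zero]
    exact contDiffAt_const.congr_of_eventuallyEq h0

lemma locallyIntegrableOn_mul_continuousOn {O : Set (EuclideanSpace ℝ (Fin n))} (hO : IsOpen O)
    {A U : EuclideanSpace ℝ (Fin n) → ℝ} (hA : ContinuousOn A O) (hU : LocallyIntegrableOn U O) :
    LocallyIntegrableOn (fun y => A y * U y) O := by
  rw [locallyIntegrableOn_iff hO.isLocallyClosed] at hU ⊢
  exact fun K hK hKc => (hU K hK hKc).continuousOn_mul (hA.mono hK) hKc

lemma locallyIntegrableOn_sum {X κ : Type*} [MeasurableSpace X] [TopologicalSpace X]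
    {μ : Measure X} {O : Set X} (s : Finset κ) {f : κ → X → ℝ}
    (hf : ∀ a ∈ s, LocallyIntegrableOn (f a) O μ) :
    LocallyIntegrableOn (fun y => ∑ a ∈ s, f a y) O μ := by
  classical
  induction s using Finset.induction_on with
  | empty => simpa using (locallyIntegrable_zero (X := X) (μ := μ) (ε'' := ℝ)).locallyIntegrableOn O
  | insert a s ha ih =>
    simp only [Finset.sum_insert ha]
    exact (hf a (Finset.mem_insert_self _ _)).add
      (ih fun b hb => hf b (Finset.mem_insert_of_mem hb))

end Regularity

section Leibniz

variable {n : ℕ} [NeZero n] {m : ℕ} {M : Type*} [TopologicalSpace M]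
  [ChartedSpace (EuclideanHalfSpace n) M] [IsManifold (𝓡∂ n) ∞ M] {r s q t : ℕ}

lemma chartDomIn_subset (c : M) (U : Set M) : chartDomIn (n := n) c U ⊆ chartDom c :=
  inter_subset_left

lemma chartDomIn_interior (c : M) : chartDomIn (n := n) c ((𝓡∂ n).interior M) = chartDom c :=
  inter_eq_left.mpr fun _ hy => symm_mem_interior hy

lemma gram_det_ne_zero (g : Metric n m M) {c : M} {y : EuclideanSpace ℝ (Fin n)}
    (hy : y ∈ chartDom c) : (gram g c y).det ≠ 0 :=
  (isUnit_det_gram g (chartDom_subset c hy)).ne_zero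

lemma contDiffOn_gram_inv (g : Metric n m M) (c : M) (i j : Fin n) :
    ContDiffOn ℝ m (fun y => (gram g c y)⁻¹ i j) (chartDom c) :=
  contDiffOn_inv (contDiffOn_gram g c) (fun _ hy => gram_det_ne_zero g hy) i j

lemma contDiffOn_christoffel (g : Metric n m M) {p : ℕ} (hp : p + 1 ≤ m) (c : M) (a i j : Fin n) :
    ContDiffOn ℝ p (christoffel g c a i j) (chartDom c) := by
  have hG : ∀ i j, ContDiffOn ℝ (p + 1 : ℕ) (fun y => gram g c y i j) (chartDom c) := fun i j =>
    (contDiffOn_gram g c i j).of_le (by exact_mod_cast hp)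
  have hd : ∀ l i j, ContDiffOn ℝ p (partialDeriv l fun y => gram g c y i j) (chartDom c) :=
    fun l i j => contDiffOn_partialDeriv (isOpen_chartDom c) (hG i j) l
  exact contDiffOn_const.mul (ContDiffOn.sum fun q _ =>
    ((contDiffOn_gram_inv g c a q).of_le (by exact_mod_cast (by omega : p ≤ m))).mul
      (((hd _ _ _).add (hd _ _ _)).sub (hd _ _ _)))

/-- The components of `u` in every chart are of class `C^p` on the part of the chart that
corresponds to `U`. -/
def CompC (p : ℕ) (U : Set M) (u : TensorField n M r s) : Prop :=
  ∀ c I J, ContDiffOn ℝ p (comp u c I J) (chartDomIn c U)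

lemma CompC.of_le {p p' : ℕ} (h : p ≤ p') {U : Set M} {u : TensorField n M r s}
    (hu : CompC p' U u) : CompC p U u :=
  fun c I J => (hu c I J).of_le (by exact_mod_cast h)

lemma comp_add (u v : TensorField n M r s) (c : M) (I : Fin r → Fin n) (J : Fin s → Fin n)
    (y : EuclideanSpace ℝ (Fin n)) : comp (u + v) c I J y = comp u c I J y + comp v c I J y := rfl

lemma CompC.add {p : ℕ} {U : Set M} {u v : TensorField n M r s} (hu : CompC p U u)
    (hv : CompC p U v) : CompC p U (u + v) := fun c I J => (hu c I J).add (hv c I J)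

lemma CompC.prod {p : ℕ} {U : Set M} (e : Fin t ≃ Fin q ⊕ Fin s) {a : TensorField n M 0 q}
    {u : TensorField n M r s} (ha : CompC p U a) (hu : CompC p U u) : CompC p U (prod e a u) :=
  fun c I J => by
    have : comp (WeightedSobolev.prod e a u) c I J = fun y => _ := funext (comp_prod e a u c I J)
    rw [this]
    exact (ha c _ _).mul (hu c _ _)

lemma CompC.connTerm (g : Metric n m M) {p : ℕ} (hp : p + 1 ≤ m) {U : Set M}
    {u : TensorField n M r s} (hu : CompC p U u) (c : M) (l : Fin n) (I : Fin r → Fin n)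
    (J : Fin s → Fin n) : ContDiffOn ℝ p (connTerm g u c l I J) (chartDomIn c U) := by
  have hΓ := fun a i j =>
    (contDiffOn_christoffel g hp c a i j).mono (chartDomIn_subset (n := n) c U)
  exact (ContDiffOn.sum fun a _ => ContDiffOn.sum fun p _ => (hΓ _ _ _).mul (hu c _ _)).sub
    (ContDiffOn.sum fun a _ => ContDiffOn.sum fun p _ => (hΓ _ _ _).mul (hu c _ _))

lemma connTerm_add (g : Metric n m M) (u v : TensorField n M r s) (c : M) (l : Fin n)
    (I : Fin r → Fin n) (J : Fin s → Fin n) (y : EuclideanSpace ℝ (Fin n)) :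
    connTerm g (u + v) c l I J y = connTerm g u c l I J y + connTerm g v c l I J y := by
  simp only [connTerm, comp_add, mul_add, Finset.sum_add_distrib]
  ring

/-! ### The Leibniz rule -/

/-- The distribution of slots for the term of `∇(a ⊗ u)` in which `a` is differentiated. -/
def succLeft (e : Fin t ≃ Fin q ⊕ Fin s) : Fin (t + 1) ≃ Fin (q + 1) ⊕ Fin s where
  toFun := Fin.cases (Sum.inl 0) (fun b => Sum.map Fin.succ id (e b))
  invFun := Sum.elim (Fin.cases 0 fun i => (e.symm (Sum.inl i)).succ)
    (fun j => (e.symm (Sum.inr j)).succ)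
  left_inv := fun b => by
    refine Fin.cases rfl (fun b => ?_) b
    obtain ⟨k, rfl⟩ := e.symm.surjective b
    rcases k with i | j <;> simp
  right_inv := fun k => by
    rcases k with i | j
    · refine Fin.cases rfl (fun i => ?_) i
      simp
    · simp

/-- The distribution of slots for the term of `∇(a ⊗ u)` in which `u` is differentiated. -/
def succRight (e : Fin t ≃ Fin q ⊕ Fin s) : Fin (t + 1) ≃ Fin q ⊕ Fin (s + 1) where
  toFun := Fin.cases (Sum.inr 0) (fun b => Sum.map id Fin.succ (e b))
  invFun := Sum.elim (fun i => (e.symm (Sum.inl i)).succ)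
    (Fin.cases 0 fun j => (e.symm (Sum.inr j)).succ)
  left_inv := fun b => by
    refine Fin.cases rfl (fun b => ?_) b
    obtain ⟨k, rfl⟩ := e.symm.surjective b
    rcases k with i | j <;> simp
  right_inv := fun k => by
    rcases k with i | j
    · simp
    · refine Fin.cases rfl (fun j => ?_) j
      simp

lemma comp_prod_succLeft (e : Fin t ≃ Fin q ⊕ Fin s) (a : TensorField n M 0 (q + 1))
    (u : TensorField n M r s) (c : M) (I : Fin r → Fin n) (l : Fin n) (J : Fin t → Fin n)
    (y : EuclideanSpace ℝ (Fin n)) :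
    comp (prod (succLeft e) a u) c I (Fin.cons l J) y
      = comp a c Fin.elim0 (Fin.cons l fun i => J (e.symm (Sum.inl i))) y
        * comp u c I (fun i => J (e.symm (Sum.inr i))) y := by
  rw [comp_prod]
  congr 2
  funext i
  refine Fin.cases rfl (fun i => rfl) i

lemma comp_prod_succRight (e : Fin t ≃ Fin q ⊕ Fin s) (a : TensorField n M 0 q)
    (u : TensorField n M r (s + 1)) (c : M) (I : Fin r → Fin n) (l : Fin n) (J : Fin t → Fin n)
    (y : EuclideanSpace ℝ (Fin n)) :
    comp (prod (succRight e) a u) c I (Fin.cons l J) y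
      = comp a c Fin.elim0 (fun i => J (e.symm (Sum.inl i))) y
        * comp u c I (Fin.cons l fun i => J (e.symm (Sum.inr i))) y := by
  rw [comp_prod]
  congr 2
  funext i
  refine Fin.cases rfl (fun i => rfl) i

lemma connTerm_prod (g : Metric n m M) (e : Fin t ≃ Fin q ⊕ Fin s) (a : TensorField n M 0 q)
    (u : TensorField n M r s) (c : M) (l : Fin n) (I : Fin r → Fin n) (J : Fin t → Fin n)
    (y : EuclideanSpace ℝ (Fin n)) :
    connTerm g (prod e a u) c l I J y
      = connTerm g a c l Fin.elim0 (fun i => J (e.symm (Sum.inl i))) y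
          * comp u c I (fun i => J (e.symm (Sum.inr i))) y
        + comp a c Fin.elim0 (fun i => J (e.symm (Sum.inl i))) y
          * connTerm g u c l I (fun i => J (e.symm (Sum.inr i))) y := by
  have hl : ∀ k p, (fun i => Function.update J (e.symm (Sum.inl k)) p (e.symm (Sum.inl i)))
      = Function.update (fun i => J (e.symm (Sum.inl i))) k p := fun k p => by
    funext i; simp [Function.update_apply]
  have hl' : ∀ k p, (fun i => Function.update J (e.symm (Sum.inl k)) p (e.symm (Sum.inr i)))
      = (fun i => J (e.symm (Sum.inr i))) := fun k p => by
    funext i; simp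
  have hr : ∀ k p, (fun i => Function.update J (e.symm (Sum.inr k)) p (e.symm (Sum.inr i)))
      = Function.update (fun i => J (e.symm (Sum.inr i))) k p := fun k p => by
    funext i; simp [Function.update_apply]
  have hr' : ∀ k p, (fun i => Function.update J (e.symm (Sum.inr k)) p (e.symm (Sum.inl i)))
      = (fun i => J (e.symm (Sum.inl i))) := fun k p => by
    funext i; simp
  simp only [connTerm, comp_prod]
  rw [← e.symm.sum_comp (fun b => ∑ p, _), Fintype.sum_sum_type]
  simp only [hl, hl', hr, hr', Finset.univ_eq_empty, Finset.sum_empty, zero_sub]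
  simp only [mul_sub, Finset.mul_sum, Finset.sum_mul, neg_mul]
  have e1 : ∀ A B C X Y Z : ℝ, X = A → Y = B → Z = C → A - (B + C) = -Y + (X - Z) := by
    intro A B C X Y Z h1 h2 h3; rw [h1, h2, h3]; ring
  refine e1 _ _ _ _ _ _ ?_ ?_ ?_ <;>
    exact Finset.sum_congr rfl fun _ _ => Finset.sum_congr rfl fun _ _ => by ring

/-- `v` is the classical covariant derivative of the `C^1` field `u` on `U`. -/
def IsClassicalDeriv (g : Metric n m M) (U : Set M) (u : TensorField n M r s)
    (v : TensorField n M r (s + 1)) : Prop :=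
  CompC 1 U u ∧ CompC 0 U v ∧ ∀ c, ∀ y ∈ chartDomIn c U, ∀ I J l,
    comp v c I (Fin.cons l J) y = partialDeriv l (comp u c I J) y + connTerm g u c l I J y

lemma IsClassicalDeriv.add {g : Metric n m M} {U : Set M} (hU : IsOpen U)
    {u u' : TensorField n M r s} {v v' : TensorField n M r (s + 1)}
    (h : IsClassicalDeriv g U u v) (h' : IsClassicalDeriv g U u' v') :
    IsClassicalDeriv g U (u + u') (v + v') := by
  refine ⟨h.1.add h'.1, h.2.1.add h'.2.1, fun c y hy I J l => ?_⟩
  have hd := fun {u : TensorField n M r s} (hu : CompC 1 U u) =>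
    ((hu c I J).contDiffAt ((isOpen_chartDomIn c hU).mem_nhds hy)).differentiableAt (by norm_num)
  rw [comp_add, h.2.2 c y hy, h'.2.2 c y hy, connTerm_add,
    show comp (u + u') c I J = fun z => comp u c I J z + comp u' c I J z from rfl,
    partialDeriv_add (hd h.1) (hd h'.1)]
  ring

lemma IsClassicalDeriv.prod {g : Metric n m M} {U : Set M} (hU : IsOpen U)
    (e : Fin t ≃ Fin q ⊕ Fin s) {a : TensorField n M 0 q} {a' : TensorField n M 0 (q + 1)}
    {u : TensorField n M r s} {v : TensorField n M r (s + 1)}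
    (ha : IsClassicalDeriv g U a a') (hu : IsClassicalDeriv g U u v) :
    IsClassicalDeriv g U (prod e a u)
      (WeightedSobolev.prod (succLeft e) a' u + WeightedSobolev.prod (succRight e) a v) := by
  refine ⟨ha.1.prod e hu.1, (ha.2.1.prod _ (hu.1.of_le zero_le_one)).add
    ((ha.1.of_le zero_le_one).prod _ hu.2.1), fun c y hy I J l => ?_⟩
  have hd := fun {r s : ℕ} {u : TensorField n M r s} (hu : CompC 1 U u) I J =>
    ((hu c I J).contDiffAt ((isOpen_chartDomIn c hU).mem_nhds hy)).differentiableAt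
      (n := ((1 : ℕ) : WithTop ℕ∞)) (by norm_num)
  rw [comp_add, comp_prod_succLeft, comp_prod_succRight, ha.2.2 c y hy, hu.2.2 c y hy,
    connTerm_prod, funext (comp_prod e a u c I J), partialDeriv_mul (hd ha.1 _ _) (hd hu.1 _ _)]
  ring

lemma locallyIntegrableOn_connTerm (g : Metric n m M) (hm : m ≠ 0) {u : TensorField n M r s}
    {c : M} (hu : ∀ I J, LocallyIntegrableOn (comp u c I J) (chartDom c)) (l : Fin n)
    (I : Fin r → Fin n) (J : Fin s → Fin n) :
    LocallyIntegrableOn (connTerm g u c l I J) (chartDom c) := by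
  have hO := isOpen_chartDom (n := n) c
  have hΓ : ∀ p i j, ContinuousOn (christoffel g c p i j) (chartDom c) := fun p i j =>
    (contDiffOn_christoffel g (p := 0) (by omega) c p i j).continuousOn
  exact (locallyIntegrableOn_sum _ fun _ _ => locallyIntegrableOn_sum _ fun _ _ =>
    locallyIntegrableOn_mul_continuousOn hO (hΓ _ _ _) (hu _ _)).sub
    (locallyIntegrableOn_sum _ fun _ _ => locallyIntegrableOn_sum _ fun _ _ =>
    locallyIntegrableOn_mul_continuousOn hO (hΓ _ _ _) (hu _ _))

/-- The Leibniz rule for the product of a weakly differentiable tensor field with a classically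
differentiable one: the components of the latter are absorbed into the test function, which then is
only of class `C^1`. -/
lemma HasWeakCovDeriv.prod {g : Metric n m M} (hm : m ≠ 0)
    (e : Fin t ≃ Fin q ⊕ Fin s) {a : TensorField n M 0 q} {a' : TensorField n M 0 (q + 1)}
    {u : TensorField n M r s} {v : TensorField n M r (s + 1)}
    (ha : IsClassicalDeriv g ((𝓡∂ n).interior M) a a') (hu : HasWeakCovDeriv g u v) :
    HasWeakCovDeriv g (prod e a u)
      (WeightedSobolev.prod (succLeft e) a' u + WeightedSobolev.prod (succRight e) a v) := by
  intro c
  obtain ⟨h1, h2, h3⟩ := hu c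
  have hO := isOpen_chartDom (n := n) c
  have ha1 : ∀ J, ContDiffOn ℝ 1 (comp a c Fin.elim0 J) (chartDom c) := fun J => by
    simpa only [chartDomIn_interior, Nat.cast_one] using ha.1 c Fin.elim0 J
  have ha0 : ∀ J, ContinuousOn (comp a' c Fin.elim0 J) (chartDom c) := fun J => by
    simpa only [chartDomIn_interior] using (ha.2.1 c Fin.elim0 J).continuousOn
  refine ⟨fun I J => ?_, fun I K => ?_, fun I J l φ hφ hφc hφs => ?_⟩
  · rw [funext (comp_prod e a u c I J)]
    exact locallyIntegrableOn_mul_continuousOn hO (ha1 _).continuousOn (h1 _ _)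
  · have : comp (WeightedSobolev.prod (succLeft e) a' u + WeightedSobolev.prod (succRight e) a v)
        c I K = fun y => _ := funext (comp_add _ _ c I K)
    rw [this, funext (comp_prod _ a' u c I K), funext (comp_prod _ a v c I K)]
    exact (locallyIntegrableOn_mul_continuousOn hO (ha0 _) (h1 _ _)).add
      (locallyIntegrableOn_mul_continuousOn hO (ha1 _).continuousOn (h2 _ _))
  · set A := comp a c Fin.elim0 (fun i => J (e.symm (Sum.inl i))) with hA
    set Jr : Fin s → Fin n := fun i => J (e.symm (Sum.inr i)) with hJr
    set W := fun y => comp v c I (Fin.cons l Jr) y - connTerm g u c l I Jr y with hW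
    have hconn : LocallyIntegrableOn (connTerm g u c l I Jr) (chartDom c) :=
      locallyIntegrableOn_connTerm g hm h1 l I Jr
    have hWi : LocallyIntegrableOn W (chartDom c) := (h2 _ _).sub hconn
    have hweak : HasWeakPartial 1 (chartDom c) l (comp u c I Jr) W :=
      HasWeakPartial.of_top hO (h1 _ _) hWi (fun ψ hψ hψc hψs => h3 I Jr l ψ hψ hψc hψs)
    have hφ1 : ContDiff ℝ 1 φ := hφ.of_le (by exact_mod_cast le_top)
    have hψ : ContDiff ℝ 1 (fun y => A y * φ y) :=
      contDiff_mul_of_tsupport_subset hO (ha1 _) hφ1.contDiffOn hφs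
    have hψs : tsupport (fun y => A y * φ y) ⊆ tsupport φ :=
      closure_mono (Function.support_mul_subset_right _ _)
    have hψc : HasCompactSupport (fun y => A y * φ y) := hφc.mul_left
    have hmain := hweak _ hψ hψc (hψs.trans hφs)
    have hder : ∀ y, partialDeriv l (fun y => A y * φ y) y
        = partialDeriv l A y * φ y + A y * partialDeriv l φ y := fun y => by
      by_cases hy : y ∈ chartDom c
      · exact partialDeriv_mul (((ha1 _).contDiffAt (hO.mem_nhds hy)).differentiableAt (by simp))
          (hφ1.differentiable (by simp) y)
      · have hy' : y ∉ tsupport φ := fun h => hy (hφs h)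
        rw [partialDeriv_eq_zero_of_notMem fun h => hy' (hψs h),
          partialDeriv_eq_zero_of_notMem hy', image_eq_zero_of_notMem_tsupport hy']
        ring
    have hdA : ContinuousOn (partialDeriv l A) (chartDom c) :=
      (contDiffOn_partialDeriv hO (p := 0) (by simpa using ha1 _) l).continuousOn
    have i1 : Integrable (fun y => A y * comp u c I Jr y * partialDeriv l φ y) :=
      integrable_mul_of_tsupport_subset
        (locallyIntegrableOn_mul_continuousOn hO (ha1 _).continuousOn (h1 _ _))
        (continuous_partialDeriv hφ1 l) (hφc.mono' ((subset_tsupport _).trans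
          (tsupport_partialDeriv_subset φ l))) ((tsupport_partialDeriv_subset φ l).trans hφs)
    have i2 : Integrable (fun y => partialDeriv l A y * comp u c I Jr y * φ y) :=
      integrable_mul_of_tsupport_subset
        (locallyIntegrableOn_mul_continuousOn hO hdA (h1 _ _)) hφ1.continuous hφc hφs
    have i3 : Integrable (fun y => A y * W y * φ y) :=
      integrable_mul_of_tsupport_subset
        (locallyIntegrableOn_mul_continuousOn hO (ha1 _).continuousOn hWi) hφ1.continuous hφc hφs
    -- expand the derivative of the test function and compare with the components of the product
    have e1 : ∫ y, comp u c I Jr y * partialDeriv l (fun y => A y * φ y) y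
        = (∫ y, partialDeriv l A y * comp u c I Jr y * φ y)
          + ∫ y, A y * comp u c I Jr y * partialDeriv l φ y := by
      rw [← integral_add i2 i1]
      refine integral_congr_ae (Filter.Eventually.of_forall fun y => ?_)
      simp only [hder]; ring
    have e2 : ∫ y, comp (WeightedSobolev.prod e a u) c I J y * partialDeriv l φ y
        = ∫ y, A y * comp u c I Jr y * partialDeriv l φ y := by
      rw [funext (comp_prod e a u c I J)]
    have e3 : ∫ y, (comp (WeightedSobolev.prod (succLeft e) a' u
          + WeightedSobolev.prod (succRight e) a v) c I (Fin.cons l J) y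
          - connTerm g (WeightedSobolev.prod e a u) c l I J y) * φ y
        = (∫ y, partialDeriv l A y * comp u c I Jr y * φ y) + ∫ y, A y * W y * φ y := by
      rw [← integral_add i2 i3]
      refine integral_congr_ae (Filter.Eventually.of_forall fun y => ?_)
      beta_reduce
      by_cases hy : y ∈ tsupport φ
      · have hy' : y ∈ chartDomIn (n := n) c ((𝓡∂ n).interior M) := by
          rw [chartDomIn_interior]; exact hφs hy
        rw [comp_add, comp_prod_succLeft, comp_prod_succRight, connTerm_prod, ha.2.2 c y hy']
        simp only [hW, ← hJr, ← hA]
        ring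
      · rw [image_eq_zero_of_notMem_tsupport hy]; ring
    rw [e2, e3]
    have e4 : ∫ y, W y * (A y * φ y) = ∫ y, A y * W y * φ y :=
      integral_congr_ae (Filter.Eventually.of_forall fun y => by simp only []; ring)
    rw [e1, e4] at hmain
    linarith

end Leibniz

/-! ### Jets with pointwise bounds -/

section Jets

variable {n : ℕ} [NeZero n] {m : ℕ} {M : Type*} [TopologicalSpace M]
  [ChartedSpace (EuclideanHalfSpace n) M] [IsManifold (𝓡∂ n) ∞ M] {r s q t : ℕ}
  {g : Metric n m M} {U : Set M}

/-- A notion of covariant differentiation for tensor fields with `r` contravariant slots that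
obeys the Leibniz rule for products with classically differentiable covariant tensor fields
on `U`. Classical and weak differentiation are the two instances. -/
structure DerivTheory (g : Metric n m M) (U : Set M) (r : ℕ) where
  /-- The regularity required of a field and of its derivatives. -/
  Reg : ∀ {s : ℕ}, TensorField n M r s → Prop
  /-- The second field is the covariant derivative of the first. -/
  Der : ∀ {s : ℕ}, TensorField n M r s → TensorField n M r (s + 1) → Prop
  reg_add : ∀ {s : ℕ} {u v : TensorField n M r s}, Reg u → Reg v → Reg (u + v)
  der_add : ∀ {s : ℕ} {u u' : TensorField n M r s} {v v' : TensorField n M r (s + 1)},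
    Der u v → Der u' v' → Der (u + u') (v + v')
  reg_prod : ∀ {q s t : ℕ} (e : Fin t ≃ Fin q ⊕ Fin s) {a : TensorField n M 0 q}
    {u : TensorField n M r s}, CompC 0 U a → Reg u → Reg (prod e a u)
  der_prod : ∀ {q s t : ℕ} (e : Fin t ≃ Fin q ⊕ Fin s) {a : TensorField n M 0 q}
    {a' : TensorField n M 0 (q + 1)} {u : TensorField n M r s} {v : TensorField n M r (s + 1)},
    IsClassicalDeriv g U a a' → Der u v →
      Der (prod e a u) (prod (succLeft e) a' u + prod (succRight e) a v)

/-- Classical differentiation on the open set `U`. -/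
def classical (g : Metric n m M) (hU : IsOpen U) (r : ℕ) : DerivTheory g U r where
  Reg := CompC 0 U
  Der := IsClassicalDeriv g U
  reg_add := CompC.add
  der_add := IsClassicalDeriv.add hU
  reg_prod := CompC.prod
  der_prod := IsClassicalDeriv.prod hU

lemma IsMeasurableField.prod (e : Fin t ≃ Fin q ⊕ Fin s) {a : TensorField n M 0 q}
    {u : TensorField n M r s} (ha : CompC 0 ((𝓡∂ n).interior M) a) (hu : IsMeasurableField u) :
    IsMeasurableField (prod e a u) := fun c I J => by
  rw [funext (comp_prod e a u c I J)]
  have h := (ha c Fin.elim0 fun i => J (e.symm (Sum.inl i))).continuousOn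
  rw [chartDomIn_interior] at h
  exact (h.aestronglyMeasurable (isOpen_chartDom c).measurableSet).mul (hu c _ _)

lemma HasWeakCovDeriv.add (hm : m ≠ 0) {u u' : TensorField n M r s}
    {v v' : TensorField n M r (s + 1)} (h : HasWeakCovDeriv g u v) (h' : HasWeakCovDeriv g u' v') :
    HasWeakCovDeriv g (u + u') (v + v') := by
  intro c
  obtain ⟨h1, h2, h3⟩ := h c
  obtain ⟨h1', h2', h3'⟩ := h' c
  refine ⟨fun I J => (h1 I J).add (h1' I J), fun I K => (h2 I K).add (h2' I K),
    fun I J l φ hφ hφc hφs => ?_⟩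
  have hφ1 : ContDiff ℝ 1 φ := hφ.of_le (by exact_mod_cast le_top)
  have hi : ∀ {u : TensorField n M r s} {v : TensorField n M r (s + 1)},
      (∀ I J, LocallyIntegrableOn (comp u c I J) (chartDom c)) →
      (∀ I J, LocallyIntegrableOn (comp v c I J) (chartDom c)) →
      Integrable (fun y => comp u c I J y * partialDeriv l φ y) ∧
      Integrable (fun y => (comp v c I (Fin.cons l J) y - connTerm g u c l I J y) * φ y) :=
    fun hu hv => ⟨integrable_mul_of_tsupport_subset (hu I J) (continuous_partialDeriv hφ1 l)
        (hφc.mono' ((subset_tsupport _).trans (tsupport_partialDeriv_subset φ l)))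
        ((tsupport_partialDeriv_subset φ l).trans hφs),
      integrable_mul_of_tsupport_subset
        ((hv I _).sub (locallyIntegrableOn_connTerm g hm hu l I J)) hφ.continuous hφc hφs⟩
  have e1 := integral_add (hi h1 h2).1 (hi h1' h2').1
  have e2 := integral_add (hi h1 h2).2 (hi h1' h2').2
  rw [h3 I J l φ hφ hφc hφs, h3' I J l φ hφ hφc hφs] at e1
  have e3 : ∀ y, comp (u + u') c I J y * partialDeriv l φ y
      = comp u c I J y * partialDeriv l φ y + comp u' c I J y * partialDeriv l φ y := fun y => by
    rw [comp_add]; ring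
  have e4 : ∀ y, (comp (v + v') c I (Fin.cons l J) y - connTerm g (u + u') c l I J y) * φ y
      = (comp v c I (Fin.cons l J) y - connTerm g u c l I J y) * φ y
        + (comp v' c I (Fin.cons l J) y - connTerm g u' c l I J y) * φ y := fun y => by
    rw [comp_add, connTerm_add]; ring
  simp only [e3, e4]
  rw [e1, e2]
  ring

/-- Weak differentiation in the interior. -/
def weak (g : Metric n m M) (hm : m ≠ 0) (r : ℕ) : DerivTheory g ((𝓡∂ n).interior M) r where
  Reg := IsMeasurableField
  Der := HasWeakCovDeriv g
  reg_add := fun hu hv c I J => (hu c I J).add (hv c I J)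
  der_add := HasWeakCovDeriv.add hm
  reg_prod := IsMeasurableField.prod
  der_prod := HasWeakCovDeriv.prod hm

/-- The field `u` has `k` successive covariant derivatives on `U`, and the norm of the `j`-th one
is at most `b j`. -/
def JetBound (T : DerivTheory g U r) : ∀ (_ : ℕ) {s : ℕ}, TensorField n M r s → (ℕ → M → ℝ) → Prop
  | 0, _, u, b => T.Reg u ∧ ∀ x ∈ U, tnorm g u x ≤ b 0 x
  | k + 1, s, u, b => (T.Reg u ∧ ∀ x ∈ U, tnorm g u x ≤ b 0 x) ∧
      ∃ v : TensorField n M r (s + 1), T.Der u v ∧ JetBound T k v fun j => b (j + 1)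

namespace JetBound

variable {T : DerivTheory g U r} {k : ℕ} {u v : TensorField n M r s} {b b' : ℕ → M → ℝ}

lemma zero (h : JetBound T k u b) : T.Reg u ∧ ∀ x ∈ U, tnorm g u x ≤ b 0 x := by
  cases k with
  | zero => exact h
  | succ k => exact h.1

lemma of_succ (h : JetBound T (k + 1) u b) : JetBound T k u b := by
  induction k generalizing s b with
  | zero => exact h.1
  | succ k ih =>
    obtain ⟨h0, v, hv, h'⟩ := h
    exact ⟨h0, v, hv, ih h'⟩

lemma of_le {k' : ℕ} (hk : k' ≤ k) (h : JetBound T k u b) : JetBound T k' u b := by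
  induction k, hk using Nat.le_induction with
  | base => exact h
  | succ k _ ih => exact ih h.of_succ

lemma mono (h : JetBound T k u b) (hb : ∀ j ≤ k, ∀ x ∈ U, b j x ≤ b' j x) :
    JetBound T k u b' := by
  induction k generalizing s b b' with
  | zero => exact ⟨h.1, fun x hx => (h.2 x hx).trans (hb 0 le_rfl x hx)⟩
  | succ k ih =>
    obtain ⟨h0, v, hv, h'⟩ := h
    exact ⟨⟨h0.1, fun x hx => (h0.2 x hx).trans (hb 0 (Nat.zero_le _) x hx)⟩, v, hv,
      ih h' fun j hj => hb (j + 1) (by omega)⟩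

lemma add (h : JetBound T k u b) (h' : JetBound T k v b') :
    JetBound T k (u + v) fun j x => b j x + b' j x := by
  induction k generalizing s b b' with
  | zero => exact ⟨T.reg_add h.1 h'.1, fun x hx =>
      (tnorm_add_le g u v x).trans (add_le_add (h.2 x hx) (h'.2 x hx))⟩
  | succ k ih =>
    obtain ⟨h0, u', hu', h1⟩ := h
    obtain ⟨h0', v', hv', h1'⟩ := h'
    exact ⟨⟨T.reg_add h0.1 h0'.1, fun x hx =>
      (tnorm_add_le g u v x).trans (add_le_add (h0.2 x hx) (h0'.2 x hx))⟩, _,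
      T.der_add hu' hv', ih h1 h1'⟩

end JetBound

/-- The bound that the Leibniz rule gives for the derivatives of a product, in terms of bounds for
the derivatives of the factors. -/
def conv {X : Type*} : ℕ → (ℕ → X → ℝ) → (ℕ → X → ℝ) → X → ℝ
  | 0, b, c, x => b 0 x * c 0 x
  | j + 1, b, c, x => conv j (fun i => b (i + 1)) c x + conv j b (fun i => c (i + 1)) x

/-- The Leibniz rule for jets. The two terms of `∇(a ⊗ u)` are products of the same kind with one
derivative less to go, whence the induction over all distributions of slots. -/
lemma JetBound.prod {T : DerivTheory g U r} {hU : IsOpen U} {k : ℕ} (e : Fin t ≃ Fin q ⊕ Fin s)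
    {a : TensorField n M 0 q} {u : TensorField n M r s} {b c : ℕ → M → ℝ}
    (ha : JetBound (classical g hU 0) k a b) (hu : JetBound T k u c) :
    JetBound T k (prod e a u) fun j => conv j b c := by
  induction k generalizing q s t b c with
  | zero =>
    refine ⟨T.reg_prod e ha.zero.1 hu.zero.1, fun x hx => ?_⟩
    rw [tnorm_prod]
    exact mul_le_mul (ha.zero.2 x hx) (hu.zero.2 x hx) (tnorm_nonneg g u x)
      ((tnorm_nonneg g a x).trans (ha.zero.2 x hx))
  | succ k ih =>
    have h0 := (ih e ha.of_succ hu.of_succ).zero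
    obtain ⟨-, a', ha', hj⟩ := id ha
    obtain ⟨-, u', hu', hj'⟩ := id hu
    exact ⟨h0, _, T.der_prod e ha' hu', (ih _ hj hu.of_succ).add (ih _ ha.of_succ hj')⟩

/-- A weak jet, from its `i`-th member on, as a field with successive weak derivatives. -/
lemma IsWeakJet.jetBound {hm : m ≠ 0} {k : ℕ} {u : TensorField n M r s}
    {w : ∀ j : ℕ, TensorField n M r (s + j)} (h : IsWeakJet g k u w) (l i : ℕ) (hl : i + l = k) :
    JetBound (weak g hm r) l (w i) fun j => tnorm g (w (i + j)) := by
  induction l generalizing i with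
  | zero => exact ⟨h.2.1 i (by omega), fun x _ => le_rfl⟩
  | succ l ih =>
    refine ⟨⟨h.2.1 i (by omega), fun x _ => le_rfl⟩, w (i + 1), h.2.2 i (by omega), ?_⟩
    refine (ih (i + 1) (by omega)).mono fun j _ x _ => le_of_eq ?_
    rw [show i + 1 + j = i + (j + 1) by omega]

open Classical in
/-- The successive derivatives, whose existence is asserted one after the other, can be chosen as
one sequence. -/
lemma JetBound.exists_isWeakJet {hm : m ≠ 0} {k : ℕ} {u : TensorField n M r s} {b : ℕ → M → ℝ}
    (h : JetBound (weak g hm r) k u b) :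
    ∃ w : ∀ j : ℕ, TensorField n M r (s + j), IsWeakJet g k u w ∧
      ∀ j ≤ k, ∀ x ∈ (𝓡∂ n).interior M, tnorm g (w j) x ≤ b j x := by
  let next : ∀ j : ℕ, TensorField n M r (s + j) → TensorField n M r (s + (j + 1)) := fun j T =>
    if h : ∃ v : TensorField n M r (s + j + 1), HasWeakCovDeriv g T v ∧
      JetBound (weak g hm r) (k - (j + 1)) v (fun i => b (j + 1 + i)) then h.choose else fun _ => 0
  let w : ∀ j : ℕ, TensorField n M r (s + j) := fun j => Nat.rec u next j
  have key : ∀ j ≤ k, JetBound (weak g hm r) (k - j) (w j) (fun i => b (j + i)) ∧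
      (∀ i, i + 1 = j → HasWeakCovDeriv g (w i) (w (i + 1))) := by
    intro j hj
    induction j with
    | zero => exact ⟨h.mono fun j _ x _ => by rw [zero_add], fun i hi => by omega⟩
    | succ j ih =>
      have hj' := (ih (by omega)).1
      rw [show k - j = k - (j + 1) + 1 by omega] at hj'
      obtain ⟨-, v, hv, hv'⟩ := hj'
      have hex : ∃ v : TensorField n M r (s + j + 1), HasWeakCovDeriv g (w j) v ∧
          JetBound (weak g hm r) (k - (j + 1)) v (fun i => b (j + 1 + i)) :=
        ⟨v, hv, hv'.mono fun i _ x _ =>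
          le_of_eq (congrArg (fun p => b p x) (by omega))⟩
      have hw : w (j + 1) = hex.choose := dif_pos hex
      refine ⟨hw ▸ hex.choose_spec.2, fun i hi => ?_⟩
      obtain rfl : i = j := by omega
      exact hw ▸ hex.choose_spec.1
  refine ⟨w, ⟨rfl, fun j hj => (key j hj).1.zero.1, fun j hj => (key (j + 1) hj).2 j rfl⟩,
    fun j hj x hx => ?_⟩
  simpa using (key j hj).1.zero.2 x hx

end Jets

/-! ### Classical derivatives of functions -/

section Classical

variable {n : ℕ} [NeZero n] {m : ℕ} {M : Type*} [TopologicalSpace M]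
  [ChartedSpace (EuclideanHalfSpace n) M] [IsManifold (𝓡∂ n) ∞ M] {r s q t : ℕ}
  {g : Metric n m M} {U U' : Set M}

lemma CompC.compDiffAt {p : ℕ} (hp : p ≠ 0) (hU : IsOpen U) {u : TensorField n M r s}
    (hu : CompC p U u) {z : M} (hz : z ∈ U) (hzi : z ∈ (𝓡∂ n).interior M) : CompDiffAt u z :=
  fun c hc I J => by
    refine ((hu c I J).contDiffAt ((isOpen_chartDomIn c hU).mem_nhds
      ⟨(mem_chartDom_iff hc).2 hzi, ?_⟩)).differentiableAt (by exact_mod_cast hp)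
    rwa [mem_preimage, (extChartAt (𝓡∂ n) c).left_inv hc]

lemma comp_covDeriv_of_compC (hm : m ≠ 0) {p : ℕ} (hp : p ≠ 0) (hU : IsOpen U)
    {u : TensorField n M r s} (hu : CompC p U u) {c : M} {y : EuclideanSpace ℝ (Fin n)}
    (hy : y ∈ chartDomIn c U) (I : Fin r → Fin n) (J : Fin s → Fin n) (l : Fin n) :
    comp (covDeriv g u) c I (Fin.cons l J) y
      = partialDeriv l (comp u c I J) y + connTerm g u c l I J y :=
  comp_covDeriv g hm hy.1 (hu.compDiffAt hp hU hy.2 (symm_mem_interior hy.1)) I J l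

lemma CompC.covDeriv {p : ℕ} (hp : p + 1 ≤ m) (hU : IsOpen U) {u : TensorField n M r s}
    (hu : CompC (p + 1) U u) : CompC p U (covDeriv g u) := fun c I K => by
  have h : ∀ y ∈ chartDomIn c U, comp (WeightedSobolev.covDeriv g u) c I K y
      = partialDeriv (K 0) (comp u c I (Fin.tail K)) y
        + WeightedSobolev.connTerm g u c (K 0) I (Fin.tail K) y := fun y hy => by
    rw [← comp_covDeriv_of_compC (by omega) (Nat.succ_ne_zero p) hU hu hy, Fin.cons_self_tail]
  refine ContDiffOn.congr ?_ h
  exact (contDiffOn_partialDeriv (isOpen_chartDomIn c hU) (hu c _ _) _).add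
    ((hu.of_le (Nat.le_succ p)).connTerm g hp c _ _ _)

lemma isClassicalDeriv_covDeriv (hm : m ≠ 0) (hU : IsOpen U) {u : TensorField n M r s}
    (hu : CompC 1 U u) : IsClassicalDeriv g U u (covDeriv g u) :=
  ⟨hu, CompC.covDeriv (p := 0) (by omega) hU hu, fun _ _ hy I J l =>
    comp_covDeriv_of_compC hm one_ne_zero hU hu hy I J l⟩

/-- Two fields with the same components on `U`. -/
def EqComp (U : Set M) (u v : TensorField n M r s) : Prop :=
  ∀ c, ∀ y ∈ chartDomIn (n := n) c U, ∀ I J, comp u c I J y = comp v c I J y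

lemma EqComp.connTerm {u v : TensorField n M r s} (h : EqComp U u v) {c : M}
    {y : EuclideanSpace ℝ (Fin n)} (hy : y ∈ chartDomIn c U) (l : Fin n) (I : Fin r → Fin n)
    (J : Fin s → Fin n) : connTerm g u c l I J y = connTerm g v c l I J y := by
  simp only [WeightedSobolev.connTerm, h c y hy]

lemma EqComp.tnorm (hUi : U ⊆ (𝓡∂ n).interior M) {u v : TensorField n M r s} (h : EqComp U u v)
    {x : M} (hx : x ∈ U) : tnorm g u x = tnorm g v x := by
  have hy : extChartAt (𝓡∂ n) x x ∈ chartDomIn x U := by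
    refine ⟨extChartAt_self_mem_chartDom (hUi hx), ?_⟩
    rwa [mem_preimage, (extChartAt (𝓡∂ n) x).left_inv (mem_extChartAt_source x)]
  simp only [WeightedSobolev.tnorm, normSq, h x _ hy]

lemma JetBound.congr {hU : IsOpen U} (hUi : U ⊆ (𝓡∂ n).interior M) {k : ℕ}
    {u u' : TensorField n M r s} {b : ℕ → M → ℝ} (h : EqComp U u u')
    (hu : JetBound (classical g hU r) k u b) : JetBound (classical g hU r) k u' b := by
  have h0 : (classical g hU r).Reg u' ∧ ∀ x ∈ U, WeightedSobolev.tnorm g u' x ≤ b 0 x :=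
    ⟨fun c I J => (hu.zero.1 c I J).congr fun y hy => (h c y hy I J).symm,
      fun x hx => (h.tnorm hUi hx).symm.trans_le (hu.zero.2 x hx)⟩
  cases k with
  | zero => exact h0
  | succ k =>
    obtain ⟨-, v, ⟨h1, h2, h3⟩, hv⟩ := hu
    refine ⟨h0, v, ⟨fun c I J => (h1 c I J).congr fun y hy => (h c y hy I J).symm, h2,
      fun c y hy I J l => ?_⟩, hv⟩
    rw [h3 c y hy, h.connTerm hy]
    congr 1
    refine partialDeriv_congr ?_
    filter_upwards [(isOpen_chartDomIn c hU).mem_nhds hy] with z hz using h c z hz I J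

lemma chartDomIn_union (c : M) :
    chartDomIn (n := n) c (U ∪ U') = chartDomIn c U ∪ chartDomIn c U' := by
  rw [chartDomIn, preimage_union, inter_union_distrib_left]; rfl

lemma CompC.union {p : ℕ} (hU : IsOpen U) (hU' : IsOpen U') {u : TensorField n M r s}
    (h : CompC p U u) (h' : CompC p U' u) : CompC p (U ∪ U') u := fun c I J => by
  rw [chartDomIn_union]
  exact (h c I J).union_of_isOpen (h' c I J) (isOpen_chartDomIn c hU) (isOpen_chartDomIn c hU')

/-- Classical jets are local. -/
lemma JetBound.union (hm : m ≠ 0) {hU : IsOpen U} {hU' : IsOpen U'}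
    (hUi : U ⊆ (𝓡∂ n).interior M) (hUi' : U' ⊆ (𝓡∂ n).interior M) {k : ℕ}
    {u : TensorField n M r s} {b : ℕ → M → ℝ} (h : JetBound (classical g hU r) k u b)
    (h' : JetBound (classical g hU' r) k u b) :
    JetBound (classical g (hU.union hU') r) k u b := by
  have h0 : ∀ {s : ℕ} {u : TensorField n M r s} {b : ℕ → M → ℝ} {k : ℕ},
      JetBound (classical g hU r) k u b → JetBound (classical g hU' r) k u b →
      (classical g (hU.union hU') r).Reg u ∧ ∀ x ∈ U ∪ U', WeightedSobolev.tnorm g u x ≤ b 0 x :=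
    fun h h' => ⟨CompC.union hU hU' h.zero.1 h'.zero.1,
      fun x hx => hx.elim (h.zero.2 x) (h'.zero.2 x)⟩
  induction k generalizing s b with
  | zero => exact h0 h h'
  | succ k ih =>
    refine ⟨h0 h h', covDeriv g u, ?_⟩
    obtain ⟨-, v, ⟨h1, h2, h3⟩, hv⟩ := h
    obtain ⟨-, v', ⟨h1', h2', h3'⟩, hv'⟩ := h'
    refine ⟨isClassicalDeriv_covDeriv hm (hU.union hU') (CompC.union hU hU' h1 h1'),
      ih (hv.congr hUi fun c y hy I K => ?_) (hv'.congr hUi' fun c y hy I K => ?_)⟩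
    · rw [← Fin.cons_self_tail K, h3 c y hy, comp_covDeriv_of_compC hm one_ne_zero hU h1 hy]
    · rw [← Fin.cons_self_tail K, h3' c y hy, comp_covDeriv_of_compC hm one_ne_zero hU' h1' hy]

lemma ofFun_apply (f : M → ℝ) (x : M) (α : Fin 0 → TangentSpace (𝓡∂ n) x →L[ℝ] ℝ)
    (v : Fin 0 → TangentSpace (𝓡∂ n) x) : ofFun (n := n) f x α v = f x := by
  simp only [ofFun, ofComp]
  rw [Fintype.sum_subsingleton _ Fin.elim0, Fintype.sum_subsingleton _ Fin.elim0]
  simp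

lemma comp_ofFun (f : M → ℝ) (c : M) (I J : Fin 0 → Fin n) (y : EuclideanSpace ℝ (Fin n)) :
    comp (ofFun (n := n) f) c I J y = f ((extChartAt (𝓡∂ n) c).symm y) := ofFun_apply f _ _ _

lemma normSq_ofFun (f : M → ℝ) (x : M) : normSq g (ofFun f) x = f x ^ 2 := by
  have hx : (extChartAt (𝓡∂ n) x).symm (extChartAt (𝓡∂ n) x x) = x :=
    (extChartAt (𝓡∂ n) x).left_inv (mem_extChartAt_source x)
  simp only [normSq, comp_ofFun, hx]
  simp [sq]

lemma tnorm_ofFun (f : M → ℝ) (x : M) : tnorm g (ofFun f) x = |f x| := by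
  rw [tnorm, normSq_ofFun, Real.sqrt_sq_eq_abs]

/-- The distribution of slots in the product of a function and a tensor field. -/
def slotsZero (s : ℕ) : Fin s ≃ Fin 0 ⊕ Fin s := (Equiv.emptySum (Fin 0) (Fin s)).symm

lemma comp_prod_ofFun (f : M → ℝ) (u : TensorField n M r s) (c : M) (I : Fin r → Fin n)
    (J : Fin s → Fin n) (y : EuclideanSpace ℝ (Fin n)) :
    comp (prod (slotsZero s) (ofFun f) u) c I J y
      = f ((extChartAt (𝓡∂ n) c).symm y) * comp u c I J y := by
  rw [comp_prod, comp_ofFun]; rfl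

lemma prod_ofFun (f : M → ℝ) (u : TensorField n M r s) :
    prod (slotsZero s) (ofFun f) u = fun x => f x • u x := by
  funext x
  ext α v
  simp only [_root_.smul_apply]
  refine Eq.trans (?_ : _ = ofFun (n := n) f x (fun i => i.elim0) (fun i => i.elim0) * u x α v) ?_
  · refine congrArg (fun w => ofFun (n := n) f x (fun i => i.elim0) w * u x α v) ?_
    exact Subsingleton.elim _ _
  · rw [ofFun_apply, smul_eq_mul]

lemma compC_ofFun {p : ℕ} {f : M → ℝ} : CompC (n := n) p U (ofFun f) ↔
    ∀ c, ContDiffOn ℝ p (fun y => f ((extChartAt (𝓡∂ n) c).symm y)) (chartDomIn (n := n) c U) := by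
  refine ⟨fun h c => ?_, fun h c I J => ?_⟩
  · have := h c Fin.elim0 Fin.elim0
    rwa [funext (comp_ofFun f c _ _)] at this
  · rw [funext (comp_ofFun f c _ _)]; exact h c

lemma comp_covDeriv_ofFun (hm : m ≠ 0) (hU : IsOpen U) {f : M → ℝ} (hf : CompC (n := n) 1 U (ofFun f))
    {c : M} {y : EuclideanSpace ℝ (Fin n)} (hy : y ∈ chartDomIn c U) (I : Fin 0 → Fin n)
    (K : Fin 1 → Fin n) :
    comp (covDeriv g (ofFun f)) c I K y
      = partialDeriv (K 0) (fun y => f ((extChartAt (𝓡∂ n) c).symm y)) y := by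
  rw [← Fin.cons_self_tail K, comp_covDeriv_of_compC hm one_ne_zero hU hf hy,
    funext (comp_ofFun f c _ _)]
  simp [connTerm]

/-- The chain rule `∇(φ ∘ d) = (φ' ∘ d) ∇d`. -/
lemma isClassicalDeriv_comp (hm : m ≠ 0) (hU : IsOpen U) {d : M → ℝ}
    (hd : CompC (n := n) 1 U (ofFun d)) {φ φ' : ℝ → ℝ}
    (hφ : ∀ x ∈ U, HasDerivAt φ (φ' (d x)) (d x)) (hφ' : ∀ x ∈ U, ContinuousAt φ' (d x)) :
    IsClassicalDeriv g U (ofFun fun x => φ (d x))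
      (prod (slotsZero 1) (ofFun fun x => φ' (d x)) (covDeriv g (ofFun d))) := by
  have hdc := fun c => compC_ofFun.1 hd c
  have hdd : ∀ c, ∀ y ∈ chartDomIn (n := n) c U,
      DifferentiableAt ℝ (fun y => d ((extChartAt (𝓡∂ n) c).symm y)) y := fun c y hy =>
    ((hdc c).contDiffAt ((isOpen_chartDomIn c hU).mem_nhds hy)).differentiableAt (by simp)
  have hcont : ∀ c, ContinuousOn (fun y => φ' (d ((extChartAt (𝓡∂ n) c).symm y)))
      (chartDomIn (n := n) c U) := fun c y hy =>
    ((hφ' _ hy.2).comp (f := fun y => d ((extChartAt (𝓡∂ n) c).symm y))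
      (hdd c y hy).continuousAt).continuousWithinAt
  have hderiv : ∀ c, ∀ y ∈ chartDomIn (n := n) c U,
      HasFDerivAt (fun y => φ (d ((extChartAt (𝓡∂ n) c).symm y)))
        (φ' (d ((extChartAt (𝓡∂ n) c).symm y)) •
          fderiv ℝ (fun y => d ((extChartAt (𝓡∂ n) c).symm y)) y) y := fun c y hy =>
    (hφ _ hy.2).comp_hasFDerivAt (f := fun y => d ((extChartAt (𝓡∂ n) c).symm y)) y
      (hdd c y hy).hasFDerivAt
  refine ⟨compC_ofFun.2 fun c => ?_, CompC.prod _ (compC_ofFun.2 fun c => ?_)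
    (CompC.covDeriv (p := 0) (by omega) hU hd), fun c y hy I J l => ?_⟩
  · rw [show ((1 : ℕ) : WithTop ℕ∞) = 0 + 1 by simp,
      contDiffOn_succ_iff_fderiv_of_isOpen (isOpen_chartDomIn c hU)]
    refine ⟨fun y hy => (hderiv c y hy).differentiableAt.differentiableWithinAt,
      fun h => by simp at h, ?_⟩
    refine ContDiffOn.congr (f := fun y => φ' (d ((extChartAt (𝓡∂ n) c).symm y)) •
      fderiv ℝ (fun y => d ((extChartAt (𝓡∂ n) c).symm y)) y) ?_
      fun y hy => (hderiv c y hy).fderiv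
    exact (contDiffOn_zero.2 (hcont c)).smul
      ((hdc c).fderiv_of_isOpen (isOpen_chartDomIn c hU) (by simp))
  · simpa using hcont c
  · rw [comp_prod_ofFun, comp_covDeriv_ofFun hm hU hd hy, funext (comp_ofFun _ c I J)]
    have h1 : partialDeriv l (fun y => φ (d ((extChartAt (𝓡∂ n) c).symm y))) y
        = φ' (d ((extChartAt (𝓡∂ n) c).symm y))
          * partialDeriv l (fun y => d ((extChartAt (𝓡∂ n) c).symm y)) y := by
      rw [partialDeriv, (hderiv c y hy).fderiv]; rfl
    rw [h1]
    simp [connTerm]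

/-- A constant function has zero derivative. -/
lemma isClassicalDeriv_const (a : ℝ) :
    IsClassicalDeriv g U (ofFun fun _ => a) (fun _ => 0) := by
  refine ⟨compC_ofFun.2 fun c => contDiffOn_const, fun c I J => contDiffOn_const,
    fun c y _ I J l => ?_⟩
  rw [funext (comp_ofFun (fun _ => a) c I J), partialDeriv_const]
  simp only [connTerm, Finset.univ_eq_empty, Finset.sum_empty, sub_zero, add_zero]
  rfl

lemma tnorm_zero (x : M) : tnorm g (fun _ => 0 : TensorField n M r s) x = 0 := by
  have : ∀ I J y, comp (fun _ => 0 : TensorField n M r s) x I J y = 0 := fun _ _ _ => rfl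
  simp [tnorm, normSq, this]

lemma jetBound_zero {hU : IsOpen U} (k : ℕ) :
    JetBound (classical g hU r) k (fun _ => 0 : TensorField n M r s) fun _ _ => 0 := by
  have h0 : ∀ {s : ℕ}, (classical g hU r).Reg (fun _ => 0 : TensorField n M r s) ∧
      ∀ x ∈ U, tnorm g (fun _ => 0 : TensorField n M r s) x ≤ 0 :=
    ⟨fun c I J => contDiffOn_const, fun x _ => (tnorm_zero x).le⟩
  induction k generalizing s with
  | zero => exact h0
  | succ k ih =>
    refine ⟨h0, fun _ => 0, ⟨fun c I J => contDiffOn_const, fun c I J => contDiffOn_const,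
      fun c y _ I J l => ?_⟩, ih⟩
    have : comp (fun _ => 0 : TensorField n M r s) c = fun _ _ _ => 0 := rfl
    have h' : comp (fun _ => 0 : TensorField n M r (s + 1)) c = fun _ _ _ => 0 := rfl
    simp [connTerm, this, h', partialDeriv_const]

end Classical

/-! ### The derivatives of the profile -/

section Profile

variable {ρ : ℝ → ℝ} {r₁ r₀ : ℝ}

/-- The derivatives of `log √(ρ̃^N) = (N / 2) log ρ̃`. -/
def logDer (ρ : ℝ → ℝ) (N : ℝ) (i : ℕ) (t : ℝ) : ℝ :=
  N / 2 * iteratedDeriv i (fun t => Real.log (ρ t)) t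

lemma IsProfile.contDiffOn_iteratedDeriv_log (h : IsProfile ρ r₁ r₀) (i : ℕ) :
    ContDiffOn ℝ ∞ (iteratedDeriv i fun t => Real.log (ρ t)) (Ioi 0) := by
  induction i with
  | zero =>
    rw [iteratedDeriv_zero]
    exact h.smooth.log fun t ht => (h.pos t ht).ne'
  | succ i ih =>
    rw [iteratedDeriv_succ]
    exact ih.deriv_of_isOpen isOpen_Ioi (by simp)

lemma IsProfile.hasDerivAt_logDer (h : IsProfile ρ r₁ r₀) (N : ℝ) (i : ℕ) {t : ℝ} (ht : 0 < t) :
    HasDerivAt (logDer ρ N i) (logDer ρ N (i + 1) t) t := by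
  have hd := ((h.contDiffOn_iteratedDeriv_log i).contDiffAt
    (isOpen_Ioi.mem_nhds ht)).differentiableAt (by simp)
  have := hd.hasDerivAt.const_mul (N / 2)
  rwa [← iteratedDeriv_succ] at this

/-- The function `√(ρ̃^N)`. -/
def sqrtProfile (ρ : ℝ → ℝ) (N t : ℝ) : ℝ := √(ρ t ^ N)

lemma IsProfile.sqrtProfile_eq (h : IsProfile ρ r₁ r₀) (N : ℝ) {t : ℝ} (ht : 0 < t) :
    sqrtProfile ρ N t = Real.exp (logDer ρ N 0 t) := by
  rw [sqrtProfile, Real.sqrt_eq_rpow, ← Real.rpow_mul (h.pos t ht).le,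
    Real.rpow_def_of_pos (h.pos t ht), logDer, iteratedDeriv_zero]
  ring_nf

lemma IsProfile.hasDerivAt_sqrtProfile (h : IsProfile ρ r₁ r₀) (N : ℝ) {t : ℝ} (ht : 0 < t) :
    HasDerivAt (sqrtProfile ρ N) (sqrtProfile ρ N t * logDer ρ N 1 t) t := by
  have h1 := (h.hasDerivAt_logDer N 0 ht).exp
  rw [← h.sqrtProfile_eq N ht] at h1
  refine h1.congr_of_eventuallyEq ?_
  filter_upwards [isOpen_Ioi.mem_nhds ht] with w hw using h.sqrtProfile_eq N hw

lemma IsProfile.logDer_eq_zero (h : IsProfile ρ r₁ r₀) (hr : 0 < r₀) (N : ℝ) (i : ℕ) {t : ℝ}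
    (ht : r₀ ≤ t) : logDer ρ N i t = 0 := by
  have h0 : ∀ t, r₀ < t → logDer ρ N i t = 0 := fun t ht => by
    have : (fun t => Real.log (ρ t)) =ᶠ[𝓝 t] fun _ => 0 := by
      filter_upwards [isOpen_Ioi.mem_nhds ht] with w hw
      rw [h.eq_one w hw, Real.log_one]
    rw [logDer, this.iteratedDeriv_eq]
    simp
  rcases ht.eq_or_lt with rfl | ht
  · -- by continuity from the right
    have hc : Filter.Tendsto (logDer ρ N i) (𝓝[>] r₀) (𝓝 (logDer ρ N i r₀)) :=
      (h.hasDerivAt_logDer N i hr).continuousAt.tendsto.mono_left nhdsWithin_le_nhds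
    refine tendsto_nhds_unique hc (tendsto_const_nhds.congr' ?_)
    filter_upwards [self_mem_nhdsWithin] with w hw using (h0 w hw).symm
  · exact h0 t ht

lemma abs_iteratedDeriv_inv_le (i : ℕ) {t : ℝ} (ht : 0 < t) :
    |iteratedDeriv i (fun t : ℝ => -1 / t) t| ≤ i.factorial * (1 / t) ^ (1 + i) := by
  have h1 : (fun t : ℝ => -1 / t) = fun t => -(t⁻¹) := by funext t; ring
  rw [h1, show (fun t : ℝ => -(t⁻¹)) = -(Inv.inv : ℝ → ℝ) from rfl, iteratedDeriv_neg, abs_neg,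
    iteratedDeriv_eq_iterate, iter_deriv_inv, abs_mul, abs_mul, abs_pow, abs_neg, abs_one, one_pow, one_mul,
    Nat.abs_cast]
  refine le_of_eq ?_
  congr 1
  rw [abs_of_pos (zpow_pos ht _), one_div, ← zpow_natCast, inv_zpow']
  congr 1
  push_cast; ring

/-- The derivatives of the logarithm of the weight grow like powers of `1 / t`, and vanish outside
of the collar. -/
lemma IsProfile.abs_logDer_le (h : IsProfile ρ r₁ r₀) (hr₁ : 0 < r₁) (hr : r₁ < r₀) (N : ℝ)
    {k : ℕ} {L : ℝ} (hL : LogProfileCkBound ρ r₁ r₀ k L) {i : ℕ} (hi : i ≤ k) {t : ℝ}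
    (ht : 0 < t) :
    |logDer ρ N i t| ≤ |N| * (k.factorial + |L|) * (if t < r₀ then max 1 (1 / t) else 0)
      * max 1 (1 / t) ^ i := by
  split_ifs with htr
  · have hX : (1 : ℝ) ≤ max 1 (1 / t) := le_max_left _ _
    rw [mul_assoc, ← pow_succ', logDer, abs_mul, abs_div, mul_assoc]
    have h2 : |N| / |(2 : ℝ)| ≤ |N| := by
      rw [abs_two]; linarith [abs_nonneg N]
    refine mul_le_mul h2 ?_ (abs_nonneg _) (abs_nonneg _)
    rcases lt_or_ge t r₁ with h1 | h1
    · have he : (fun t => Real.log (ρ t)) =ᶠ[𝓝 t] fun t => -1 / t := by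
        filter_upwards [(isOpen_Ioo (a := 0) (b := r₁)).mem_nhds ⟨ht, h1⟩] with w hw
        rw [h.eq_exp w hw.1 hw.2, Real.log_exp]
      rw [he.iteratedDeriv_eq]
      calc _ ≤ i.factorial * (1 / t) ^ (1 + i) := abs_iteratedDeriv_inv_le i ht
        _ ≤ (k.factorial + |L|) * max 1 (1 / t) ^ (i + 1) := by
          rw [add_comm 1 i]
          have : (i.factorial : ℝ) ≤ k.factorial := by exact_mod_cast Nat.factorial_le hi
          gcongr
          · linarith [abs_nonneg L]
          · exact le_max_right _ _
    · calc _ ≤ L := hL t ⟨h1, htr.le⟩ i hi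
        _ ≤ (k.factorial + |L|) * 1 := by
          have : (0 : ℝ) ≤ k.factorial := Nat.cast_nonneg _
          linarith [le_abs_self L]
        _ ≤ _ := by
          have := one_le_pow₀ (n := i + 1) hX
          gcongr
  · rw [h.logDer_eq_zero (hr₁.trans hr) N i (not_lt.1 htr)]
    simp

end Profile

/-! ### The derivatives of the weight -/

section Conv

/-- If the derivatives of the first factor grow like powers of `ξ²`, then so does the effect of the
multiplication by it. -/
lemma conv_le {X : Type*} (j : ℕ) {b c : ℕ → X → ℝ} {x : X} {β ξ : ℝ} (hξ : 0 ≤ ξ)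
    (hβ : 0 ≤ β) (hb : ∀ i ≤ j, b i x ≤ β * ξ ^ (2 * i)) (hc : ∀ i ≤ j, 0 ≤ c i x) :
    conv j b c x ≤ 2 ^ j * β * ∑ i ∈ Finset.range (j + 1), ξ ^ (2 * (j - i)) * c i x := by
  induction j generalizing b c β with
  | zero => simpa [conv] using mul_le_mul_of_nonneg_right (by simpa using hb 0 le_rfl) (hc 0 le_rfl)
  | succ j ih =>
    set S := ∑ i ∈ Finset.range (j + 1 + 1), ξ ^ (2 * (j + 1 - i)) * c i x with hS
    have h1 : conv j (fun i => b (i + 1)) c x ≤ 2 ^ j * β * S := by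
      refine (ih (β := β * ξ ^ 2) (by positivity) (fun i hi => ?_)
        fun i hi => hc i (by omega)).trans ?_
      · refine (hb (i + 1) (by omega)).trans_eq ?_
        ring
      · have : ξ ^ 2 * ∑ i ∈ Finset.range (j + 1), ξ ^ (2 * (j - i)) * c i x ≤ S := by
          rw [hS, Finset.sum_range_succ _ (j + 1), Finset.mul_sum]
          have h0 : 0 ≤ ξ ^ (2 * (j + 1 - (j + 1))) * c (j + 1) x :=
            mul_nonneg (by positivity) (hc _ le_rfl)
          refine (Finset.sum_le_sum fun i hi => le_of_eq ?_).trans (le_add_of_nonneg_right h0)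
          rw [← mul_assoc, ← pow_add]
          congr 2
          have := Finset.mem_range.1 hi
          omega
        calc _ = 2 ^ j * β * (ξ ^ 2 * ∑ i ∈ Finset.range (j + 1), ξ ^ (2 * (j - i)) * c i x) := by
              ring
          _ ≤ _ := mul_le_mul_of_nonneg_left this (by positivity)
    have h2 : conv j b (fun i => c (i + 1)) x ≤ 2 ^ j * β * S := by
      refine (ih hβ (fun i hi => hb i (by omega)) fun i hi => hc (i + 1) (by omega)).trans ?_
      refine mul_le_mul_of_nonneg_left ?_ (by positivity)
      rw [hS, Finset.sum_range_succ' _ (j + 1)]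
      have h0 : 0 ≤ ξ ^ (2 * (j + 1 - 0)) * c 0 x :=
        mul_nonneg (by positivity) (hc _ (Nat.zero_le _))
      refine (Finset.sum_le_sum fun i hi => le_of_eq ?_).trans (le_add_of_nonneg_right h0)
      congr 2
      omega
    calc conv (j + 1) b c x ≤ 2 ^ j * β * S + 2 ^ j * β * S := add_le_add h1 h2
      _ = _ := by ring

lemma conv_le_pow {X : Type*} {k j : ℕ} (hj : j ≤ k) {b c : ℕ → X → ℝ} {x : X} {β γ ξ : ℝ}
    (hξ : 0 ≤ ξ) (hβ : 0 ≤ β) (hb : ∀ i ≤ j, b i x ≤ β * ξ ^ (2 * i)) (hc : ∀ i ≤ j, 0 ≤ c i x)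
    (hc' : β ≠ 0 → ∀ i ≤ j, c i x ≤ γ * ξ ^ (2 * i)) (hγ : 0 ≤ γ) :
    conv j b c x ≤ 2 ^ k * (k + 1) * β * γ * ξ ^ (2 * j) := by
  refine (conv_le j hξ hβ hb hc).trans ?_
  rcases eq_or_ne β 0 with h0 | h0
  · simp [h0]
  have h1 : ∑ i ∈ Finset.range (j + 1), ξ ^ (2 * (j - i)) * c i x
      ≤ (j + 1) * (γ * ξ ^ (2 * j)) := by
    have := Finset.sum_le_card_nsmul (Finset.range (j + 1))
      (fun i => ξ ^ (2 * (j - i)) * c i x) (γ * ξ ^ (2 * j)) fun i hi => by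
        have hi' : i ≤ j := by have := Finset.mem_range.1 hi; omega
        calc ξ ^ (2 * (j - i)) * c i x ≤ ξ ^ (2 * (j - i)) * (γ * ξ ^ (2 * i)) := by
              gcongr; exact hc' h0 i hi'
          _ = γ * (ξ ^ (2 * (j - i)) * ξ ^ (2 * i)) := by ring
          _ = γ * ξ ^ (2 * j) := by rw [← pow_add]; congr 2; omega
    simpa using this
  have h2 : (2 : ℝ) ^ j ≤ 2 ^ k := pow_le_pow_right₀ (by norm_num) hj
  have h3 : (j : ℝ) ≤ k := by exact_mod_cast hj
  calc _ ≤ 2 ^ j * β * ((j + 1) * (γ * ξ ^ (2 * j))) := by gcongr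
    _ ≤ 2 ^ k * β * ((k + 1) * (γ * ξ ^ (2 * j))) := by gcongr
    _ = _ := by ring

end Conv

section WeightJets

variable {n : ℕ} [NeZero n] {m : ℕ} {M : Type*} [TopologicalSpace M]
  [ChartedSpace (EuclideanHalfSpace n) M] [IsManifold (𝓡∂ n) ∞ M] {r s q t : ℕ}
  {g : Metric n m M} {U : Set M}

/-- The constants in the bounds for the derivatives of a function of the distance, as produced by
the chain and product rules. Here `A` bounds the function and `D` the derivatives of the distance.
-/
def chainConst (A D : ℝ) : ℕ → ℝ
  | 0 => A
  | k + 1 => A + 2 ^ k * (k + 1) * chainConst A D k * D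

lemma chainConst_nonneg {A D : ℝ} (hA : 0 ≤ A) (hD : 0 ≤ D) (k : ℕ) : 0 ≤ chainConst A D k := by
  induction k with
  | zero => exact hA
  | succ k ih => rw [chainConst]; positivity

lemma le_chainConst {A D : ℝ} (hA : 0 ≤ A) (hD : 0 ≤ D) (k : ℕ) : A ≤ chainConst A D k := by
  cases k with
  | zero => exact le_rfl
  | succ k =>
    have := chainConst_nonneg hA hD k
    rw [chainConst]; exact le_add_of_nonneg_right (by positivity)

/-- Bounds for the derivatives of functions `φ_i ∘ d`, where `φ_{i+1} = φ_i'`, from bounds for the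
`φ_i` and for the derivatives of `d`. The latter are needed only where the `φ_i ∘ d` do not
vanish. -/
lemma jetBound_comp (hm : m ≠ 0) {hU : IsOpen U} {d X Y : M → ℝ}
    (hd : CompC (n := n) 1 U (ofFun d)) {φ : ℕ → ℝ → ℝ}
    (hφ : ∀ i, ∀ x ∈ U, HasDerivAt (φ i) (φ (i + 1) (d x)) (d x)) {A D : ℝ} (hA : 0 ≤ A)
    (hD : 0 ≤ D) (hX : ∀ x ∈ U, 1 ≤ X x) (hY : ∀ x ∈ U, 0 ≤ Y x) {κ : ℕ}
    (hb : ∀ i ≤ κ, ∀ x ∈ U, |φ i (d x)| ≤ A * Y x * X x ^ i) {c : ℕ → M → ℝ} (k i : ℕ)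
    (hi : i + k ≤ κ) (hc : 1 ≤ k → JetBound (classical g hU 0) (k - 1) (covDeriv g (ofFun d)) c)
    (hcn : ∀ j, ∀ x ∈ U, 0 ≤ c j x) (hcD : ∀ j < k, ∀ x ∈ U, Y x ≠ 0 → c j x ≤ D) :
    JetBound (classical g hU 0) k (ofFun fun x => φ i (d x))
      fun j x => chainConst A D k * Y x * X x ^ (i + 2 * j) := by
  have hder : ∀ i, IsClassicalDeriv g U (ofFun fun x => φ i (d x))
      (prod (slotsZero 1) (ofFun fun x => φ (i + 1) (d x)) (covDeriv g (ofFun d))) := fun i =>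
    isClassicalDeriv_comp hm hU hd (hφ i) fun x hx => (hφ (i + 1) x hx).continuousAt
  have h0 : ∀ k, ∀ i ≤ κ, (classical g hU 0).Reg (ofFun fun x => φ i (d x)) ∧
      ∀ x ∈ U, tnorm g (ofFun fun x => φ i (d x)) x
        ≤ chainConst A D k * Y x * X x ^ (i + 2 * 0) := by
    intro k i hi
    refine ⟨(hder i).1.of_le zero_le_one, fun x hx => ?_⟩
    rw [tnorm_ofFun]
    refine (hb i hi x hx).trans ?_
    have := hX x hx
    have := hY x hx
    have := le_chainConst hA hD k
    simp only [mul_zero, add_zero]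
    gcongr
  induction k generalizing i with
  | zero => exact h0 0 i (by omega)
  | succ k ih =>
    refine ⟨h0 (k + 1) i (by omega), _, hder i, ?_⟩
    have hc' : JetBound (classical g hU 0) k (covDeriv g (ofFun d)) c := hc (by omega)
    have ih' := ih (i + 1) (by omega) (fun h => hc'.of_le (by omega))
      (fun j hj => hcD j (by omega))
    refine (ih'.prod (slotsZero 1) hc').mono fun j hj x hx => ?_
    have hX' := hX x hx
    have hY' := hY x hx
    have hB := chainConst_nonneg hA hD k
    -- one power of `X` comes from the derivative of `φ_i`, the second one is given away
    have := conv_le_pow (k := k) (b := fun j x => chainConst A D k * Y x * X x ^ (i + 1 + 2 * j))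
      (c := c) (x := x) (β := chainConst A D k * Y x * X x ^ (i + 1)) (γ := D) (ξ := X x) hj
      (by linarith) (by positivity) (fun l _ => le_of_eq (by ring)) (fun l _ => hcn l x hx)
      (fun hne l hl => ?_) hD
    · refine this.trans ?_
      calc _ = (2 ^ k * (k + 1) * chainConst A D k * D) * Y x * X x ^ (i + 1 + 2 * j) := by ring
        _ ≤ chainConst A D (k + 1) * Y x * X x ^ (i + 2 * (j + 1)) := by
          have h1 : X x ^ (i + 1 + 2 * j) ≤ X x ^ (i + 2 * (j + 1)) :=
            pow_le_pow_right₀ hX' (by omega)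
          rw [chainConst]
          refine mul_le_mul (mul_le_mul_of_nonneg_right (by linarith) hY') h1 (by positivity)
            (by positivity)
    · have hY0 : Y x ≠ 0 := by
        rintro h; exact hne (by rw [h]; ring)
      exact (hcD l (by omega) x hx hY0).trans (le_mul_of_one_le_right hD (one_le_pow₀ hX'))

/-- The constants in the bounds for the derivatives of a function `f` with `∇f = f K`, where `E`
bounds the derivatives of `K`. -/
def weightConst (E : ℝ) : ℕ → ℝ
  | 0 => 1
  | k + 1 => 1 + 2 ^ k * (k + 1) * weightConst E k * E

lemma one_le_weightConst {E : ℝ} (hE : 0 ≤ E) (k : ℕ) : 1 ≤ weightConst E k := by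
  induction k with
  | zero => exact le_rfl
  | succ k ih =>
    have : 0 ≤ weightConst E k := by linarith
    rw [weightConst]; exact le_add_of_nonneg_right (by positivity)

/-- If `∇f = f K`, then bounds for the derivatives of `K` give bounds for those of `f`. -/
lemma jetBound_of_deriv_eq_mul {hU : IsOpen U} {f X : M → ℝ} {K : TensorField n M 0 1} {E : ℝ}
    (hE : 0 ≤ E) (hf : IsClassicalDeriv g U (ofFun f) (prod (slotsZero 1) (ofFun f) K))
    (hf0 : ∀ x ∈ U, 0 ≤ f x) (hX : ∀ x ∈ U, 1 ≤ X x) (k : ℕ)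
    (hK : 1 ≤ k → JetBound (classical g hU 0) (k - 1) K fun j x => E * X x ^ 2 * X x ^ (2 * j)) :
    JetBound (classical g hU 0) k (ofFun f)
      fun j x => weightConst E k * f x * X x ^ (2 * j) := by
  have h0 : ∀ k, (classical g hU 0).Reg (ofFun f) ∧
      ∀ x ∈ U, tnorm g (ofFun f) x ≤ weightConst E k * f x * X x ^ (2 * 0) := by
    refine fun k => ⟨hf.1.of_le zero_le_one, fun x hx => ?_⟩
    rw [tnorm_ofFun, abs_of_nonneg (hf0 x hx), mul_zero, pow_zero, mul_one]
    exact le_mul_of_one_le_left (hf0 x hx) (one_le_weightConst hE k)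
  induction k with
  | zero => exact h0 0
  | succ k ih =>
    refine ⟨h0 (k + 1), _, hf, ?_⟩
    have hK' : JetBound (classical g hU 0) k K fun j x => E * X x ^ 2 * X x ^ (2 * j) :=
      hK (by omega)
    refine ((ih fun h => hK'.of_le (by omega)).prod (slotsZero 1) hK').mono fun j hj x hx => ?_
    have hX' := hX x hx
    have hf' := hf0 x hx
    have hw := one_le_weightConst hE k
    have := conv_le_pow (k := k) (b := fun j x => weightConst E k * f x * X x ^ (2 * j))
      (c := fun j x => E * X x ^ 2 * X x ^ (2 * j)) (x := x) (β := weightConst E k * f x)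
      (γ := E * X x ^ 2) (ξ := X x) hj (by linarith) (by positivity) (fun l _ => le_rfl)
      (fun l _ => by positivity) (fun _ l _ => le_rfl) (by positivity)
    refine this.trans ?_
    calc _ = (2 ^ k * (k + 1) * weightConst E k * E) * f x * X x ^ (2 * (j + 1)) := by ring
      _ ≤ weightConst E (k + 1) * f x * X x ^ (2 * (j + 1)) := by
        rw [weightConst]
        have : (0 : ℝ) ≤ X x := by linarith
        gcongr
        linarith

end WeightJets

/-! ### The distance to the boundary -/

section Continuity

variable {n : ℕ} [NeZero n] {m : ℕ} {M : Type*} [TopologicalSpace M]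
  [ChartedSpace (EuclideanHalfSpace n) M] [IsManifold (𝓡∂ n) ∞ M] {r s : ℕ}
  {g : Metric n m M} {U : Set M}

lemma continuousOn_gram (g : Metric n m M) (c : M) (i j : Fin n) :
    ContinuousOn (fun y => gram g c y i j) (chartDom c) := (contDiffOn_gram g c i j).continuousOn

lemma continuousOn_gram_inv (g : Metric n m M) (c : M) (i j : Fin n) :
    ContinuousOn (fun y => (gram g c y)⁻¹ i j) (chartDom c) :=
  (contDiffOn_gram_inv g c i j).continuousOn

lemma continuousOn_metricSlots (g : Metric n m M) (c : M) (a : Fin r ⊕ Fin s) (i j : Fin n) :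
    ContinuousOn (fun y => metricSlots g r s c ((extChartAt (𝓡∂ n) c).symm y) a i j)
      (chartDom c) := by
  cases a with
  | inl a => exact continuousOn_gram g c i j
  | inr b => exact continuousOn_gram_inv g c i j

lemma normSq_eq_sum_comp (g : Metric n m M) (u : TensorField n M r s) {c : M}
    {y : EuclideanSpace ℝ (Fin n)} (hy : y ∈ chartDom c) :
    normSq g u ((extChartAt (𝓡∂ n) c).symm y) = ∑ K : Fin r ⊕ Fin s → Fin n,
      ∑ L : Fin r ⊕ Fin s → Fin n,
        (∏ a, metricSlots g r s c ((extChartAt (𝓡∂ n) c).symm y) a (K a) (L a))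
          * comp u c (K ∘ Sum.inl) (K ∘ Sum.inr) y * comp u c (L ∘ Sum.inl) (L ∘ Sum.inr) y := by
  rw [normSq_eq_slotForm g (symm_mem_source hy), slotForm_eq_sum]
  simp only [comp_eq_arr, Sum.elim_comp_inl_inr]

lemma CompC.continuousOn_normSq {u : TensorField n M r s} (hu : CompC 0 U u) (c : M) :
    ContinuousOn (fun y => normSq g u ((extChartAt (𝓡∂ n) c).symm y)) (chartDomIn c U) := by
  refine ContinuousOn.congr ?_ fun y hy => normSq_eq_sum_comp g u hy.1
  exact continuousOn_finsetSum _ fun K _ => continuousOn_finsetSum _ fun L _ =>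
    ((continuousOn_finsetProd _ fun a _ =>
      (continuousOn_metricSlots g c a _ _).mono (chartDomIn_subset c U)).mul
      (hu c _ _).continuousOn).mul (hu c _ _).continuousOn

lemma CompC.continuousAt_normSq (hU : IsOpen U) {u : TensorField n M r s} (hu : CompC 0 U u)
    {x : M} (hx : x ∈ U) (hxi : x ∈ (𝓡∂ n).interior M) : ContinuousAt (normSq g u) x := by
  have hxs := mem_extChartAt_source (I := 𝓡∂ n) x
  have hinv : (extChartAt (𝓡∂ n) x).symm (extChartAt (𝓡∂ n) x x) = x :=
    (extChartAt (𝓡∂ n) x).left_inv hxs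
  have hy : extChartAt (𝓡∂ n) x x ∈ chartDomIn x U :=
    ⟨extChartAt_self_mem_chartDom hxi, by rwa [mem_preimage, hinv]⟩
  have h := ((hu.continuousOn_normSq (g := g) x).continuousAt
    ((isOpen_chartDomIn x hU).mem_nhds hy)).comp (f := extChartAt (𝓡∂ n) x)
      (continuousAt_extChartAt x)
  refine h.congr ?_
  filter_upwards [extChartAt_source_mem_nhds (I := 𝓡∂ n) x] with z hz
  simp only [Function.comp_apply]
  rw [(extChartAt (𝓡∂ n) x).left_inv hz]

end Continuity

section Distance

variable {n : ℕ} [NeZero n] {m : ℕ} {M : Type*} [TopologicalSpace M]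
  [ChartedSpace (EuclideanHalfSpace n) M] [IsManifold (𝓡∂ n) ∞ M] {g : Metric n m M}

/-- The distance between two points. -/
def gdist (g : Metric n m M) (x y : M) : ℝ≥0∞ :=
  letI : RiemannianBundle (fun x : M => TangentSpace (𝓡∂ n) x) := ⟨g.toRiemannianMetric⟩
  riemannianEDist (𝓡∂ n) x y

/-- The distance to the boundary, before it is known to be finite. -/
def bdist (g : Metric n m M) (x : M) : ℝ≥0∞ := ⨅ y ∈ (𝓡∂ n).boundary M, gdist g x y

lemma boundaryDist_eq (g : Metric n m M) (x : M) : boundaryDist g x = (bdist g x).toReal := rfl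

lemma gdist_self (x : M) : gdist g x x = 0 := by
  let : RiemannianBundle (fun x : M => TangentSpace (𝓡∂ n) x) := ⟨g.toRiemannianMetric⟩
  exact riemannianEDist_self

lemma gdist_comm (x y : M) : gdist g x y = gdist g y x := by
  let : RiemannianBundle (fun x : M => TangentSpace (𝓡∂ n) x) := ⟨g.toRiemannianMetric⟩
  exact riemannianEDist_comm

lemma gdist_triangle (x y z : M) : gdist g x z ≤ gdist g x y + gdist g y z := by
  let : RiemannianBundle (fun x : M => TangentSpace (𝓡∂ n) x) := ⟨g.toRiemannianMetric⟩
  have : IsManifold (𝓡∂ n) 1 M := IsManifold.of_le (n := (∞ : WithTop ℕ∞)) (by exact_mod_cast le_top)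
  exact riemannianEDist_triangle

lemma eventually_gdist_lt (x : M) {c : ℝ≥0∞} (hc : 0 < c) : ∀ᶠ y in 𝓝 x, gdist g x y < c := by
  let : RiemannianBundle (fun x : M => TangentSpace (𝓡∂ n) x) := ⟨g.toRiemannianMetric⟩
  have : IsContinuousRiemannianBundle (EuclideanSpace ℝ (Fin n))
      (fun x : M => TangentSpace (𝓡∂ n) x) := ⟨g.inner, g.contMDiff.continuous, fun _ _ _ => rfl⟩
  have : IsManifold (𝓡∂ n) 1 M := IsManifold.of_le (n := (∞ : WithTop ℕ∞)) (by exact_mod_cast le_top)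
  exact eventually_riemannianEDist_lt (𝓡∂ n) x hc

lemma exists_gdist_lt_subset [RegularSpace M] {x : M} {s : Set M} (hs : s ∈ 𝓝 x) :
    ∃ c > 0, {y | gdist g x y < c} ⊆ s := by
  let : RiemannianBundle (fun x : M => TangentSpace (𝓡∂ n) x) := ⟨g.toRiemannianMetric⟩
  have : IsContinuousRiemannianBundle (EuclideanSpace ℝ (Fin n))
      (fun x : M => TangentSpace (𝓡∂ n) x) := ⟨g.inner, g.contMDiff.continuous, fun _ _ _ => rfl⟩
  have : IsManifold (𝓡∂ n) 1 M := IsManifold.of_le (n := (∞ : WithTop ℕ∞)) (by exact_mod_cast le_top)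
  exact setOfPred_riemannianEDist_lt_subset_nhds' (𝓡∂ n) hs

lemma bdist_le_add (x y : M) : bdist g x ≤ gdist g x y + bdist g y := by
  rw [bdist, bdist, ENNReal.add_iInf₂]
  · exact le_iInf₂ fun z hz => (iInf₂_le z hz).trans (gdist_triangle x y z)

lemma bdist_eq_zero {x : M} (hx : x ∈ (𝓡∂ n).boundary M) : bdist g x = 0 :=
  le_antisymm ((iInf₂_le x hx).trans_eq (gdist_self x)) bot_le

/-- On a connected manifold with boundary, the distance to the boundary is finite. -/
lemma bdist_lt_top [ConnectedSpace M] (hb : ((𝓡∂ n).boundary M).Nonempty) (x : M) :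
    bdist g x < ⊤ := by
  have h1 : ∀ x y : M, gdist g x y < 1 → bdist g y < ⊤ → bdist g x < ⊤ := fun x y h h' =>
    (bdist_le_add x y).trans_lt (ENNReal.add_lt_top.2 ⟨h.trans ENNReal.one_lt_top, h'⟩)
  have hclopen : IsClopen {x : M | bdist g x < ⊤} := by
    refine ⟨⟨?_⟩, ?_⟩
    · rw [isOpen_iff_mem_nhds]
      intro x hx
      filter_upwards [eventually_gdist_lt (g := g) x one_pos] with y hy hy'
      exact hx (h1 x y hy hy')
    · rw [isOpen_iff_mem_nhds]
      intro x hx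
      filter_upwards [eventually_gdist_lt (g := g) x one_pos] with y hy
      exact h1 y x (by rwa [gdist_comm]) hx
  obtain ⟨z, hz⟩ := hb
  have hx : x ∈ {x : M | bdist g x < ⊤} := by
    rw [hclopen.eq_univ ⟨z, by simp [bdist_eq_zero hz]⟩]
    exact mem_univ x
  exact hx

lemma ofReal_boundaryDist [ConnectedSpace M] (hb : ((𝓡∂ n).boundary M).Nonempty) (x : M) :
    ENNReal.ofReal (boundaryDist g x) = bdist g x :=
  ENNReal.ofReal_toReal (bdist_lt_top hb x).ne

lemma boundaryDist_nonneg (x : M) : 0 ≤ boundaryDist g x := ENNReal.toReal_nonneg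

lemma boundaryDist_eq_zero {x : M} (hx : x ∈ (𝓡∂ n).boundary M) : boundaryDist g x = 0 := by
  rw [boundaryDist_eq, bdist_eq_zero hx, ENNReal.toReal_zero]

lemma continuous_boundaryDist [ConnectedSpace M] (hb : ((𝓡∂ n).boundary M).Nonempty) :
    Continuous (boundaryDist g) := by
  rw [continuous_iff_continuousAt]
  intro x
  have hlt : ∀ x y : M, ∀ ε > 0, gdist g x y < ENNReal.ofReal ε →
      boundaryDist g x < boundaryDist g y + ε := fun x y ε hε h => by
    have h1 : bdist g x < ENNReal.ofReal (boundaryDist g y + ε) := by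
      rw [ENNReal.ofReal_add (boundaryDist_nonneg y) hε.le, ofReal_boundaryDist hb, add_comm]
      exact (bdist_le_add x y).trans_lt (ENNReal.add_lt_add_right (bdist_lt_top hb y).ne h)
    rw [← ofReal_boundaryDist hb] at h1
    exact (ENNReal.ofReal_lt_ofReal_iff (by have := boundaryDist_nonneg (g := g) y; linarith)).1 h1
  rw [Metric.continuousAt_iff']
  intro ε hε
  filter_upwards [eventually_gdist_lt (g := g) x (ENNReal.ofReal_pos.2 hε)] with y hy
  rw [Real.dist_eq, abs_lt]
  have h1 := hlt x y ε hε hy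
  have h2 := hlt y x ε hε (by rwa [gdist_comm])
  constructor <;> linarith

lemma boundaryDist_pos [RegularSpace M] [ConnectedSpace M] (hb : ((𝓡∂ n).boundary M).Nonempty)
    {x : M} (hx : x ∈ (𝓡∂ n).interior M) : 0 < boundaryDist g x := by
  obtain ⟨c, hc, hsub⟩ := exists_gdist_lt_subset (g := g) (isOpen_interior_manifold.mem_nhds hx)
  have h : c ≤ bdist g x := le_iInf₂ fun y hy => by
    by_contra h
    have : y ∈ (𝓡∂ n).interior M := hsub (not_le.1 h)
    rw [← ModelWithCorners.compl_interior] at hy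
    exact hy this
  exact ENNReal.toReal_pos (hc.trans_le h).ne' (bdist_lt_top hb x).ne

lemma mem_interior_of_boundaryDist_pos {x : M} (hx : 0 < boundaryDist g x) :
    x ∈ (𝓡∂ n).interior M := by
  by_contra h
  have : x ∈ (𝓡∂ n).boundary M := by rwa [← ModelWithCorners.compl_interior]
  rw [boundaryDist_eq_zero this] at hx
  exact lt_irrefl _ hx

end Distance

/-! ### The gradient of the distance to the boundary -/

section Eikonal

/-- The Cauchy–Schwarz inequality for a covector and a vector. -/
lemma sq_dotProduct_le {ι : Type*} [Fintype ι] [DecidableEq ι] {G : Matrix ι ι ℝ} (hG : G.PosDef)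
    (v A : ι → ℝ) : (v ⬝ᵥ A) ^ 2 ≤ (v ⬝ᵥ G.mulVec v) * (A ⬝ᵥ G⁻¹.mulVec A) := by
  have hs : G.transpose = G := by
    have := hG.isHermitian
    rwa [Matrix.IsHermitian, Matrix.conjTranspose_eq_transpose_of_trivial] at this
  have hGA : G.mulVec (G⁻¹.mulVec A) = A := by
    rw [Matrix.mulVec_mulVec, Matrix.mul_nonsing_inv _ hG.det_pos.ne'.isUnit, Matrix.one_mulVec]
  have h1 : G⁻¹.mulVec A ⬝ᵥ G.mulVec v = v ⬝ᵥ A := by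
    rw [Matrix.dotProduct_mulVec, ← Matrix.mulVec_transpose, hs, hGA, dotProduct_comm]
  have key : ∀ t : ℝ, 0 ≤ (A ⬝ᵥ G⁻¹.mulVec A) * (t * t) + (-2 * (v ⬝ᵥ A)) * t
      + v ⬝ᵥ G.mulVec v := fun t => by
    have := hG.posSemidef.dotProduct_mulVec_nonneg (v - t • G⁻¹.mulVec A)
    simp only [star_trivial, Matrix.mulVec_sub, Matrix.mulVec_smul, hGA, sub_dotProduct,
      dotProduct_sub, smul_dotProduct, dotProduct_smul, h1, smul_eq_mul,
      dotProduct_comm (G⁻¹.mulVec A) A] at this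
    linarith
  have := discrim_le_zero key
  rw [discrim] at this
  linarith

variable {n : ℕ} [NeZero n] {m : ℕ} {M : Type*} [TopologicalSpace M]
  [ChartedSpace (EuclideanHalfSpace n) M] [IsManifold (𝓡∂ n) ∞ M] {g : Metric n m M} {U : Set M}

lemma coordVec_self (z : M) (i : Fin n) :
    coordVec z z i = (EuclideanSpace.single i (1 : ℝ) : EuclideanSpace ℝ (Fin n)) :=
  tangentCoordChange_self (E := EuclideanSpace ℝ (Fin n)) (mem_extChartAt_source z)

/-- The differential of a function is bounded by the norm of its gradient. -/
lemma sq_mfderiv_le (hm : m ≠ 0) (hU : IsOpen U) {d : M → ℝ} (hd : CompC (n := n) 1 U (ofFun d))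
    {z : M} (hz : z ∈ U) (hzi : z ∈ (𝓡∂ n).interior M) (hdz : MDifferentiableAt (𝓡∂ n) 𝓘(ℝ, ℝ) d z)
    (v : TangentSpace (𝓡∂ n) z) {a : ℝ} (ha : a = mfderiv (𝓡∂ n) 𝓘(ℝ, ℝ) d z v) :
    a ^ 2 ≤ normSq g (covDeriv g (ofFun d)) z * g.inner z v v := by
  have hzs := mem_extChartAt_source (I := 𝓡∂ n) z
  have hinv : (extChartAt (𝓡∂ n) z).symm (extChartAt (𝓡∂ n) z z) = z :=
    (extChartAt (𝓡∂ n) z).left_inv hzs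
  set y := extChartAt (𝓡∂ n) z z with hy
  have hyd : y ∈ chartDom z := extChartAt_self_mem_chartDom hzi
  set F : EuclideanSpace ℝ (Fin n) → ℝ := fun y => d ((extChartAt (𝓡∂ n) z).symm y) with hF
  set v' : EuclideanSpace ℝ (Fin n) := v with hv'
  have hv : v' = ∑ i, v' i • (EuclideanSpace.single i (1 : ℝ) : EuclideanSpace ℝ (Fin n)) := by
    ext j; simp [Finset.sum_apply, Pi.single_apply]
  have h1 : a = fderiv ℝ F y v' := by
    rw [ha, hdz.mfderiv]
    have hr : range (𝓡∂ n) ∈ 𝓝 y := Filter.mem_of_superset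
      ((isOpen_chartDom z).mem_nhds hyd) ((chartDom_subset z).trans (extChartAt_target_subset_range z))
    rw [fderivWithin_of_mem_nhds hr]
    rfl
  set A : Fin n → ℝ := fun i => partialDeriv i F y with hA
  have h2 : fderiv ℝ F y v' = (fun i => v' i) ⬝ᵥ A := by
    conv_lhs => rw [hv]
    simp only [map_sum, map_smul, smul_eq_mul]
    rfl
  have hg : gram g z y = gramAt g z z := by rw [gram_eq_gramAt, hinv]
  have h3 : g.inner z v v = (fun i => v' i) ⬝ᵥ (gram g z y).mulVec fun i => v' i := by
    have hv2 : v = ∑ i, v' i • coordVec z z i := by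
      simp only [coordVec_self]; exact hv
    conv_lhs => rw [hv2]
    simp only [map_sum, map_smul, _root_.sum_apply, _root_.smul_apply, dotProduct, Matrix.mulVec,
      hg, gramAt, Matrix.of_apply, smul_eq_mul, Finset.mul_sum]
    rw [Finset.sum_comm]
    refine Finset.sum_congr rfl fun p _ => Finset.sum_congr rfl fun q _ => by ring
  have h4 : normSq g (covDeriv g (ofFun d)) z = A ⬝ᵥ (gram g z y)⁻¹.mulVec A := by
    have hyU : y ∈ chartDomIn z U := ⟨hyd, by rwa [mem_preimage, hinv]⟩
    rw [normSq]
    rw [Fintype.sum_subsingleton _ Fin.elim0, Fintype.sum_subsingleton _ Fin.elim0]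
    simp only [← hy, comp_covDeriv_ofFun hm hU hd hyU]
    rw [← (Equiv.funUnique (Fin 1) (Fin n)).symm.sum_comp]
    simp only [dotProduct, Matrix.mulVec, Finset.mul_sum]
    refine Finset.sum_congr rfl fun i _ => ?_
    rw [← (Equiv.funUnique (Fin 1) (Fin n)).symm.sum_comp]
    refine Finset.sum_congr rfl fun j _ => ?_
    simp [hA, hF]
    ring
  rw [h1, h2, h3, h4, mul_comm]
  refine sq_dotProduct_le ?_ _ _
  rw [hg]
  exact posDef_gramAt g hzs

end Eikonal

section Eikonal

variable {n : ℕ} [NeZero n] {m : ℕ} {M : Type*} [TopologicalSpace M]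
  [ChartedSpace (EuclideanHalfSpace n) M] [IsManifold (𝓡∂ n) ∞ M] {g : Metric n m M} {U : Set M}

lemma compC_of_contMDiffOn {p : ℕ} {d : M → ℝ}
    (hd : ContMDiffOn (𝓡∂ n) 𝓘(ℝ, ℝ) (p : WithTop ℕ∞) d U) : CompC (n := n) p U (ofFun d) := by
  refine compC_ofFun.2 fun c => ?_
  rw [← contMDiffOn_iff_contDiffOn]
  exact hd.comp (((contMDiffOn_extChartAt_symm (n := (∞ : WithTop ℕ∞)) c).of_le
    (by exact_mod_cast le_top)).mono ((chartDomIn_subset c U).trans (chartDom_subset c)))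
    fun y hy => hy.2

/-- Along a curve, a function whose gradient has norm at most `q` varies by at most `q` times the
length of the curve. -/
lemma enorm_sub_le_mul_pathELength (hm : m ≠ 0) (hU : IsOpen U) (hUi : U ⊆ (𝓡∂ n).interior M)
    {d : M → ℝ} (hd : ContMDiffOn (𝓡∂ n) 𝓘(ℝ, ℝ) 1 d U) {q : ℝ} (hq : 0 ≤ q) {γ : ℝ → M}
    (hγ : ContMDiff 𝓘(ℝ, ℝ) (𝓡∂ n) 1 γ) {t₀ : ℝ} (ht₀ : 0 ≤ t₀) (hγU : ∀ t ∈ Icc 0 t₀, γ t ∈ U)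
    (hb : ∀ t ∈ Icc 0 t₀, normSq g (covDeriv g (ofFun d)) (γ t) ≤ q ^ 2) :
    letI : RiemannianBundle (fun x : M => TangentSpace (𝓡∂ n) x) := ⟨g.toRiemannianMetric⟩
    ‖d (γ t₀) - d (γ 0)‖ₑ ≤ ENNReal.ofReal q * pathELength (𝓡∂ n) γ 0 t₀ := by
  let : RiemannianBundle (fun x : M => TangentSpace (𝓡∂ n) x) := ⟨g.toRiemannianMetric⟩
  have hc : ContDiffOn ℝ 1 (d ∘ γ) (Icc 0 t₀) := by
    rw [← contMDiffOn_iff_contDiffOn]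
    exact hd.comp hγ.contMDiffOn hγU
  have hcomp : CompC (n := n) 1 U (ofFun d) := compC_of_contMDiffOn (by exact_mod_cast hd)
  refine (enorm_sub_le_lintegral_derivWithin_Icc_of_contDiffOn_Icc hc ht₀).trans ?_
  rw [pathELength_eq_lintegral_mfderiv_Ioo, ← restrict_Ioo_eq_restrict_Icc,
    ← lintegral_const_mul' _ _ ENNReal.ofReal_ne_top]
  refine setLIntegral_mono' measurableSet_Ioo fun t ht => ?_
  have ht' : t ∈ Icc 0 t₀ := Ioo_subset_Icc_self ht
  have hdz : MDifferentiableAt (𝓡∂ n) 𝓘(ℝ, ℝ) d (γ t) :=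
    ((hd (γ t) (hγU t ht')).contMDiffAt (hU.mem_nhds (hγU t ht'))).mdifferentiableAt (by simp)
  have hγt : MDifferentiableAt 𝓘(ℝ, ℝ) (𝓡∂ n) γ t := hγ.mdifferentiableAt (by simp)
  set v : TangentSpace (𝓡∂ n) (γ t) := mfderiv 𝓘(ℝ, ℝ) (𝓡∂ n) γ t (1 : ℝ) with hv
  have h1 : derivWithin (d ∘ γ) (Icc 0 t₀) t = mfderiv (𝓡∂ n) 𝓘(ℝ, ℝ) d (γ t) v := by
    rw [derivWithin_of_mem_nhds (Icc_mem_nhds ht.1 ht.2), ← fderiv_apply_one_eq_deriv,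
      ← mfderiv_eq_fderiv, mfderiv_comp t hdz hγt]
    rfl
  have h2 := sq_mfderiv_le (g := g) hm hU hcomp (hγU t ht') (hUi (hγU t ht')) hdz v h1
  have h3 : g.inner (γ t) v v = ‖v‖ ^ 2 := by
    rw [← real_inner_self_eq_norm_sq]; rfl
  have h4 : |derivWithin (d ∘ γ) (Icc 0 t₀) t| ≤ q * ‖v‖ := by
    refine abs_le_of_sq_le_sq (h2.trans ?_) (mul_nonneg hq (norm_nonneg v))
    rw [h3, mul_pow]
    exact mul_le_mul_of_nonneg_right (hb t ht') (sq_nonneg _)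
  rw [← ofReal_norm, ← ofReal_norm, ← ENNReal.ofReal_mul hq]
  exact ENNReal.ofReal_le_ofReal h4

/-- Where the distance to the boundary is of class `C^1`, its gradient has norm at least one:
otherwise an almost shortest path to the boundary would be too long, since the distance would
decrease too slowly along its initial part. -/
lemma one_le_tnorm_grad [RegularSpace M] [ConnectedSpace M] (hm : m ≠ 0)
    (hbd : ((𝓡∂ n).boundary M).Nonempty) (hU : IsOpen U) (hUi : U ⊆ (𝓡∂ n).interior M)
    (hd : ContMDiffOn (𝓡∂ n) 𝓘(ℝ, ℝ) 1 (boundaryDist g) U) {x : M} (hx : x ∈ U) :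
    1 ≤ tnorm g (covDeriv g (ofFun (boundaryDist g))) x := by
  let : RiemannianBundle (fun x : M => TangentSpace (𝓡∂ n) x) := ⟨g.toRiemannianMetric⟩
  have : IsManifold (𝓡∂ n) 1 M :=
    IsManifold.of_le (n := (∞ : WithTop ℕ∞)) (by exact_mod_cast le_top)
  by_contra! hlt
  obtain ⟨q, hq, hq1⟩ := exists_between hlt
  have hq0 : 0 < q := (tnorm_nonneg _ _ _).trans_lt hq
  have hcomp : CompC (n := n) 1 U (ofFun (boundaryDist g)) :=
    compC_of_contMDiffOn (by exact_mod_cast hd)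
  have hcont : ContinuousAt (normSq g (covDeriv g (ofFun (boundaryDist g)))) x :=
    (CompC.covDeriv (p := 0) (by omega) hU hcomp).continuousAt_normSq hU hx (hUi hx)
  have hsq : normSq g (covDeriv g (ofFun (boundaryDist g))) x < q ^ 2 := by
    rw [← tnorm_sq]
    have := tnorm_nonneg g (covDeriv g (ofFun (boundaryDist g))) x
    gcongr
  have hW' : {z | z ∈ U ∧ normSq g (covDeriv g (ofFun (boundaryDist g))) z < q ^ 2} ∈ 𝓝 x :=
    Filter.inter_mem (hU.mem_nhds hx) (hcont.eventually_lt_const hsq)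
  obtain ⟨T, hT, hTc, hTW⟩ := exists_mem_nhds_isClosed_subset hW'
  obtain ⟨c, hc, hcW⟩ := exists_gdist_lt_subset (g := g) (interior_mem_nhds.2 hT)
  set η := min c 1
  have hη : 0 < η := lt_min hc one_pos
  have hηt : η ≠ ⊤ := ((min_le_right c 1).trans_lt ENNReal.one_lt_top).ne
  have he : 0 < η.toReal := ENNReal.toReal_pos hη.ne' hηt
  have hfin := (bdist_lt_top (g := g) hbd x).ne
  have hlt : bdist g x < bdist g x + ENNReal.ofReal ((1 - q) * η.toReal) :=
    ENNReal.lt_add_right hfin (ENNReal.ofReal_pos.2 (mul_pos (by linarith) he)).ne'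
  obtain ⟨y, hy'⟩ := iInf_lt_iff.1 hlt
  obtain ⟨hy, hxy⟩ := iInf_lt_iff.1 hy'
  obtain ⟨γ, hγ0, hγ1, hγ, hlen, -, -⟩ :=
    exists_lt_locally_constant_of_riemannianEDist_lt (I := 𝓡∂ n) hxy zero_lt_one
  have hWi : interior T ⊆ U := interior_subset.trans fun z hz => (hTW hz).1
  -- the first exit time from the neighbourhood of `x` in which the gradient is small
  have hcpt : IsCompact {t ∈ Icc (0 : ℝ) 1 | γ t ∉ interior T} :=
    isCompact_Icc.inter_right ((isOpen_interior.isClosed_compl).preimage hγ.continuous)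
  have hy1 : y ∉ interior T := fun h => by
    rw [← ModelWithCorners.compl_interior] at hy
    exact hy (hUi (hWi h))
  obtain ⟨t₀, ⟨ht₀, htT⟩, hmin⟩ := hcpt.exists_isLeast ⟨1, ⟨by simp, by rwa [hγ1]⟩⟩
  have hpos : 0 < t₀ := by
    refine ht₀.1.lt_of_ne ?_
    rintro rfl
    rw [hγ0] at htT
    exact htT (mem_interior_iff_mem_nhds.2 hT)
  have hin : ∀ t ∈ Ico 0 t₀, γ t ∈ interior T := fun t ht => by
    by_contra h
    exact absurd (hmin ⟨⟨ht.1, ht.2.le.trans ht₀.2⟩, h⟩) (not_le.2 ht.2)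
  have hin' : ∀ t ∈ Icc 0 t₀, γ t ∈ T := by
    rw [← closure_Ico hpos.ne]
    intro t ht
    have h := image_closure_subset_closure_image hγ.continuous (mem_image_of_mem γ ht)
    refine closure_minimal ?_ hTc h
    rintro _ ⟨t, ht, rfl⟩
    exact interior_subset (hin t ht)
  have hvar := enorm_sub_le_mul_pathELength (g := g) hm hU hUi hd hq0.le hγ hpos.le
    (fun t ht => (hTW (hin' t ht)).1) (fun t ht => (hTW (hin' t ht)).2.le)
  set L₁ := pathELength (𝓡∂ n) γ 0 t₀
  set L₂ := pathELength (𝓡∂ n) γ t₀ 1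
  have hsum : L₁ + L₂ = pathELength (𝓡∂ n) γ 0 1 := pathELength_add hpos.le ht₀.2
  rw [← hsum] at hlen
  have hL := hlen.trans (ENNReal.add_lt_top.2 ⟨hfin.lt_top, ENNReal.ofReal_lt_top⟩)
  have hL₁ : L₁ ≠ ⊤ := (ENNReal.add_lt_top.1 hL).1.ne
  have hL₂ : L₂ ≠ ⊤ := (ENNReal.add_lt_top.1 hL).2.ne
  have h1 : η ≤ L₁ := by
    refine (min_le_left c 1).trans (le_trans ?_ (riemannianEDist_le_pathELength
      (x := x) (y := γ t₀) hγ.contMDiffOn hγ0 rfl hpos.le))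
    by_contra h
    exact htT (hcW (not_le.1 h))
  have h2 : bdist g (γ t₀) ≤ L₂ := (iInf₂_le y hy).trans
    (riemannianEDist_le_pathELength (x := γ t₀) (y := y) hγ.contMDiffOn rfl hγ1 ht₀.2)
  -- pass to real numbers
  have e1 : η.toReal ≤ L₁.toReal := (ENNReal.toReal_le_toReal hηt hL₁).2 h1
  have e2 : boundaryDist g (γ t₀) ≤ L₂.toReal := ENNReal.toReal_mono hL₂ h2
  have e3 : L₁.toReal + L₂.toReal < boundaryDist g x + (1 - q) * η.toReal := by
    have := (ENNReal.toReal_lt_toReal hL.ne (ENNReal.add_ne_top.2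
      ⟨hfin, ENNReal.ofReal_ne_top⟩)).2 hlen
    rwa [ENNReal.toReal_add hL₁ hL₂, ENNReal.toReal_add hfin ENNReal.ofReal_ne_top,
      ENNReal.toReal_ofReal (mul_nonneg (by linarith) he.le)] at this
  have e4 : |boundaryDist g (γ t₀) - boundaryDist g x| ≤ q * L₁.toReal := by
    rw [hγ0] at hvar
    have := ENNReal.toReal_mono (ENNReal.mul_ne_top ENNReal.ofReal_ne_top hL₁) hvar
    rwa [ENNReal.toReal_mul, ENNReal.toReal_ofReal hq0.le, toReal_enorm, Real.norm_eq_abs] at this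
  have e5 := (abs_le.1 e4).1
  nlinarith

end Eikonal

/-! ### Multiplication by the square root of the weight -/

section SqrtWeight

variable {n : ℕ} [NeZero n] {m : ℕ} {M : Type*} [TopologicalSpace M]
  [ChartedSpace (EuclideanHalfSpace n) M] [IsManifold (𝓡∂ n) ∞ M] {r s : ℕ}
  {g : Metric n m M} {U : Set M}

lemma CompC.iterCovDeriv (hU : IsOpen U) {u : TensorField n M r s} (hu : CompC m U u) {j : ℕ}
    (hj : j ≤ m) : CompC (m - j) U (iterCovDeriv g u j) := by
  induction j with
  | zero => exact hu
  | succ j ih =>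
    have h := ih (by omega)
    rw [show m - j = m - (j + 1) + 1 by omega] at h
    exact CompC.covDeriv (by omega) hU h

lemma jetBound_iterCovDeriv {hU : IsOpen U} {u : TensorField n M r s} (hu : CompC m U u)
    (l i : ℕ) (hl : i + l ≤ m) :
    JetBound (classical g hU r) l (iterCovDeriv g u i)
      fun j => tnorm g (iterCovDeriv g u (i + j)) := by
  induction l generalizing i with
  | zero => exact ⟨(hu.iterCovDeriv hU (by omega)).of_le (by omega), fun x _ => le_rfl⟩
  | succ l ih =>
    refine ⟨⟨(hu.iterCovDeriv hU (by omega)).of_le (by omega), fun x _ => le_rfl⟩,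
      iterCovDeriv g u (i + 1), isClassicalDeriv_covDeriv (by omega) hU
        ((hu.iterCovDeriv hU (by omega)).of_le (by omega)), ?_⟩
    refine (ih (i + 1) (by omega)).mono fun j _ x _ => le_of_eq ?_
    rw [show i + 1 + j = i + (j + 1) by omega]

/-- The factor `max 1 (1 / d)`, in powers of which the loss under differentiation of the weight is
measured: each derivative costs its square. -/
def blowup (g : Metric n m M) (x : M) : ℝ := max 1 (1 / boundaryDist g x)

lemma one_le_blowup (x : M) : 1 ≤ blowup g x := le_max_left _ _

/-- The constant in the bounds for the derivatives of the square root of the weight. The argument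
of `weightConst` bounds the derivatives of order at most `k - 1` of `∇ log ρ^{1/2} = (log
ρ̃^{N/2})' ∇d`, and `k!` those of `1 / t` up to the power of `1 / t`. -/
def jetConst (k : ℕ) (N L D : ℝ) : ℝ :=
  weightConst (2 ^ (k - 1) * ((k - 1 : ℕ) + 1)
    * chainConst (|N| * (k.factorial + |L|)) |D| (k - 1) * |D|) k

lemma jetConst_arg_nonneg (k : ℕ) (N L D : ℝ) :
    0 ≤ 2 ^ (k - 1) * (((k - 1 : ℕ) : ℝ) + 1)
      * chainConst (|N| * (k.factorial + |L|)) |D| (k - 1) * |D| :=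
  mul_nonneg (mul_nonneg (by positivity) (chainConst_nonneg (by positivity) (abs_nonneg D) _))
    (abs_nonneg D)

lemma one_le_jetConst (k : ℕ) (N L D : ℝ) : 1 ≤ jetConst k N L D :=
  one_le_weightConst (jetConst_arg_nonneg k N L D) k

variable {ρ : ℝ → ℝ} {r₁ r₀ : ℝ}

lemma IsProfile.weight_pos (h : IsProfile ρ r₁ r₀) (N : ℝ) {x : M} (hx : 0 < boundaryDist g x) :
    0 < weight g ρ N x := Real.rpow_pos_of_pos (h.pos _ hx) N

/-- Inside the collar, the derivatives of the square root of the weight up to order `k`: its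
gradient is the product of itself with `∇ log ρ^{1/2}`. -/
lemma jetBound_sqrt_weight_collar (hm : m ≠ 0) (h : IsProfile ρ r₁ r₀) (hr₁ : 0 < r₁)
    (hr : r₁ < r₀) {k : ℕ} (hk : k ≤ m) {N L D : ℝ} (hL : LogProfileCkBound ρ r₁ r₀ k L)
    (hD : DistCkBound g r₀ k D) {hU : IsOpen U} (hUi : U ⊆ (𝓡∂ n).interior M)
    (hpos : ∀ x ∈ U, 0 < boundaryDist g x)
    (hd : CompC (n := n) m U (ofFun (boundaryDist g))) :
    JetBound (classical g hU 0) k (ofFun fun x => √(weight g ρ N x))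
      fun j x => jetConst k N L D * √(weight g ρ N x) * blowup g x ^ (2 * j) := by
  set d := boundaryDist g
  have hd1 : CompC (n := n) 1 U (ofFun d) := hd.of_le (by omega)
  set K := prod (slotsZero 1) (ofFun fun x => logDer ρ N 1 (d x)) (covDeriv g (ofFun d))
  have hf : IsClassicalDeriv g U (ofFun fun x => √(weight g ρ N x))
      (prod (slotsZero 1) (ofFun fun x => √(weight g ρ N x)) K) := by
    have h1 := isClassicalDeriv_comp (g := g) hm hU hd1 (φ := sqrtProfile ρ N)
      (φ' := fun t => sqrtProfile ρ N t * logDer ρ N 1 t)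
      (fun x hx => h.hasDerivAt_sqrtProfile N (hpos x hx))
      (fun x hx => (h.hasDerivAt_sqrtProfile N (hpos x hx)).continuousAt.mul
        (h.hasDerivAt_logDer N 1 (hpos x hx)).continuousAt)
    have h2 : prod (slotsZero 1) (ofFun fun x => √(weight g ρ N x)) K = prod (slotsZero 1)
        (ofFun fun x => sqrtProfile ρ N (d x) * logDer ρ N 1 (d x)) (covDeriv g (ofFun d)) := by
      rw [prod_ofFun, prod_ofFun]
      funext x
      rw [← smul_smul]
      exact congrArg _ (congrFun (prod_ofFun (fun x => logDer ρ N 1 (d x))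
        (covDeriv g (ofFun d))) x)
    rw [h2]
    exact h1
  refine jetBound_of_deriv_eq_mul (jetConst_arg_nonneg k N L D) hf
    (fun x _ => Real.sqrt_nonneg _) (fun x _ => one_le_blowup x) k fun hk1 => ?_
  -- beyond `r₀` the bound for `d` is not available, but there the weight is constant
  set Y : M → ℝ := fun x => if d x < r₀ then blowup g x else 0
  set c : ℕ → M → ℝ := fun j => tnorm g (iterCovDeriv g (ofFun d) (1 + j))
  have hY0 : ∀ x, 0 ≤ Y x := fun x => by
    by_cases hx : d x < r₀
    · simp only [Y, if_pos hx]; linarith [one_le_blowup (g := g) x]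
    · simp only [Y, if_neg hx, le_refl]
  have hYX : ∀ x, Y x ≤ blowup g x := fun x => by
    by_cases hx : d x < r₀
    · simp only [Y, if_pos hx, le_refl]
    · simp only [Y, if_neg hx]; linarith [one_le_blowup (g := g) x]
  have hcn : ∀ j, ∀ x ∈ U, 0 ≤ c j x := fun j x _ => tnorm_nonneg _ _ _
  have hcD : ∀ j < k, ∀ x ∈ U, Y x ≠ 0 → c j x ≤ |D| := fun j hj x hx hY => by
    refine le_trans ?_ (le_abs_self D)
    exact hD x (hUi hx) (by_contra fun hc => hY (if_neg hc)) (1 + j) (by omega)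
  have hc : JetBound (classical g hU 0) (k - 1) (covDeriv g (ofFun d)) c :=
    jetBound_iterCovDeriv (g := g) hd (k - 1) 1 (by omega)
  have hlog := jetBound_comp (g := g) hm (hU := hU) (X := blowup g) (Y := Y) hd1
    (φ := logDer ρ N) (fun i x hx => h.hasDerivAt_logDer N i (hpos x hx))
    (A := |N| * (k.factorial + |L|)) (D := |D|) (by positivity) (abs_nonneg D)
    (fun x _ => one_le_blowup x) (fun x _ => hY0 x) (κ := k)
    (fun i hi x hx => h.abs_logDer_le hr₁ hr N hL hi (hpos x hx)) (c := c) (k - 1) 1 (by omega)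
    (fun h' => hc.of_le (by omega)) hcn (fun j hj => hcD j (by omega))
  refine (hlog.prod (slotsZero 1) hc).mono fun j hj x hx => ?_
  have hX := one_le_blowup (g := g) x
  have hB := chainConst_nonneg (A := |N| * (k.factorial + |L|)) (by positivity) (abs_nonneg D)
    (k - 1)
  refine (conv_le_pow (k := k - 1) (β := chainConst (|N| * (k.factorial + |L|)) |D| (k - 1) * Y x
    * blowup g x) (γ := |D|) (ξ := blowup g x) hj (by linarith)
    (mul_nonneg (mul_nonneg hB (hY0 x)) (by linarith)) (fun l _ => le_of_eq (by ring))
    (fun l _ => hcn l x hx) (fun hne l hl => ?_) (abs_nonneg D)).trans ?_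
  · refine (hcD l (by omega) x hx fun h0 => hne (by rw [h0]; ring)).trans
      (le_mul_of_one_le_right (abs_nonneg D) (one_le_pow₀ hX))
  · have h2 : Y x * blowup g x ≤ blowup g x ^ 2 := by
      rw [sq]; exact mul_le_mul_of_nonneg_right (hYX x) (by linarith)
    calc _ = 2 ^ (k - 1) * (((k - 1 : ℕ) : ℝ) + 1)
          * chainConst (|N| * (k.factorial + |L|)) |D| (k - 1) * |D| * (Y x * blowup g x)
          * blowup g x ^ (2 * j) := by ring
      _ ≤ _ := mul_le_mul_of_nonneg_right (mul_le_mul_of_nonneg_left h2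
          (jetConst_arg_nonneg k N L D)) (by positivity)

lemma jetBound_of_eq {U V : Set M} {hU : IsOpen U} {hV : IsOpen V} (e : U = V) {k : ℕ}
    {u : TensorField n M r s} {b : ℕ → M → ℝ} (h : JetBound (classical g hU r) k u b) :
    JetBound (classical g hV r) k u b := by
  subst e; exact h

/-- The derivatives of the square root of the weight up to order `k`, on the whole interior. -/
lemma jetBound_sqrt_weight [RegularSpace M] [ConnectedSpace M]
    (hbd : ((𝓡∂ n).boundary M).Nonempty) (hm : m ≠ 0) (h : IsProfile ρ r₁ r₀) (hr₁ : 0 < r₁)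
    (hr : r₁ < r₀) {k : ℕ} (hk : k ≤ m) {N L D : ℝ} (hreg : HasRegularCollar g r₀)
    (hL : LogProfileCkBound ρ r₁ r₀ k L) (hD : DistCkBound g r₀ k D) :
    JetBound (classical g (isOpen_interior_manifold (n := n) (M := M)) 0) k
      (ofFun fun x => √(weight g ρ N x))
      fun j x => jetConst k N L D * √(weight g ρ N x) * blowup g x ^ (2 * j) := by
  obtain ⟨r', hr', hd⟩ := hreg
  have hcont := continuous_boundaryDist (g := g) hbd
  have hint := isOpen_interior_manifold (n := n) (M := M)
  have hU : IsOpen ((𝓡∂ n).interior M ∩ {x | boundaryDist g x < r'}) :=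
    hint.inter (isOpen_lt hcont continuous_const)
  have hV : IsOpen ((𝓡∂ n).interior M ∩ {x | r₀ < boundaryDist g x}) :=
    hint.inter (isOpen_lt continuous_const hcont)
  have h1 := jetBound_sqrt_weight_collar (N := N) hm h hr₁ hr hk hL hD (hU := hU)
    inter_subset_left (fun x hx => boundaryDist_pos hbd hx.1)
    (fun c I J => (compC_of_contMDiffOn hd c I J).mono fun y hy => ⟨hy.1, hy.2.2⟩)
  -- beyond the collar the weight is constant
  have h2 : JetBound (classical g hV 0) k (ofFun fun x => √(weight g ρ N x))
      fun j x => jetConst k N L D * √(weight g ρ N x) * blowup g x ^ (2 * j) := by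
    have hone : ∀ x ∈ (𝓡∂ n).interior M ∩ {x | r₀ < boundaryDist g x},
        √(weight g ρ N x) = 1 := fun x hx => by
      rw [weight, h.eq_one _ hx.2, Real.one_rpow, Real.sqrt_one]
    have hJ := one_le_jetConst k N L D
    have hconst : JetBound (classical g hV 0) k (ofFun fun _ => (1 : ℝ))
        fun j _ => if j = 0 then 1 else 0 := by
      have h0 : (classical g hV 0).Reg (ofFun fun _ => (1 : ℝ)) ∧
          ∀ x ∈ (𝓡∂ n).interior M ∩ {x | r₀ < boundaryDist g x},
            tnorm g (ofFun fun _ => (1 : ℝ)) x ≤ 1 :=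
        ⟨(isClassicalDeriv_const (g := g) 1).1.of_le zero_le_one,
          fun x _ => by rw [tnorm_ofFun, abs_one]⟩
      cases k with
      | zero => exact h0
      | succ k =>
        exact ⟨h0, _, isClassicalDeriv_const 1, (jetBound_zero k).mono fun j _ x _ => by simp⟩
    refine JetBound.congr inter_subset_left (fun c y hy I J => ?_) (hconst.mono fun j _ x hx => ?_)
    · rw [comp_ofFun, comp_ofFun, hone _ hy.2]
    · rw [hone x hx]
      have hX := one_le_pow₀ (n := 2 * j) (one_le_blowup (g := g) x)
      have : (if j = 0 then (1 : ℝ) else 0) ≤ 1 := by split_ifs <;> norm_num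
      nlinarith
  refine jetBound_of_eq ?_ (h1.union hm inter_subset_left inter_subset_left h2)
  rw [← inter_union_distrib_left]
  refine inter_eq_left.2 fun x _ => ?_
  rcases lt_or_ge (boundaryDist g x) r' with hx | hx
  · exact Or.inl hx
  · exact Or.inr (hr'.trans_le hx)

/-- The weak derivatives of `ρ^{1/2} u` in terms of those of `u`. The `i`-th derivative of `u`
occurs in the `j`-th one of the product with the loss `d^{-4(j-i)}` in the square of its norm. -/
lemma exists_isWeakJet_mulSqrtWeight [RegularSpace M] [ConnectedSpace M]
    (hbd : ((𝓡∂ n).boundary M).Nonempty) (hm : m ≠ 0) (h : IsProfile ρ r₁ r₀) (hr₁ : 0 < r₁)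
    (hr : r₁ < r₀) {k : ℕ} (hk : k ≤ m) {N L D : ℝ} (hreg : HasRegularCollar g r₀)
    (hL : LogProfileCkBound ρ r₁ r₀ k L) (hD : DistCkBound g r₀ k D) {u : TensorField n M r s}
    {w : ∀ j : ℕ, TensorField n M r (s + j)} (hw : IsWeakJet g k u w) :
    ∃ w' : ∀ j : ℕ, TensorField n M r (s + j),
      IsWeakJet g k (mulSqrtWeight g ρ N u) w' ∧ ∀ j ≤ k, ∀ x ∈ (𝓡∂ n).interior M,
        normSq g (w' j) x ≤ (2 ^ k * jetConst k N L D) ^ 2 * (k + 1) *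
          ∑ i ∈ Finset.range (j + 1),
            weight g ρ N x * blowup g x ^ (4 * (j - i)) * normSq g (w i) x := by
  have hf := jetBound_sqrt_weight (N := N) hbd hm h hr₁ hr hk hreg hL hD
  have hu := (hw.jetBound (hm := hm) k 0 (by omega)).mono (b' := fun j => tnorm g (w j))
    fun j _ x _ => by rw [zero_add]
  rw [hw.1] at hu
  have hprod := hf.prod (slotsZero s) hu
  rw [prod_ofFun] at hprod
  obtain ⟨w', hw', hb⟩ := hprod.exists_isWeakJet
  refine ⟨w', hw', fun j hj x hx => ?_⟩
  have hX := one_le_blowup (g := g) x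
  have hJ := one_le_jetConst k N L D
  have hσ : 0 ≤ weight g ρ N x := (h.weight_pos N (boundaryDist_pos hbd hx)).le
  have h1 := (hb j hj x hx).trans (conv_le (ξ := blowup g x)
    (β := jetConst k N L D * √(weight g ρ N x)) j (by linarith) (by positivity)
    (fun i _ => le_rfl) (fun i _ => tnorm_nonneg _ _ _))
  rw [← tnorm_sq]
  calc tnorm g (w' j) x ^ 2
      ≤ (2 ^ j * (jetConst k N L D * √(weight g ρ N x)) * ∑ i ∈ Finset.range (j + 1),
          blowup g x ^ (2 * (j - i)) * tnorm g (w i) x) ^ 2 :=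
        pow_le_pow_left₀ (tnorm_nonneg _ _ _) h1 2
    _ = (2 ^ j * jetConst k N L D) ^ 2 * weight g ρ N x * (∑ i ∈ Finset.range (j + 1),
          blowup g x ^ (2 * (j - i)) * tnorm g (w i) x) ^ 2 := by
        rw [mul_pow, mul_pow, mul_pow, Real.sq_sqrt hσ]
        ring
    _ ≤ (2 ^ k * jetConst k N L D) ^ 2 * weight g ρ N x * ((k + 1) * ∑ i ∈ Finset.range (j + 1),
          (blowup g x ^ (2 * (j - i)) * tnorm g (w i) x) ^ 2) := by
        have hcs := sq_sum_le_card_mul_sum_sq (s := Finset.range (j + 1))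
          (f := fun i => blowup g x ^ (2 * (j - i)) * tnorm g (w i) x)
        rw [Finset.card_range] at hcs
        have hjk : ((j + 1 : ℕ) : ℝ) ≤ k + 1 := by exact_mod_cast Nat.succ_le_succ hj
        have hs : 0 ≤ ∑ i ∈ Finset.range (j + 1),
          (blowup g x ^ (2 * (j - i)) * tnorm g (w i) x) ^ 2 :=
          Finset.sum_nonneg fun _ _ => sq_nonneg _
        have hp : (2 : ℝ) ^ j ≤ 2 ^ k := pow_le_pow_right₀ one_le_two hj
        refine mul_le_mul ?_ (hcs.trans (mul_le_mul_of_nonneg_right hjk hs)) (sq_nonneg _)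
          (by positivity)
        gcongr
    _ = _ := by
        rw [Finset.mul_sum, Finset.mul_sum, Finset.mul_sum]
        refine Finset.sum_congr rfl fun i _ => ?_
        rw [mul_pow (blowup g x ^ (2 * (j - i))), tnorm_sq, ← pow_mul, show 2 * (j - i) * 2 = 4 * (j - i) by omega]
        ring

end SqrtWeight

/-! ### The volume measure in charts -/

section Volume

variable {n : ℕ} [NeZero n] {m : ℕ} {M : Type*} [TopologicalSpace M]
  [ChartedSpace (EuclideanHalfSpace n) M] [IsManifold (𝓡∂ n) ∞ M] {r s : ℕ}
  {g : Metric n m M} {U : Set M}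

/-- The interior points in the source of the chart at `c`. -/
def chartSrc (c : M) : Set M := (extChartAt (𝓡∂ n) c).source ∩ (𝓡∂ n).interior M

lemma isOpen_chartSrc (c : M) : IsOpen (chartSrc (n := n) c) :=
  (isOpen_extChartAt_source c).inter isOpen_interior_manifold

lemma extChartAt_mem_chartDom {c x : M} (hx : x ∈ chartSrc (n := n) c) :
    extChartAt (𝓡∂ n) c x ∈ chartDom c := (mem_chartDom_iff hx.1).2 hx.2

lemma symm_mem_chartSrc {c : M} {y : EuclideanSpace ℝ (Fin n)} (hy : y ∈ chartDom c) :
    (extChartAt (𝓡∂ n) c).symm y ∈ chartSrc (n := n) c :=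
  ⟨symm_mem_source hy, symm_mem_interior hy⟩

lemma mem_chartSrc_self {x : M} (hx : x ∈ (𝓡∂ n).interior M) : x ∈ chartSrc (n := n) x :=
  ⟨mem_extChartAt_source x, hx⟩

lemma isOpenEmbedding_symm (c : M) :
    Topology.IsOpenEmbedding fun y : chartDom (n := n) c => (extChartAt (𝓡∂ n) c).symm y := by
  refine .of_continuous_injective_isOpenMap
    ((continuousOn_extChartAt_symm c).mono (chartDom_subset c)).domRestrict (fun y y' h => ?_)
    fun V hV => ?_
  · have := congrArg (extChartAt (𝓡∂ n) c) h
    exact Subtype.ext (by simpa only [extChartAt_right_inv y.2, extChartAt_right_inv y'.2] using this)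
  · have hV' : IsOpen ((↑) '' V : Set (EuclideanSpace ℝ (Fin n))) :=
      (isOpen_chartDom c).isOpenMap_subtype_val V hV
    have h := isOpen_extChartAt_preimage' (I := 𝓡∂ n) c hV'
    convert h using 1
    ext x
    constructor
    · rintro ⟨y, hy, rfl⟩
      exact ⟨symm_mem_source y.2, y, hy, (extChartAt_right_inv y.2).symm⟩
    · rintro ⟨hx, y, hy, e⟩
      exact ⟨y, hy, by simp only [e, (extChartAt (𝓡∂ n) c).left_inv hx]⟩

/-- The density of the volume measure in the chart at `c`. -/
def volDens (g : Metric n m M) (c : M) (y : EuclideanSpace ℝ (Fin n)) : ℝ := √(gram g c y).det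

lemma det_gram_pos (g : Metric n m M) {c : M} {y : EuclideanSpace ℝ (Fin n)}
    (hy : y ∈ chartDom c) : 0 < (gram g c y).det :=
  (posDef_gramAt g (symm_mem_source hy)).det_pos

lemma volDens_pos (g : Metric n m M) {c : M} {y : EuclideanSpace ℝ (Fin n)}
    (hy : y ∈ chartDom c) : 0 < volDens g c y := Real.sqrt_pos.2 (det_gram_pos g hy)

lemma contDiffOn_volDens (g : Metric n m M) (c : M) :
    ContDiffOn ℝ m (volDens g c) (chartDom c) :=
  (contDiffOn_det fun i j => contDiffOn_gram g c i j).sqrt fun _ hy => (det_gram_pos g hy).ne'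

lemma measurableSet_target (c : M) : MeasurableSet (extChartAt (𝓡∂ n) c).target := by
  rw [extChartAt_target]
  exact (((𝓡∂ n).continuous_symm.isOpen_preimage _
    (chartAt (EuclideanHalfSpace n) c).open_target).measurableSet).inter
      (𝓡∂ n).isClosed_range.measurableSet

/-- The density transforms with the Jacobian determinant. -/
lemma volDens_transition (g : Metric n m M) {c c' : M} {y : EuclideanSpace ℝ (Fin n)}
    (hy : y ∈ chartDom c)
    (hy' : (extChartAt (𝓡∂ n) c).symm y ∈ (extChartAt (𝓡∂ n) c').source) :
    volDens g c y = |(tangentCoordChange (𝓡∂ n) c c' ((extChartAt (𝓡∂ n) c).symm y)).det|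
      * volDens g c' (extChartAt (𝓡∂ n) c' ((extChartAt (𝓡∂ n) c).symm y)) := by
  have h1 : (tangentCoordChange (𝓡∂ n) c c' ((extChartAt (𝓡∂ n) c).symm y)).det
      = (jac (n := n) c c' ((extChartAt (𝓡∂ n) c).symm y)).det := by
    rw [ContinuousLinearMap.det, ← LinearMap.det_toMatrix
      (EuclideanSpace.basisFun (Fin n) ℝ).toBasis]
    congr 1
  rw [h1, volDens, volDens, gram_eq_gramAt, gram_eq_gramAt, (extChartAt (𝓡∂ n) c').left_inv hy',
    gramAt_eq g (symm_mem_source hy) hy', Matrix.det_mul, Matrix.det_mul, Matrix.det_transpose,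
    show ∀ a b : ℝ, a * b * a = a ^ 2 * b by intros; ring, Real.sqrt_mul (sq_nonneg _),
    Real.sqrt_sq_eq_abs]

variable [MeasurableSpace M] [BorelSpace M]

/-- The volume measure as seen in the chart at `c`. -/
def chartVol (g : Metric n m M) (c : M) : Measure M :=
  Measure.map (extChartAt (𝓡∂ n) c).symm
    ((volume.restrict (extChartAt (𝓡∂ n) c).target).withDensity
      (fun y => ENNReal.ofReal (√(gram g c y).det)))

lemma aemeasurable_symm (g : Metric n m M) (c : M) :
    AEMeasurable (extChartAt (𝓡∂ n) c).symm
      ((volume.restrict (extChartAt (𝓡∂ n) c).target).withDensity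
        (fun y => ENNReal.ofReal (√(gram g c y).det))) :=
  ((continuousOn_extChartAt_symm c).aemeasurable (measurableSet_target c)).mono_ac
    (withDensity_absolutelyContinuous _ _)

lemma chartDomIn_eq_target_inter (c : M) {A : Set M} (hA : A ⊆ (𝓡∂ n).interior M) :
    (extChartAt (𝓡∂ n) c).target ∩ (extChartAt (𝓡∂ n) c).symm ⁻¹' A = chartDomIn (n := n) c A := by
  ext y
  refine ⟨fun hy => ⟨?_, hy.2⟩, fun hy => ⟨chartDom_subset c hy.1, hy.2⟩⟩
  have := (mem_chartDom_iff ((extChartAt (𝓡∂ n) c).map_target hy.1)).2 (hA hy.2)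
  rwa [(extChartAt (𝓡∂ n) c).right_inv hy.1] at this

lemma measurableSet_chartDomIn (c : M) {A : Set M} (hA : MeasurableSet A) :
    MeasurableSet (chartDomIn (n := n) c A) := by
  have h := ((continuousOn_extChartAt_symm (I := 𝓡∂ n) c).mono (chartDom_subset c)).domRestrict
  have h2 := (isOpen_chartDom c).measurableSet.subtype_image (h.measurable hA)
  convert h2 using 1
  ext y
  exact ⟨fun hy => ⟨⟨y, hy.1⟩, hy.2, rfl⟩, by rintro ⟨y, hy, rfl⟩; exact ⟨y.2, hy⟩⟩

lemma chartVol_apply (g : Metric n m M) (c : M) {A : Set M} (hA : MeasurableSet A)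
    (hAi : A ⊆ (𝓡∂ n).interior M) :
    chartVol g c A = ∫⁻ y in chartDomIn c A, ENNReal.ofReal (volDens g c y) := by
  have hset : (extChartAt (𝓡∂ n) c).symm ⁻¹' A ∩ (extChartAt (𝓡∂ n) c).target
      = chartDomIn (n := n) c A := by
    rw [inter_comm, chartDomIn_eq_target_inter c hAi]
  rw [chartVol, Measure.map_apply_of_aemeasurable (aemeasurable_symm g c) hA,
    withDensity_apply', Measure.restrict_restrict' (measurableSet_target c), hset]
  rfl

/-- The change of variables formula: on the domain of the chart at `c`, no other chart gives a
larger volume. So the supremum in the definition of the volume measure is attained there at `c`.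
-/
lemma chartVol_le (g : Metric n m M) (c c' : M) {A : Set M} (hA : MeasurableSet A)
    (hAc : A ⊆ chartSrc (n := n) c) : chartVol g c' A ≤ chartVol g c A := by
  have hAi : A ⊆ (𝓡∂ n).interior M := hAc.trans inter_subset_right
  rw [chartVol_apply g c' hA hAi, chartVol_apply g c hA hAi]
  set τ := extChartAt (𝓡∂ n) c ∘ (extChartAt (𝓡∂ n) c').symm
  have hinj : InjOn τ (chartDomIn c' A) := fun y hy y' hy' h => by
    have h1 := (extChartAt (𝓡∂ n) c).injOn (hAc hy.2).1 (hAc hy'.2).1 h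
    rw [← extChartAt_right_inv hy.1, h1, extChartAt_right_inv hy'.1]
  have himg : τ '' chartDomIn c' A ⊆ chartDomIn c A := by
    rintro _ ⟨y, hy, rfl⟩
    refine ⟨extChartAt_mem_chartDom (hAc hy.2), ?_⟩
    change (extChartAt (𝓡∂ n) c).symm (extChartAt (𝓡∂ n) c _) ∈ A
    rw [(extChartAt (𝓡∂ n) c).left_inv (hAc hy.2).1]
    exact hy.2
  refine le_trans (le_of_eq ?_) (lintegral_mono_set himg)
  rw [lintegral_image_eq_lintegral_abs_det_fderiv_mul volume (measurableSet_chartDomIn c' hA)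
    (fun y hy => (hasFDerivAt_transition hy.1 (hAc hy.2).1).hasFDerivWithinAt) hinj]
  refine setLIntegral_congr_fun (measurableSet_chartDomIn c' hA) fun y hy => ?_
  rw [← ENNReal.ofReal_mul (abs_nonneg _), volDens_transition g hy.1 (hAc hy.2).1]
  rfl

lemma volumeMeasure_restrict_chartSrc (g : Metric n m M) (c : M) :
    (volumeMeasure g).restrict (chartSrc (n := n) c)
      = (chartVol g c).restrict (chartSrc (n := n) c) := by
  have hS := (isOpen_chartSrc (n := n) c).measurableSet
  refine le_antisymm ?_ (Measure.restrict_mono le_rfl (le_iSup (chartVol g) c))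
  have hle : volumeMeasure g ≤ (chartVol g c).restrict (chartSrc (n := n) c)
      + (volumeMeasure g).restrict (chartSrc (n := n) c)ᶜ := by
    refine iSup_le fun c' => ?_
    change chartVol g c' ≤ _
    rw [← Measure.restrict_add_restrict_compl (μ := chartVol g c') hS]
    refine add_le_add ?_ (Measure.restrict_mono le_rfl (le_iSup (chartVol g) c'))
    refine Measure.le_iff.2 fun A hA => ?_
    rw [Measure.restrict_apply hA, Measure.restrict_apply hA]
    exact chartVol_le g c c' (hA.inter hS) inter_subset_right
  refine (Measure.restrict_mono le_rfl hle).trans (le_of_eq ?_)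
  rw [Measure.restrict_add, Measure.restrict_restrict hS, Measure.restrict_restrict hS, inter_self,
    inter_compl_self, Measure.restrict_empty, add_zero]

/-- The volume measure on the interior of a chart, as the image of a measure on the domain of the
coordinates. -/
lemma volumeMeasure_restrict_eq_map (g : Metric n m M) (c : M) :
    (volumeMeasure g).restrict (chartSrc (n := n) c)
      = ((Measure.comap (Subtype.val : chartDom (n := n) c → EuclideanSpace ℝ (Fin n))
          volume).withDensity fun y => ENNReal.ofReal (volDens g c y)).map
        fun y : chartDom (n := n) c => (extChartAt (𝓡∂ n) c).symm y := by
  have hS := (isOpen_chartSrc (n := n) c).measurableSet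
  have hemb := (isOpenEmbedding_symm (n := n) c).measurableEmbedding
  rw [volumeMeasure_restrict_chartSrc]
  ext A hA
  rw [Measure.restrict_apply hA, chartVol_apply g c (hA.inter hS)
    (inter_subset_right.trans inter_subset_right), hemb.map_apply,
    withDensity_apply _ (hemb.measurable hA)]
  rw [setLIntegral_subtype (isOpen_chartDom c).measurableSet _
    fun y => ENNReal.ofReal (volDens g c y)]
  congr 2
  ext y
  constructor
  · exact fun hy => ⟨⟨y, hy.1⟩, hy.2.1, rfl⟩
  · rintro ⟨y, hy, rfl⟩
    exact ⟨y.2, hy, symm_mem_chartSrc y.2⟩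

lemma aemeasurable_volDens (g : Metric n m M) (c : M) :
    AEMeasurable (fun y : chartDom (n := n) c => ENNReal.ofReal (volDens g c y))
      (Measure.comap Subtype.val volume) :=
  ((contDiffOn_volDens g c).continuousOn.domRestrict.measurable.ennreal_ofReal).aemeasurable

lemma integral_chartSrc (g : Metric n m M) (c : M) (F : M → ℝ) :
    ∫ x in chartSrc (n := n) c, F x ∂(volumeMeasure g)
      = ∫ y in chartDom c, volDens g c y * F ((extChartAt (𝓡∂ n) c).symm y) := by
  rw [volumeMeasure_restrict_eq_map,
    (isOpenEmbedding_symm (n := n) c).measurableEmbedding.integral_map,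
    integral_withDensity_eq_integral_toReal_smul₀ (aemeasurable_volDens g c)
      (.of_forall fun _ => ENNReal.ofReal_lt_top),
    ← integral_subtype_comap (isOpen_chartDom c).measurableSet]
  refine integral_congr_ae (.of_forall fun y => ?_)
  simp only [smul_eq_mul]
  rw [ENNReal.toReal_ofReal (volDens_pos g y.2).le]

/-- Measurability on the interior of `M` can be checked in charts. -/
lemma aemeasurable_of_chartDom [CompactSpace M] (g : Metric n m M) {F : M → ℝ}
    (h : ∀ c, AEMeasurable (fun y => F ((extChartAt (𝓡∂ n) c).symm y))
      (volume.restrict (chartDom (n := n) c))) :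
    AEMeasurable F ((volumeMeasure g).restrict ((𝓡∂ n).interior M)) := by
  obtain ⟨t, ht⟩ := isCompact_univ.elim_finite_subcover
    (fun c : M => (extChartAt (𝓡∂ n) c).source) (fun c => isOpen_extChartAt_source c)
    fun x _ => mem_iUnion.2 ⟨x, mem_extChartAt_source x⟩
  have hcov : (𝓡∂ n).interior M = ⋃ c : t, chartSrc (n := n) (c : M) := by
    ext x
    refine ⟨fun hx => ?_, fun hx => ?_⟩
    · obtain ⟨c, hc, hxc⟩ := mem_iUnion₂.1 (ht (mem_univ x))
      exact mem_iUnion.2 ⟨⟨c, hc⟩, hxc, hx⟩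
    · obtain ⟨c, hc⟩ := mem_iUnion.1 hx
      exact hc.2
  rw [hcov, aemeasurable_iUnion_iff]
  rintro ⟨c, -⟩
  rw [volumeMeasure_restrict_eq_map,
    (isOpenEmbedding_symm (n := n) c).measurableEmbedding.aemeasurable_map_iff]
  refine AEMeasurable.mono_ac ?_ (withDensity_absolutelyContinuous _ _)
  have hsub := MeasurableEmbedding.subtype_coe (isOpen_chartDom (n := n) c).measurableSet
  have := h c
  rw [← map_comap_subtype_coe (isOpen_chartDom (n := n) c).measurableSet, hsub.aemeasurable_map_iff] at this
  exact this

end Volume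

/-! ### The Laplacian in divergence form -/

section Jacobi

variable {n : ℕ} {ι : Type*} [Fintype ι] [DecidableEq ι]

/-- The derivative of the determinant along a line through an invertible matrix. -/
lemma hasDerivAt_det_add_smul {A : Matrix ι ι ℝ} (hA : IsUnit A.det) (H : Matrix ι ι ℝ) :
    HasDerivAt (fun t : ℝ => (A + t • H).det) (A.det * (A⁻¹ * H).trace) 0 := by
  have h : ∀ t : ℝ, (A + t • H).det = A.det * (Polynomial.eval t
      (1 + (Polynomial.X : Polynomial ℝ) • (A⁻¹ * H).map Polynomial.C).det) := fun t => by
    rw [← Polynomial.coe_evalRingHom, RingHom.map_det, ← Matrix.det_mul]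
    congr 1
    have : (Polynomial.evalRingHom t).mapMatrix
        (1 + (Polynomial.X : Polynomial ℝ) • (A⁻¹ * H).map Polynomial.C) = 1 + t • (A⁻¹ * H) := by
      ext i j
      simp [Matrix.one_apply, apply_ite, -Matrix.map_mul, mul_comm t]
    rw [this, mul_add, mul_one, Matrix.mul_smul, ← mul_assoc, Matrix.mul_nonsing_inv A hA, one_mul]
  rw [funext h, ← Matrix.derivative_det_one_add_X_smul (A⁻¹ * H)]
  exact (Polynomial.hasDerivAt _ 0).const_mul _

/-- The Jacobi formula. -/
lemma partialDeriv_det {A : EuclideanSpace ℝ (Fin n) → Matrix ι ι ℝ}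
    {y : EuclideanSpace ℝ (Fin n)} (hA : ∀ i j, DifferentiableAt ℝ (fun z => A z i j) y)
    (hdet : IsUnit (A y).det) (l : Fin n) :
    partialDeriv l (fun z => (A z).det) y = (A y).det * ((A y)⁻¹ * matDeriv l A y).trace := by
  set A' : EuclideanSpace ℝ (Fin n) → ι → ι → ℝ := fun z i j => A z i j
  have hA' : DifferentiableAt ℝ A' y :=
    differentiableAt_pi.2 fun i => differentiableAt_pi.2 fun j => hA i j
  have hdd : Differentiable ℝ fun B : ι → ι → ℝ => (Matrix.of B).det := by
    simp only [Matrix.det_apply, Matrix.of_apply]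
    fun_prop
  have h1 : HasFDerivAt (fun z => (A z).det)
      ((fderiv ℝ (fun B : ι → ι → ℝ => (Matrix.of B).det) (A' y)).comp (fderiv ℝ A' y)) y :=
    (hdd (A' y)).hasFDerivAt.comp y hA'.hasFDerivAt
  have h2 : fderiv ℝ A' y (EuclideanSpace.single l 1) = fun i j => matDeriv l A y i j := by
    funext i j
    rw [fderiv_pi fun i => differentiableAt_pi.2 fun j => hA i j]
    simp only [ContinuousLinearMap.coe_pi']
    rw [fderiv_pi fun j => hA i j]
    rfl
  rw [partialDeriv, h1.fderiv, ContinuousLinearMap.comp_apply, h2]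
  have h3 := (hdd (A' y)).hasFDerivAt.comp_hasDerivAt_of_eq (0 : ℝ)
    (((hasDerivAt_id (0 : ℝ)).smul_const fun i j => matDeriv l A y i j).const_add (A' y))
    (by simp)
  have h4 := hasDerivAt_det_add_smul hdet (matDeriv l A y)
  have h5 := h3.unique h4
  simpa using h5

end Jacobi

section Divergence

variable {n : ℕ} [NeZero n] {m : ℕ} {M : Type*} [TopologicalSpace M]
  [ChartedSpace (EuclideanHalfSpace n) M] [IsManifold (𝓡∂ n) ∞ M] {r s : ℕ}
  {g : Metric n m M} {U : Set M} {c : M} {y : EuclideanSpace ℝ (Fin n)}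

lemma partialDeriv_volDens (hm : m ≠ 0) (hy : y ∈ chartDom c) (l : Fin n) :
    partialDeriv l (volDens g c) y = volDens g c y * (connMat g c l y).trace := by
  have hG : ∀ i j, DifferentiableAt ℝ (fun z => gram g c z i j) y :=
    fun i j => differentiableAt_gram g hm hy i j
  have hu := isUnit_det_gram g (chartDom_subset c hy)
  have hpos := det_gram_pos g hy
  have hdiff : DifferentiableAt ℝ (fun z => (gram g c z).det) y :=
    (((contDiffOn_det fun i j => contDiffOn_gram g c i j).contDiffAt
      ((isOpen_chartDom c).mem_nhds hy)).differentiableAt (by exact_mod_cast hm))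
  have htr : ((gram g c y)⁻¹ * matDeriv l (gram g c) y).trace = 2 * (connMat g c l y).trace := by
    rw [matDeriv_gram g (chartDom_subset c hy), mul_add, Matrix.trace_add, ← mul_assoc,
      Matrix.nonsing_inv_mul _ hu, one_mul, Matrix.trace_mul_comm, mul_assoc,
      Matrix.mul_nonsing_inv _ hu, mul_one, Matrix.trace_transpose]
    ring
  have h1 := partialDeriv_det hG hu l
  rw [htr] at h1
  have h2 := hdiff.hasFDerivAt.sqrt hpos.ne'
  rw [partialDeriv, show volDens g c = fun z => √(gram g c z).det from rfl, h2.fderiv]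
  change 1 / (2 * √(gram g c y).det) * partialDeriv l (fun z => (gram g c z).det) y = _
  rw [h1]
  have hs : √(gram g c y).det * √(gram g c y).det = (gram g c y).det := Real.mul_self_sqrt hpos.le
  have hs0 : √(gram g c y).det ≠ 0 := (Real.sqrt_pos.2 hpos).ne'
  change _ = √(gram g c y).det * _
  field_simp
  rw [sq, hs]

lemma differentiableAt_gram_inv (hm : m ≠ 0) (hy : y ∈ chartDom c) (i j : Fin n) :
    DifferentiableAt ℝ (fun z => (gram g c z)⁻¹ i j) y :=
  ((contDiffOn_gram_inv g c i j).contDiffAt ((isOpen_chartDom c).mem_nhds hy)).differentiableAt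
    (by exact_mod_cast hm)

/-- The inverse metric is parallel. -/
lemma matDeriv_gram_inv (hm : m ≠ 0) (hy : y ∈ chartDom c) (l : Fin n) :
    matDeriv l (fun z => (gram g c z)⁻¹) y
      = -((gram g c y)⁻¹ * (connMat g c l y).transpose) - connMat g c l y * (gram g c y)⁻¹ := by
  have hu := isUnit_det_gram g (chartDom_subset c hy)
  have h1 : matDeriv l (fun z => gram g c z * (gram g c z)⁻¹) y = 0 := by
    rw [matDeriv_congr (B := fun _ => 1) (Filter.eventually_of_mem
      ((isOpen_chartDom c).mem_nhds hy) fun z hz =>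
        Matrix.mul_nonsing_inv _ (isUnit_det_gram g (chartDom_subset c hz)))]
    ext i j
    simp [matDeriv, partialDeriv_const]
  rw [matDeriv_mul (differentiableAt_gram g hm hy) (differentiableAt_gram_inv hm hy),
    matDeriv_gram g (chartDom_subset c hy)] at h1
  have h2 := congrArg (fun X => (gram g c y)⁻¹ * X) h1
  simp only [mul_add, add_mul, mul_zero] at h2
  rw [← mul_assoc _ (gram g c y) (matDeriv _ _ _), Matrix.nonsing_inv_mul _ hu, one_mul,
    ← mul_assoc, ← mul_assoc, Matrix.nonsing_inv_mul _ hu, one_mul, mul_assoc _ (gram g c y),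
    Matrix.mul_nonsing_inv _ hu, mul_one] at h2
  rw [eq_sub_iff_add_eq, eq_neg_iff_add_eq_zero, ← h2]
  abel

/-- The gradient of a function in coordinates. -/
def gradComp (g : Metric n m M) (c : M) (D : EuclideanSpace ℝ (Fin n) → ℝ) (l : Fin n)
    (y : EuclideanSpace ℝ (Fin n)) : ℝ := ∑ p, (gram g c y)⁻¹ l p * partialDeriv p D y

/-- The Laplacian in divergence form, `∂_l(√G G^{lp} ∂_p D) = √G ΔD` with `G = det g_{ij}`. -/
lemma sum_partialDeriv_volDens_mul_gradComp (hm : m ≠ 0) (hy : y ∈ chartDom c)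
    {D : EuclideanSpace ℝ (Fin n) → ℝ} (hD : ContDiffAt ℝ 2 D y) :
    ∑ l, partialDeriv l (fun z => volDens g c z * gradComp g c D l z) y
      = volDens g c y * ∑ l, ∑ p, (gram g c y)⁻¹ l p * (partialDeriv l (partialDeriv p D) y
          - ∑ q, christoffel g c q l p y * partialDeriv q D y) := by
  have hD1 : ∀ p, DifferentiableAt ℝ (partialDeriv p D) y := fun p =>
    ((hD.fderiv_right (m := 1) (by norm_num)).differentiableAt (by simp)).clm_apply
      (differentiableAt_const _)
  have hV : DifferentiableAt ℝ (volDens g c) y :=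
    ((contDiffOn_volDens g c).contDiffAt ((isOpen_chartDom c).mem_nhds hy)).differentiableAt
      (by exact_mod_cast hm)
  have hI := differentiableAt_gram_inv (g := g) hm hy
  have hmul : ∀ l p, DifferentiableAt ℝ (fun z => (gram g c z)⁻¹ l p * partialDeriv p D z) y :=
    fun l p => (hI l p).mul (hD1 p)
  have hgrad : ∀ l, DifferentiableAt ℝ (gradComp g c D l) y := fun l => by
    have := DifferentiableAt.fun_sum (u := Finset.univ) fun p _ => hmul l p
    exact this
  have hdI : ∀ l p, partialDeriv l (fun z => (gram g c z)⁻¹ l p) y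
      = -(∑ q, (gram g c y)⁻¹ l q * christoffel g c p l q y)
        - ∑ q, christoffel g c l l q y * (gram g c y)⁻¹ q p := fun l p => by
    have := congrFun (congrFun (matDeriv_gram_inv (g := g) hm hy l) l) p
    simp only [← connMat_apply]
    exact this
  have htr : ∀ l, (connMat g c l y).trace = ∑ q, christoffel g c q q l y := fun l => by
    refine Finset.sum_congr rfl fun q _ => ?_
    rw [Matrix.diag_apply, connMat_symm, connMat_apply]
  have hstep : ∀ l, partialDeriv l (fun z => volDens g c z * gradComp g c D l z) y
      = volDens g c y * ((∑ q, christoffel g c q q l y) * gradComp g c D l y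
        + ∑ p, ((-(∑ q, (gram g c y)⁻¹ l q * christoffel g c p l q y)
          - ∑ q, christoffel g c l l q y * (gram g c y)⁻¹ q p) * partialDeriv p D y
          + (gram g c y)⁻¹ l p * partialDeriv l (partialDeriv p D) y)) := fun l => by
    rw [partialDeriv_mul hV (hgrad l), partialDeriv_volDens hm hy, htr,
      show gradComp g c D l = fun z => ∑ p, (gram g c z)⁻¹ l p * partialDeriv p D z from rfl,
      partialDeriv_sum _ fun p _ => hmul l p, mul_assoc, ← mul_add]
    congr 2
    refine Finset.sum_congr rfl fun p _ => ?_
    rw [partialDeriv_mul (hI l p) (hD1 p), hdI]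
  simp_rw [hstep, ← Finset.mul_sum]
  congr 1
  simp only [gradComp, Finset.sum_add_distrib, sub_mul, neg_mul, Finset.sum_sub_distrib, mul_sub,
    Finset.sum_neg_distrib, Finset.mul_sum, Finset.sum_mul]
  -- the trace of the connection from the density cancels one of the two terms from the inverse metric
  have e1 : ∑ l, ∑ p, ∑ q, christoffel g c q q l y * ((gram g c y)⁻¹ l p * partialDeriv p D y)
      = ∑ l, ∑ p, ∑ q, christoffel g c l l q y * (gram g c y)⁻¹ q p * partialDeriv p D y := by
    calc _ = ∑ l, ∑ q, ∑ p, christoffel g c q q l y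
            * ((gram g c y)⁻¹ l p * partialDeriv p D y) :=
          Finset.sum_congr rfl fun l _ => Finset.sum_comm
      _ = ∑ q, ∑ l, ∑ p, christoffel g c q q l y
            * ((gram g c y)⁻¹ l p * partialDeriv p D y) := Finset.sum_comm
      _ = _ := Finset.sum_congr rfl fun q _ => by
          rw [Finset.sum_comm]
          exact Finset.sum_congr rfl fun p _ => Finset.sum_congr rfl fun l _ => by ring
  have e2 : ∑ l, ∑ p, ∑ q, (gram g c y)⁻¹ l q * christoffel g c p l q y * partialDeriv p D y
      = ∑ l, ∑ p, ∑ q, (gram g c y)⁻¹ l p * (christoffel g c q l p y * partialDeriv q D y) :=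
    Finset.sum_congr rfl fun l _ => by
      rw [Finset.sum_comm]
      exact Finset.sum_congr rfl fun p _ => Finset.sum_congr rfl fun q _ => by ring
  rw [← e2]
  have e1' : ∑ l, ∑ q, ∑ p, christoffel g c q q l y * ((gram g c y)⁻¹ l p * partialDeriv p D y)
      = ∑ l, ∑ p, ∑ q, christoffel g c q q l y * ((gram g c y)⁻¹ l p * partialDeriv p D y) :=
    Finset.sum_congr rfl fun l _ => Finset.sum_comm
  linarith [e1, e1']

end Divergence

/-! ### Gradients and the Laplacian as contractions -/

section Contraction

variable {n : ℕ} [NeZero n] {m : ℕ} {M : Type*} [TopologicalSpace M]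
  [ChartedSpace (EuclideanHalfSpace n) M] [IsManifold (𝓡∂ n) ∞ M] {r s : ℕ}
  {g : Metric n m M} {U : Set M} {c : M} {y : EuclideanSpace ℝ (Fin n)}

/-- The metric as a tensor field of type `(0, 2)`. -/
def metricTensor (g : Metric n m M) : TensorField n M 0 2 := fun x =>
  MultilinearMap.constOfIsEmpty ℝ _
    { toFun := fun v => g.inner x (v 0) (v 1)
      map_update_add' := fun v i a b => by
        fin_cases i <;> simp
      map_update_smul' := fun v i t a => by
        fin_cases i <;> simp }

lemma arr_metricTensor (z : M) (K : Fin 0 ⊕ Fin 2 → Fin n) :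
    arr c z (metricTensor g z) K = gramAt g c z (K (Sum.inr 0)) (K (Sum.inr 1)) := rfl

lemma sum_fin_two (f : (Fin 2 → Fin n) → ℝ) : ∑ K, f K = ∑ i, ∑ j, f ![i, j] := by
  rw [← (finTwoArrowEquiv (Fin n)).symm.sum_comp, Fintype.sum_prod_type]
  rfl

lemma sum_fin_one (f : (Fin (0 + 1) → Fin n) → ℝ) : ∑ K, f K = ∑ i, f fun _ => i :=
  ((Equiv.funUnique (Fin 1) (Fin n)).symm.sum_comp f).symm

lemma sum_slots_zero (f : (Fin 0 ⊕ Fin s → Fin n) → ℝ) :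
    ∑ K, f K = ∑ J : Fin s → Fin n, f (Sum.elim ![] J) := by
  rw [sum_sumElim, Fintype.sum_subsingleton _ ![]]

lemma sum_reverse_pairs {ι : Type*} [Fintype ι] (F : ι → ι → ι → ι → ℝ) :
    ∑ i, ∑ j, ∑ k, ∑ l, F i j k l = ∑ k, ∑ l, ∑ j, ∑ i, F i j k l := by
  calc _ = ∑ i, ∑ k, ∑ l, ∑ j, F i j k l := Finset.sum_congr rfl fun i _ => by
        rw [Finset.sum_comm]
        exact Finset.sum_congr rfl fun k _ => Finset.sum_comm
    _ = _ := by
        rw [Finset.sum_comm]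
        refine Finset.sum_congr rfl fun k _ => ?_
        rw [Finset.sum_comm]
        exact Finset.sum_congr rfl fun l _ => Finset.sum_comm

/-- The inner product with the metric is the trace. -/
lemma tinner_metricTensor (hc : y ∈ chartDom c) (h : TensorField n M 0 2) :
    tinner g ((extChartAt (𝓡∂ n) c).symm y) (metricTensor g _) (h _)
      = ∑ i, ∑ j, (gram g c y)⁻¹ i j * comp h c ![] ![i, j] y := by
  have hz := symm_mem_source hc
  set z := (extChartAt (𝓡∂ n) c).symm y
  have hu := isUnit_det_gramAt g hz
  have hT : ∀ i j, (gramAt g c z)⁻¹ i j = (gramAt g c z)⁻¹ j i := fun i j => by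
    conv_lhs => rw [← gramAt_transpose, ← Matrix.transpose_nonsing_inv]
    rfl
  rw [tinner_eq g hz, slotForm_eq_sum, gram_eq_gramAt]
  simp only [sum_slots_zero, sum_fin_two, arr_metricTensor, Fintype.prod_sum_type,
    Finset.univ_eq_empty, Finset.prod_empty, one_mul, Fin.prod_univ_two, metricSlots, Sum.elim_inr,
    Matrix.cons_val_zero, Matrix.cons_val_one, comp_eq_arr]
  change ∑ i, ∑ j, ∑ k, ∑ l, (gramAt g c z)⁻¹ i k * (gramAt g c z)⁻¹ j l * gramAt g c z i j
    * arr c z (h z) (Sum.elim ![] ![k, l]) = _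
  have hone : ∀ j k, ∑ i, (gramAt g c z)⁻¹ i k * gramAt g c z i j
      = (1 : Matrix (Fin n) (Fin n) ℝ) k j := fun j k => by
    rw [← Matrix.nonsing_inv_mul _ hu, Matrix.mul_apply]
    exact Finset.sum_congr rfl fun i _ => by rw [hT i k]
  calc _ = ∑ k, ∑ l, ∑ j, (∑ i, (gramAt g c z)⁻¹ i k * gramAt g c z i j)
        * (gramAt g c z)⁻¹ j l * arr c z (h z) (Sum.elim ![] ![k, l]) := by
        simp only [Finset.sum_mul, mul_right_comm _ (gramAt g c z _ _) ((gramAt g c z)⁻¹ _ _)]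
        exact sum_reverse_pairs fun i j k l => (gramAt g c z)⁻¹ i k * (gramAt g c z)⁻¹ j l
          * gramAt g c z i j * arr c z (h z) (Sum.elim ![] ![k, l])
    _ = _ := by
        refine Finset.sum_congr rfl fun k _ => Finset.sum_congr rfl fun l _ => ?_
        simp only [hone, Matrix.one_apply, ite_mul, one_mul, zero_mul, Finset.sum_ite_eq,
          Finset.mem_univ, if_true]
        rfl

/-- The metric has squared norm `n`, so that the Laplacian, as its inner product with the Hessian,
is bounded by `√n` times the norm of the latter. -/
lemma normSq_metricTensor {x : M} (hx : x ∈ (𝓡∂ n).interior M) :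
    normSq g (metricTensor g) x = n := by
  have hx' := extChartAt_self_mem_chartDom hx
  have hu := isUnit_det_gram g (chartDom_subset x hx')
  have h := tinner_metricTensor (g := g) hx' (metricTensor g)
  rw [extChartAt_to_inv] at h
  rw [normSq_eq_tinner, h]
  have h2 : ∀ i j, comp (metricTensor g) x ![] ![i, j] (extChartAt (𝓡∂ n) x x)
      = gram g x (extChartAt (𝓡∂ n) x x) j i := fun i j => by
    rw [gram_symm]; rfl
  simp only [h2]
  calc _ = ((gram g x (extChartAt (𝓡∂ n) x x))⁻¹ * gram g x (extChartAt (𝓡∂ n) x x)).trace := rfl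
    _ = n := by rw [Matrix.nonsing_inv_mul _ hu, Matrix.trace_one, Fintype.card_fin]

lemma laplacian_eq_tinner {d : M → ℝ} {x : M} (hx : x ∈ (𝓡∂ n).interior M) :
    laplacian g d x
      = tinner g x (metricTensor g x) (covDeriv g (covDeriv g (ofFun d)) x) := by
  have h := tinner_metricTensor (g := g) (extChartAt_self_mem_chartDom hx)
    (covDeriv g (covDeriv g (ofFun d)))
  rw [extChartAt_to_inv] at h
  exact h.symm

lemma abs_laplacian_le {d : M → ℝ} {x : M} (hx : x ∈ (𝓡∂ n).interior M) :
    |laplacian g d x| ≤ √n * tnorm g (covDeriv g (covDeriv g (ofFun d))) x := by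
  rw [laplacian_eq_tinner hx]
  refine (abs_tinner_le g (metricTensor g) _ x).trans (le_of_eq ?_)
  rw [tnorm, normSq_metricTensor hx]

/-- The Laplacian in any chart. -/
lemma laplacian_eq (hm : m ≠ 0) (hU : IsOpen U) {d : M → ℝ}
    (hd : CompC (n := n) 2 U (ofFun d)) (hdm : 2 ≤ m) (hy : y ∈ chartDomIn c U) :
    laplacian g d ((extChartAt (𝓡∂ n) c).symm y)
      = ∑ l, ∑ p, (gram g c y)⁻¹ l p *
        (partialDeriv l (partialDeriv p fun y => d ((extChartAt (𝓡∂ n) c).symm y)) y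
          - ∑ q, christoffel g c q l p y
            * partialDeriv q (fun y => d ((extChartAt (𝓡∂ n) c).symm y)) y) := by
  rw [laplacian_eq_tinner (symm_mem_interior hy.1), tinner_metricTensor hy.1]
  refine Finset.sum_congr rfl fun l _ => Finset.sum_congr rfl fun p _ => ?_
  congr 1
  have hd1 : CompC (n := n) 1 U (ofFun d) := hd.of_le one_le_two
  have h1 : CompC 1 U (covDeriv g (ofFun d)) := CompC.covDeriv (p := 1) hdm hU hd
  have h2 := comp_covDeriv_of_compC (g := g) hm one_ne_zero hU h1 hy ![] ![p] l
  have hcons : (Fin.cons l ![p] : Fin 2 → Fin n) = ![l, p] := rfl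
  rw [hcons] at h2
  refine h2.trans ?_
  have h3 : comp (covDeriv g (ofFun d)) c ![] ![p]
      =ᶠ[𝓝 y] partialDeriv p fun y => d ((extChartAt (𝓡∂ n) c).symm y) :=
    Filter.eventually_of_mem ((isOpen_chartDomIn c hU).mem_nhds hy) fun z hz =>
      comp_covDeriv_ofFun hm hU hd1 hz _ _
  rw [partialDeriv_congr h3, connTerm]
  rw [Finset.univ_eq_empty (α := Fin 0), Finset.sum_empty, zero_sub, ← sub_eq_add_neg, Fin.sum_univ_succ,
    Finset.univ_eq_empty (α := Fin 0), Finset.sum_empty, add_zero]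
  refine congrArg₂ _ rfl (Finset.sum_congr rfl fun q _ => ?_)
  rw [comp_covDeriv_ofFun hm hU hd1 hy, Function.update_self]
  rfl

/-- The inner product of two gradients in any chart. -/
lemma tinner_grad_eq (hm : m ≠ 0) (hU : IsOpen U) {θ d : M → ℝ}
    (hθ : CompC (n := n) 1 U (ofFun θ)) (hd : CompC (n := n) 1 U (ofFun d))
    (hy : y ∈ chartDomIn c U) :
    tinner g ((extChartAt (𝓡∂ n) c).symm y) (covDeriv g (ofFun θ) _) (covDeriv g (ofFun d) _)
      = ∑ l, partialDeriv l (fun y => θ ((extChartAt (𝓡∂ n) c).symm y)) y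
        * gradComp g c (fun y => d ((extChartAt (𝓡∂ n) c).symm y)) l y := by
  have hz := symm_mem_source hy.1
  rw [tinner_eq g hz, slotForm_eq_sum]
  simp only [sum_slots_zero, gradComp, Finset.mul_sum]
  rw [sum_fin_one]
  refine Finset.sum_congr rfl fun l _ => ?_
  rw [sum_fin_one]
  refine Finset.sum_congr rfl fun p _ => ?_
  have h1 := comp_covDeriv_ofFun (g := g) hm hU hθ hy ![] fun _ => l
  have h2 := comp_covDeriv_ofFun (g := g) hm hU hd hy ![] fun _ => p
  rw [comp_eq_arr] at h1 h2
  simp only [Fintype.prod_sum_type, Finset.univ_eq_empty, Finset.prod_empty, one_mul,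
    metricSlots, Sum.elim_inr]
  rw [← h1, ← h2, gram_eq_gramAt, Fin.prod_univ_succ, Finset.univ_eq_empty,
    Finset.prod_empty, mul_one, mul_left_comm, ← mul_assoc]

/-- Splitting off the first of the covariant slots. -/
def slotsFirst (s : ℕ) : Fin (s + 1) ≃ Fin 1 ⊕ Fin s where
  toFun := Fin.cases (Sum.inl 0) Sum.inr
  invFun := Sum.elim (fun _ => 0) Fin.succ
  left_inv := fun b => by refine Fin.cases rfl (fun b => rfl) b
  right_inv := fun k => by
    rcases k with i | j
    · rw [Subsingleton.elim i 0]; rfl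
    · rfl

/-- Contracting the derivative of a tensor field with a gradient and the tensor field itself. -/
lemma tinner_prod_grad_eq (hm : m ≠ 0) (hU : IsOpen U) {d : M → ℝ}
    (hd : CompC (n := n) 1 U (ofFun d)) (hy : y ∈ chartDomIn c U) (u : TensorField n M r s)
    (v : TensorField n M r (s + 1)) :
    tinner g ((extChartAt (𝓡∂ n) c).symm y) (v _)
        (prod (slotsFirst s) (covDeriv g (ofFun d)) u _)
      = ∑ l, gradComp g c (fun y => d ((extChartAt (𝓡∂ n) c).symm y)) l y
        * slotForm (metricSlots g r s c ((extChartAt (𝓡∂ n) c).symm y))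
          (fun K => comp v c (K ∘ Sum.inl) (Fin.cons l (K ∘ Sum.inr)) y)
          (arr c _ (u ((extChartAt (𝓡∂ n) c).symm y))) := by
  have hz := symm_mem_source hy.1
  rw [tinner_eq g hz]
  simp only [slotForm_eq_sum]
  have hcons : ∀ {f : (Fin r ⊕ Fin (s + 1) → Fin n) → ℝ}, ∑ K, f K
      = ∑ l, ∑ I : Fin r → Fin n, ∑ J : Fin s → Fin n, f (Sum.elim I (Fin.cons l J)) := by
    intro f
    rw [sum_sumElim, Finset.sum_comm, ← (Fin.consEquiv fun _ => Fin n).sum_comp,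
      Fintype.sum_prod_type]
    refine Finset.sum_congr rfl fun l _ => ?_
    rw [Finset.sum_comm]
    rfl
  have hv : ∀ (I : Fin r → Fin n) J, arr c ((extChartAt (𝓡∂ n) c).symm y)
      (v ((extChartAt (𝓡∂ n) c).symm y)) (Sum.elim I J) = comp v c I J y :=
    fun I J => (comp_eq_arr v c I J y).symm
  have hp : ∀ (I : Fin r → Fin n) (J : Fin s → Fin n) p, arr c ((extChartAt (𝓡∂ n) c).symm y)
      (prod (slotsFirst s) (covDeriv g (ofFun d)) u ((extChartAt (𝓡∂ n) c).symm y))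
        (Sum.elim I (Fin.cons p J))
      = partialDeriv p (fun y => d ((extChartAt (𝓡∂ n) c).symm y)) y
        * arr c _ (u ((extChartAt (𝓡∂ n) c).symm y)) (Sum.elim I J) := fun I J p => by
    rw [← comp_eq_arr, ← comp_eq_arr, comp_prod, comp_covDeriv_ofFun hm hU hd hy]
    rfl
  simp only [hcons, hv, hp]
  simp only [sum_sumElim, gradComp]
  refine Finset.sum_congr rfl fun l _ => ?_
  rw [Finset.mul_sum]
  refine Finset.sum_congr rfl fun I _ => ?_
  rw [Finset.mul_sum]
  refine Finset.sum_congr rfl fun J _ => ?_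
  rw [Finset.sum_mul]
  refine Finset.sum_congr rfl fun p _ => ?_
  rw [Finset.mul_sum]
  refine Finset.sum_congr rfl fun I' _ => ?_
  rw [Finset.mul_sum]
  refine Finset.sum_congr rfl fun J' _ => ?_
  rw [Fintype.prod_sum_type, Fintype.prod_sum_type, Fin.prod_univ_succ, gram_eq_gramAt]
  simp only [metricSlots, Sum.elim_inl, Sum.elim_inr, Fin.cons_zero, Fin.cons_succ, Sum.elim_comp_inl, Sum.elim_comp_inr]
  ring

end Contraction

/-! ### The divergence of `θ |u|² ∇d` in coordinates -/

section LocalL2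

variable {n : ℕ} {O : Set (EuclideanSpace ℝ (Fin n))} {A U V : EuclideanSpace ℝ (Fin n) → ℝ}

lemma MemL2loc.sub (hU : MemL2loc O U) (hV : MemL2loc O V) : MemL2loc O fun y => U y - V y :=
  fun K hK hc => (hU K hK hc).sub (hV K hK hc)

lemma MemL2loc.sum {κ : Type*} (t : Finset κ) {U : κ → EuclideanSpace ℝ (Fin n) → ℝ}
    (hU : ∀ i ∈ t, MemL2loc O (U i)) : MemL2loc O fun y => ∑ i ∈ t, U i y :=
  fun K hK hc => memLp_finsetSum t fun i hi => hU i hi K hK hc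

lemma MemL2loc.continuousOn_mul (hU : MemL2loc O U) (hA : ContinuousOn A O) :
    MemL2loc O fun y => A y * U y := fun K hK hc => by
  obtain ⟨C, hC⟩ := hc.exists_bound_of_continuousOn (hA.mono hK)
  refine (hU K hK hc).of_le_mul (c := C) (((hA.mono hK).aestronglyMeasurable
    hc.measurableSet).mul (hU K hK hc).1) ?_
  refine (ae_restrict_iff' hc.measurableSet).2 (.of_forall fun y hy => ?_)
  rw [norm_mul]
  exact mul_le_mul_of_nonneg_right (hC y hy) (norm_nonneg _)

lemma MemL2loc.locallyIntegrableOn_mul (hO : IsOpen O) (hU : MemL2loc O U) (hV : MemL2loc O V) :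
    LocallyIntegrableOn (fun y => U y * V y) O :=
  (locallyIntegrableOn_iff hO.isLocallyClosed).2 fun K hK hc =>
    (hU K hK hc).integrable_mul (hV K hK hc)

end LocalL2

section Quadratic

variable {n : ℕ} [NeZero n] {m : ℕ} {M : Type*} [TopologicalSpace M]
  [ChartedSpace (EuclideanHalfSpace n) M] [IsManifold (𝓡∂ n) ∞ M] {r s : ℕ}
  {g : Metric n m M} {U : Set M} {c : M} {y : EuclideanSpace ℝ (Fin n)}

lemma differentiableAt_metricSlots (hm : m ≠ 0) (hy : y ∈ chartDom c) (a : Fin r ⊕ Fin s)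
    (i j : Fin n) :
    DifferentiableAt ℝ (fun z => metricSlots g r s c ((extChartAt (𝓡∂ n) c).symm z) a i j) y := by
  rcases a with a | a
  · exact differentiableAt_gram g hm hy i j
  · exact differentiableAt_gram_inv hm hy i j

/-- The metric on tensors is parallel. -/
lemma matDeriv_metricSlots (hm : m ≠ 0) (hy : y ∈ chartDom c) (l : Fin n) (a : Fin r ⊕ Fin s) :
    matDeriv l (fun z => metricSlots g r s c ((extChartAt (𝓡∂ n) c).symm z) a) y
      = metricSlots g r s c ((extChartAt (𝓡∂ n) c).symm y) a * connSlot g r s c l y a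
        + (connSlot g r s c l y a).transpose
          * metricSlots g r s c ((extChartAt (𝓡∂ n) c).symm y) a := by
  rcases a with a | a
  · exact matDeriv_gram g (chartDom_subset c hy) l
  · refine (matDeriv_gram_inv (g := g) hm hy l).trans ?_
    change _ = (gram g c y)⁻¹ * -(connMat g c l y).transpose
      + (-(connMat g c l y).transpose).transpose * (gram g c y)⁻¹
    rw [mul_neg, Matrix.transpose_neg, Matrix.transpose_transpose, neg_mul, sub_eq_add_neg]

/-- The product rule for the squared norm of a tensor field, in coordinates and with a scalar
factor: since the metric is parallel, the Christoffel symbols cancel. -/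
lemma sum_partialDeriv_quadratic (hm : m ≠ 0) (hy : y ∈ chartDom c) (l : Fin n)
    {f : EuclideanSpace ℝ (Fin n) → ℝ} (hf : DifferentiableAt ℝ f y)
    (u v w : (Fin r ⊕ Fin s → Fin n) → ℝ) (hw : w = v - slotDer (connSlot g r s c l y) u) :
    ∑ K, ∑ L, (u K * u L * partialDeriv l (fun z => f z
          * ∏ a, metricSlots g r s c ((extChartAt (𝓡∂ n) c).symm z) a (K a) (L a)) y
        + (w K * u L + u K * w L) * (f y
          * ∏ a, metricSlots g r s c ((extChartAt (𝓡∂ n) c).symm y) a (K a) (L a)))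
      = partialDeriv l f y
          * slotForm (metricSlots g r s c ((extChartAt (𝓡∂ n) c).symm y)) u u
        + 2 * f y * slotForm (metricSlots g r s c ((extChartAt (𝓡∂ n) c).symm y)) v u := by
  set H : EuclideanSpace ℝ (Fin n) → Fin r ⊕ Fin s → Matrix (Fin n) (Fin n) ℝ :=
    fun z => metricSlots g r s c ((extChartAt (𝓡∂ n) c).symm z) with hH
  have hsym : ∀ a, (H y a).transpose = H y a := metricSlots_transpose g c _
  have hHd : ∀ a i j, DifferentiableAt ℝ (fun z => H z a i j) y :=
    fun a i j => differentiableAt_metricSlots hm hy a i j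
  have hprod : ∀ K L : Fin r ⊕ Fin s → Fin n,
      DifferentiableAt ℝ (fun z => ∏ a, H z a (K a) (L a)) y := fun K L => by
    exact (HasFDerivAt.finsetProd (u := Finset.univ) (g := fun a z => H z a (K a) (L a))
      fun a _ => (hHd a (K a) (L a)).hasFDerivAt).differentiableAt
  have hvar : ∑ K, ∑ L, u K * u L * partialDeriv l (fun z => ∏ a, H z a (K a) (L a)) y
      = 2 * slotForm (H y) u (slotDer (connSlot g r s c l y) u) := by
    rw [← slotForm_var hsym]
    have hX : (fun a => H y a * connSlot g r s c l y a + (connSlot g r s c l y a).transpose * H y a)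
        = fun a => matDeriv l (fun z => H z a) y :=
      funext fun a => (matDeriv_metricSlots hm hy l a).symm
    rw [hX]
    simp only [dotProduct, slotVar, Finset.sum_apply, slotMap_apply]
    refine Finset.sum_congr rfl fun K _ => ?_
    rw [Finset.sum_comm, Finset.mul_sum]
    refine Finset.sum_congr rfl fun L _ => ?_
    rw [partialDeriv_slotKernel (P := fun a z => H z a) hHd, ← Finset.sum_mul]
    ring
  have h1 : slotForm (H y) w u = slotForm (H y) v u
      - slotForm (H y) u (slotDer (connSlot g r s c l y) u) := by
    rw [slotForm_comm hsym u, hw, sub_eq_add_neg, slotForm_add_left,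
      ← neg_one_smul ℝ (slotDer _ _), slotForm_smul_left]
    ring
  have h2 : slotForm (H y) u w = slotForm (H y) w u := slotForm_comm hsym u w
  have hsplit : ∀ K L, u K * u L * partialDeriv l (fun z => f z * ∏ a, H z a (K a) (L a)) y
        + (w K * u L + u K * w L) * (f y * ∏ a, H y a (K a) (L a))
      = partialDeriv l f y * ((∏ a, H y a (K a) (L a)) * u K * u L)
        + f y * (u K * u L * partialDeriv l (fun z => ∏ a, H z a (K a) (L a)) y)
        + f y * ((∏ a, H y a (K a) (L a)) * w K * u L)
        + f y * ((∏ a, H y a (K a) (L a)) * u K * w L) := fun K L => by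
    rw [partialDeriv_mul hf (hprod K L)]
    ring
  change ∑ K, ∑ L, (u K * u L * partialDeriv l (fun z => f z * ∏ a, H z a (K a) (L a)) y
        + (w K * u L + u K * w L) * (f y * ∏ a, H y a (K a) (L a)))
      = partialDeriv l f y * slotForm (H y) u u + 2 * f y * slotForm (H y) v u
  simp only [hsplit, Finset.sum_add_distrib, ← Finset.mul_sum]
  rw [← slotForm_eq_sum, ← slotForm_eq_sum, ← slotForm_eq_sum, hvar, h2, h1]
  ring

end Quadratic

section Divergence

variable {n : ℕ} [NeZero n] {m : ℕ} {M : Type*} [TopologicalSpace M]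
  [ChartedSpace (EuclideanHalfSpace n) M] [IsManifold (𝓡∂ n) ∞ M] {r s : ℕ}
  {g : Metric n m M} {U : Set M}

/-- The divergence of the vector field `θ |u|² ∇d`, where `v` stands for `∇u`. -/
def divField (g : Metric n m M) (d θ : M → ℝ) (u : TensorField n M r s)
    (v : TensorField n M r (s + 1)) (x : M) : ℝ :=
  normSq g u x * (tinner g x (covDeriv g (ofFun θ) x) (covDeriv g (ofFun d) x)
      + θ x * laplacian g d x)
    + 2 * θ x * tinner g x (v x) (prod (slotsFirst s) (covDeriv g (ofFun d)) u x)

lemma tinner_covDeriv_eq_zero {θ : M → ℝ} {x : M} (hθ : θ =ᶠ[𝓝 x] 0)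
    (T : TensorAt n 0 1 x) : tinner g x (covDeriv g (ofFun θ) x) T = 0 := by
  have h0 : arr x x (covDeriv g (ofFun θ) x) = 0 := by
    rw [covDeriv, arr_ofComp]
    funext K
    have hc : ContinuousAt (extChartAt (𝓡∂ n) x).symm (extChartAt (𝓡∂ n) x x) :=
      continuousAt_extChartAt_symm x
    rw [ContinuousAt, extChartAt_to_inv] at hc
    have h1 : comp (ofFun θ) x (K ∘ Sum.inl) (Fin.tail (K ∘ Sum.inr))
        =ᶠ[𝓝 (extChartAt (𝓡∂ n) x x)] fun _ => 0 := by
      filter_upwards [hc.eventually hθ] with y hy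
      rw [comp_ofFun, hy]
      rfl
    rw [partialDeriv_congr h1, partialDeriv_const, connTerm]
    simp
  rw [tinner, h0, slotForm, zero_dotProduct]

lemma divField_eq_zero {d θ : M → ℝ} {u : TensorField n M r s} {v : TensorField n M r (s + 1)}
    {x : M} (hθ : θ =ᶠ[𝓝 x] 0) : divField g d θ u v x = 0 := by
  have h0 : θ x = 0 := hθ.self_of_nhds
  rw [divField, tinner_covDeriv_eq_zero hθ, h0]
  ring

/-- The coordinate expression of `divField`, with derivatives of `u` only through `v`: the form in
which it is to be compared with `∂_l(√G θ g^{lp} ∂_p d |u|²)`. -/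
lemma divField_eq (hm : 2 ≤ m) (hU : IsOpen U) {d θ : M → ℝ}
    (hd : CompC (n := n) 2 U (ofFun d)) (hθ : CompC (n := n) 1 U (ofFun θ)) {c : M}
    {y : EuclideanSpace ℝ (Fin n)} (hy : y ∈ chartDomIn c U) (u : TensorField n M r s)
    (v : TensorField n M r (s + 1)) :
    volDens g c y * divField g d θ u v ((extChartAt (𝓡∂ n) c).symm y)
      = ∑ l, (partialDeriv l (fun z => volDens g c z
            * gradComp g c (fun y => d ((extChartAt (𝓡∂ n) c).symm y)) l z
            * θ ((extChartAt (𝓡∂ n) c).symm z)) y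
          * slotForm (metricSlots g r s c ((extChartAt (𝓡∂ n) c).symm y))
            (arr c _ (u ((extChartAt (𝓡∂ n) c).symm y)))
            (arr c _ (u ((extChartAt (𝓡∂ n) c).symm y)))
        + 2 * (volDens g c y * gradComp g c (fun y => d ((extChartAt (𝓡∂ n) c).symm y)) l y
            * θ ((extChartAt (𝓡∂ n) c).symm y))
          * slotForm (metricSlots g r s c ((extChartAt (𝓡∂ n) c).symm y))
            (fun K => comp v c (K ∘ Sum.inl) (Fin.cons l (K ∘ Sum.inr)) y)
            (arr c _ (u ((extChartAt (𝓡∂ n) c).symm y)))) := by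
  have hm0 : m ≠ 0 := by omega
  have hO := isOpen_chartDomIn (n := n) c hU
  have hd1 : CompC (n := n) 1 U (ofFun d) := hd.of_le one_le_two
  set D := fun y => d ((extChartAt (𝓡∂ n) c).symm y) with hDdef
  have hD : ContDiffAt ℝ 2 D y := by
    have := compC_ofFun.1 hd c
    exact (this.contDiffAt (hO.mem_nhds hy))
  have hθd : DifferentiableAt ℝ (fun y => θ ((extChartAt (𝓡∂ n) c).symm y)) y :=
    ((compC_ofFun.1 hθ c).contDiffAt (hO.mem_nhds hy)).differentiableAt (by simp)
  have hV : DifferentiableAt ℝ (volDens g c) y :=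
    ((contDiffOn_volDens g c).contDiffAt ((isOpen_chartDom c).mem_nhds hy.1)).differentiableAt
      (by exact_mod_cast hm0)
  have hgrad : ∀ l, DifferentiableAt ℝ (gradComp g c D l) y := fun l =>
    DifferentiableAt.fun_sum (u := Finset.univ) fun p _ =>
      (differentiableAt_gram_inv hm0 hy.1 l p).mul
        (((hD.fderiv_right (m := 1) (by norm_num)).differentiableAt (by simp)).clm_apply
          (differentiableAt_const _))
  have hdiv := sum_partialDeriv_volDens_mul_gradComp (g := g) hm0 hy.1 hD
  rw [← laplacian_eq hm0 hU hd hm hy] at hdiv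
  have hpd : ∀ l, partialDeriv l (fun z => volDens g c z * gradComp g c D l z
        * θ ((extChartAt (𝓡∂ n) c).symm z)) y
      = partialDeriv l (fun z => volDens g c z * gradComp g c D l z) y
          * θ ((extChartAt (𝓡∂ n) c).symm y)
        + volDens g c y * gradComp g c D l y
          * partialDeriv l (fun y => θ ((extChartAt (𝓡∂ n) c).symm y)) y := fun l =>
    partialDeriv_mul (hV.mul (hgrad l)) hθd
  rw [divField, tinner_grad_eq hm0 hU hθ hd1 hy, tinner_prod_grad_eq hm0 hU hd1 hy,
    normSq_eq_slotForm g (symm_mem_source hy.1), Finset.sum_add_distrib, ← Finset.sum_mul]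
  simp only [hpd]
  rw [Finset.sum_add_distrib, ← Finset.sum_mul, hdiv]
  simp only [← hDdef]
  rw [show ∀ a b e f h : ℝ, a * (b * (e + f) + h) = b * (a * e) + a * (b * f + h) by
      intros; ring, show ∀ a b f e h : ℝ, a * (b * f + 2 * e * h) = a * b * f + 2 * a * e * h by
      intros; ring, Finset.mul_sum, Finset.mul_sum, Finset.mul_sum, add_mul, Finset.sum_mul]
  have e1 : ∀ N V A X : ℝ, N * (V * (A * X)) = V * X * A * N := by intros; ring
  have e2 : ∀ V t X S : ℝ, 2 * V * t * (X * S) = 2 * (V * X * t) * S := by intros; ring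
  simp only [e1, e2]
  ring

end Divergence

/-! ### The divergence theorem in a chart -/

section DivergenceTheorem

variable {n : ℕ} [NeZero n] {m : ℕ} {M : Type*} [TopologicalSpace M]
  [ChartedSpace (EuclideanHalfSpace n) M] [IsManifold (𝓡∂ n) ∞ M] {r s : ℕ}
  {g : Metric n m M} {U : Set M}

lemma contDiffOn_gradComp (hm : m ≠ 0) {c : M} {O : Set (EuclideanSpace ℝ (Fin n))}
    (hO : IsOpen O) (hOc : O ⊆ chartDom c) {D : EuclideanSpace ℝ (Fin n) → ℝ}
    (hD : ContDiffOn ℝ 2 D O) (l : Fin n) : ContDiffOn ℝ 1 (gradComp g c D l) O :=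
  ContDiffOn.sum fun p _ => (((contDiffOn_gram_inv g c l p).mono hOc).of_le
    (by exact_mod_cast Nat.one_le_iff_ne_zero.2 hm)).mul
      (contDiffOn_partialDeriv hO (p := 1) (by exact_mod_cast hD) p)

lemma contDiffOn_metricSlots (c : M) (a : Fin r ⊕ Fin s) (i j : Fin n) :
    ContDiffOn ℝ m (fun y => metricSlots g r s c ((extChartAt (𝓡∂ n) c).symm y) a i j)
      (chartDom c) := by
  rcases a with a | a
  · exact contDiffOn_gram g c i j
  · exact contDiffOn_gram_inv g c i j

/-- The components of a weakly differentiable tensor field have weak partial derivatives, also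
against test functions of class `C^1`. -/
lemma HasWeakCovDeriv.hasWeakPartial (hm : m ≠ 0) {u : TensorField n M r s}
    {v : TensorField n M r (s + 1)} (h : HasWeakCovDeriv g u v) (c : M)
    {O : Set (EuclideanSpace ℝ (Fin n))} (hOc : O ⊆ chartDom c) (I : Fin r → Fin n)
    (J : Fin s → Fin n) (l : Fin n) :
    HasWeakPartial 1 O l (comp u c I J)
      fun y => comp v c I (Fin.cons l J) y - connTerm g u c l I J y := by
  obtain ⟨h1, h2, h3⟩ := h c
  have hw : HasWeakPartial 1 (chartDom c) l (comp u c I J)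
      fun y => comp v c I (Fin.cons l J) y - connTerm g u c l I J y :=
    HasWeakPartial.of_top (isOpen_chartDom c) (h1 _ _)
      ((h2 _ _).sub (locallyIntegrableOn_connTerm g hm h1 l I J))
      fun ψ hψ hψc hψs => h3 I J l ψ hψ hψc hψs
  exact fun φ hφ hφc hφs => hw φ hφ hφc (hφs.trans hOc)

lemma memL2loc_connTerm (hm : m ≠ 0) {u : TensorField n M r s} {c : M}
    {O : Set (EuclideanSpace ℝ (Fin n))} (hOc : O ⊆ chartDom c)
    (hu : ∀ I J, MemL2loc O (comp u c I J)) (l : Fin n) (I : Fin r → Fin n) (J : Fin s → Fin n) :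
    MemL2loc O (connTerm g u c l I J) := by
  have hΓ : ∀ a i j, ContinuousOn (christoffel g c a i j) O := fun a i j =>
    (contDiffOn_christoffel g (p := 0) (by omega) c a i j).continuousOn.mono hOc
  exact MemL2loc.sub
    (MemL2loc.sum _ fun a _ => MemL2loc.sum _ fun p _ => (hu _ _).continuousOn_mul (hΓ _ _ _))
    (MemL2loc.sum _ fun a _ => MemL2loc.sum _ fun p _ => (hu _ _).continuousOn_mul (hΓ _ _ _))

variable [MeasurableSpace M] [BorelSpace M]

/-- The divergence theorem for vector fields supported in the domain of a chart. In coordinates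
`|u|²` is a quadratic form in the components of `u`, and for each pair of components the product
rule for weak derivatives is tested against the corresponding coefficient. -/
lemma setIntegral_divField_chart (hm : 2 ≤ m) (hU : IsOpen U)
    {d θ : M → ℝ} (hd : CompC (n := n) 2 U (ofFun d)) (hθ : CompC (n := n) 1 U (ofFun θ))
    {u : TensorField n M r s} {v : TensorField n M r (s + 1)} (hw : HasWeakCovDeriv g u v) {c : M}
    (hu : ∀ I J, MemL2loc (chartDomIn c U) (comp u c I J))
    (hv : ∀ I J, MemL2loc (chartDomIn c U) (comp v c I J))
    {K : Set M} (hK : IsCompact K) (hKcl : IsClosed K) (hKU : K ⊆ U)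
    (hKc : K ⊆ chartSrc (n := n) c) (hθK : ∀ x ∉ K, θ x = 0) :
    ∫ x in chartSrc (n := n) c, divField g d θ u v x ∂(volumeMeasure g) = 0 := by
  have hm0 : m ≠ 0 := by omega
  set O := chartDomIn (n := n) c U with hOdef
  have hO : IsOpen O := isOpen_chartDomIn (n := n) c hU
  have hOc : O ⊆ chartDom c := chartDomIn_subset c U
  have hev : ∀ x ∉ K, θ =ᶠ[𝓝 x] 0 := fun x hx =>
    Filter.eventually_of_mem (hKcl.isOpen_compl.mem_nhds hx) fun z hz => hθK z hz
  -- the cut-off function in coordinates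
  set Θ : EuclideanSpace ℝ (Fin n) → ℝ := O.indicator fun y => θ ((extChartAt (𝓡∂ n) c).symm y)
    with hΘdef
  have hΘO : ∀ y ∈ O, Θ y = θ ((extChartAt (𝓡∂ n) c).symm y) := fun y hy => indicator_of_mem hy _
  have hKimg : IsCompact (extChartAt (𝓡∂ n) c '' K) :=
    hK.image_of_continuousOn ((continuousOn_extChartAt c).mono fun x hx => (hKc hx).1)
  have hΘsub : tsupport Θ ⊆ extChartAt (𝓡∂ n) c '' K := by
    refine closure_minimal (fun y hy => ?_) hKimg.isClosed
    have hyO : y ∈ O := by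
      by_contra h
      exact hy (indicator_of_notMem h _)
    refine ⟨_, ?_, extChartAt_right_inv (hOc hyO)⟩
    by_contra h
    exact hy ((hΘO y hyO).trans (hθK _ h))
  have hΘs : tsupport Θ ⊆ O := by
    rintro y hy
    obtain ⟨x, hx, rfl⟩ := hΘsub hy
    refine ⟨extChartAt_mem_chartDom (hKc hx), ?_⟩
    rw [mem_preimage, (extChartAt (𝓡∂ n) c).left_inv (hKc hx).1]
    exact hKU hx
  have hΘc : HasCompactSupport Θ := hKimg.of_isClosed_subset (isClosed_tsupport _) hΘsub
  have hΘ1 : ContDiffOn ℝ 1 Θ O := by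
    have := compC_ofFun.1 hθ c
    exact ContDiffOn.congr (by exact_mod_cast this) hΘO
  -- the coefficients of the quadratic form
  set D : EuclideanSpace ℝ (Fin n) → ℝ := fun y => d ((extChartAt (𝓡∂ n) c).symm y)
  have hD : ContDiffOn ℝ 2 D O := by
    have := compC_ofFun.1 hd c
    exact_mod_cast this
  set F : Fin n → EuclideanSpace ℝ (Fin n) → ℝ := fun l y => volDens g c y * gradComp g c D l y
  have hF : ∀ l, ContDiffOn ℝ 1 (F l) O := fun l =>
    (((contDiffOn_volDens g c).mono hOc).of_le
      (by exact_mod_cast Nat.one_le_iff_ne_zero.2 hm0)).mul (contDiffOn_gradComp hm0 hO hOc hD l)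
  set H : (Fin r ⊕ Fin s → Fin n) → (Fin r ⊕ Fin s → Fin n) → EuclideanSpace ℝ (Fin n) → ℝ :=
    fun A B y => ∏ a, metricSlots g r s c ((extChartAt (𝓡∂ n) c).symm y) a (A a) (B a)
  have hH : ∀ A B, ContDiffOn ℝ 1 (H A B) O := fun A B =>
    contDiffOn_prod fun a _ => ((contDiffOn_metricSlots c a _ _).mono hOc).of_le
      (by exact_mod_cast Nat.one_le_iff_ne_zero.2 hm0)
  set φ : Fin n → (Fin r ⊕ Fin s → Fin n) → (Fin r ⊕ Fin s → Fin n) →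
    EuclideanSpace ℝ (Fin n) → ℝ := fun l A B y => (F l y * H A B y) * Θ y
  have hφ : ∀ l A B, ContDiff ℝ 1 (φ l A B) := fun l A B =>
    contDiff_mul_of_tsupport_subset hO ((hF l).mul (hH A B)) hΘ1 hΘs
  have hφs' : ∀ l A B, tsupport (φ l A B) ⊆ tsupport Θ := fun l A B =>
    closure_mono (Function.support_mul_subset_right _ _)
  have hφs : ∀ l A B, tsupport (φ l A B) ⊆ O := fun l A B => (hφs' l A B).trans hΘs
  have hφc : ∀ l A B, HasCompactSupport (φ l A B) := fun l A B => hΘc.mul_left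
  -- the components and their weak derivatives
  set u' : (Fin r ⊕ Fin s → Fin n) → EuclideanSpace ℝ (Fin n) → ℝ :=
    fun A => comp u c (A ∘ Sum.inl) (A ∘ Sum.inr)
  set w' : Fin n → (Fin r ⊕ Fin s → Fin n) → EuclideanSpace ℝ (Fin n) → ℝ :=
    fun l A y => comp v c (A ∘ Sum.inl) (Fin.cons l (A ∘ Sum.inr)) y
      - connTerm g u c l (A ∘ Sum.inl) (A ∘ Sum.inr) y
  have hu' : ∀ A, MemL2loc O (u' A) := fun A => hu _ _
  have hw' : ∀ l A, MemL2loc O (w' l A) := fun l A =>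
    (hv _ _).sub (memL2loc_connTerm hm0 hOc hu l _ _)
  have hder : ∀ l A, HasWeakPartial 1 O l (u' A) (w' l A) := fun l A =>
    hw.hasWeakPartial hm0 c hOc _ _ l
  set T : Fin n → (Fin r ⊕ Fin s → Fin n) → (Fin r ⊕ Fin s → Fin n) →
    EuclideanSpace ℝ (Fin n) → ℝ := fun l A B y => u' A y * u' B y * partialDeriv l (φ l A B) y
      + (w' l A y * u' B y + u' A y * w' l B y) * φ l A B y
  have hT1 : ∀ l A B, Integrable fun y => u' A y * u' B y * partialDeriv l (φ l A B) y :=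
    fun l A B => integrable_mul_of_tsupport_subset
      ((hu' A).locallyIntegrableOn_mul hO (hu' B)) (continuous_partialDeriv (hφ l A B) l)
      ((hφc l A B).mono' ((subset_tsupport _).trans (tsupport_partialDeriv_subset _ l)))
      ((tsupport_partialDeriv_subset _ l).trans (hφs l A B))
  have hT2 : ∀ l A B, Integrable fun y =>
      (w' l A y * u' B y + u' A y * w' l B y) * φ l A B y := fun l A B =>
    integrable_mul_of_tsupport_subset (((hw' l A).locallyIntegrableOn_mul hO (hu' B)).add
      ((hu' A).locallyIntegrableOn_mul hO (hw' l B))) (hφ l A B).continuous (hφc l A B) (hφs l A B)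
  have hTi : ∀ l A B, Integrable (T l A B) := fun l A B => (hT1 l A B).add (hT2 l A B)
  have hT0 : ∀ l A B, ∫ y, T l A B y = 0 := fun l A B => by
    have := ((hder l A).mul hO (hu' A) (hw' l A) (hu' B) (hw' l B) (hder l B)) (φ l A B)
      (by exact_mod_cast hφ l A B) (hφc l A B) (hφs l A B)
    rw [integral_add (hT1 l A B) (hT2 l A B), this, neg_add_cancel]
  have hsum : ∫ y, ∑ l, ∑ A, ∑ B, T l A B y = 0 := by
    rw [integral_finsetSum _ fun l _ => integrable_finsetSum _ fun A _ =>
      integrable_finsetSum _ fun B _ => hTi l A B]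
    refine Finset.sum_eq_zero fun l _ => ?_
    rw [integral_finsetSum _ fun A _ => integrable_finsetSum _ fun B _ => hTi l A B]
    refine Finset.sum_eq_zero fun A _ => ?_
    rw [integral_finsetSum _ fun B _ => hTi l A B]
    exact Finset.sum_eq_zero fun B _ => hT0 l A B
  -- the integrand is the divergence
  have hpt : ∀ y ∈ O, ∑ l, ∑ A, ∑ B, T l A B y
      = volDens g c y * divField g d θ u v ((extChartAt (𝓡∂ n) c).symm y) := fun y hy => by
    rw [divField_eq hm hU hd hθ hy]
    refine Finset.sum_congr rfl fun l _ => ?_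
    have hf : DifferentiableAt ℝ (fun z => F l z * θ ((extChartAt (𝓡∂ n) c).symm z)) y := by
      have h1 := ((hF l).contDiffAt (hO.mem_nhds hy)).differentiableAt (by simp)
      have h2 := ((compC_ofFun.1 hθ c).contDiffAt (hO.mem_nhds hy)).differentiableAt (by simp)
      exact h1.mul h2
    have hq := sum_partialDeriv_quadratic (g := g) (c := c) hm0 (hOc hy) l hf
      (fun A => u' A y) (fun A => comp v c (A ∘ Sum.inl) (Fin.cons l (A ∘ Sum.inr)) y)
      (fun A => w' l A y) (by
        funext A
        simp only [w', Pi.sub_apply, connTerm_eq_slotDer, Sum.elim_comp_inl_inr]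
        congr 1)
    have hua : (fun A => u' A y)
        = arr c _ (u ((extChartAt (𝓡∂ n) c).symm y)) := by
      funext A
      simp only [u', comp_eq_arr, Sum.elim_comp_inl_inr]
    rw [hua] at hq
    rw [← hq]
    refine Finset.sum_congr rfl fun A _ => Finset.sum_congr rfl fun B _ => ?_
    have hφe : φ l A B =ᶠ[𝓝 y] fun z => F l z * θ ((extChartAt (𝓡∂ n) c).symm z) * H A B z :=
      Filter.eventually_of_mem (hO.mem_nhds hy) fun z hz => by
        simp only [φ, hΘO z hz]
        ring
    simp only [T, partialDeriv_congr hφe, hφe.self_of_nhds]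
    rfl
  have hT00 : ∀ y ∉ O, ∑ l, ∑ A, ∑ B, T l A B y = 0 := fun y hy =>
    Finset.sum_eq_zero fun l _ => Finset.sum_eq_zero fun A _ => Finset.sum_eq_zero fun B _ => by
      have hy' : y ∉ tsupport (φ l A B) := fun h => hy (hφs l A B h)
      simp only [T, partialDeriv_eq_zero_of_notMem hy', image_eq_zero_of_notMem_tsupport hy',
        mul_zero, add_zero]
  rw [integral_chartSrc, setIntegral_eq_of_subset_of_forall_sdiff_eq_zero
    (isOpen_chartDom c).measurableSet hOc fun y hy => ?_,
    ← setIntegral_congr_fun hO.measurableSet hpt,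
    setIntegral_eq_integral_of_forall_compl_eq_zero hT00, hsum]
  rw [divField_eq_zero (hev _ fun h => hy.2 ⟨hy.1, hKU h⟩), mul_zero]

end DivergenceTheorem

/-! ### Continuity, measurability and local integrability of tensor fields -/

section Pointwise

variable {n : ℕ} [NeZero n] {m : ℕ} {M : Type*} [TopologicalSpace M]
  [ChartedSpace (EuclideanHalfSpace n) M] [IsManifold (𝓡∂ n) ∞ M] {r s q t : ℕ}
  {g : Metric n m M} {U : Set M}

/-- Polarisation. -/
lemma tinner_polar (u v : TensorField n M r s) (x : M) :
    tinner g x (u x) (v x) = (normSq g (u + v) x - normSq g u x - normSq g v x) / 2 := by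
  have hsym : ∀ a, (metricSlots g r s x x a).transpose = metricSlots g r s x x a :=
    metricSlots_transpose g x x
  simp only [normSq_eq_tinner, tinner, Pi.add_apply, arr_add, slotForm_add_left,
    slotForm_add_right, slotForm_comm hsym (arr x x (v x)) (arr x x (u x))]
  ring

lemma CompC.continuousOn_normSq_manifold (hU : IsOpen U) (hUi : U ⊆ (𝓡∂ n).interior M)
    {u : TensorField n M r s} (hu : CompC 0 U u) : ContinuousOn (normSq g u) U :=
  fun _ hx => (hu.continuousAt_normSq hU hx (hUi hx)).continuousWithinAt

lemma CompC.continuousOn_tinner (hU : IsOpen U) (hUi : U ⊆ (𝓡∂ n).interior M)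
    {u v : TensorField n M r s} (hu : CompC 0 U u) (hv : CompC 0 U v) :
    ContinuousOn (fun x => tinner g x (u x) (v x)) U := by
  simp only [tinner_polar]
  exact ((((CompC.add hu hv).continuousOn_normSq_manifold hU hUi).sub
    (hu.continuousOn_normSq_manifold hU hUi)).sub
      (hv.continuousOn_normSq_manifold hU hUi)).div_const 2

lemma compC_metricTensor : CompC (n := n) 0 U (metricTensor g) := fun c I J => by
  have h : comp (metricTensor g) c I J = fun y => gram g c y (J 0) (J 1) := rfl
  rw [h]
  exact ((contDiffOn_gram g c _ _).mono (chartDomIn_subset c U)).of_le (by simp)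

lemma continuousOn_laplacian (hm : 2 ≤ m) (hU : IsOpen U) (hUi : U ⊆ (𝓡∂ n).interior M)
    {d : M → ℝ} (hd : CompC (n := n) 2 U (ofFun d)) : ContinuousOn (laplacian g d) U := by
  have h1 : CompC 1 U (covDeriv g (ofFun d)) := CompC.covDeriv (p := 1) hm hU hd
  have h2 : CompC 0 U (covDeriv g (covDeriv g (ofFun d))) :=
    CompC.covDeriv (p := 0) (by omega) hU h1
  exact (CompC.continuousOn_tinner (g := g) hU hUi compC_metricTensor h2).congr
    fun x hx => laplacian_eq_tinner (hUi hx)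

lemma continuousOn_of_compC (hU : IsOpen U) (hUi : U ⊆ (𝓡∂ n).interior M) {f : M → ℝ}
    (hf : CompC (n := n) 0 U (ofFun f)) : ContinuousOn f U := fun x hx => by
  have hx' := extChartAt_self_mem_chartDom (hUi hx)
  have hxO : extChartAt (𝓡∂ n) x x ∈ chartDomIn x U :=
    ⟨hx', by rw [mem_preimage, extChartAt_to_inv]; exact hx⟩
  have h1 := ((compC_ofFun.1 hf x).continuousOn.continuousAt
    ((isOpen_chartDomIn x hU).mem_nhds hxO)).comp (continuousAt_extChartAt (I := 𝓡∂ n) x)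
  refine (h1.congr ?_).continuousWithinAt
  filter_upwards [extChartAt_source_mem_nhds (I := 𝓡∂ n) x] with z hz
  simp only [Function.comp_apply, (extChartAt (𝓡∂ n) x).left_inv hz]

lemma IsMeasurableField.add {u v : TensorField n M r s} (hu : IsMeasurableField u)
    (hv : IsMeasurableField v) : IsMeasurableField (u + v) :=
  fun c I J => (hu c I J).add (hv c I J)

open Classical in
/-- The product of a field that is continuous on `U` with a measurable field is measurable
on `U`. -/
lemma IsMeasurableField.exists_prod (hU : IsOpen U) (e : Fin t ≃ Fin q ⊕ Fin s)
    {a : TensorField n M 0 q} {u : TensorField n M r s} (ha : CompC 0 U a)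
    (hu : IsMeasurableField u) :
    ∃ P : TensorField n M r t, IsMeasurableField P ∧ ∀ x ∈ U, P x = WeightedSobolev.prod e a u x := by
  refine ⟨fun x => if x ∈ U then WeightedSobolev.prod e a u x else 0, fun c I J => ?_,
    fun x hx => if_pos hx⟩
  have h : comp (fun x => if x ∈ U then WeightedSobolev.prod e a u x else 0) c I J
      =ᵐ[volume.restrict (chartDom c)]
        (chartDomIn (n := n) c U).indicator (comp (WeightedSobolev.prod e a u) c I J) := by
    refine (ae_restrict_iff' (isOpen_chartDom c).measurableSet).2 (.of_forall fun y hy => ?_)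
    by_cases hyU : (extChartAt (𝓡∂ n) c).symm y ∈ U
    · rw [indicator_of_mem (show y ∈ chartDomIn c U from ⟨hy, hyU⟩), comp, if_pos hyU]
      rfl
    · rw [indicator_of_notMem fun h => hyU h.2, comp, if_neg hyU]
      rfl
  have hO := isOpen_chartDomIn (n := n) c hU
  refine AEStronglyMeasurable.congr ?_ h.symm
  refine (aestronglyMeasurable_indicator_iff hO.measurableSet).2 ?_
  rw [funext (comp_prod e a u c I J)]
  have h1 := (ha c Fin.elim0 fun i => J (e.symm (Sum.inl i))).continuousOn.aestronglyMeasurable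
    (μ := volume) hO.measurableSet
  rw [← inter_eq_left.2 (chartDomIn_subset (n := n) c U),
    ← Measure.restrict_restrict hO.measurableSet] at h1
  exact h1.mul ((hu c _ _).mono_measure Measure.restrict_le_self)

variable [MeasurableSpace M] [BorelSpace M]

lemma integrableOn_chartDomIn {F : M → ℝ} {c : M} {A : Set M} (hA : MeasurableSet A)
    (hF : IntegrableOn F A (volumeMeasure g)) :
    IntegrableOn (fun y => volDens g c y * F ((extChartAt (𝓡∂ n) c).symm y))
      (chartDomIn (n := n) c A) := by
  have h1 : IntegrableOn (A.indicator F) (chartSrc (n := n) c) (volumeMeasure g) :=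
    ((integrable_indicator_iff hA).2 hF).integrableOn
  have hmd := (isOpen_chartDom (n := n) c).measurableSet
  rw [IntegrableOn, volumeMeasure_restrict_eq_map,
    (isOpenEmbedding_symm (n := n) c).measurableEmbedding.integrable_map_iff,
    integrable_withDensity_iff_integrable_smul₀' (aemeasurable_volDens g c)
      (.of_forall fun _ => ENNReal.ofReal_lt_top)] at h1
  have h2 : IntegrableOn (fun y => (ENNReal.ofReal (volDens g c y)).toReal
      • A.indicator F ((extChartAt (𝓡∂ n) c).symm y)) (chartDom (n := n) c) :=
    (integrableOn_iff_comap_subtypeVal hmd).2 h1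
  refine (h2.mono_set (chartDomIn_subset c A)).congr_fun (fun y hy => ?_)
    (measurableSet_chartDomIn c hA)
  simp only [smul_eq_mul]
  rw [ENNReal.toReal_ofReal (volDens_pos g hy.1).le, indicator_of_mem (show _ ∈ A from hy.2)]

/-- Locally square integrable tensor fields have locally square integrable components. -/
lemma memL2loc_comp [T2Space M] {u : TensorField n M r s} (hu : IsMeasurableField u)
    (hloc : ∀ K ⊆ U, IsCompact K → IntegrableOn (normSq g u) K (volumeMeasure g)) (c : M)
    (I : Fin r → Fin n) (J : Fin s → Fin n) : MemL2loc (chartDomIn c U) (comp u c I J) := by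
  intro K hK hKc
  have hKd : K ⊆ chartDom c := hK.trans (chartDomIn_subset c U)
  set A := (extChartAt (𝓡∂ n) c).symm '' K
  have hAc : IsCompact A :=
    hKc.image_of_continuousOn ((continuousOn_extChartAt_symm c).mono
      (hKd.trans (chartDom_subset c)))
  have hAU : A ⊆ U := by
    rintro _ ⟨y, hy, rfl⟩
    exact (hK hy).2
  have hKA : K ⊆ chartDomIn c A := fun y hy => ⟨hKd hy, mem_image_of_mem _ hy⟩
  have hint := (integrableOn_chartDomIn (g := g) (c := c) hAc.measurableSet
    (hloc A hAU hAc)).mono_set hKA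
  have hmeas : AEStronglyMeasurable (comp u c I J) (volume.restrict K) :=
    (hu c I J).mono_measure (Measure.restrict_mono hKd le_rfl)
  rw [memLp_two_iff_integrable_sq hmeas]
  have hH : ∀ y ∈ K, ∀ a : Fin r ⊕ Fin s,
      (metricSlots g r s c ((extChartAt (𝓡∂ n) c).symm y) a).PosDef := fun y hy a =>
    posDef_metricSlots g (symm_mem_source (hKd hy)) a
  have hcont : ContinuousOn (fun y => (volDens g c y)⁻¹
      * ∏ a, (metricSlots g r s c ((extChartAt (𝓡∂ n) c).symm y) a)⁻¹
        (Sum.elim I J a) (Sum.elim I J a)) K := by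
    refine ContinuousOn.mul (((contDiffOn_volDens g c).continuousOn.mono hKd).inv₀
      fun y hy => (volDens_pos g (hKd hy)).ne') (continuousOn_finsetProd _ fun a _ => ?_)
    have h := contDiffOn_inv (p := 0) (A := fun y => metricSlots g r s c
      ((extChartAt (𝓡∂ n) c).symm y) a) (O := chartDom c)
      (fun i j => (contDiffOn_metricSlots c a i j).of_le (by simp))
      (fun y hy => (posDef_metricSlots g (symm_mem_source hy) a).det_pos.ne')
      (Sum.elim I J a) (Sum.elim I J a)
    exact h.continuousOn.mono hKd
  obtain ⟨C, hC⟩ := hKc.exists_bound_of_continuousOn hcont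
  refine (hint.const_mul C).mono' (hmeas.pow 2) ?_
  refine (ae_restrict_iff' hKc.measurableSet).2 (.of_forall fun y hy => ?_)
  have hsq := sq_apply_le_slotForm (hH y hy)
    (arr c _ (u ((extChartAt (𝓡∂ n) c).symm y))) (Sum.elim I J)
  rw [← comp_eq_arr, ← normSq_eq_slotForm g (symm_mem_source (hKd hy))] at hsq
  have hV := volDens_pos g (hKd hy)
  have hN := normSq_nonneg g u ((extChartAt (𝓡∂ n) c).symm y)
  rw [Real.norm_of_nonneg (sq_nonneg _)]
  refine hsq.trans ?_
  have h2 := (le_abs_self _).trans (hC y hy)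
  calc _ = (volDens g c y)⁻¹ * (∏ a, (metricSlots g r s c ((extChartAt (𝓡∂ n) c).symm y) a)⁻¹
        (Sum.elim I J a) (Sum.elim I J a))
          * (volDens g c y * normSq g u ((extChartAt (𝓡∂ n) c).symm y)) := by
        field_simp
    _ ≤ _ := mul_le_mul_of_nonneg_right h2 (mul_nonneg hV.le hN)

variable [CompactSpace M]

lemma IsMeasurableField.aemeasurable_normSq {u : TensorField n M r s} (hu : IsMeasurableField u) :
    AEMeasurable (normSq g u) ((volumeMeasure g).restrict ((𝓡∂ n).interior M)) := by
  refine aemeasurable_of_chartDom g fun c => ?_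
  have hO := (isOpen_chartDom (n := n) c).measurableSet
  refine AEMeasurable.congr ?_ ((ae_restrict_iff' hO).2 (.of_forall fun y hy =>
    (normSq_eq_sum_comp g u hy).symm))
  refine Finset.aemeasurable_fun_sum _ fun K _ => Finset.aemeasurable_fun_sum _ fun L _ => ?_
  refine ((ContinuousOn.aemeasurable (continuousOn_finsetProd _ fun a _ =>
    continuousOn_metricSlots g c a _ _) hO).mul (hu c _ _).aemeasurable).mul
      (hu c _ _).aemeasurable

lemma IsMeasurableField.aemeasurable_tinner {u v : TensorField n M r s}
    (hu : IsMeasurableField u) (hv : IsMeasurableField v) :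
    AEMeasurable (fun x => tinner g x (u x) (v x))
      ((volumeMeasure g).restrict ((𝓡∂ n).interior M)) := by
  simp only [tinner_polar]
  exact (((hu.add hv).aemeasurable_normSq.sub hu.aemeasurable_normSq).sub
    hv.aemeasurable_normSq).div_const 2

end Pointwise

/-! ### The divergence theorem on the manifold -/

section GlobalDivergence

variable {n : ℕ} [NeZero n] {m : ℕ} {M : Type*} [TopologicalSpace M]
  [ChartedSpace (EuclideanHalfSpace n) M] [IsManifold (𝓡∂ n) ∞ M] {r s : ℕ}
  {g : Metric n m M} {U : Set M} [MeasurableSpace M] [BorelSpace M] [CompactSpace M] [T2Space M]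

lemma integrableOn_divField (hm : 2 ≤ m) (hU : IsOpen U) (hUi : U ⊆ (𝓡∂ n).interior M)
    {d θ : M → ℝ} (hd : CompC (n := n) 2 U (ofFun d)) (hθ : CompC (n := n) 1 U (ofFun θ))
    {u : TensorField n M r s} {v : TensorField n M r (s + 1)} (hum : IsMeasurableField u)
    (hvm : IsMeasurableField v)
    (hu : ∀ K ⊆ U, IsCompact K → IntegrableOn (normSq g u) K (volumeMeasure g))
    (hv : ∀ K ⊆ U, IsCompact K → IntegrableOn (normSq g v) K (volumeMeasure g))
    {K : Set M} (hK : IsCompact K) (hKU : K ⊆ U) (hθK : ∀ x ∉ K, θ x = 0) :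
    IntegrableOn (divField g d θ u v) U (volumeMeasure g) := by
  have hd1 : CompC (n := n) 1 U (ofFun d) := hd.of_le one_le_two
  have hgd : CompC 0 U (covDeriv g (ofFun d)) := CompC.covDeriv (p := 0) (by omega) hU hd1
  have hgθ : CompC 0 U (covDeriv g (ofFun θ)) := CompC.covDeriv (p := 0) (by omega) hU hθ
  have hθc : ContinuousOn θ U := continuousOn_of_compC hU hUi (hθ.of_le zero_le_one)
  have hzero : ∀ x ∈ U \ K, divField g d θ u v x = 0 := fun x hx => divField_eq_zero
    (Filter.eventually_of_mem (hK.isClosed.isOpen_compl.mem_nhds hx.2) fun z hz => hθK z hz)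
  suffices h : IntegrableOn (divField g d θ u v) K (volumeMeasure g) from
    h.of_forall_sdiff_eq_zero hU.measurableSet hzero
  have h1 : IntegrableOn (fun x => normSq g u x * (tinner g x (covDeriv g (ofFun θ) x)
      (covDeriv g (ofFun d) x) + θ x * laplacian g d x)) K (volumeMeasure g) :=
    (hu K hKU hK).mul_continuousOn (((CompC.continuousOn_tinner hU hUi hgθ hgd).add
      (hθc.mul (continuousOn_laplacian hm hU hUi hd))).mono hKU) hK
  have h2 : IntegrableOn (fun x => tinner g x (v x)
      (prod (slotsFirst s) (covDeriv g (ofFun d)) u x)) K (volumeMeasure g) := by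
    obtain ⟨P, hPm, hP⟩ := hum.exists_prod hU (slotsFirst s) hgd
    have hmeas : AEMeasurable (fun x => tinner g x (v x)
        (prod (slotsFirst s) (covDeriv g (ofFun d)) u x)) ((volumeMeasure g).restrict K) := by
      refine AEMeasurable.congr (((hvm.aemeasurable_tinner (g := g) hPm).mono_measure
        (Measure.restrict_mono (hKU.trans hUi) le_rfl))) ?_
      exact (ae_restrict_iff' hK.measurableSet).2 (.of_forall fun x hx => by
        simp only [hP x (hKU hx)])
    have hT : ContinuousOn (tnorm g (covDeriv g (ofFun d))) K :=
      ((hgd.continuousOn_normSq_manifold hU hUi).mono hKU).sqrt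
    refine ((((hu K hKU hK).add (hv K hKU hK)).continuousOn_mul hT hK)).mono'
      hmeas.aestronglyMeasurable (.of_forall fun x => ?_)
    have h3 := abs_tinner_le g v (prod (slotsFirst s) (covDeriv g (ofFun d)) u) x
    rw [tnorm_prod] at h3
    have ha := tnorm_nonneg g (covDeriv g (ofFun d)) x
    have hb := tnorm_nonneg g u x
    have hc := tnorm_nonneg g v x
    rw [Real.norm_eq_abs]
    refine h3.trans ?_
    simp only [Pi.add_apply, ← tnorm_sq]
    have hab : tnorm g v x * tnorm g u x ≤ tnorm g u x ^ 2 + tnorm g v x ^ 2 := by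
      nlinarith [sq_nonneg (tnorm g v x - tnorm g u x), sq_nonneg (tnorm g v x + tnorm g u x)]
    calc _ = tnorm g (covDeriv g (ofFun d)) x * (tnorm g v x * tnorm g u x) := by ring
      _ ≤ _ := mul_le_mul_of_nonneg_left hab ha
  have h3 : IntegrableOn (fun x => 2 * θ x * tinner g x (v x)
      (prod (slotsFirst s) (covDeriv g (ofFun d)) u x)) K (volumeMeasure g) :=
    h2.continuousOn_mul ((continuousOn_const.mul hθc).mono hKU) hK
  exact h1.add h3

lemma divField_sum {κ : Type*} [Fintype κ] (hm : m ≠ 0) (hU : IsOpen U)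
    (hUi : U ⊆ (𝓡∂ n).interior M) {d : M → ℝ} {θ : κ → M → ℝ}
    (hd : CompC (n := n) 1 U (ofFun d)) (hθ : ∀ i, CompC (n := n) 1 U (ofFun (θ i)))
    (u : TensorField n M r s) (v : TensorField n M r (s + 1)) {x : M} (hx : x ∈ U) :
    divField g d (fun x => ∑ i, θ i x) u v x = ∑ i, divField g d (θ i) u v x := by
  have hxO : extChartAt (𝓡∂ n) x x ∈ chartDomIn x U :=
    ⟨extChartAt_self_mem_chartDom (hUi hx), by rw [mem_preimage, extChartAt_to_inv]; exact hx⟩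
  have hsum : CompC (n := n) 1 U (ofFun fun x => ∑ i, θ i x) := compC_ofFun.2 fun c =>
    ContDiffOn.sum fun i _ => compC_ofFun.1 (hθ i) c
  have h1 : ∀ {η : M → ℝ}, CompC (n := n) 1 U (ofFun η) →
      tinner g x (covDeriv g (ofFun η) x) (covDeriv g (ofFun d) x)
        = ∑ l, partialDeriv l (fun y => η ((extChartAt (𝓡∂ n) x).symm y)) (extChartAt (𝓡∂ n) x x)
          * gradComp g x (fun y => d ((extChartAt (𝓡∂ n) x).symm y)) l
            (extChartAt (𝓡∂ n) x x) := fun hη => by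
    have := tinner_grad_eq (g := g) hm hU hη hd hxO
    rwa [extChartAt_to_inv] at this
  have h2 : tinner g x (covDeriv g (ofFun fun x => ∑ i, θ i x) x) (covDeriv g (ofFun d) x)
      = ∑ i, tinner g x (covDeriv g (ofFun (θ i)) x) (covDeriv g (ofFun d) x) := by
    simp only [h1 hsum, h1 (hθ _)]
    rw [Finset.sum_comm]
    refine Finset.sum_congr rfl fun l _ => ?_
    rw [partialDeriv_sum (f := fun i y => θ i ((extChartAt (𝓡∂ n) x).symm y)) Finset.univ
      fun i _ => ((compC_ofFun.1 (hθ i) x).contDiffAt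
        ((isOpen_chartDomIn x hU).mem_nhds hxO)).differentiableAt (by simp), Finset.sum_mul]
  simp only [divField, Finset.sum_add_distrib, ← Finset.mul_sum, ← Finset.sum_mul, h2]

/-- The divergence theorem for the vector field `θ |u|² ∇d`, where `θ` has compact support; by a
partition of unity it reduces to the case of a single chart. -/
lemma setIntegral_divField (hm : 2 ≤ m) (hU : IsOpen U) (hUi : U ⊆ (𝓡∂ n).interior M)
    {d θ : M → ℝ} (hd : CompC (n := n) 2 U (ofFun d)) (hθ : CompC (n := n) 1 U (ofFun θ))
    {u : TensorField n M r s} {v : TensorField n M r (s + 1)} (hum : IsMeasurableField u)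
    (hvm : IsMeasurableField v) (hw : HasWeakCovDeriv g u v)
    (hu : ∀ K ⊆ U, IsCompact K → IntegrableOn (normSq g u) K (volumeMeasure g))
    (hv : ∀ K ⊆ U, IsCompact K → IntegrableOn (normSq g v) K (volumeMeasure g))
    {K : Set M} (hK : IsCompact K) (hKU : K ⊆ U) (hθK : ∀ x ∉ K, θ x = 0) :
    ∫ x in U, divField g d θ u v x ∂(volumeMeasure g) = 0 := by
  have hd1 : CompC (n := n) 1 U (ofFun d) := hd.of_le one_le_two
  obtain ⟨t, ht⟩ := hK.elim_finite_subcover (fun c : M => chartSrc (n := n) c)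
    (fun c => isOpen_chartSrc c)
    fun x hx => mem_iUnion.2 ⟨x, mem_chartSrc_self (hUi (hKU hx))⟩
  obtain ⟨f, hf⟩ := SmoothPartitionOfUnity.exists_isSubordinate (I := 𝓡∂ n) hK.isClosed
    (fun c : t => chartSrc (n := n) (c : M)) (fun c => isOpen_chartSrc _)
    fun x hx => by
      obtain ⟨c, hc, hxc⟩ := mem_iUnion₂.1 (ht hx)
      exact mem_iUnion.2 ⟨⟨c, hc⟩, hxc⟩
  set η : t → M → ℝ := fun c x => f c x * θ x
  have hη : ∀ c, CompC (n := n) 1 U (ofFun (η c)) := fun c => compC_ofFun.2 fun c' => by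
    have h1 : CompC (n := n) 1 U (ofFun (f c)) := compC_of_contMDiffOn
      (((f c).contMDiff.of_le (by exact_mod_cast le_top)).contMDiffOn)
    exact (compC_ofFun.1 h1 c').mul (compC_ofFun.1 hθ c')
  have hsum : θ = fun x => ∑ c, η c x := by
    funext x
    by_cases hx : x ∈ K
    · have h1 := f.sum_eq_one hx
      rw [finsum_eq_sum_of_fintype] at h1
      rw [← Finset.sum_mul, h1, one_mul]
    · simp only [η, hθK x hx, mul_zero, Finset.sum_const_zero]
  have hKc : ∀ c : t, IsCompact (K ∩ tsupport (f c)) := fun c =>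
    hK.inter_right (isClosed_tsupport _)
  have hηK : ∀ c, ∀ x ∉ K ∩ tsupport (f c), η c x = 0 := fun c x hx => by
    by_cases hxK : x ∈ K
    · have : x ∉ tsupport (f c) := fun h => hx ⟨hxK, h⟩
      simp only [η, image_eq_zero_of_notMem_tsupport this, zero_mul]
    · simp only [η, hθK x hxK, mul_zero]
  have hint : ∀ c, IntegrableOn (divField g d (η c) u v) U (volumeMeasure g) := fun c =>
    integrableOn_divField hm hU hUi hd (hη c) hum hvm hu hv (hKc c)
      (inter_subset_left.trans hKU) (hηK c)
  have hzero : ∀ c, ∀ x ∉ K ∩ tsupport (f c), divField g d (η c) u v x = 0 := fun c x hx =>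
    divField_eq_zero (Filter.eventually_of_mem ((hKc c).isClosed.isOpen_compl.mem_nhds hx)
      fun z hz => hηK c z hz)
  have hc0 : ∀ c : t, ∫ x in U, divField g d (η c) u v x ∂(volumeMeasure g) = 0 := fun c => by
    have h1 := setIntegral_divField_chart (c := (c : M)) hm hU hd (hη c) hw
      (memL2loc_comp hum hu _) (memL2loc_comp hvm hv _) (hKc c) (hKc c).isClosed
      (inter_subset_left.trans hKU) (inter_subset_right.trans (hf c)) (hηK c)
    rw [setIntegral_eq_of_subset_of_forall_sdiff_eq_zero hU.measurableSet
      (inter_subset_left : U ∩ chartSrc (n := n) (c : M) ⊆ U)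
      fun x hx => hzero c x fun h => hx.2 ⟨hx.1, hf c h.2⟩]
    rwa [setIntegral_eq_of_subset_of_forall_sdiff_eq_zero
      (isOpen_chartSrc (n := n) (c : M)).measurableSet
      (inter_subset_right : U ∩ chartSrc (n := n) (c : M) ⊆ chartSrc (n := n) (c : M))
      fun x hx => hzero c x fun h => hx.2 ⟨hKU h.1, hx.1⟩] at h1
  calc ∫ x in U, divField g d θ u v x ∂(volumeMeasure g)
      = ∫ x in U, ∑ c, divField g d (η c) u v x ∂(volumeMeasure g) := by
        refine setIntegral_congr_fun hU.measurableSet fun x hx => ?_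
        conv_lhs => rw [hsum]
        exact divField_sum (by omega) hU hUi hd1 hη u v hx
    _ = 0 := by
        rw [integral_finsetSum _ fun c _ => hint c]
        exact Finset.sum_eq_zero fun c _ => hc0 c

end GlobalDivergence

/-! ### The radial cut-off -/

section Cutoff

lemma deriv_smoothTransition_eq_zero {x : ℝ} (hx : x ∉ Icc (0 : ℝ) 1) :
    deriv Real.smoothTransition x = 0 := by
  rcases lt_or_ge x 0 with h | h
  · have : Real.smoothTransition =ᶠ[𝓝 x] fun _ => 0 :=
      Filter.eventually_of_mem (Iio_mem_nhds h) fun y hy =>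
        Real.smoothTransition.zero_of_nonpos (le_of_lt hy)
    rw [this.deriv_eq, deriv_const]
  · have h1 : 1 < x := by
      by_contra hc
      exact hx ⟨h, not_lt.1 hc⟩
    have : Real.smoothTransition =ᶠ[𝓝 x] fun _ => 1 :=
      Filter.eventually_of_mem (Ioi_mem_nhds h1) fun y hy =>
        Real.smoothTransition.one_of_one_le (le_of_lt hy)
    rw [this.deriv_eq, deriv_const]

lemma exists_deriv_smoothTransition_le : ∃ C : ℝ, ∀ x, |deriv Real.smoothTransition x| ≤ C := by
  have hcont : Continuous (deriv Real.smoothTransition) :=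
    (Real.smoothTransition.contDiff (n := 1)).continuous_deriv le_rfl
  obtain ⟨C, hC⟩ := (isCompact_Icc (a := (0 : ℝ)) (b := 1)).exists_bound_of_continuousOn
    hcont.continuousOn
  refine ⟨C, fun x => ?_⟩
  by_cases hx : x ∈ Icc (0 : ℝ) 1
  · exact hC x hx
  · rw [deriv_smoothTransition_eq_zero hx, abs_zero]
    exact (norm_nonneg _).trans (hC 0 (by simp))

/-- A bound for the derivative of the standard smooth transition function. -/
def transitionConst : ℝ := exists_deriv_smoothTransition_le.choose

lemma abs_deriv_smoothTransition_le (x : ℝ) :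
    |deriv Real.smoothTransition x| ≤ transitionConst :=
  exists_deriv_smoothTransition_le.choose_spec x

lemma transitionConst_nonneg : 0 ≤ transitionConst :=
  (abs_nonneg _).trans (abs_deriv_smoothTransition_le 0)

/-- The weight `e^{-N/t} t^{-a}`. -/
def expWeight (N : ℝ) (a : ℕ) (t : ℝ) : ℝ := Real.exp (-N / t) * (1 / t) ^ a

lemma expWeight_pos (N : ℝ) (a : ℕ) {t : ℝ} (ht : 0 < t) : 0 < expWeight N a t := by
  unfold expWeight; positivity

lemma hasDerivAt_expWeight (N : ℝ) (a : ℕ) {t : ℝ} (ht : 0 < t) :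
    HasDerivAt (expWeight N a) (expWeight N a t * (N * (1 / t) ^ 2 - a * (1 / t))) t := by
  have h1 : HasDerivAt (fun t : ℝ => 1 / t) (-(1 / t) ^ 2) t := by
    have := hasDerivAt_inv ht.ne'
    simp only [one_div]
    exact this.congr_deriv (by rw [inv_pow])
  have h2 : HasDerivAt (fun t : ℝ => Real.exp (-N / t))
      (Real.exp (-N / t) * (N * (1 / t) ^ 2)) t := by
    have h := (h1.const_mul (-N)).exp
    have e : ∀ t : ℝ, -N * (1 / t) = -N / t := fun t => by ring
    simp only [e] at h
    convert h using 1
    ring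
  refine (h2.mul (h1.pow a)).congr_deriv ?_
  rcases a with _ | a
  · simp [expWeight]
  · simp only [expWeight, Nat.add_sub_cancel, Pi.pow_apply]
    push_cast
    ring

/-- The radial cut-off of the weight `e^{-N/t} t^{-a}` to the interval `(ε, r)`: it vanishes
outside and agrees with the weight on `[2ε, r/2]`. -/
def cutWeight (N : ℝ) (a : ℕ) (r ε t : ℝ) : ℝ :=
  Real.smoothTransition (t / ε - 1)
    * (Real.smoothTransition (2 - 2 * t / r) * expWeight N a t)

/-- The derivative of `cutWeight`. -/
def cutWeightDeriv (N : ℝ) (a : ℕ) (r ε t : ℝ) : ℝ :=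
  deriv Real.smoothTransition (t / ε - 1) * (1 / ε)
      * (Real.smoothTransition (2 - 2 * t / r) * expWeight N a t)
    + Real.smoothTransition (t / ε - 1)
      * (deriv Real.smoothTransition (2 - 2 * t / r) * (-(2 / r)) * expWeight N a t
        + Real.smoothTransition (2 - 2 * t / r)
          * (expWeight N a t * (N * (1 / t) ^ 2 - a * (1 / t))))

variable {N r ε t : ℝ} {a : ℕ}

lemma hasDerivAt_cutWeight (ht : 0 < t) :
    HasDerivAt (cutWeight N a r ε) (cutWeightDeriv N a r ε t) t := by
  have hS : ∀ x, HasDerivAt Real.smoothTransition (deriv Real.smoothTransition x) x := fun x =>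
    ((Real.smoothTransition.contDiff (n := 1)).differentiable (by simp) x).hasDerivAt
  have h1 : HasDerivAt (fun t : ℝ => t / ε - 1) (1 / ε) t :=
    ((hasDerivAt_id t).div_const ε).sub_const 1
  have h2 : HasDerivAt (fun t : ℝ => 2 - 2 * t / r) (-(2 / r)) t := by
    have := (((hasDerivAt_id t).const_mul 2).div_const r).const_sub 2
    exact this.congr_deriv (by ring)
  exact ((hS _).comp t h1).mul (((hS _).comp t h2).mul (hasDerivAt_expWeight N a ht))

lemma continuousAt_cutWeightDeriv (ht : 0 < t) : ContinuousAt (cutWeightDeriv N a r ε) t := by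
  have hS : Continuous Real.smoothTransition := Real.smoothTransition.continuous
  have hS' : Continuous (deriv Real.smoothTransition) :=
    (Real.smoothTransition.contDiff (n := 1)).continuous_deriv le_rfl
  have hE := (hasDerivAt_expWeight N a ht).continuousAt
  have hinv : ContinuousAt (fun t : ℝ => 1 / t) t := continuousAt_const.div continuousAt_id ht.ne'
  have c1 : ContinuousAt (fun t : ℝ => t / ε - 1) t := by fun_prop
  have c2 : ContinuousAt (fun t : ℝ => 2 - 2 * t / r) t := by fun_prop
  have s1 := hS.continuousAt.comp c1
  have s2 := hS.continuousAt.comp c2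
  have d1 := hS'.continuousAt.comp c1
  have d2 := hS'.continuousAt.comp c2
  exact ((d1.mul continuousAt_const).mul (s2.mul hE)).add
    (s1.mul (((d2.mul continuousAt_const).mul hE).add
      (s2.mul (hE.mul ((continuousAt_const.mul (hinv.pow 2)).sub
        (continuousAt_const.mul hinv))))))

lemma cutWeight_eq_zero (hε : 0 < ε) (hr : 0 < r) (ht : t ∉ Icc ε r) :
    cutWeight N a r ε t = 0 := by
  rcases lt_or_ge t ε with h | h
  · have : t / ε - 1 ≤ 0 := by rw [sub_nonpos, div_le_one hε]; exact h.le
    rw [cutWeight, Real.smoothTransition.zero_of_nonpos this, zero_mul]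
  · have h1 : r < t := by
      by_contra hc
      exact ht ⟨h, not_lt.1 hc⟩
    have : 2 - 2 * t / r ≤ 0 := by
      rw [sub_nonpos, le_div_iff₀ hr]
      linarith
    rw [cutWeight, Real.smoothTransition.zero_of_nonpos this, zero_mul, mul_zero]

lemma cutWeight_eq (hε : 0 < ε) (hr : 0 < r) (h1 : 2 * ε ≤ t) (h2 : t ≤ r / 2) :
    cutWeight N a r ε t = expWeight N a t := by
  have e1 : 1 ≤ t / ε - 1 := by rw [le_sub_iff_add_le, le_div_iff₀ hε]; linarith
  have e2 : 1 ≤ 2 - 2 * t / r := by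
    rw [le_sub_comm, div_le_iff₀ hr]
    linarith
  rw [cutWeight, Real.smoothTransition.one_of_one_le e1, Real.smoothTransition.one_of_one_le e2,
    one_mul, one_mul]

lemma cutWeight_nonneg (ht : 0 < t) : 0 ≤ cutWeight N a r ε t :=
  mul_nonneg (Real.smoothTransition.nonneg _)
    (mul_nonneg (Real.smoothTransition.nonneg _) (expWeight_pos N a ht).le)

lemma cutWeight_le (ht : 0 < t) : cutWeight N a r ε t ≤ expWeight N a t := by
  have hE := (expWeight_pos N a ht).le
  have h1 := Real.smoothTransition.le_one (t / ε - 1)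
  have h2 := Real.smoothTransition.le_one (2 - 2 * t / r)
  have h3 := Real.smoothTransition.nonneg (2 - 2 * t / r)
  calc cutWeight N a r ε t ≤ 1 * (1 * expWeight N a t) := by
        unfold cutWeight
        gcongr
    _ = _ := by ring

/-- Up to an error supported in `[r/2, r]`, the cut-off only increases the logarithmic derivative
of the weight. In particular the error does not depend on `ε`. -/
lemma le_cutWeightDeriv (hε : 0 < ε) (hr : 0 < r) (ht : 0 < t) :
    cutWeight N a r ε t * (N * (1 / t) ^ 2 - a * (1 / t))
        - (if t ∈ Icc (r / 2) r then transitionConst * (2 / r) * expWeight N a t else 0)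
      ≤ cutWeightDeriv N a r ε t := by
  have hE := (expWeight_pos N a ht).le
  have h1 := Real.smoothTransition.le_one (t / ε - 1)
  have h1' := Real.smoothTransition.nonneg (t / ε - 1)
  have h2' := Real.smoothTransition.nonneg (2 - 2 * t / r)
  have hd : 0 ≤ deriv Real.smoothTransition (t / ε - 1) :=
    Real.smoothTransition.monotone.deriv_nonneg
  have hp : 0 ≤ deriv Real.smoothTransition (t / ε - 1) * (1 / ε)
      * (Real.smoothTransition (2 - 2 * t / r) * expWeight N a t) := by positivity
  have hq : Real.smoothTransition (t / ε - 1)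
        * (deriv Real.smoothTransition (2 - 2 * t / r) * (2 / r) * expWeight N a t)
      ≤ if t ∈ Icc (r / 2) r then transitionConst * (2 / r) * expWeight N a t else 0 := by
    split_ifs with h
    · have h3 := (le_abs_self _).trans (abs_deriv_smoothTransition_le (2 - 2 * t / r))
      have hd2 : 0 ≤ deriv Real.smoothTransition (2 - 2 * t / r) :=
        Real.smoothTransition.monotone.deriv_nonneg
      calc _ ≤ 1 * (transitionConst * (2 / r) * expWeight N a t) := by gcongr
        _ = _ := one_mul _
    · have : 2 - 2 * t / r ∉ Icc (0 : ℝ) 1 := fun hc => h ⟨by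
        have := hc.2
        rw [sub_le_comm, le_div_iff₀ hr] at this
        linarith, by
        have := hc.1
        rw [sub_nonneg, div_le_iff₀ hr] at this
        linarith⟩
      rw [deriv_smoothTransition_eq_zero this]
      simp
  unfold cutWeightDeriv
  rw [cutWeight]
  nlinarith [hp, hq]

end Cutoff

/-! ### Ingredients of the Hardy inequality -/

section Hardy

variable {n : ℕ} [NeZero n] {m : ℕ} {M : Type*} [TopologicalSpace M]
  [ChartedSpace (EuclideanHalfSpace n) M] [IsManifold (𝓡∂ n) ∞ M] {r s : ℕ}
  {g : Metric n m M} {U : Set M}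

/-- The chain rule `⟨∇(φ ∘ d), ∇d⟩ = φ'(d) |∇d|²`. -/
lemma tinner_grad_comp (hm : m ≠ 0) (hU : IsOpen U) (hUi : U ⊆ (𝓡∂ n).interior M) {d : M → ℝ}
    (hd : CompC (n := n) 1 U (ofFun d)) {φ φ' : ℝ → ℝ}
    (hφ : ∀ x ∈ U, HasDerivAt φ (φ' (d x)) (d x)) (hφ' : ∀ x ∈ U, ContinuousAt φ' (d x))
    {x : M} (hx : x ∈ U) :
    tinner g x (covDeriv g (ofFun fun x => φ (d x)) x) (covDeriv g (ofFun d) x)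
      = φ' (d x) * normSq g (covDeriv g (ofFun d)) x := by
  have hx' := extChartAt_self_mem_chartDom (hUi hx)
  have hinv : (extChartAt (𝓡∂ n) x).symm (extChartAt (𝓡∂ n) x x) = x := extChartAt_to_inv x
  have hxO : extChartAt (𝓡∂ n) x x ∈ chartDomIn x U :=
    ⟨hx', by rw [mem_preimage, hinv]; exact hx⟩
  have hdd : DifferentiableAt ℝ (fun y => d ((extChartAt (𝓡∂ n) x).symm y))
      (extChartAt (𝓡∂ n) x x) :=
    ((compC_ofFun.1 hd x).contDiffAt ((isOpen_chartDomIn x hU).mem_nhds hxO)).differentiableAt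
      (by simp)
  have hder := (hφ _ hxO.2).comp_hasFDerivAt (f := fun y => d ((extChartAt (𝓡∂ n) x).symm y)) _
    hdd.hasFDerivAt
  have hθ := (isClassicalDeriv_comp (g := g) hm hU hd hφ hφ').1
  have h1 := tinner_grad_eq (g := g) hm hU hθ hd hxO
  have h2 := tinner_grad_eq (g := g) hm hU hd hd hxO
  rw [hinv] at h1 h2
  rw [h1, normSq_eq_tinner, h2, Finset.mul_sum]
  refine Finset.sum_congr rfl fun l _ => ?_
  have h3 : partialDeriv l (fun y => φ (d ((extChartAt (𝓡∂ n) x).symm y))) (extChartAt (𝓡∂ n) x x)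
      = φ' (d x) * partialDeriv l (fun y => d ((extChartAt (𝓡∂ n) x).symm y))
        (extChartAt (𝓡∂ n) x x) := by
    have h4 : fderiv ℝ (fun y => φ (d ((extChartAt (𝓡∂ n) x).symm y))) (extChartAt (𝓡∂ n) x x)
        = _ := hder.fderiv
    rw [partialDeriv, h4, hinv]; rfl
  rw [h3, mul_assoc]

/-- The pointwise inequality behind the Hardy estimate, in terms of numbers: `t` stands for the
distance, `X` for its inverse, `T` for `|∇d|`, `ψ` and `ψ'` for the cut-off weight and its
derivative, `Δ` for the Laplacian of the distance, `u` and `v` for the norms of the field and its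
derivative, and `W` for the term of the divergence in which the field is differentiated. The term
`N X²` in the logarithmic derivative of the weight dominates all the others: `X² T²` is lost to
`W`, and `X² / 2` to the Laplacian. -/
lemma hardy_pointwise {N a t X T Δ ψ ψ' e W u v : ℝ} (htX : t * X = 1) (hT : 1 ≤ T)
    (hψ : 0 ≤ ψ) (hψ' : ψ * (N * X ^ 2 - a * X) - e ≤ ψ') (hW : |W| ≤ v * (T * u))
    (hΔ : |Δ| ≤ X ^ 2 / 2) (ha : a * X ≤ a / 4 * X ^ 2) (hN : 5 / 2 ≤ N - a / 4) :
    ψ * X ^ 2 * u ^ 2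
      ≤ u ^ 2 * (ψ' * T ^ 2 + ψ * Δ) + 2 * ψ * W + (ψ * t ^ 2 * v ^ 2 + e * T ^ 2 * u ^ 2) := by
  have hT2 : 1 ≤ T ^ 2 := one_le_pow₀ hT
  have hX2 := sq_nonneg X
  have hu2 := sq_nonneg u
  have h1 : ψ * (N - a / 4) * X ^ 2 - e ≤ ψ' := by
    have := mul_le_mul_of_nonneg_left ha hψ
    nlinarith
  have h2 : (ψ * (N - a / 4) * X ^ 2 - e) * T ^ 2 * u ^ 2 ≤ ψ' * T ^ 2 * u ^ 2 := by gcongr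
  have h3 : -(ψ * (T ^ 2 * X ^ 2 * u ^ 2 + t ^ 2 * v ^ 2)) ≤ 2 * ψ * W := by
    have h4 : 2 * (v * (T * u)) ≤ T ^ 2 * X ^ 2 * u ^ 2 + t ^ 2 * v ^ 2 := by
      have h5 := sq_nonneg (T * X * u - t * v)
      have h6 : (T * X * u) * (t * v) = v * (T * u) := by
        linear_combination (T * u * v) * htX
      nlinarith
    have := neg_le_of_abs_le hW
    nlinarith [mul_le_mul_of_nonneg_left h4 hψ, mul_le_mul_of_nonneg_left this hψ]
  have h7 : -(ψ * (X ^ 2 / 2) * u ^ 2) ≤ ψ * Δ * u ^ 2 := by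
    have := neg_le_of_abs_le hΔ
    have := mul_le_mul_of_nonneg_right (mul_le_mul_of_nonneg_left this hψ) hu2
    linarith
  have h8 : ψ * X ^ 2 * u ^ 2 * (3 / 2) ≤ ψ * X ^ 2 * u ^ 2 * ((N - a / 4 - 1) * T ^ 2) := by
    have : (3 / 2 : ℝ) ≤ (N - a / 4 - 1) * T ^ 2 := by nlinarith
    gcongr
  nlinarith [h2, h3, h7, h8]

variable [MeasurableSpace M]

lemma IsProfile.weight_eq_exp {ρ : ℝ → ℝ} {r₁ r₀ : ℝ} (h : IsProfile ρ r₁ r₀) (N : ℝ) {x : M}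
    (hx : 0 < boundaryDist g x) (hx1 : boundaryDist g x < r₁) :
    weight g ρ N x = Real.exp (-N / boundaryDist g x) := by
  rw [weight, h.eq_exp _ hx hx1, ← Real.exp_mul]
  congr 1
  ring

lemma IsProfile.continuousOn_weight [RegularSpace M] [ConnectedSpace M]
    (hbd : ((𝓡∂ n).boundary M).Nonempty) {ρ : ℝ → ℝ} {r₁ r₀ : ℝ} (h : IsProfile ρ r₁ r₀) (N : ℝ) :
    ContinuousOn (weight g ρ N) ((𝓡∂ n).interior M) := by
  have h1 : ContinuousOn (fun x => ρ (boundaryDist g x)) ((𝓡∂ n).interior M) :=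
    h.smooth.continuousOn.comp (continuous_boundaryDist hbd).continuousOn
      fun x hx => boundaryDist_pos hbd hx
  exact h1.rpow_const fun x hx => Or.inl (h.pos _ (boundaryDist_pos hbd hx)).ne'

lemma blowup_eq {x : M} (hx : 0 < boundaryDist g x) (hx1 : boundaryDist g x ≤ 1) :
    blowup g x = 1 / boundaryDist g x :=
  max_eq_right ((one_le_div hx).2 hx1)

lemma continuousOn_blowup [RegularSpace M] [ConnectedSpace M]
    (hbd : ((𝓡∂ n).boundary M).Nonempty) : ContinuousOn (blowup g) ((𝓡∂ n).interior M) :=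
  continuousOn_const.sup (continuousOn_const.div (continuous_boundaryDist hbd).continuousOn
    fun _ hx => (boundaryDist_pos hbd hx).ne')

variable [BorelSpace M] [CompactSpace M] [T2Space M]

/-- A finite weighted energy gives local square integrability. -/
lemma integrableOn_normSq {σ : M → ℝ} (hσ : ContinuousOn σ ((𝓡∂ n).interior M))
    (hσ0 : ∀ x ∈ (𝓡∂ n).interior M, 0 < σ x) {u : TensorField n M r s} (hum : IsMeasurableField u)
    (hu : weightedEnergy g σ u < ⊤) {K : Set M} (hKi : K ⊆ (𝓡∂ n).interior M) (hK : IsCompact K) :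
    IntegrableOn (normSq g u) K (volumeMeasure g) := by
  rcases K.eq_empty_or_nonempty with rfl | hne
  · exact integrableOn_empty
  obtain ⟨x₀, hx₀, hmin⟩ := hK.exists_isMinOn hne (hσ.mono hKi)
  have hc := hσ0 x₀ (hKi hx₀)
  refine ⟨(hum.aemeasurable_normSq.mono_measure
    (Measure.restrict_mono hKi le_rfl)).aestronglyMeasurable, ?_⟩
  rw [hasFiniteIntegral_iff_ofReal (Filter.Eventually.of_forall (normSq_nonneg g u))]
  calc ∫⁻ x in K, ENNReal.ofReal (normSq g u x) ∂(volumeMeasure g)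
      ≤ ∫⁻ x in K, ENNReal.ofReal (σ x₀)⁻¹ * ENNReal.ofReal (normSq g u x * σ x)
          ∂(volumeMeasure g) := by
        refine setLIntegral_mono' hK.measurableSet fun x hx => ?_
        rw [← ENNReal.ofReal_mul (inv_nonneg.2 hc.le)]
        refine ENNReal.ofReal_le_ofReal ?_
        have h1 : σ x₀ ≤ σ x := hmin hx
        have h2 := normSq_nonneg g u x
        rw [inv_mul_eq_div, le_div_iff₀ hc]
        gcongr
    _ = ENNReal.ofReal (σ x₀)⁻¹ * ∫⁻ x in K, ENNReal.ofReal (normSq g u x * σ x)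
          ∂(volumeMeasure g) := lintegral_const_mul' _ _ ENNReal.ofReal_ne_top
    _ ≤ ENNReal.ofReal (σ x₀)⁻¹ * weightedEnergy g σ u := by
        gcongr
        exact lintegral_mono_set hKi
    _ < ⊤ := ENNReal.mul_lt_top ENNReal.ofReal_lt_top hu

lemma aemeasurable_normSq_mul {σ : M → ℝ} (hσ : ContinuousOn σ ((𝓡∂ n).interior M))
    {u : TensorField n M r s} (hum : IsMeasurableField u) :
    AEMeasurable (fun x => normSq g u x * σ x)
      ((volumeMeasure g).restrict ((𝓡∂ n).interior M)) :=
  hum.aemeasurable_normSq.mul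
    (hσ.aemeasurable (isOpen_interior_manifold (n := n) (M := M)).measurableSet)

lemma integrableOn_normSq_mul {σ : M → ℝ} (hσ : ContinuousOn σ ((𝓡∂ n).interior M))
    (hσ0 : ∀ x ∈ (𝓡∂ n).interior M, 0 < σ x) {u : TensorField n M r s} (hum : IsMeasurableField u)
    (hu : weightedEnergy g σ u < ⊤) :
    IntegrableOn (fun x => normSq g u x * σ x) ((𝓡∂ n).interior M) (volumeMeasure g) := by
  refine ⟨(aemeasurable_normSq_mul hσ hum).aestronglyMeasurable, ?_⟩
  rw [hasFiniteIntegral_iff_ofReal]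
  · exact hu
  · refine (ae_restrict_iff' (isOpen_interior_manifold (n := n) (M := M)).measurableSet).2
      (Filter.Eventually.of_forall fun x hx => mul_nonneg (normSq_nonneg g u x) (hσ0 x hx).le)

end Hardy

/-! ### The Hardy inequality -/

section Hardy

variable {n : ℕ} [NeZero n] {m : ℕ} {M : Type*} [TopologicalSpace M]
  [ChartedSpace (EuclideanHalfSpace n) M] [IsManifold (𝓡∂ n) ∞ M] {r s : ℕ}
  {g : Metric n m M} {U : Set M}

/-- The factor of the lower order term in the Hardy inequality. The first summand is due to the
outer cut-off, on `[r₂/2, r₂]`, and the second one to the region where the distance exceeds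
`r₂/2`. -/
def hardyConst (p : ℕ) (r₂ D : ℝ) : ℝ :=
  transitionConst * (2 / r₂) * (2 / r₂) ^ (4 * p + 2) * D ^ 2 + (2 / r₂) ^ (4 * (p + 1))

lemma hardyConst_pos (p : ℕ) {r₂ : ℝ} (hr : 0 < r₂) (D : ℝ) : 0 < hardyConst p r₂ D := by
  have := transitionConst_nonneg
  unfold hardyConst
  positivity

/-- The pointwise inequality at a point of the support of the cut-off. The power `4p + 2` makes `ψ
d^{-2}` the weight of `|u|²` with `d^{-4(p+1)}`, and `ψ d²` the weight of `|∇u|²` with `d^{-4p}`.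
-/
lemma hardy_pointwise_divField {p : ℕ} {N r₂ ε D : ℝ} (hN : 4 * (4 * ((p : ℝ) + 1) - 3) ≤ N)
    {u : TensorField n M r s} {v : TensorField n M r (s + 1)} {x : M} (hε : 0 < ε) (hr₂ : 0 < r₂)
    (hd : 0 < boundaryDist g x) (hdr : boundaryDist g x ≤ r₂)
    (hΔ : r₂ ^ 2 * |laplacian g (boundaryDist g) x| + 2 * r₂ ≤ 1 / 2)
    (hT : 1 ≤ tnorm g (covDeriv g (ofFun (boundaryDist g))) x)
    (hTD : tnorm g (covDeriv g (ofFun (boundaryDist g))) x ≤ D)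
    (hgrad : tinner g x
        (covDeriv g (ofFun fun x => cutWeight N (4 * p + 2) r₂ ε (boundaryDist g x)) x)
        (covDeriv g (ofFun (boundaryDist g)) x)
      = cutWeightDeriv N (4 * p + 2) r₂ ε (boundaryDist g x)
        * normSq g (covDeriv g (ofFun (boundaryDist g))) x) :
    cutWeight N (4 * p + 2) r₂ ε (boundaryDist g x) * (1 / boundaryDist g x) ^ 2 * normSq g u x
      ≤ divField g (boundaryDist g) (fun x => cutWeight N (4 * p + 2) r₂ ε (boundaryDist g x))
          u v x
        + (normSq g v x * (Real.exp (-N / boundaryDist g x) * (1 / boundaryDist g x) ^ (4 * p))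
          + transitionConst * (2 / r₂) * (2 / r₂) ^ (4 * p + 2) * D ^ 2
            * (normSq g u x * Real.exp (-N / boundaryDist g x))) := by
  set t := boundaryDist g x with ht
  set T := tnorm g (covDeriv g (ofFun (boundaryDist g))) x with hTdef
  set ψ := cutWeight N (4 * p + 2) r₂ ε t with hψdef
  have hc := transitionConst_nonneg
  have hX : 0 < 1 / t := by positivity
  -- both parts of the smallness of `r₂` are needed: `r₂ ≤ 1/4` and `r₂² |Δd| ≤ 1/2`
  have hr4 : r₂ ≤ 1 / 4 := by
    have : 0 ≤ r₂ ^ 2 * |laplacian g (boundaryDist g) x| := by positivity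
    linarith
  have htX : t * (1 / t) = 1 := mul_one_div_cancel hd.ne'
  have hX4 : 4 ≤ 1 / t := by rw [le_div_iff₀ hd]; linarith
  have hXr : 1 / r₂ ≤ 1 / t := one_div_le_one_div_of_le hd hdr
  have hΔ' : |laplacian g (boundaryDist g) x| ≤ (1 / t) ^ 2 / 2 := by
    have h1 : |laplacian g (boundaryDist g) x| ≤ (1 / r₂) ^ 2 / 2 := by
      rw [one_div, inv_pow, ← one_div, div_div, le_div_iff₀ (by positivity)]
      nlinarith
    refine h1.trans ?_
    gcongr
  set e : ℝ := if t ∈ Icc (r₂ / 2) r₂ then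
    transitionConst * (2 / r₂) * expWeight N (4 * p + 2) t else 0 with he
  have heE : e ≤ transitionConst * (2 / r₂) * (2 / r₂) ^ (4 * p + 2) * Real.exp (-N / t) := by
    rw [he]
    split_ifs with h
    · have : 1 / t ≤ 2 / r₂ := by
        rw [div_le_div_iff₀ hd hr₂]
        linarith [h.1]
      calc transitionConst * (2 / r₂) * expWeight N (4 * p + 2) t
          ≤ transitionConst * (2 / r₂) * (Real.exp (-N / t) * (2 / r₂) ^ (4 * p + 2)) := by
            unfold expWeight; gcongr
        _ = _ := by ring
    · positivity
  have he0 : 0 ≤ e := by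
    rw [he]
    have := (expWeight_pos N (4 * p + 2) hd).le
    split_ifs <;> positivity
  have hψ0 : 0 ≤ ψ := cutWeight_nonneg hd
  have hψ' := le_cutWeightDeriv (N := N) (a := 4 * p + 2) hε hr₂ hd
  have hW := abs_tinner_le g v (prod (slotsFirst s) (covDeriv g (ofFun (boundaryDist g))) u) x
  rw [tnorm_prod] at hW
  have key := hardy_pointwise (a := ((4 * p + 2 : ℕ) : ℝ)) (N := N) (u := tnorm g u x)
    (v := tnorm g v x) htX hT hψ0 hψ' hW hΔ' ?_ ?_
  · rw [tnorm_sq g u, tnorm_sq g v] at key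
    rw [divField, hgrad, ← tnorm_sq g (covDeriv g (ofFun (boundaryDist g)))]
    refine key.trans (add_le_add (le_of_eq rfl) (add_le_add ?_ ?_))
    · have h1 : ψ ≤ expWeight N (4 * p + 2) t := cutWeight_le hd
      have h2 := normSq_nonneg g v x
      calc ψ * t ^ 2 * normSq g v x
          ≤ expWeight N (4 * p + 2) t * t ^ 2 * normSq g v x := by gcongr
        _ = normSq g v x * (Real.exp (-N / t) * (1 / t) ^ (4 * p)) * (t * (1 / t)) ^ 2 := by
            unfold expWeight; ring
        _ = _ := by rw [htX]; ring
    · have h2 := normSq_nonneg g u x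
      calc e * T ^ 2 * normSq g u x
          ≤ transitionConst * (2 / r₂) * (2 / r₂) ^ (4 * p + 2) * Real.exp (-N / t) * D ^ 2
            * normSq g u x := by gcongr
        _ = _ := by ring
  · have h0 : (0 : ℝ) ≤ ((4 * p + 2 : ℕ) : ℝ) := Nat.cast_nonneg _
    nlinarith [mul_le_mul_of_nonneg_left hX4 (mul_nonneg h0 hX.le)]
  · push_cast
    have : (0 : ℝ) ≤ p := Nat.cast_nonneg _
    linarith

variable [MeasurableSpace M] [BorelSpace M] [CompactSpace M] [T2Space M] [ConnectedSpace M]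

/-- The weight `ρ_g` times the `b`-th power of `max 1 (1 / d)`. -/
def blowupWeight (g : Metric n m M) (ρ : ℝ → ℝ) (N : ℝ) (b : ℕ) (x : M) : ℝ :=
  weight g ρ N x * blowup g x ^ b

lemma blowupWeight_zero (g : Metric n m M) (ρ : ℝ → ℝ) (N : ℝ) :
    blowupWeight g ρ N 0 = weight g ρ N := by
  funext x; rw [blowupWeight, pow_zero, mul_one]

variable {ρ : ℝ → ℝ} {r₁ r₀ N r₂ D : ℝ}

lemma IsProfile.blowupWeight_pos (hbd : ((𝓡∂ n).boundary M).Nonempty) (h : IsProfile ρ r₁ r₀)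
    (b : ℕ) {x : M} (hx : x ∈ (𝓡∂ n).interior M) : 0 < blowupWeight g ρ N b x :=
  mul_pos (h.weight_pos N (boundaryDist_pos hbd hx))
    (pow_pos (one_pos.trans_le (one_le_blowup x)) b)

lemma IsProfile.continuousOn_blowupWeight (hbd : ((𝓡∂ n).boundary M).Nonempty)
    (h : IsProfile ρ r₁ r₀) (b : ℕ) :
    ContinuousOn (blowupWeight g ρ N b) ((𝓡∂ n).interior M) :=
  (h.continuousOn_weight hbd N).mul ((continuousOn_blowup hbd).pow b)

lemma IsProfile.blowupWeight_eq (h : IsProfile ρ r₁ r₀) (hr : r₁ < r₀) (hr₀ : r₀ < 1 / 2) (b : ℕ)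
    {x : M} (hx : 0 < boundaryDist g x) (hx1 : boundaryDist g x < r₁) :
    blowupWeight g ρ N b x
      = Real.exp (-N / boundaryDist g x) * (1 / boundaryDist g x) ^ b := by
  rw [blowupWeight, h.weight_eq_exp N hx hx1, blowup_eq hx (by linarith)]

/-- The Hardy inequality with the left hand side restricted to a region away from the boundary,
with a bound that does not depend on the region: integrate the pointwise inequality. -/
lemma lintegral_le_of_cutoff (hm : 2 ≤ m) (hbd : ((𝓡∂ n).boundary M).Nonempty)
    (h : IsProfile ρ r₁ r₀) (hr : r₁ < r₀) (hr₀ : r₀ < 1 / 2)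
    (hreg : HasRegularCollar g r₀) (hr₂ : IsInnerRadius g r₂ r₁ r₀)
    (hD : ∀ x ∈ (𝓡∂ n).interior M, boundaryDist g x < r₀ →
      tnorm g (covDeriv g (ofFun (boundaryDist g))) x ≤ D) {p : ℕ}
    (hN : 4 * (4 * ((p : ℝ) + 1) - 3) ≤ N) {u : TensorField n M r s}
    {v : TensorField n M r (s + 1)} (hum : IsMeasurableField u) (hvm : IsMeasurableField v)
    (hw : HasWeakCovDeriv g u v) (hu : weightedEnergy g (blowupWeight g ρ N 0) u < ⊤)
    (hv : weightedEnergy g (blowupWeight g ρ N (4 * p)) v < ⊤) {ε : ℝ} (hε : 0 < ε) :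
    ∫⁻ x in (𝓡∂ n).interior M ∩ {x | 2 * ε ≤ boundaryDist g x ∧ boundaryDist g x ≤ r₂ / 2},
        ENNReal.ofReal (normSq g u x * blowupWeight g ρ N (4 * (p + 1)) x) ∂(volumeMeasure g)
      ≤ weightedEnergy g (blowupWeight g ρ N (4 * p)) v
        + ENNReal.ofReal (transitionConst * (2 / r₂) * (2 / r₂) ^ (4 * p + 2) * D ^ 2)
          * weightedEnergy g (blowupWeight g ρ N 0) u := by
  obtain ⟨h20, h21, hΔ⟩ := hr₂
  obtain ⟨r', hr', hreg⟩ := hreg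
  set d := boundaryDist g with hddef
  set B : ℝ := transitionConst * (2 / r₂) * (2 / r₂) ^ (4 * p + 2) * D ^ 2 with hB
  have hB0 : 0 ≤ B := by have := transitionConst_nonneg; positivity
  have hcont : Continuous d := continuous_boundaryDist hbd
  have hint := isOpen_interior_manifold (n := n) (M := M)
  set U : Set M := (𝓡∂ n).interior M ∩ {x | d x < r'} with hUdef
  have hU : IsOpen U := hint.inter (isOpen_lt hcont continuous_const)
  have hUi : U ⊆ (𝓡∂ n).interior M := inter_subset_left
  have hdpos : ∀ x ∈ (𝓡∂ n).interior M, 0 < d x := fun x hx => boundaryDist_pos hbd hx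
  have hregU : ContMDiffOn (𝓡∂ n) 𝓘(ℝ, ℝ) (m : WithTop ℕ∞) d U := hreg.mono inter_subset_right
  have hd2 : CompC (n := n) 2 U (ofFun d) :=
    compC_of_contMDiffOn (hregU.of_le (by exact_mod_cast hm))
  have hd1 : CompC (n := n) 1 U (ofFun d) := hd2.of_le one_le_two
  set θ : M → ℝ := fun x => cutWeight N (4 * p + 2) r₂ ε (d x) with hθdef
  have hder : ∀ x ∈ U, HasDerivAt (cutWeight N (4 * p + 2) r₂ ε)
      (cutWeightDeriv N (4 * p + 2) r₂ ε (d x)) (d x) := fun x hx =>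
    hasDerivAt_cutWeight (hdpos x hx.1)
  have hder' : ∀ x ∈ U, ContinuousAt (cutWeightDeriv N (4 * p + 2) r₂ ε) (d x) := fun x hx =>
    continuousAt_cutWeightDeriv (hdpos x hx.1)
  have hθ : CompC (n := n) 1 U (ofFun θ) :=
    (isClassicalDeriv_comp (g := g) (by omega) hU hd1 hder hder').1
  set K : Set M := {x | ε ≤ d x ∧ d x ≤ r₂} with hKdef
  have hKc : IsClosed K := (isClosed_le continuous_const hcont).inter
    (isClosed_le hcont continuous_const)
  have hK : IsCompact K := hKc.isCompact
  have hKi : K ⊆ (𝓡∂ n).interior M := fun x hx =>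
    mem_interior_of_boundaryDist_pos (hε.trans_le hx.1)
  have hKU : K ⊆ U := fun x hx => ⟨hKi hx, by
    have := hx.2
    show d x < r'
    linarith⟩
  have hθK : ∀ x ∉ K, θ x = 0 := fun x hx => cutWeight_eq_zero hε h20 hx
  have hσ := fun b => h.continuousOn_blowupWeight (g := g) (N := N) hbd b
  have hσ0 := fun b x (hx : x ∈ (𝓡∂ n).interior M) => h.blowupWeight_pos (g := g) (N := N) hbd b hx
  have hul : ∀ K ⊆ U, IsCompact K → IntegrableOn (normSq g u) K (volumeMeasure g) :=
    fun K hK hKc => integrableOn_normSq (hσ 0) (hσ0 0) hum hu (hK.trans hUi) hKc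
  have hvl : ∀ K ⊆ U, IsCompact K → IntegrableOn (normSq g v) K (volumeMeasure g) :=
    fun K hK hKc => integrableOn_normSq (hσ _) (hσ0 _) hvm hv (hK.trans hUi) hKc
  have hZi := integrableOn_divField hm hU hUi hd2 hθ hum hvm hul hvl hK hKU hθK
  have hZ := setIntegral_divField hm hU hUi hd2 hθ hum hvm hw hul hvl hK hKU hθK
  set Z := divField g d θ u v with hZdef
  set A : M → ℝ := fun x => θ x * (1 / d x) ^ 2 * normSq g u x with hAdef
  set R : M → ℝ := fun x => normSq g v x * blowupWeight g ρ N (4 * p) x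
    + B * (normSq g u x * blowupWeight g ρ N 0 x) with hRdef
  have hR0 : ∀ x ∈ U, 0 ≤ R x := fun x hx => by
    have h1 := normSq_nonneg g v x
    have h2 := normSq_nonneg g u x
    have h3 := (hσ0 (4 * p) x hx.1).le
    have h4 := (hσ0 0 x hx.1).le
    positivity
  have hRi : IntegrableOn R U (volumeMeasure g) :=
    ((integrableOn_normSq_mul (hσ _) (hσ0 _) hvm hv).add
      ((integrableOn_normSq_mul (hσ _) (hσ0 _) hum hu).const_mul B)).mono_set hUi
  have hA0 : ∀ x ∈ U, 0 ≤ A x := fun x hx => by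
    have h1 := normSq_nonneg g u x
    have h2 : 0 ≤ θ x := cutWeight_nonneg (hdpos x hx.1)
    positivity
  have hAZR : ∀ x ∈ U, A x ≤ Z x + R x := fun x hx => by
    by_cases hxK : x ∈ K
    · have hx0 := hdpos x hx.1
      have hxr : d x < r₀ := by have := hxK.2; linarith
      have hT := one_le_tnorm_grad (g := g) (by omega) hbd hU hUi
        (hregU.of_le (by exact_mod_cast (by omega : 1 ≤ m))) hx
      have h1 := hardy_pointwise_divField (u := u) (v := v) hN hε h20 hx0 hxK.2 (hΔ x hx.1 hxr)
        hT (hD x hx.1 hxr) (tinner_grad_comp (by omega) hU hUi hd1 hder hder' hx)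
      have h2 := fun b => h.blowupWeight_eq (g := g) (N := N) hr hr₀ b hx0
        (by have := hxK.2; linarith : d x < r₁)
      simp only [hAdef, hRdef, h2, pow_zero, mul_one]
      exact h1
    · have h1 : Z x = 0 := divField_eq_zero
        (Filter.eventually_of_mem (hKc.isOpen_compl.mem_nhds hxK) fun z hz => hθK z hz)
      have h2 : A x = 0 := by simp only [hAdef, hθK x hxK, zero_mul]
      rw [h1, h2, zero_add]
      exact hR0 x hx
  have hUm : MeasurableSet U := hU.measurableSet
  have hsub : (𝓡∂ n).interior M ∩ {x | 2 * ε ≤ d x ∧ d x ≤ r₂ / 2} ⊆ U := fun x hx =>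
    ⟨hx.1, by
      have := hx.2.2
      show d x < r'
      linarith⟩
  have hSm : MeasurableSet ((𝓡∂ n).interior M ∩ {x | 2 * ε ≤ d x ∧ d x ≤ r₂ / 2}) :=
    hint.measurableSet.inter ((isClosed_le continuous_const hcont).inter
      (isClosed_le hcont continuous_const)).measurableSet
  -- the divergence integrates to zero, so the pointwise inequality leaves only the remainder
  calc ∫⁻ x in (𝓡∂ n).interior M ∩ {x | 2 * ε ≤ d x ∧ d x ≤ r₂ / 2},
        ENNReal.ofReal (normSq g u x * blowupWeight g ρ N (4 * (p + 1)) x) ∂(volumeMeasure g)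
      = ∫⁻ x in (𝓡∂ n).interior M ∩ {x | 2 * ε ≤ d x ∧ d x ≤ r₂ / 2},
        ENNReal.ofReal (A x) ∂(volumeMeasure g) := by
        refine setLIntegral_congr_fun hSm fun x hx => ?_
        have hx0 := hdpos x hx.1
        have h1 := h.blowupWeight_eq (g := g) (N := N) hr hr₀ (4 * (p + 1)) hx0
          (by have := hx.2.2; linarith : d x < r₁)
        simp only [hAdef, hθdef]
        rw [h1, cutWeight_eq hε h20 hx.2.1 hx.2.2, expWeight]
        congr 1
        ring
    _ ≤ ∫⁻ x in U, ENNReal.ofReal (A x) ∂(volumeMeasure g) := lintegral_mono_set hsub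
    _ ≤ ∫⁻ x in U, ENNReal.ofReal (Z x + R x) ∂(volumeMeasure g) :=
        setLIntegral_mono' hUm fun x hx => ENNReal.ofReal_le_ofReal (hAZR x hx)
    _ = ENNReal.ofReal (∫ x in U, (Z x + R x) ∂(volumeMeasure g)) :=
        (ofReal_integral_eq_lintegral_ofReal (hZi.add hRi)
          ((ae_restrict_iff' hUm).2 (Filter.Eventually.of_forall fun x hx =>
            (hA0 x hx).trans (hAZR x hx)))).symm
    _ = ENNReal.ofReal (∫ x in U, R x ∂(volumeMeasure g)) := by
        rw [integral_add hZi hRi, hZ, zero_add]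
    _ = ∫⁻ x in U, ENNReal.ofReal (R x) ∂(volumeMeasure g) :=
        ofReal_integral_eq_lintegral_ofReal hRi
          ((ae_restrict_iff' hUm).2 (Filter.Eventually.of_forall hR0))
    _ ≤ ∫⁻ x in (𝓡∂ n).interior M, ENNReal.ofReal (R x) ∂(volumeMeasure g) :=
        lintegral_mono_set hUi
    _ = ∫⁻ x in (𝓡∂ n).interior M,
          (ENNReal.ofReal (normSq g v x * blowupWeight g ρ N (4 * p) x)
            + ENNReal.ofReal B * ENNReal.ofReal (normSq g u x * blowupWeight g ρ N 0 x))
          ∂(volumeMeasure g) := by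
        refine setLIntegral_congr_fun hint.measurableSet fun x hx => ?_
        have h1 := mul_nonneg (normSq_nonneg g v x) (hσ0 (4 * p) x hx).le
        have h2 := mul_nonneg (normSq_nonneg g u x) (hσ0 0 x hx).le
        simp only [hRdef]
        rw [ENNReal.ofReal_add h1 (mul_nonneg hB0 h2), ENNReal.ofReal_mul hB0]
    _ = _ := by
        rw [lintegral_add_left' (aemeasurable_normSq_mul (hσ _) hvm).ennreal_ofReal,
          lintegral_const_mul' _ _ ENNReal.ofReal_ne_top]
        rfl

/-- **Hardy inequality.** A factor `d^{-4(p+1)}` in front of `|u|²` is controlled by a factor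
`d^{-4p}` in front of `|∇u|²`. No finiteness is assumed of the left hand side: it is the limit of
integrals over regions away from the boundary. -/
lemma weightedEnergy_blowupWeight_succ_le (hm : 2 ≤ m) (hbd : ((𝓡∂ n).boundary M).Nonempty)
    (h : IsProfile ρ r₁ r₀) (hr : r₁ < r₀) (hr₀ : r₀ < 1 / 2)
    (hreg : HasRegularCollar g r₀) (hr₂ : IsInnerRadius g r₂ r₁ r₀)
    (hD : ∀ x ∈ (𝓡∂ n).interior M, boundaryDist g x < r₀ →
      tnorm g (covDeriv g (ofFun (boundaryDist g))) x ≤ D) {p : ℕ}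
    (hN : 4 * (4 * ((p : ℝ) + 1) - 3) ≤ N) {u : TensorField n M r s}
    {v : TensorField n M r (s + 1)} (hum : IsMeasurableField u) (hvm : IsMeasurableField v)
    (hw : HasWeakCovDeriv g u v) :
    weightedEnergy g (blowupWeight g ρ N (4 * (p + 1))) u
      ≤ weightedEnergy g (blowupWeight g ρ N (4 * p)) v
        + ENNReal.ofReal (hardyConst p r₂ D) * weightedEnergy g (blowupWeight g ρ N 0) u := by
  have h20 := hr₂.1
  rcases eq_or_ne (weightedEnergy g (blowupWeight g ρ N (4 * p)) v) ⊤ with hv | hv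
  · rw [hv, top_add]; exact le_top
  rcases eq_or_ne (weightedEnergy g (blowupWeight g ρ N 0) u) ⊤ with hu | hu
  · rw [hu, ENNReal.mul_top (ENNReal.ofReal_pos.2 (hardyConst_pos p h20 D)).ne', add_top]
    exact le_top
  have hcont : Continuous (boundaryDist g) := continuous_boundaryDist hbd
  have hint := isOpen_interior_manifold (n := n) (M := M)
  -- an exhaustion of the region `d ≤ r₂ / 2`
  set S : ℕ → Set M := fun i => (𝓡∂ n).interior M ∩
    {x | 2 * (1 / ((i : ℝ) + 1)) ≤ boundaryDist g x ∧ boundaryDist g x ≤ r₂ / 2} with hS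
  set F : M → ℝ≥0∞ := fun x =>
    ENNReal.ofReal (normSq g u x * blowupWeight g ρ N (4 * (p + 1)) x) with hF
  set Q := weightedEnergy g (blowupWeight g ρ N (4 * p)) v
    + ENNReal.ofReal (transitionConst * (2 / r₂) * (2 / r₂) ^ (4 * p + 2) * D ^ 2)
      * weightedEnergy g (blowupWeight g ρ N 0) u with hQ
  have hcover : (𝓡∂ n).interior M ⊆
      (⋃ i, S i) ∪ ((𝓡∂ n).interior M ∩ {x | r₂ / 2 < boundaryDist g x}) := fun x hx => by
    rcases lt_or_ge (r₂ / 2) (boundaryDist g x) with hlt | hge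
    · exact Or.inr ⟨hx, hlt⟩
    · obtain ⟨i, hi⟩ := exists_nat_one_div_lt (half_pos (boundaryDist_pos (g := g) hbd hx))
      exact Or.inl (mem_iUnion.2 ⟨i, hx, by linarith, hge⟩)
  have hmono : Monotone S := fun i j hij x hx => ⟨hx.1, by
    have := one_div_le_one_div_of_le (by positivity : (0 : ℝ) < (i : ℝ) + 1)
      (by gcongr : (i : ℝ) + 1 ≤ (j : ℝ) + 1)
    have := hx.2.1
    linarith, hx.2.2⟩
  have h1 : ∫⁻ x in ⋃ i, S i, F x ∂(volumeMeasure g) ≤ Q := by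
    rw [setLIntegral_iUnion_of_directed _ hmono.directed_le]
    exact iSup_le fun i => lintegral_le_of_cutoff hm hbd h hr hr₀ hreg hr₂ hD hN hum hvm hw
      hu.lt_top hv.lt_top (by positivity)
  have h2 : ∫⁻ x in (𝓡∂ n).interior M ∩ {x | r₂ / 2 < boundaryDist g x}, F x ∂(volumeMeasure g)
      ≤ ENNReal.ofReal ((2 / r₂) ^ (4 * (p + 1)))
        * weightedEnergy g (blowupWeight g ρ N 0) u := by
    rw [weightedEnergy, ← lintegral_const_mul' _ _ ENNReal.ofReal_ne_top]
    refine (setLIntegral_mono' (hint.inter (isOpen_lt continuous_const hcont)).measurableSet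
      fun x hx => ?_).trans (lintegral_mono_set inter_subset_left)
    rw [← ENNReal.ofReal_mul (by positivity)]
    refine ENNReal.ofReal_le_ofReal ?_
    have hx2 : r₂ / 2 < boundaryDist g x := hx.2
    have hb : blowup g x ≤ 2 / r₂ := max_le (by
        rw [le_div_iff₀ h20]
        linarith [hr₂.2.1]) (by
        rw [div_le_div_iff₀ (boundaryDist_pos hbd hx.1) h20]
        linarith)
    have hb0 := one_pos.trans_le (one_le_blowup (g := g) x)
    have h3 := normSq_nonneg g u x
    have h4 := (h.weight_pos (g := g) N (boundaryDist_pos hbd hx.1)).le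
    calc normSq g u x * (weight g ρ N x * blowup g x ^ (4 * (p + 1)))
        ≤ normSq g u x * (weight g ρ N x * (2 / r₂) ^ (4 * (p + 1))) := by gcongr
      _ = _ := by rw [blowupWeight, pow_zero]; ring
  calc weightedEnergy g (blowupWeight g ρ N (4 * (p + 1))) u
      ≤ ∫⁻ x in (⋃ i, S i) ∪ ((𝓡∂ n).interior M ∩ {x | r₂ / 2 < boundaryDist g x}), F x
          ∂(volumeMeasure g) := lintegral_mono_set hcover
    _ ≤ Q + ENNReal.ofReal ((2 / r₂) ^ (4 * (p + 1)))
        * weightedEnergy g (blowupWeight g ρ N 0) u :=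
        (lintegral_union_le _ _ _).trans (add_le_add h1 h2)
    _ = _ := by
        have := transitionConst_nonneg
        rw [hQ, add_assoc, ← add_mul, ← ENNReal.ofReal_add (by positivity) (by positivity)]
        rfl

/-- The constant of the iterated Hardy inequality. -/
def iterHardyConst (r₂ D : ℝ) : ℕ → ℝ
  | 0 => 1
  | p + 1 => iterHardyConst r₂ D p + hardyConst p r₂ D

lemma iterHardyConst_pos (h20 : 0 < r₂) (p : ℕ) : 0 < iterHardyConst r₂ D p := by
  induction p with
  | zero => exact one_pos
  | succ p ih => exact add_pos ih (hardyConst_pos p h20 D)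

/-- The Hardy inequality along a jet: each step trades four powers of `1 / d` for one derivative. -/
lemma weightedEnergy_blowupWeight_le (hm : 2 ≤ m) (hbd : ((𝓡∂ n).boundary M).Nonempty)
    (h : IsProfile ρ r₁ r₀) (hr : r₁ < r₀) (hr₀ : r₀ < 1 / 2)
    (hreg : HasRegularCollar g r₀) (hr₂ : IsInnerRadius g r₂ r₁ r₀) {k : ℕ}
    (hD : k ≠ 0 → ∀ x ∈ (𝓡∂ n).interior M, boundaryDist g x < r₀ →
      tnorm g (covDeriv g (ofFun (boundaryDist g))) x ≤ D)
    (hN : 4 * (4 * (k : ℝ) - 3) ≤ N) {u : TensorField n M r s}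
    {w : ∀ j : ℕ, TensorField n M r (s + j)} (hw : IsWeakJet g k u w) {i p : ℕ}
    (hip : i + p ≤ k) :
    weightedEnergy g (blowupWeight g ρ N (4 * p)) (w i)
      ≤ ENNReal.ofReal (iterHardyConst r₂ D p)
        * ∑ j ∈ Finset.range (k + 1), weightedEnergy g (weight g ρ N) (w j) := by
  have hle : ∀ i ≤ k, weightedEnergy g (weight g ρ N) (w i)
      ≤ ∑ j ∈ Finset.range (k + 1), weightedEnergy g (weight g ρ N) (w j) := fun i hi =>
    Finset.single_le_sum (f := fun j => weightedEnergy g (weight g ρ N) (w j))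
      (fun _ _ => zero_le) (Finset.mem_range.2 (by omega))
  induction p generalizing i with
  | zero =>
    rw [iterHardyConst, ENNReal.ofReal_one, one_mul, mul_zero, blowupWeight_zero]
    exact hle i (by omega)
  | succ p ih =>
    have hpk : (p : ℝ) + 1 ≤ k := by exact_mod_cast (by omega : p + 1 ≤ k)
    have h1 := weightedEnergy_blowupWeight_succ_le (p := p) hm hbd h hr hr₀ hreg hr₂
      (hD (by omega)) (by linarith) (hw.2.1 i (by omega)) (hw.2.1 (i + 1) (by omega))
      (hw.2.2 i (by omega))
    refine h1.trans ?_
    rw [blowupWeight_zero, iterHardyConst, ENNReal.ofReal_add (iterHardyConst_pos hr₂.1 p).le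
      (hardyConst_pos p hr₂.1 D).le, add_mul]
    exact add_le_add (ih (by omega)) (by gcongr; exact hle i (by omega))

end Hardy

/-! ### The weighted estimate -/

section Estimate

variable {n : ℕ} [NeZero n] {m : ℕ} {M : Type*} [TopologicalSpace M]
  [ChartedSpace (EuclideanHalfSpace n) M] [IsManifold (𝓡∂ n) ∞ M] {r s : ℕ}
  {g : Metric n m M} [MeasurableSpace M] [BorelSpace M] [CompactSpace M] [T2Space M]
  [ConnectedSpace M] {ρ : ℝ → ℝ} {r₁ r₀ N r₂ L D : ℝ}

/-- The constant in the comparison of the energies of `u` and `ρ^{1/2} u`. -/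
def energyConst (k : ℕ) (N r₂ L D : ℝ) : ℝ :=
  ∑ j ∈ Finset.range (k + 1), (2 ^ k * jetConst k N L D) ^ 2 * (k + 1)
    * ∑ i ∈ Finset.range (j + 1), iterHardyConst r₂ D (j - i)

/-- The comparison of the energies for jets: the loss of powers of `1 / d` in the Leibniz rule is
made up for by the Hardy inequality. -/
lemma exists_isWeakJet_sum_weightedEnergy_le (hm : 2 ≤ m)
    (hbd : ((𝓡∂ n).boundary M).Nonempty) (h : IsProfile ρ r₁ r₀) (hr₁ : 0 < r₁) (hr : r₁ < r₀)
    (hr₀ : r₀ < 1 / 2) (hreg : HasRegularCollar g r₀) (hr₂ : IsInnerRadius g r₂ r₁ r₀) {k : ℕ}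
    (hk : k ≤ m) (hN : 4 * (4 * (k : ℝ) - 3) ≤ N) (hL : LogProfileCkBound ρ r₁ r₀ k L)
    (hD : DistCkBound g r₀ k D) {u : TensorField n M r s}
    {w : ∀ j : ℕ, TensorField n M r (s + j)} (hw : IsWeakJet g k u w) :
    ∃ w' : ∀ j : ℕ, TensorField n M r (s + j), IsWeakJet g k (mulSqrtWeight g ρ N u) w' ∧
      ∑ j ∈ Finset.range (k + 1), weightedEnergy g (fun _ => 1) (w' j)
        ≤ ENNReal.ofReal (energyConst k N r₂ L D)
          * ∑ j ∈ Finset.range (k + 1), weightedEnergy g (weight g ρ N) (w j) := by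
  obtain ⟨w', hw', hb⟩ := exists_isWeakJet_mulSqrtWeight (N := N) hbd (by omega) h hr₁ hr hk
    hreg hL hD hw
  refine ⟨w', hw', ?_⟩
  set E := ∑ j ∈ Finset.range (k + 1), weightedEnergy g (weight g ρ N) (w j) with hE
  set c : ℝ := (2 ^ k * jetConst k N L D) ^ 2 * (k + 1) with hc
  have hc0 : 0 ≤ c := by positivity
  have hint := isOpen_interior_manifold (n := n) (M := M)
  have hDk : k ≠ 0 → ∀ x ∈ (𝓡∂ n).interior M, boundaryDist g x < r₀ →
      tnorm g (covDeriv g (ofFun (boundaryDist g))) x ≤ D := fun hk0 x hx hxr =>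
    hD x hx hxr 1 (by omega)
  have hH : ∀ j, 0 ≤ iterHardyConst r₂ D j := fun j => (iterHardyConst_pos hr₂.1 j).le
  have hterm : ∀ j ∈ Finset.range (k + 1), weightedEnergy g (fun _ => 1) (w' j)
      ≤ ENNReal.ofReal (c * ∑ i ∈ Finset.range (j + 1), iterHardyConst r₂ D (j - i)) * E :=
    fun j hj => by
      have hjk : j ≤ k := Nat.lt_succ_iff.1 (Finset.mem_range.1 hj)
      calc weightedEnergy g (fun _ => 1) (w' j)
          ≤ ∫⁻ x in (𝓡∂ n).interior M, ENNReal.ofReal c * ∑ i ∈ Finset.range (j + 1),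
              ENNReal.ofReal (normSq g (w i) x * blowupWeight g ρ N (4 * (j - i)) x)
              ∂(volumeMeasure g) := by
            refine setLIntegral_mono' hint.measurableSet fun x hx => ?_
            have h1 : ∀ i ∈ Finset.range (j + 1),
                0 ≤ normSq g (w i) x * blowupWeight g ρ N (4 * (j - i)) x := fun i _ =>
              mul_nonneg (normSq_nonneg g _ x) (h.blowupWeight_pos hbd _ hx).le
            rw [← ENNReal.ofReal_sum_of_nonneg h1, ← ENNReal.ofReal_mul hc0, mul_one]
            refine ENNReal.ofReal_le_ofReal ((hb j hjk x hx).trans (le_of_eq ?_))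
            congr 1
            refine Finset.sum_congr rfl fun i _ => ?_
            rw [blowupWeight]
            ring
        _ = ENNReal.ofReal c * ∑ i ∈ Finset.range (j + 1),
              weightedEnergy g (blowupWeight g ρ N (4 * (j - i))) (w i) := by
            rw [lintegral_const_mul' _ _ ENNReal.ofReal_ne_top, lintegral_finsetSum']
            · rfl
            · exact fun i hi => (aemeasurable_normSq_mul (h.continuousOn_blowupWeight hbd _)
                (hw.2.1 i (by have := Finset.mem_range.1 hi; omega))).ennreal_ofReal
        _ ≤ ENNReal.ofReal c * ∑ i ∈ Finset.range (j + 1),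
              ENNReal.ofReal (iterHardyConst r₂ D (j - i)) * E := by
            gcongr with i hi
            exact weightedEnergy_blowupWeight_le hm hbd h hr hr₀ hreg hr₂ hDk hN hw
              (by have := Finset.mem_range.1 hi; omega)
        _ = _ := by
            rw [← Finset.sum_mul, ← ENNReal.ofReal_sum_of_nonneg fun i _ => hH _, ← mul_assoc,
              ← ENNReal.ofReal_mul hc0]
  calc ∑ j ∈ Finset.range (k + 1), weightedEnergy g (fun _ => 1) (w' j)
      ≤ ∑ j ∈ Finset.range (k + 1),
        ENNReal.ofReal (c * ∑ i ∈ Finset.range (j + 1), iterHardyConst r₂ D (j - i)) * E :=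
        Finset.sum_le_sum hterm
    _ = _ := by
        rw [← Finset.sum_mul, ← ENNReal.ofReal_sum_of_nonneg fun j _ =>
          mul_nonneg hc0 (Finset.sum_nonneg fun i _ => hH _)]
        rfl

/-- The constant in the comparison of the Sobolev norms of `u` and `ρ^{1/2} u`. -/
def sobolevConst (k : ℕ) (N r₂ L D : ℝ) : ℝ := √(energyConst k N r₂ L D) + 1

lemma sobolevConst_pos (k : ℕ) (N r₂ L D : ℝ) : 0 < sobolevConst k N r₂ L D :=
  add_pos_of_nonneg_of_pos (Real.sqrt_nonneg _) one_pos

lemma memSobolev_mulSqrtWeight (hm : 2 ≤ m)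
    (hbd : ((𝓡∂ n).boundary M).Nonempty) (h : IsProfile ρ r₁ r₀) (hr₁ : 0 < r₁) (hr : r₁ < r₀)
    (hr₀ : r₀ < 1 / 2) (hreg : HasRegularCollar g r₀) (hr₂ : IsInnerRadius g r₂ r₁ r₀) {k : ℕ}
    (hk : k ≤ m) (hN : 4 * (4 * (k : ℝ) - 3) ≤ N) (hL : LogProfileCkBound ρ r₁ r₀ k L)
    (hD : DistCkBound g r₀ k D) {u : TensorField n M r s}
    (hu : MemSobolev g (weight g ρ N) k u) :
    MemSobolev g (fun _ => 1) k (mulSqrtWeight g ρ N u) := by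
  obtain ⟨w, hw, hfin⟩ := hu
  obtain ⟨w', hw', hle⟩ := exists_isWeakJet_sum_weightedEnergy_le hm hbd h hr₁ hr hr₀ hreg hr₂ hk
    hN hL hD hw
  refine ⟨w', hw', fun j hj => ?_⟩
  refine ((Finset.single_le_sum (f := fun j => weightedEnergy g (fun _ => 1) (w' j))
    (fun _ _ => zero_le) (Finset.mem_range.2 (by omega : j < k + 1))).trans hle).trans_lt ?_
  exact ENNReal.mul_lt_top ENNReal.ofReal_lt_top (ENNReal.sum_lt_top.2 fun i hi =>
    hfin i (Nat.lt_succ_iff.1 (Finset.mem_range.1 hi)))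

lemma sobolevNorm_mulSqrtWeight_le (hm : 2 ≤ m)
    (hbd : ((𝓡∂ n).boundary M).Nonempty) (h : IsProfile ρ r₁ r₀) (hr₁ : 0 < r₁) (hr : r₁ < r₀)
    (hr₀ : r₀ < 1 / 2) (hreg : HasRegularCollar g r₀) (hr₂ : IsInnerRadius g r₂ r₁ r₀) {k : ℕ}
    (hk : k ≤ m) (hN : 4 * (4 * (k : ℝ) - 3) ≤ N) (hL : LogProfileCkBound ρ r₁ r₀ k L)
    (hD : DistCkBound g r₀ k D) (u : TensorField n M r s) :
    sobolevNorm g (fun _ => 1) k (mulSqrtWeight g ρ N u)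
      ≤ ENNReal.ofReal (sobolevConst k N r₂ L D) * sobolevNorm g (weight g ρ N) k u := by
  have hC := (ENNReal.ofReal_pos.2 (sobolevConst_pos k N r₂ L D)).ne'
  simp only [sobolevNorm, ENNReal.mul_iInf_of_ne hC ENNReal.ofReal_ne_top]
  refine le_iInf₂ fun w hw => ?_
  obtain ⟨w', hw', hle⟩ := exists_isWeakJet_sum_weightedEnergy_le hm hbd h hr₁ hr hr₀ hreg hr₂ hk
    hN hL hD hw
  refine (iInf₂_le w' hw').trans ?_
  calc (∑ j ∈ Finset.range (k + 1), weightedEnergy g (fun _ => 1) (w' j)) ^ (1 / 2 : ℝ)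
      ≤ (ENNReal.ofReal (energyConst k N r₂ L D)
          * ∑ j ∈ Finset.range (k + 1), weightedEnergy g (weight g ρ N) (w j)) ^ (1 / 2 : ℝ) := by
        gcongr
    _ = ENNReal.ofReal (energyConst k N r₂ L D) ^ (1 / 2 : ℝ)
          * (∑ j ∈ Finset.range (k + 1), weightedEnergy g (weight g ρ N) (w j)) ^ (1 / 2 : ℝ) :=
        ENNReal.mul_rpow_of_nonneg _ _ (by norm_num)
    _ ≤ _ := by
        gcongr
        have hc0 : 0 ≤ energyConst k N r₂ L D := Finset.sum_nonneg fun j _ =>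
          mul_nonneg (by positivity) (Finset.sum_nonneg fun i _ => (iterHardyConst_pos hr₂.1 _).le)
        rw [ENNReal.ofReal_rpow_of_nonneg hc0 (by norm_num), ← Real.sqrt_eq_rpow]
        exact ENNReal.ofReal_le_ofReal (by unfold sobolevConst; linarith)

lemma IsProfile.exists_logProfileCkBound (h : IsProfile ρ r₁ r₀) (hr₁ : 0 < r₁) (k : ℕ) :
    ∃ L, LogProfileCkBound ρ r₁ r₀ k L := by
  have hj : ∀ j, ∃ C, ∀ t ∈ Icc r₁ r₀, |iteratedDeriv j (fun t => Real.log (ρ t)) t| ≤ C :=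
    fun j => isCompact_Icc.exists_bound_of_continuousOn
      ((h.contDiffOn_iteratedDeriv_log j).continuousOn.mono fun t ht => hr₁.trans_le ht.1)
  choose C hC using hj
  refine ⟨∑ j ∈ Finset.range (k + 1), |C j|, fun t ht j hjk => ?_⟩
  exact ((hC j t ht).trans (le_abs_self _)).trans
    (Finset.single_le_sum (f := fun j => |C j|) (fun _ _ => abs_nonneg _)
      (Finset.mem_range.2 (by omega)))

/-- A bound for the second derivatives of the distance gives an inner radius. -/
lemma exists_isInnerRadius (n m : ℕ) [NeZero n] (M : Type*) [TopologicalSpace M]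
    [ChartedSpace (EuclideanHalfSpace n) M] [IsManifold (𝓡∂ n) ∞ M] (hm : 2 ≤ m) {r₁ : ℝ}
    (hr₁ : 0 < r₁) (hr₁' : r₁ < 1 / 2) (r₀ D : ℝ) :
    ∃ r₂, ∀ g : Metric n m M, DistCkBound g r₀ m D → IsInnerRadius g r₂ r₁ r₀ := by
  set q : ℝ := √n * |D| + 2 with hq
  have hq0 : 0 < q := by positivity
  refine ⟨min (r₁ / 2) (1 / (2 * q)), fun g hD => ?_⟩
  set r₂ := min (r₁ / 2) (1 / (2 * q)) with hr₂
  have h0 : 0 < r₂ := lt_min (half_pos hr₁) (by positivity)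
  have h1 : r₂ ≤ r₁ / 2 := min_le_left _ _
  have h2 : r₂ * q ≤ 1 / 2 := by
    calc r₂ * q ≤ 1 / (2 * q) * q := by gcongr; exact min_le_right _ _
      _ = 1 / 2 := by field_simp
  refine ⟨h0, by linarith, fun x hx hxr => ?_⟩
  have h3 : |laplacian g (boundaryDist g) x| ≤ √n * |D| := by
    refine (abs_laplacian_le hx).trans ?_
    have : tnorm g (covDeriv g (covDeriv g (ofFun (boundaryDist g)))) x ≤ D := hD x hx hxr 2 hm
    gcongr
    exact this.trans (le_abs_self D)
  calc r₂ ^ 2 * |laplacian g (boundaryDist g) x| + 2 * r₂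
      ≤ r₂ * (√n * |D|) + 2 * r₂ := by
        gcongr
        nlinarith
    _ = r₂ * q := by rw [hq]; ring
    _ ≤ 1 / 2 := h2

end Estimate

end WeightedSobolev

end

theorem mainTheorem11 :
    -- the constant depends only on `k`, `N`, `r₂`, `‖log ρ̃‖_{C^k}` and `‖d_g‖_{C^k}`
    (∀ (k : ℕ) (N r₂ L D : ℝ), 4 * (4 * (k : ℝ) - 3) ≤ N →
      ∃ C : ℝ, 0 < C ∧
        ∀ (n : ℕ) [NeZero n] (M : Type u) [TopologicalSpace M] [T2Space M] [CompactSpace M]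
          [ConnectedSpace M] [ChartedSpace (EuclideanHalfSpace n) M] [IsManifold (𝓡∂ n) ∞ M]
          [MeasurableSpace M] [BorelSpace M],
          ((𝓡∂ n).boundary M).Nonempty →
          ∀ (m : ℕ), 2 ≤ m → k ≤ m →
          ∀ (g : WeightedSobolev.Metric n m M) (r₀ r₁ : ℝ) (ρ : ℝ → ℝ),
            0 < r₁ → r₁ < r₀ → r₀ < 1 / 2 →
            WeightedSobolev.IsProfile ρ r₁ r₀ →
            WeightedSobolev.HasRegularCollar g r₀ →
            WeightedSobolev.IsInnerRadius g r₂ r₁ r₀ →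
            WeightedSobolev.LogProfileCkBound ρ r₁ r₀ k L →
            WeightedSobolev.DistCkBound g r₀ k D →
            ∀ (r s : ℕ) (u : WeightedSobolev.TensorField n M r s),
              WeightedSobolev.MemSobolev g (WeightedSobolev.weight g ρ N) k u →
              WeightedSobolev.MemSobolev g (fun _ => 1) k
                (WeightedSobolev.mulSqrtWeight g ρ N u) ∧
              WeightedSobolev.sobolevNorm g (fun _ => 1) k
                  (WeightedSobolev.mulSqrtWeight g ρ N u) ≤
                ENNReal.ofReal C *
                  WeightedSobolev.sobolevNorm g (WeightedSobolev.weight g ρ N) k u) ∧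
    -- uniformity over a family of metrics with a common collar and `‖d_g‖_{C^m}` bounded there
    (∀ (n : ℕ) [NeZero n] (M : Type u) [TopologicalSpace M] [T2Space M] [CompactSpace M]
      [ConnectedSpace M] [ChartedSpace (EuclideanHalfSpace n) M] [IsManifold (𝓡∂ n) ∞ M]
      [MeasurableSpace M] [BorelSpace M],
      ((𝓡∂ n).boundary M).Nonempty →
      ∀ (k m : ℕ), 2 ≤ m → k ≤ m →
      ∀ (N r₀ r₁ : ℝ) (ρ : ℝ → ℝ), 4 * (4 * (k : ℝ) - 3) ≤ N →
        0 < r₁ → r₁ < r₀ → r₀ < 1 / 2 →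
        WeightedSobolev.IsProfile ρ r₁ r₀ →
        ∀ U₀ : Set (WeightedSobolev.Metric n m M),
          (∀ g ∈ U₀, WeightedSobolev.HasRegularCollar g r₀) →
          (∃ D : ℝ, ∀ g ∈ U₀, WeightedSobolev.DistCkBound g r₀ m D) →
          ∃ C : ℝ, 0 < C ∧ ∀ g ∈ U₀, ∀ (r s : ℕ) (u : WeightedSobolev.TensorField n M r s),
            WeightedSobolev.MemSobolev g (WeightedSobolev.weight g ρ N) k u →
            WeightedSobolev.MemSobolev g (fun _ => 1) k
              (WeightedSobolev.mulSqrtWeight g ρ N u) ∧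
            WeightedSobolev.sobolevNorm g (fun _ => 1) k
                (WeightedSobolev.mulSqrtWeight g ρ N u) ≤
              ENNReal.ofReal C *
                WeightedSobolev.sobolevNorm g (WeightedSobolev.weight g ρ N) k u) := by
  refine ⟨fun k N r₂ L D hN => ⟨WeightedSobolev.sobolevConst k N r₂ L D,
    WeightedSobolev.sobolevConst_pos k N r₂ L D, ?_⟩, ?_⟩
  · intro n _ M _ _ _ _ _ _ _ _ hbd m hm hk g r₀ r₁ ρ hr₁ hr hr₀ h hreg hr₂ hL hD r s u hu
    exact ⟨WeightedSobolev.memSobolev_mulSqrtWeight hm hbd h hr₁ hr hr₀ hreg hr₂ hk hN hL hD hu,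
      WeightedSobolev.sobolevNorm_mulSqrtWeight_le hm hbd h hr₁ hr hr₀ hreg hr₂ hk hN hL hD u⟩
  · intro n _ M _ _ _ _ _ _ _ _ hbd k m hm hk N r₀ r₁ ρ hN hr₁ hr hr₀ h U₀ hreg ⟨D, hD⟩
    obtain ⟨L, hL⟩ := h.exists_logProfileCkBound hr₁ k
    obtain ⟨r₂, hr₂⟩ := WeightedSobolev.exists_isInnerRadius n m M hm hr₁ (hr.trans hr₀) r₀ D
    refine ⟨WeightedSobolev.sobolevConst k N r₂ L D, WeightedSobolev.sobolevConst_pos k N r₂ L D,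
      fun g hg r s u hu => ?_⟩
    have hDk : WeightedSobolev.DistCkBound g r₀ k D := fun x hx hxr j hj =>
      hD g hg x hx hxr j (hj.trans hk)
    exact ⟨WeightedSobolev.memSobolev_mulSqrtWeight hm hbd h hr₁ hr hr₀ (hreg g hg)
        (hr₂ g (hD g hg)) hk hN hL hDk hu,
      WeightedSobolev.sobolevNorm_mulSqrtWeight_le hm hbd h hr₁ hr hr₀ (hreg g hg)
        (hr₂ g (hD g hg)) hk hN hL hDk u⟩
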